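/- Notation. For $n,k\in\mathbb N$ let $Z_n^k=\{(n_1,\dots,n_k)\in\mathbb{N}^k:\sum_j n_j=n\}$, where $0\in\mathbb N$, and let $Y_n^d=\{\boldsymbol n\in Z_n^d: n_1\ge\dots\ge n_d\}$ (Young diagrams with $n$ boxes and at most $d$ rows). For $\boldsymbol n\in Y_n^d$ let $\mathcal U_{\boldsymbol n}$ and $\mathcal V_{\boldsymbol n}$ be the irreducible representations of $\mathrm U(d)$ and of $S_n$ labelled by $\boldsymbol n$, so that by Schur–Weyl duality $(\mathbb C^d)^{\otimes n}=\bigoplus_{\boldsymbol n\in Y_n^d}\mathcal U_{\boldsymbol n}\otimes\mathcal V_{\boldsymbol n}$; let $s_{\boldsymbol n}(\boldsymbol t)=\det(t_i^{n_j+d-j})_{i,j}/\det(t_i^{d-j})_{i,j}$ be the Schur polynomial, and put $$f_q(n,d;\boldsymbol n)=\frac{\dim\mathcal U_{\boldsymbol n}}{s_{\boldsymbol n}(\boldsymbol n/n)\dim\mathcal V_{\boldsymbol n}},\qquad f_c(n,k;\boldsymbol m)=\Bigl[\frac{n!}{n_1!\cdots n_k!}\prod_{j=1}^k\Bigl(\frac{n_j}{n}\Bigr)^{n_j}\Bigr]^{-1}\quad(\boldsymbol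 m=(n_1,\dots,n_k)\in Z_n^k),$$ with $0^0=1$ and, for $n=0$, $\boldsymbol n/n=0$. Let $\pi$ be a unitary representation of a group $G$ on a Hilbert space $\mathcal H_A$ of finite dimension $d$. Then $\mathcal H_A$ has a decomposition $\mathcal H_A=\bigoplus_{j=1}^k\mathcal H_j^R\otimes\mathcal H_j^D$, $\pi(g)=\bigoplus_j\pi_j(g)\otimes I$, with pairwise inequivalent irreducible unitary representations $\pi_j$ on $\mathcal H_j^R$, $r_j=\dim\mathcal H_j^R$, $d_j=\dim\mathcal H_j^D\ge1$. Fix any such decomposition, and an orthonormal basis of each $\mathcal H_j^R$ and $\mathcal H_j^D$. For $\boldsymbol m=(n_1,\dots,n_k)\in Z_n^k$ and $\boldsymbol n_j\in Y_{n_j}^{d_j}$, let $P_{\boldsymbol m;\boldsymbol n_1,\dots,\boldsymbol n_k}$ be the orthogonal projection of $\mathcal H_A^{\otimes n}$ onto $$\sum_{\sigma\in S_n}V_\sigma\Bigl[\bigotimes_{j=1}^k(\mathcal H_j^R)^{\otimes n_j}\otimes(\mathcal U_{\boldsymbol n_j}\otimes\mathcal V_{\boldsymbol n_j})\Bigr],\qquad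 \mathcal U_{\boldsymbol n_j}\otimes\mathcal V_{\boldsymbol n_j}\subseteq(\mathcal H_j^D)^{\otimes n_j},$$ where $V_\sigma$ permutes the $n$ tensor factors. Let $\mathcal H_E$ denote an arbitrary Hilbert space. An operator $X$ on $\mathcal H_A^{\otimes n}\otimes\mathcal H_E$ is permutation-invariant if it commutes with all $V_\sigma\otimes I_E$, and locally $G$-invariant if it commutes with all $\pi(g_1)\otimes\cdots\otimes\pi(g_n)\otimes I_E$, $g_1,\dots,g_n\in G$. Projections $P_{\boldsymbol m;\dots}$ act on $\mathcal H_A^{\otimes n}\otimes\mathcal H_E$ as $P_{\boldsymbol m;\dots}\otimes I_E$. Theorem. Every bounded operator $X$ on $\mathcal H_A^{\otimes n}\otimes\mathcal H_E$ (in particular, every density operator) that is permutation-invariant and locally $G$-invariant satisfies $$X=\sum_{\boldsymbol m\in Z_n^k}\ \sum_{(\boldsymbol n_1,\dots,\boldsymbol n_k)\in Y_{n_1}^{d_1}\times\cdots\times Y_{n_k}^{d_k}}P_{\boldsymbol m;\boldsymbol n_1,\dots,\boldsymbol n_k}\,X\,P_{\boldsymbol m;\boldsymbol n_1,\dots,\boldsymbol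 n_k}.$$ Furthermore, there are completely positive trace-preserving maps $\mathcal S^G,\mathcal R^G$ on the operators on $\mathcal H_A^{\otimes n}$ such that, for all $\mathcal H_E$: (i) for every bounded operator $X$ on $\mathcal H_A^{\otimes n}\otimes\mathcal H_E$ (in particular, every density operator), every $\boldsymbol m\in Z_n^k$ and all $\boldsymbol n_j\in Y_{n_j}^{d_j}$, writing $P=P_{\boldsymbol m;\boldsymbol n_1,\dots,\boldsymbol n_k}$, $$(\mathcal S^G\otimes\mathrm{Id}_E)(PXP)=P\,(\mathcal S^G\otimes\mathrm{Id}_E)(X)\,P;$$ (ii) for every permutation-invariant and locally $G$-invariant bounded operator $X$ on $\mathcal H_A^{\otimes n}\otimes\mathcal H_E$ (in particular, every such density operator), $\bigl((\mathcal R^G\circ\mathcal S^G)\otimes\mathrm{Id}_E\bigr)(X)=X$; (iii) for every permutation-invariant and locally $G$-invariant density operator $\rho$ on $\mathcal H_A^{\otimes n}$, every $\boldsymbol m\in Z_n^k$ and all $\boldsymbol n_j\in Y_{n_j}^{d_j}$, writing $P=P_{\boldsymbol m;\boldsymbol n_1,\dots,\boldsymbol n_k}$, $$\mathrm{supp}\bigl(\mathcal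 S^G(P\rho P)\bigr)\ \le\ f_c(n,k;\boldsymbol m)\prod_{j=1}^kf_q(n_j,d_j;\boldsymbol n_j)\ \mathcal S^G\Bigl(\mathbb E_{\boldsymbol U}\bigl[\tau_{\boldsymbol U}(\boldsymbol n_1,\dots,\boldsymbol n_k)^{\otimes n}\bigr]\Bigr),$$ where $\mathrm{supp}(\tau)$ is the smallest projection $Q$ with $\mathrm{Tr}[Q\tau]=\mathrm{Tr}[\tau]$, the unitaries $U_j$ in $\boldsymbol U=(U_1,\dots,U_k)$ are independent and Haar distributed on $\mathrm U(d_j)$, and $$\tau_{\boldsymbol U}(\boldsymbol n_1,\dots,\boldsymbol n_k)=\bigoplus_{j=1}^k\frac{I_{\mathcal H_j^R}}{r_j}\otimes U_j\,\mathrm{diag}(\boldsymbol n_j/n)\,U_j^\dagger .$$ -/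

import Mathlib

open scoped Matrix Kronecker ComplexOrder

namespace DeFinetti

/-! ### Young diagrams and symmetric functions -/

/-- `Z_n^k`: the `k`-tuples of natural numbers with sum `n`. -/
def types (n k : ℕ) : Finset (Fin k → ℕ) := Finset.piAntidiag Finset.univ n

/-- `Y_n^d`: Young diagrams with `n` boxes and at most `d` rows, given by their row lengths. -/
noncomputable def diagrams (n d : ℕ) : Finset (Fin d → ℕ) := by
  classical exact (types n d).filter Antitone

/-- The alternant `det (X_i ^ (lam_j + d - j))`, where `i, j` run from `1` to `d`. -/
noncomputable def alternant {d : ℕ} (lam : Fin d → ℕ) : MvPolynomial (Fin d) ℝ :=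
  Matrix.det (Matrix.of fun i j : Fin d =>
    (MvPolynomial.X i : MvPolynomial (Fin d) ℝ) ^ (lam j + (d - 1 - (j : ℕ))))

theorem X_sub_X_dvd_alternant {d : ℕ} (lam : Fin d → ℕ) {i j : Fin d} (h : i ≠ j) :
    (MvPolynomial.X i - MvPolynomial.X j : MvPolynomial (Fin d) ℝ) ∣ alternant lam := by
  rw [← Ideal.mem_span_singleton, ← Ideal.Quotient.eq_zero_iff_mem, alternant, RingHom.map_det]
  refine Matrix.det_zero_of_row_eq h ?_
  have key : Ideal.Quotient.mk (Ideal.span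
      {(MvPolynomial.X i - MvPolynomial.X j : MvPolynomial (Fin d) ℝ)}) (MvPolynomial.X i)
      = Ideal.Quotient.mk _ (MvPolynomial.X j) := by
    rw [Ideal.Quotient.eq]
    exact Ideal.mem_span_singleton_self _
  funext l
  simp [RingHom.mapMatrix_apply, key]

open MvPolynomial in
theorem irreducible_X_sub_X {d : ℕ} {i j : Fin d} (h : i ≠ j) :
    Irreducible (X i - X j : MvPolynomial (Fin d) ℝ) := by
  have hc : coeff (Finsupp.single i 1) (X i - X j : MvPolynomial (Fin d) ℝ) = 1 := by
    classical
    simp [coeff_X, Finsupp.single_left_inj, h.symm]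
  have hne : (X i - X j : MvPolynomial (Fin d) ℝ) ≠ 0 := by
    intro h0; rw [h0] at hc; simp at hc
  have hd : (X i - X j : MvPolynomial (Fin d) ℝ).totalDegree = 1 :=
    ((isHomogeneous_X ℝ i).sub (isHomogeneous_X ℝ j)).totalDegree hne
  refine irreducible_of_totalDegree_eq_one hd fun x hx => ?_
  exact isUnit_of_dvd_one (hc ▸ hx _)

open MvPolynomial in
theorem isRelPrime_X_sub_X {d : ℕ} {i j k l : Fin d} (h : i < j) (h' : k < l)
    (hne : ¬ (i = k ∧ j = l)) :
    IsRelPrime (X i - X j : MvPolynomial (Fin d) ℝ) (X k - X l) := by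
  rw [(irreducible_X_sub_X h.ne).isRelPrime_iff_not_dvd]
  rintro ⟨q, hq⟩
  have := congrArg (MvPolynomial.eval fun p : Fin d => if p = i ∨ p = j then (0 : ℝ) else
    if p = k then 1 else 2) hq
  simp only [map_sub, map_mul, eval_X] at this
  simp at this
  grind

open MvPolynomial in
/-- The Vandermonde denominator `det (X_i ^ (d - j))` is the alternant of the empty diagram. -/
theorem alternant_zero_dvd {d : ℕ} (lam : Fin d → ℕ) :
    alternant (0 : Fin d → ℕ) ∣ alternant lam := by
  have h1 : (∏ i : Fin d, ∏ j ∈ Finset.Ioi i, (X i - X j : MvPolynomial (Fin d) ℝ)) ∣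
      alternant lam := by
    rw [Finset.prod_sigma']
    refine Finset.prod_dvd_of_isRelPrime ?_ ?_
    · rintro ⟨i, j⟩ hp ⟨k, l⟩ hq hne
      simp only [Finset.coe_sigma, Set.mem_sigma_iff, Finset.mem_coe, Finset.mem_univ,
        Finset.mem_Ioi, true_and] at hp hq
      exact isRelPrime_X_sub_X hp hq (by rintro ⟨rfl, rfl⟩; exact hne rfl)
    · rintro ⟨i, j⟩ hp
      simp only [Finset.mem_sigma, Finset.mem_univ, Finset.mem_Ioi, true_and] at hp
      exact X_sub_X_dvd_alternant lam hp.ne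
  have h2 : alternant (0 : Fin d → ℕ) =
      (∏ i : Fin d, ∏ j ∈ Finset.Ioi i, (X i - X j : MvPolynomial (Fin d) ℝ)) := by
    have := Matrix.det_projVandermonde (R := MvPolynomial (Fin d) ℝ) (fun _ => 1) (fun i => X i)
    simp only [one_mul] at this
    rw [alternant]
    convert this using 2
    ext1 i j
    simp [Matrix.projVandermonde_apply, Fin.rev]
    congr 1
    omega
  rw [h2]; exact h1

/-- The Schur polynomial `s_lam = det (X_i ^ (lam_j + d - j)) / det (X_i ^ (d - j))`, the quotient
being taken in the polynomial ring (where the division is exact). -/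
noncomputable def schurPoly {d : ℕ} (lam : Fin d → ℕ) : MvPolynomial (Fin d) ℝ :=
  Classical.choose (alternant_zero_dvd lam)

theorem alternant_eq_mul_schurPoly {d : ℕ} (lam : Fin d → ℕ) :
    alternant lam = alternant 0 * schurPoly lam :=
  Classical.choose_spec (alternant_zero_dvd lam)

/-! ### Tensor powers, permutations and Young symmetrizers

`(ℂ^κ)^{⊗ ι}` is `EuclideanSpace ℂ (ι → κ)`, with the product basis indexed by `ι → κ`. -/

/-- The tensor product `⨂ p, A p` of matrices. -/
def tensorMatrix {ι κ κ' : Type*} [Fintype ι] (A : ι → Matrix κ κ' ℂ) :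
    Matrix (ι → κ) (ι → κ') ℂ :=
  Matrix.of fun x y => ∏ p, A p (x p) (y p)

/-- The unitary representation of the permutations of the tensor factors,
`V_σ |y⟩ = |y ∘ σ⁻¹⟩`. -/
def permOp (ι κ : Type*) [Fintype ι] [DecidableEq ι] [Fintype κ] [DecidableEq κ] :
    Equiv.Perm ι →* Matrix (ι → κ) (ι → κ) ℂ where
  toFun σ := Matrix.of fun x y => if x = y ∘ σ.symm then 1 else 0
  map_one' := by
    ext x y
    have h1 : y ∘ (Equiv.symm (1 : Equiv.Perm ι)) = y := rfl
    simp [Matrix.one_apply, h1]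
  map_mul' σ τ := by
    ext x y
    have h1 : y ∘ (σ * τ).symm = (y ∘ τ.symm) ∘ σ.symm := rfl
    simp [Matrix.mul_apply, h1]

/-- The boxes of a Young diagram with row lengths `lam`. -/
abbrev Boxes {d : ℕ} (lam : Fin d → ℕ) : Type := Σ i : Fin d, Fin (lam i)

/-- The Young symmetrizer `c_T = (∑ row permutations) * (∑ signed column permutations)` in the
group algebra, for a numbering `T` of the boxes of `lam` by the elements of `ι`. -/
noncomputable def youngSymmetrizer {ι : Type*} [Fintype ι] [DecidableEq ι] {d : ℕ}
    {lam : Fin d → ℕ} (T : ι ≃ Boxes lam) : MonoidAlgebra ℂ (Equiv.Perm ι) :=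
  (∑ σ ∈ Finset.univ.filter fun σ : Equiv.Perm ι => ∀ p, (T (σ p)).1 = (T p).1,
      MonoidAlgebra.single σ 1) *
    (∑ σ ∈ Finset.univ.filter fun σ : Equiv.Perm ι =>
        ∀ p, ((T (σ p)).2 : ℕ) = ((T p).2 : ℕ),
      MonoidAlgebra.single σ (((Equiv.Perm.sign σ : ℤˣ) : ℤ) : ℂ))

/-- The operator on `(ℂ^κ)^{⊗ ι}` by which an element of the group algebra of the permutations
of `ι` acts. -/
noncomputable def groupAlgebraOp {ι : Type*} [Fintype ι] [DecidableEq ι] (κ : Type*) [Fintype κ]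
    [DecidableEq κ] (a : MonoidAlgebra ℂ (Equiv.Perm ι)) : Matrix (ι → κ) (ι → κ) ℂ :=
  MonoidAlgebra.lift ℂ _ _ (permOp ι κ) a

/-- A numbering of the boxes of `lam`, row by row. -/
def standardNumbering {d : ℕ} (lam : Fin d → ℕ) : Fin (∑ i, lam i) ≃ Boxes lam :=
  finSigmaFinEquiv.symm

/-- The irreducible representation `V_lam = ℂ[S_n] c_T` of `S_n`, as a left ideal of the group
algebra. -/
noncomputable def irrepSym {d : ℕ} (lam : Fin d → ℕ) :
    Submodule ℂ (MonoidAlgebra ℂ (Equiv.Perm (Fin (∑ i, lam i)))) :=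
  LinearMap.range (LinearMap.mulRight ℂ (youngSymmetrizer (standardNumbering lam)))

/-- The irreducible representation `U_lam = c_T (ℂ^d)^{⊗ n}` of `U(d)`. -/
noncomputable def irrepUnitary {d : ℕ} (lam : Fin d → ℕ) :
    Submodule ℂ (EuclideanSpace ℂ (Fin (∑ i, lam i) → Fin d)) :=
  LinearMap.range (Matrix.toEuclideanLin
    (groupAlgebraOp (Fin d) (youngSymmetrizer (standardNumbering lam))))

/-- The summand `U_lam ⊗ V_lam` of `(ℂ^d)^{⊗ ι}` in the Schur-Weyl decomposition, i.e. the
`V_lam`-isotypic component `ℂ[S_n] c_T (ℂ^d)^{⊗ ι}`. The sum over all numberings `T` accounts for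
the factor `ℂ[S_n]`, because `V_σ c_T V_σ⁻¹` is the Young symmetrizer of another numbering. -/
noncomputable def schurWeylSummand (ι : Type*) [Fintype ι] [DecidableEq ι] {d : ℕ}
    (lam : Fin d → ℕ) : Submodule ℂ (EuclideanSpace ℂ (ι → Fin d)) :=
  ⨆ T : ι ≃ Boxes lam,
    LinearMap.range (Matrix.toEuclideanLin (groupAlgebraOp (Fin d) (youngSymmetrizer T)))

/-! ### The prefactors -/

/-- `f_q(n, d; lam) = dim U_lam / (s_lam(lam / n) * dim V_lam)`, where `n` is the number of boxes
of `lam`. -/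
noncomputable def fq {d : ℕ} (lam : Fin d → ℕ) : ℝ :=
  (Module.finrank ℂ (irrepUnitary lam) : ℝ) /
    (MvPolynomial.eval (fun i => (lam i : ℝ) / ((∑ l, lam l : ℕ) : ℝ)) (schurPoly lam) *
      (Module.finrank ℂ (irrepSym lam) : ℝ))

/-- The multinomial probability `n! / (m_1! ⋯ m_k!) * ∏ t_j ^ m_j`, where `n = ∑ m_j`. -/
noncomputable def multinomialPdf {k : ℕ} (t : Fin k → ℝ) (m : Fin k → ℕ) : ℝ :=
  ((∑ j, m j).factorial : ℝ) / (∏ j, ((m j).factorial : ℝ)) * ∏ j, t j ^ m j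

/-- `f_c(n, k; m) = 1 / Mult_{m / n}(m)`, where `n = ∑ m_j`. -/
noncomputable def fc {k : ℕ} (m : Fin k → ℕ) : ℝ :=
  (multinomialPdf (fun j => (m j : ℝ) / ((∑ l, m l : ℕ) : ℝ)) m)⁻¹

/-! ### Operators and channels

`I` indexes an orthonormal basis of a finite-dimensional Hilbert space `H = ℂ^I`. A bounded
operator on `H ⊗ E`, for an arbitrary Hilbert space `E`, is the same thing as its block matrix
`X : Matrix I I (E →L[ℂ] E)`. -/

section Operators

variable {I : Type*} [Fintype I] [DecidableEq I]

/-- A density operator on `ℂ^I`. -/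
def IsDensity (ρ : Matrix I I ℂ) : Prop := ρ.PosSemidef ∧ ρ.trace = 1

/-- `A ⊗ 1_E`. -/
def tensorOne (E : Type*) [NormedAddCommGroup E] [InnerProductSpace ℂ E] (A : Matrix I I ℂ) :
    Matrix I I (E →L[ℂ] E) :=
  A.map (algebraMap ℂ (E →L[ℂ] E))

/-- `S ⊗ Id`, applied to a matrix with entries in a complex vector space `M` (an algebra of
operators on a second system): `(S ⊗ Id)(∑ |c⟩⟨d| ⊗ X c d) = ∑ S(|c⟩⟨d|) ⊗ X c d`. -/
def tensorId {M : Type*} [AddCommGroup M] [Module ℂ M]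
    (S : Matrix I I ℂ →ₗ[ℂ] Matrix I I ℂ) (X : Matrix I I M) : Matrix I I M :=
  Matrix.of fun a b => ∑ c, ∑ d, S (Matrix.single c d 1) a b • X c d

/-- Completely positive trace-preserving maps: `S ⊗ Id` preserves positivity for every
finite-dimensional second system, and `S` preserves the trace. -/
def IsCPTP (S : Matrix I I ℂ →ₗ[ℂ] Matrix I I ℂ) : Prop :=
  (∀ (l : ℕ) (X : Matrix I I (Matrix (Fin l) (Fin l) ℂ)),
      (Matrix.comp I I (Fin l) (Fin l) ℂ X).PosSemidef →
      (Matrix.comp I I (Fin l) (Fin l) ℂ (tensorId S X)).PosSemidef) ∧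
    ∀ X, (S X).trace = X.trace

/-- `Q` is the support projection of the positive operator `τ`: the smallest projection with
`Tr[Q τ] = Tr[τ]`. -/
def IsSupportProjection (τ Q : Matrix I I ℂ) : Prop :=
  IsStarProjection Q ∧ (Q * τ).trace = τ.trace ∧
    ∀ Q' : Matrix I I ℂ, IsStarProjection Q' → (Q' * τ).trace = τ.trace → (Q' - Q).PosSemidef

/-- The matrix of the orthogonal projection onto a subspace. -/
noncomputable def projMatrix (W : Submodule ℂ (EuclideanSpace ℂ I)) : Matrix I I ℂ :=
  Matrix.of fun a b => (W.starProjection (EuclideanSpace.single b 1)) a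

end Operators

section Invariance

variable {n d : ℕ} {E : Type*} [NormedAddCommGroup E] [InnerProductSpace ℂ E]

/-- Invariance of an operator on `(ℂ^d)^{⊗ n} ⊗ E` under the permutations of the `n` systems. -/
def PermInvariantExt (X : Matrix (Fin n → Fin d) (Fin n → Fin d) (E →L[ℂ] E)) : Prop :=
  ∀ σ : Equiv.Perm (Fin n),
    tensorOne E (permOp (Fin n) (Fin d) σ) * X * tensorOne E (permOp (Fin n) (Fin d) σ)ᴴ = X

/-- Local `G`-invariance of an operator on `(ℂ^d)^{⊗ n} ⊗ E`. -/
def LocallyInvariantExt {G : Type*} [Group G] (π : G →* Matrix.unitaryGroup (Fin d) ℂ)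
    (X : Matrix (Fin n → Fin d) (Fin n → Fin d) (E →L[ℂ] E)) : Prop :=
  ∀ g : Fin n → G,
    tensorOne E (tensorMatrix fun p => (π (g p) : Matrix (Fin d) (Fin d) ℂ)) * X *
      tensorOne E (tensorMatrix fun p => (π (g p) : Matrix (Fin d) (Fin d) ℂ))ᴴ = X

/-- Invariance of an operator on `(ℂ^d)^{⊗ n}` under the permutations of the `n` systems. -/
def PermInvariant (X : Matrix (Fin n → Fin d) (Fin n → Fin d) ℂ) : Prop :=
  ∀ σ : Equiv.Perm (Fin n),
    permOp (Fin n) (Fin d) σ * X * (permOp (Fin n) (Fin d) σ)ᴴ = X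

/-- Local `G`-invariance of an operator on `(ℂ^d)^{⊗ n}`. -/
def LocallyInvariant {G : Type*} [Group G] (π : G →* Matrix.unitaryGroup (Fin d) ℂ)
    (X : Matrix (Fin n → Fin d) (Fin n → Fin d) ℂ) : Prop :=
  ∀ g : Fin n → G,
    tensorMatrix (fun p => (π (g p) : Matrix (Fin d) (Fin d) ℂ)) * X *
      (tensorMatrix fun p => (π (g p) : Matrix (Fin d) (Fin d) ℂ))ᴴ = X

end Invariance

/-! ### The Haar measure of the unitary group -/

instance compactSpace_unitaryGroup (l : ℕ) : CompactSpace (Matrix.unitaryGroup (Fin l) ℂ) := by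
  have h1 : IsClosed (Matrix.unitaryGroup (Fin l) ℂ : Set (Matrix (Fin l) (Fin l) ℂ)) := by
    have : (Matrix.unitaryGroup (Fin l) ℂ : Set (Matrix (Fin l) (Fin l) ℂ)) =
        {A | A * star A = 1} := by
      ext A
      exact Matrix.mem_unitaryGroup_iff
    rw [this]
    exact isClosed_eq (by fun_prop) continuous_const
  have h2 : IsCompact (Set.univ.pi fun _ : Fin l => Set.univ.pi fun _ : Fin l =>
      Metric.closedBall (0 : ℂ) 1) :=
    isCompact_univ_pi fun _ => isCompact_univ_pi fun _ => isCompact_closedBall _ _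
  refine isCompact_iff_compactSpace.mp (h2.of_isClosed_subset h1 fun A hA => ?_)
  simp only [Set.mem_pi, Set.mem_univ, forall_true_left, mem_closedBall_zero_iff]
  exact fun i j => entry_norm_bound_of_unitary hA i j

noncomputable instance measurableSpace_unitaryGroup (l : ℕ) :
    MeasurableSpace (Matrix.unitaryGroup (Fin l) ℂ) := borel _

instance borelSpace_unitaryGroup (l : ℕ) : BorelSpace (Matrix.unitaryGroup (Fin l) ℂ) := ⟨rfl⟩

/-- The normalized Haar measure `Haar(l)` on `U(l)`. -/
noncomputable def haarUnitary (l : ℕ) : MeasureTheory.Measure (Matrix.unitaryGroup (Fin l) ℂ) :=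
  MeasureTheory.Measure.haarMeasure ⊤

/-! ### The decomposition of the local system -/

/-- The representation on `ℂ^r` given by a homomorphism into `U(r)`. -/
noncomputable def matrixRep {G : Type*} [Group G] {r : ℕ} (ρ : G →* Matrix.unitaryGroup (Fin r) ℂ) :
    Representation ℂ G (Fin r → ℂ) :=
  ((Matrix.toLinAlgEquiv' : Matrix (Fin r) (Fin r) ℂ ≃ₐ[ℂ] _) :
      Matrix (Fin r) (Fin r) ℂ →* Module.End ℂ (Fin r → ℂ)).comp
    ((Matrix.unitaryGroup (Fin r) ℂ).subtype.comp ρ)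

/-- A decomposition `ℂ^d = ⨁_j ℂ^{r_j} ⊗ ℂ^{d_j}`, `π(g) = ⨁_j π_j(g) ⊗ 1`, of a unitary
representation `π` on `ℂ^d`, where the `π_j` are pairwise inequivalent irreducible unitary
representations of dimension `r_j` and `d_j ≥ 1` is the degeneracy of `π_j` in `π`. -/
structure LocalDecomposition {G : Type*} [Group G] {d : ℕ}
    (π : G →* Matrix.unitaryGroup (Fin d) ℂ) where
  /-- the number of inequivalent irreducible representations in `π` -/
  k : ℕ
  /-- their dimensions -/
  r : Fin k → ℕ
  /-- their degeneracies `d_j` -/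
  deg : Fin k → ℕ
  deg_pos : ∀ j, 0 < deg j
  /-- the irreducible representations `π_j` -/
  irrep : ∀ j, G →* Matrix.unitaryGroup (Fin (r j)) ℂ
  irreducible : ∀ j, (matrixRep (irrep j)).IsIrreducible
  inequivalent : ∀ i j, i ≠ j → IsEmpty ((matrixRep (irrep i)).Equiv (matrixRep (irrep j)))
  /-- the unitary identification of `⨁_j ℂ^{r_j} ⊗ ℂ^{d_j}` with `ℂ^d` -/
  W : Matrix (Fin d) (Σ j, Fin (r j) × Fin (deg j)) ℂ
  W_star_mul : Wᴴ * W = 1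
  W_mul_star : W * Wᴴ = 1
  decomp : ∀ g, (π g : Matrix (Fin d) (Fin d) ℂ) =
    W * Matrix.blockDiagonal' (fun j =>
      (irrep j g : Matrix (Fin (r j)) (Fin (r j)) ℂ) ⊗ₖ
        (1 : Matrix (Fin (deg j)) (Fin (deg j)) ℂ)) * Wᴴ

/-- For a bijection `e` from the slots `(j, i)`, `i < m_j`, to the `n` systems, the product vector
`⨂_j (v_j ⊗ w_j)` with `v_j ∈ (ℂ^{r_j})^{⊗ m_j}` and `w_j ∈ (ℂ^{d_j})^{⊗ m_j}`, the slot `(j, i)`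
being placed in the summand `ℂ^{r_j} ⊗ ℂ^{d_j}` of system `e (j, i)`. -/
noncomputable def placedVector {n k : ℕ} {r deg m : Fin k → ℕ} (e : (Σ j, Fin (m j)) ≃ Fin n)
    (v : ∀ j, EuclideanSpace ℂ (Fin (m j) → Fin (r j)))
    (w : ∀ j, EuclideanSpace ℂ (Fin (m j) → Fin (deg j))) :
    EuclideanSpace ℂ (Fin n → Σ j, Fin (r j) × Fin (deg j)) :=
  WithLp.toLp 2 fun x =>
    ∑ a : ∀ j, Fin (m j) → Fin (r j), ∑ b : ∀ j, Fin (m j) → Fin (deg j),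
      if x = fun p => ⟨(e.symm p).1, a _ (e.symm p).2, b _ (e.symm p).2⟩ then
        ∏ j, v j (a j) * w j (b j)
      else 0

/-- The space `H_{m; lam_1, …, lam_k}`: the sum over all permutations of the `n` systems of the
images of `⨂_j (ℂ^{r_j})^{⊗ m_j} ⊗ (U_{lam_j} ⊗ V_{lam_j})`. -/
noncomputable def blockSpace (n : ℕ) {k : ℕ} (r : Fin k → ℕ) {deg : Fin k → ℕ} (m : Fin k → ℕ)
    (lam : ∀ j, Fin (deg j) → ℕ) :
    Submodule ℂ (EuclideanSpace ℂ (Fin n → Σ j, Fin (r j) × Fin (deg j))) :=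
  Submodule.span ℂ {ψ | ∃ (e : (Σ j, Fin (m j)) ≃ Fin n)
    (v : ∀ j, EuclideanSpace ℂ (Fin (m j) → Fin (r j)))
    (w : ∀ j, EuclideanSpace ℂ (Fin (m j) → Fin (deg j))),
    (∀ j, w j ∈ schurWeylSummand (Fin (m j)) (lam j)) ∧ ψ = placedVector e v w}

namespace LocalDecomposition

variable {G : Type*} [Group G] {d : ℕ} {π : G →* Matrix.unitaryGroup (Fin d) ℂ}
  (D : LocalDecomposition π)

/-- The index set of the families `(lam_1, …, lam_k)`, `lam_j ∈ Y_{m_j}^{d_j}`. -/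
noncomputable def diagramFamilies (m : Fin D.k → ℕ) : Finset (∀ j, Fin (D.deg j) → ℕ) :=
  Fintype.piFinset fun j => diagrams (m j) (D.deg j)

/-- The projection `P_{m; lam_1, …, lam_k}` on `(ℂ^d)^{⊗ n}`. -/
noncomputable def P (n : ℕ) (m : Fin D.k → ℕ) (lam : ∀ j, Fin (D.deg j) → ℕ) :
    Matrix (Fin n → Fin d) (Fin n → Fin d) ℂ :=
  tensorMatrix (fun _ : Fin n => D.W) * projMatrix (blockSpace n D.r m lam) *
    (tensorMatrix fun _ : Fin n => D.W)ᴴ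

/-- `τ_U(lam_1, …, lam_k) = ⨁_j (1 / r_j) ⊗ U_j diag(lam_j / n) U_j†`. -/
noncomputable def tau (n : ℕ) (lam : ∀ j, Fin (D.deg j) → ℕ)
    (U : ∀ j, Matrix.unitaryGroup (Fin (D.deg j)) ℂ) : Matrix (Fin d) (Fin d) ℂ :=
  D.W * Matrix.blockDiagonal' (fun j =>
    ((D.r j : ℂ)⁻¹ • (1 : Matrix (Fin (D.r j)) (Fin (D.r j)) ℂ)) ⊗ₖ
      ((U j : Matrix (Fin (D.deg j)) (Fin (D.deg j)) ℂ) *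
        Matrix.diagonal (fun i => (lam j i : ℂ) / (n : ℂ)) *
        (U j : Matrix (Fin (D.deg j)) (Fin (D.deg j)) ℂ)ᴴ)) * D.Wᴴ

/-- The average of `τ_U(lam_1, …, lam_k)^{⊗ n}` over independent Haar distributed `U_j`. -/
noncomputable def averagedIID (n : ℕ) (lam : ∀ j, Fin (D.deg j) → ℕ) :
    Matrix (Fin n → Fin d) (Fin n → Fin d) ℂ :=
  Matrix.of fun x y =>
    ∫ U, tensorMatrix (fun _ : Fin n => D.tau n lam U) x y
      ∂(MeasureTheory.Measure.pi fun j => haarUnitary (D.deg j))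

end LocalDecomposition

end DeFinetti

open DeFinetti

set_option linter.unusedSectionVars false

/-! The invariant operators lie in the commutant of a finite-dimensional algebra, and everything is
read off from one minimal projection in each simple summand of that algebra. Let 𝒜 be the algebra
generated by the permutations V_σ and the local matrix units |a⟩⟨b| ⊗ 1 of the spaces ℂ^{r_j}. By
Schur's lemma every one-system slice of a locally invariant operator has the form ⨁_j 1 ⊗ B_j, so an
invariant operator lies in 𝒜' (`localFamily_mem_of_invariant`). A weighted average over the products
of V_σ with matrix units is a unital trace-preserving projection 𝓔 onto 𝒜' (`localFamily`).

For each label b = (m; lam_1, …, lam_k) let e_b fix the arrangement of the types, fix one basis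
vector in every ℂ^{r_j}, and apply the self-adjoint Young idempotent of lam_j on the multiplicity
spaces (`minimalProj`). For every generator K, e_b K e_b is a multiple of e_b and e_b K e_c = 0 for
c ≠ b. Orthogonality of the compression coefficients identifies the dimension D_b, and the ranges of
all K e_b span the space. From this alone (`TwirlFamily.Blocks`) the operators P_b = D_b 𝓔(e_b) are
central projections with sum 1, which gives the pinching identity. The channels are S(X) = ∑ D_b e_b
𝓔(X) e_b and R = 𝓔; for X in 𝒜' one has S(X) = ∑ D_b X e_b, and 𝓔(D_b X e_b) = X P_b gives recovery.

For the support bound, S(P_b ρ P_b) = D_b e_b ρ e_b has support below e_b. The averaged i.i.d.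
operator A lies in 𝒜' and commutes with 𝒜', hence A e_b = w_b e_b with w_b ≥ 0 and S(A) ≥ D_b w_b
e_b. The constant needed is tr e_b / (D_b tr(e_b A)), which is the product of the prefactors
(`prefactor_mul_trace`), because tr e_b = ∏ dim U_{lam_j} and tr(e_b A) = ∏ r_j^{-m_j}
s_{lam_j}(lam_j / n).

Four inputs carry the rest. The Young idempotents are primitive, pairwise orthogonal and complete;
completeness is a count of partitions against conjugacy classes (`one_mem_span_youngCentral`). The
trace of a Young idempotent against t^{⊗n} is the Schur polynomial (`tracePoly_youngIdem`):
multiplied by the Vandermonde product it solves a Casimir equation, and dominance leaves only the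
exponents of the alternant. The averaged operator commutes with 𝒜' by polarization and the spectral
theorem (`comm_of_mem`). Statements with a second system E reduce to matrix elements in E. -/

namespace DeFinetti

/-! ### Row sums and signed column sums in the group algebra -/

section Symmetrizers

variable {ι α β : Type*} [Fintype ι] [DecidableEq ι] [DecidableEq α] [DecidableEq β]

/-- The basis element of the group algebra attached to a permutation. -/
noncomputable abbrev gr (σ : Equiv.Perm ι) : MonoidAlgebra ℂ (Equiv.Perm ι) :=
  MonoidAlgebra.single σ 1

/-- The sign of a permutation as a complex number. -/
noncomputable abbrev sgn (σ : Equiv.Perm ι) : ℂ := (((Equiv.Perm.sign σ : ℤˣ) : ℤ) : ℂ)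

theorem gr_mul (σ τ : Equiv.Perm ι) : gr (σ * τ) = gr σ * gr τ := by
  simp [gr, MonoidAlgebra.single_mul_single]

theorem single_eq_smul_gr (σ : Equiv.Perm ι) (z : ℂ) :
    (MonoidAlgebra.single σ z : MonoidAlgebra ℂ (Equiv.Perm ι)) = z • gr σ := by
  simp [gr]

theorem gr_one : gr (1 : Equiv.Perm ι) = 1 := rfl

theorem sgn_mul (σ τ : Equiv.Perm ι) : sgn (σ * τ) = sgn σ * sgn τ := by
  simp [sgn]

theorem sgn_inv (σ : Equiv.Perm ι) : sgn σ⁻¹ = sgn σ := by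
  simp [sgn]

theorem sgn_mul_self (σ : Equiv.Perm ι) : sgn σ * sgn σ = 1 := by
  rcases Int.units_eq_one_or (Equiv.Perm.sign σ) with h | h <;> simp [sgn, h]

/-- The permutations preserving the fibres of a function. -/
def fiberPerms (r : ι → α) : Finset (Equiv.Perm ι) :=
  Finset.univ.filter fun σ => ∀ p, r (σ p) = r p

theorem mem_fiberPerms {r : ι → α} {σ : Equiv.Perm ι} :
    σ ∈ fiberPerms r ↔ ∀ p, r (σ p) = r p := by
  simp [fiberPerms]

theorem one_mem_fiberPerms (r : ι → α) : 1 ∈ fiberPerms r := by simp [fiberPerms]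

theorem mul_mem_fiberPerms {r : ι → α} {σ τ : Equiv.Perm ι} (hσ : σ ∈ fiberPerms r)
    (hτ : τ ∈ fiberPerms r) : σ * τ ∈ fiberPerms r := by
  rw [mem_fiberPerms] at *
  intro p
  rw [Equiv.Perm.mul_apply, hσ, hτ]

theorem inv_mem_fiberPerms {r : ι → α} {σ : Equiv.Perm ι} (hσ : σ ∈ fiberPerms r) :
    σ⁻¹ ∈ fiberPerms r := by
  rw [mem_fiberPerms] at *
  intro p
  have := hσ (σ⁻¹ p)
  simpa using this.symm

theorem swap_mem_fiberPerms {r : ι → α} {p q : ι} (h : r p = r q) :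
    Equiv.swap p q ∈ fiberPerms r := by
  rw [mem_fiberPerms]
  intro s
  rw [Equiv.swap_apply_def]
  split_ifs with h1 h2 <;> simp_all

/-- The sum of the permutations preserving the fibres of `r`. -/
noncomputable def rowSum (r : ι → α) : MonoidAlgebra ℂ (Equiv.Perm ι) :=
  ∑ σ ∈ fiberPerms r, gr σ

/-- The signed sum of the permutations preserving the fibres of `c`. -/
noncomputable def colSum (c : ι → β) : MonoidAlgebra ℂ (Equiv.Perm ι) :=
  ∑ σ ∈ fiberPerms c, sgn σ • gr σ

theorem sum_fiberPerms_mul_left {M : Type*} [AddCommMonoid M] {r : ι → α} {σ : Equiv.Perm ι}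
    (hσ : σ ∈ fiberPerms r) (f : Equiv.Perm ι → M) :
    ∑ τ ∈ fiberPerms r, f (σ * τ) = ∑ τ ∈ fiberPerms r, f τ :=
  Finset.sum_bij' (fun τ _ => σ * τ) (fun τ _ => σ⁻¹ * τ)
    (fun _ h => mul_mem_fiberPerms hσ h) (fun _ h => mul_mem_fiberPerms (inv_mem_fiberPerms hσ) h)
    (by simp) (by simp) (by simp)

theorem sum_fiberPerms_mul_right {M : Type*} [AddCommMonoid M] {r : ι → α} {σ : Equiv.Perm ι}
    (hσ : σ ∈ fiberPerms r) (f : Equiv.Perm ι → M) :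
    ∑ τ ∈ fiberPerms r, f (τ * σ) = ∑ τ ∈ fiberPerms r, f τ :=
  Finset.sum_bij' (fun τ _ => τ * σ) (fun τ _ => τ * σ⁻¹)
    (fun _ h => mul_mem_fiberPerms h hσ) (fun _ h => mul_mem_fiberPerms h (inv_mem_fiberPerms hσ))
    (by simp) (by simp) (by simp)

theorem gr_mul_rowSum {r : ι → α} {σ : Equiv.Perm ι} (hσ : σ ∈ fiberPerms r) :
    gr σ * rowSum r = rowSum r := by
  simp only [rowSum, Finset.mul_sum, ← gr_mul]
  exact sum_fiberPerms_mul_left hσ gr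

theorem rowSum_mul_gr {r : ι → α} {σ : Equiv.Perm ι} (hσ : σ ∈ fiberPerms r) :
    rowSum r * gr σ = rowSum r := by
  simp only [rowSum, Finset.sum_mul, ← gr_mul]
  exact sum_fiberPerms_mul_right hσ gr

theorem gr_mul_colSum {c : ι → β} {σ : Equiv.Perm ι} (hσ : σ ∈ fiberPerms c) :
    gr σ * colSum c = sgn σ • colSum c := by
  have h := sum_fiberPerms_mul_left hσ (fun τ => (sgn σ * sgn τ) • gr τ)
  simp only [colSum, Finset.mul_sum, mul_smul_comm, ← gr_mul, Finset.smul_sum, smul_smul]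
  rw [← h]
  refine Finset.sum_congr rfl fun τ _ => ?_
  rw [sgn_mul, ← mul_assoc, sgn_mul_self, one_mul]

theorem colSum_mul_gr {c : ι → β} {σ : Equiv.Perm ι} (hσ : σ ∈ fiberPerms c) :
    colSum c * gr σ = sgn σ • colSum c := by
  have h := sum_fiberPerms_mul_right hσ (fun τ => (sgn σ * sgn τ) • gr τ)
  simp only [colSum, Finset.sum_mul, smul_mul_assoc, ← gr_mul, Finset.smul_sum, smul_smul]
  rw [← h]
  refine Finset.sum_congr rfl fun τ _ => ?_
  rw [sgn_mul, mul_comm (sgn τ), ← mul_assoc, sgn_mul_self, one_mul]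

theorem rowSum_mul_rowSum (r : ι → α) :
    rowSum r * rowSum r = ((fiberPerms r).card : ℂ) • rowSum r := by
  conv_lhs => enter [1]; rw [rowSum]
  rw [Finset.sum_mul, Finset.sum_congr rfl fun σ hσ => gr_mul_rowSum hσ]
  rw [Finset.sum_const, Nat.cast_smul_eq_nsmul]

theorem fiberPerms_comp (r : ι → α) (σ τ : Equiv.Perm ι) :
    τ ∈ fiberPerms (r ∘ σ) ↔ σ * τ * σ⁻¹ ∈ fiberPerms r := by
  simp only [mem_fiberPerms, Function.comp, Equiv.Perm.mul_apply]
  refine ⟨fun h p => ?_, fun h p => ?_⟩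
  · simpa using h (σ⁻¹ p)
  · simpa using h (σ p)

theorem sum_fiberPerms_comp {M : Type*} [AddCommMonoid M] (r : ι → α) (σ : Equiv.Perm ι)
    (f : Equiv.Perm ι → M) :
    ∑ τ ∈ fiberPerms (r ∘ σ), f (σ * τ) = ∑ τ ∈ fiberPerms r, f (τ * σ) :=
  Finset.sum_bij' (fun τ _ => σ * τ * σ⁻¹) (fun τ _ => σ⁻¹ * τ * σ)
    (fun _ h => (fiberPerms_comp r σ _).1 h)
    (fun τ h => by
      rw [fiberPerms_comp]
      simpa [mul_assoc] using h)
    (by simp [mul_assoc]) (by simp [mul_assoc]) (by simp)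

/-- The fibre groups of `r ∘ σ` and `r` are conjugate under `σ`. This moves a permutation past a row
sum, so that vanishing has to be proved only for a row sum standing next to a column sum. -/
theorem gr_mul_rowSum_comp (r : ι → α) (σ : Equiv.Perm ι) :
    gr σ * rowSum (r ∘ σ) = rowSum r * gr σ := by
  simp only [rowSum, Finset.mul_sum, Finset.sum_mul, ← gr_mul]
  exact sum_fiberPerms_comp r σ gr

theorem gr_mul_colSum_comp (c : ι → β) (σ : Equiv.Perm ι) :
    gr σ * colSum (c ∘ σ) = colSum c * gr σ := by
  have h := sum_fiberPerms_comp c σ (fun τ => (sgn σ * sgn τ) • gr τ)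
  simp only [colSum, Finset.mul_sum, Finset.sum_mul, mul_smul_comm, smul_mul_assoc, ← gr_mul]
  simp only [sgn_mul, ← mul_assoc, sgn_mul_self, one_mul, mul_comm _ (sgn σ)] at h
  exact h

theorem eq_zero_of_eq_neg {M : Type*} [AddCommGroup M] [Module ℂ M] {x : M} (h : x = -x) :
    x = 0 := by
  have h2 : (2 : ℂ) • x = 0 := by
    rw [two_smul]
    nth_rewrite 2 [h]
    exact add_neg_cancel x
  exact (smul_eq_zero.mp h2).resolve_left two_ne_zero

/-- If two elements lie in a common fibre of `r` and of `c`, the products of the two sums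
vanish. -/
theorem rowSum_mul_colSum_eq_zero {r : ι → α} {c : ι → β} {p q : ι} (hpq : p ≠ q)
    (hr : r p = r q) (hc : c p = c q) : rowSum r * colSum c = 0 := by
  -- The transposition (p q) is absorbed by the row sum with sign +1 and by the column sum with sign
  -- -1.
  have h1 := rowSum_mul_gr (swap_mem_fiberPerms hr)
  have h2 := gr_mul_colSum (swap_mem_fiberPerms hc)
  have h3 : rowSum r * colSum c = -(rowSum r * colSum c) := by
    conv_lhs => rw [← h1, mul_assoc, h2]
    simp [sgn, Equiv.Perm.sign_swap hpq]
  exact eq_zero_of_eq_neg h3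

theorem colSum_mul_rowSum_eq_zero {r : ι → α} {c : ι → β} {p q : ι} (hpq : p ≠ q)
    (hr : r p = r q) (hc : c p = c q) : colSum c * rowSum r = 0 := by
  have h1 := gr_mul_rowSum (swap_mem_fiberPerms hr)
  have h2 := colSum_mul_gr (swap_mem_fiberPerms hc)
  have h3 : colSum c * rowSum r = -(colSum c * rowSum r) := by
    conv_lhs => rw [← h1, ← mul_assoc, h2]
    simp [sgn, Equiv.Perm.sign_swap hpq]
  exact eq_zero_of_eq_neg h3

theorem rowSum_gr_colSum_eq_zero {r : ι → α} {c : ι → β} (σ : Equiv.Perm ι) {p q : ι}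
    (hpq : p ≠ q) (hr : r (σ p) = r (σ q)) (hc : c p = c q) :
    rowSum r * gr σ * colSum c = 0 := by
  rw [← gr_mul_rowSum_comp, mul_assoc, rowSum_mul_colSum_eq_zero hpq hr hc, mul_zero]

theorem colSum_gr_rowSum_eq_zero {r : ι → α} {c : ι → β} (σ : Equiv.Perm ι) {p q : ι}
    (hpq : p ≠ q) (hr : r p = r q) (hc : c (σ p) = c (σ q)) :
    colSum c * gr σ * rowSum r = 0 := by
  rw [← gr_mul_colSum_comp, mul_assoc, colSum_mul_rowSum_eq_zero hpq hr hc, mul_zero]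

end Symmetrizers

/-! ### Numberings of Young diagrams -/

section Numberings

variable {ι : Type*} [Fintype ι] [DecidableEq ι] {d : ℕ} {lam mu : Fin d → ℕ}

/-- The row of an element in a numbering. -/
abbrev rowOf (T : ι ≃ Boxes lam) (p : ι) : Fin d := (T p).1

/-- The column of an element in a numbering. -/
abbrev colOf (T : ι ≃ Boxes lam) (p : ι) : ℕ := ((T p).2 : ℕ)

theorem youngSymmetrizer_eq (T : ι ≃ Boxes lam) :
    youngSymmetrizer T = rowSum (rowOf T) * colSum (colOf T) := by
  have h : colSum (colOf T) = ∑ σ ∈ fiberPerms (colOf T),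
      (MonoidAlgebra.single σ (sgn σ) : MonoidAlgebra ℂ (Equiv.Perm ι)) :=
    Finset.sum_congr rfl fun σ _ => (single_eq_smul_gr σ _).symm
  rw [h]
  rfl

@[simp]
theorem rowOf_symm (T : ι ≃ Boxes lam) (b : Boxes lam) : rowOf T (T.symm b) = b.1 := by
  rw [rowOf, T.apply_symm_apply]

@[simp]
theorem colOf_symm (T : ι ≃ Boxes lam) (b : Boxes lam) : colOf T (T.symm b) = b.2 := by
  rw [colOf, T.apply_symm_apply]

theorem eq_of_row_col (T : ι ≃ Boxes lam) {p q : ι} (hr : rowOf T p = rowOf T q)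
    (hc : colOf T p = colOf T q) : p = q := by
  apply T.injective
  rw [rowOf, rowOf] at hr
  rw [colOf, colOf] at hc
  generalize T p = a at *
  generalize T q = b at *
  obtain ⟨i, x⟩ := a
  obtain ⟨j, y⟩ := b
  simp only at hr
  subst hr
  simp only [Sigma.mk.injEq, heq_eq_eq, true_and]
  exact Fin.ext hc

theorem colOf_lt (T : ι ≃ Boxes lam) (p : ι) : colOf T p < lam (rowOf T p) := (T p).2.2

theorem card_rowOf_eq (T : ι ≃ Boxes lam) (i : Fin d) :
    (Finset.univ.filter fun p => rowOf T p = i).card = lam i := by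
  rw [← Fintype.card_fin (lam i), ← Finset.card_univ]
  refine Finset.card_bij' (fun p hp => ⟨colOf T p, ?_⟩) (fun x _ => T.symm ⟨i, x⟩) ?_ ?_ ?_ ?_
  · have := colOf_lt T p
    rwa [(Finset.mem_filter.1 hp).2] at this
  · simp
  · intro x _
    simp only [Finset.mem_filter, Finset.mem_univ, true_and, rowOf_symm]
  · intro p hp
    have hp' := (Finset.mem_filter.1 hp).2
    exact eq_of_row_col T ((rowOf_symm T _).trans hp'.symm) (colOf_symm T _)
  · intro x _
    exact Fin.ext (colOf_symm T _)

/-- If column `c` reaches row `i` or beyond, it has a box in every row `k < i`, and distinct entries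
`k < i` inject into these boxes. Otherwise all its boxes lie in rows `< i` and there is nothing to
prove. -/
theorem card_col_lt_le (T : ι ≃ Boxes lam) (hlam : Antitone lam) (x : ι → Fin d)
    (hx : ∀ p q, colOf T p = colOf T q → x p = x q → p = q) (i c : ℕ) :
    (Finset.univ.filter fun p => (x p : ℕ) < i ∧ colOf T p = c).card ≤
      (Finset.univ.filter fun p => (rowOf T p : ℕ) < i ∧ colOf T p = c).card := by
  by_cases h : ∃ p, colOf T p = c ∧ i ≤ (rowOf T p : ℕ)
  · obtain ⟨p₀, hp, hi⟩ := h
    have hlt : ∀ k : Fin d, (k : ℕ) < i → c < lam k := fun k hk => by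
      have h1 := colOf_lt T p₀
      rw [hp] at h1
      exact h1.trans_le (hlam (Fin.le_def.2 (by omega)))
    -- The value `p` in the other branch is a dummy: only elements with `x p < i` are tested.
    refine Finset.card_le_card_of_injOn (fun p => if h : (x p : ℕ) < i then
      T.symm ⟨x p, c, hlt _ h⟩ else p) ?_ ?_
    · intro p hp
      simp only [Finset.coe_filter, Finset.mem_univ, true_and, Set.mem_ofPred_eq] at hp ⊢
      rw [dif_pos hp.1, rowOf_symm, colOf_symm]
      exact ⟨hp.1, rfl⟩
    · intro p hp q hq hpq
      simp only [Finset.coe_filter, Finset.mem_univ, true_and, Set.mem_ofPred_eq] at hp hq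
      simp only [hp.1, hq.1, dif_pos] at hpq
      have := T.symm.injective hpq
      simp only [Sigma.mk.injEq] at this
      exact hx p q (hp.2.trans hq.2.symm) this.1
  · push Not at h
    refine Finset.card_le_card fun p hp => ?_
    simp only [Finset.mem_filter, Finset.mem_univ, true_and] at hp ⊢
    exact ⟨h p hp.2, hp.2⟩

theorem card_filter_eq_sum_col (T : ι ≃ Boxes lam) (P : ι → Prop) [DecidablePred P] :
    (Finset.univ.filter P).card =
      ∑ c ∈ Finset.univ.image (colOf T), (Finset.univ.filter fun p => P p ∧ colOf T p = c).card := by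
  rw [Finset.card_eq_sum_card_fiberwise (f := colOf T) (t := Finset.univ.image (colOf T))]
  · simp only [Finset.filter_filter]
  · intro p _
    simp

/-- A filling with distinct entries in each column has a content dominated by the diagram. -/
theorem card_lt_le (T : ι ≃ Boxes lam) (hlam : Antitone lam) (x : ι → Fin d)
    (hx : ∀ p q, colOf T p = colOf T q → x p = x q → p = q) (i : ℕ) :
    (Finset.univ.filter fun p => (x p : ℕ) < i).card ≤
      (Finset.univ.filter fun p => (rowOf T p : ℕ) < i).card := by
  rw [card_filter_eq_sum_col T, card_filter_eq_sum_col T]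
  exact Finset.sum_le_sum fun c _ => card_col_lt_le T hlam x hx i c

/-- A filling with distinct entries in each column whose content is the diagram arises from the
row filling by a column permutation. -/
theorem exists_col_perm (T : ι ≃ Boxes lam) (hlam : Antitone lam) (x : ι → Fin d)
    (hx : ∀ p q, colOf T p = colOf T q → x p = x q → p = q)
    (hcont : ∀ i : ℕ, (Finset.univ.filter fun p => (x p : ℕ) < i).card =
      (Finset.univ.filter fun p => (rowOf T p : ℕ) < i).card) :
    ∃ γ ∈ fiberPerms (colOf T), rowOf T ∘ γ = x := by
  -- Equal totals force equality of the counts in every column. If the column of `p` ended above row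
  -- `x p`, all its boxes, that of `p` included, would lie in rows `< x p`, whereas `p` itself does
  -- not have an entry `< x p`; the count in that column would be strict.
  have hlt : ∀ p, colOf T p < lam (x p) := by
    intro p
    by_contra hp
    push Not at hp
    have h1 : ∀ c ∈ Finset.univ.image (colOf T),
        (Finset.univ.filter fun q => (x q : ℕ) < (x p : ℕ) ∧ colOf T q = c).card =
        (Finset.univ.filter fun q => (rowOf T q : ℕ) < (x p : ℕ) ∧ colOf T q = c).card := by
      have := hcont (x p)
      rw [card_filter_eq_sum_col T, card_filter_eq_sum_col T,
        Finset.sum_eq_sum_iff_of_le fun c _ => card_col_lt_le T hlam x hx _ c] at this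
      exact this
    have h2 := h1 (colOf T p) (Finset.mem_image_of_mem _ (Finset.mem_univ p))
    refine h2.not_lt (Finset.card_lt_card ⟨fun q hq => ?_, fun hs => ?_⟩)
    · simp only [Finset.mem_filter, Finset.mem_univ, true_and] at hq ⊢
      refine ⟨?_, hq.2⟩
      by_contra hle
      have h3 := colOf_lt T q
      rw [hq.2] at h3
      have h4 : lam (rowOf T q) ≤ lam (x p) := hlam (Fin.le_def.2 (not_lt.1 hle))
      omega
    · have hmem : p ∈ Finset.univ.filter fun q => (rowOf T q : ℕ) < (x p : ℕ) ∧
          colOf T q = colOf T p := by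
        simp only [Finset.mem_filter, Finset.mem_univ, true_and, and_true]
        by_contra hle
        have h3 := colOf_lt T p
        have h4 : lam (rowOf T p) ≤ lam (x p) := hlam (Fin.le_def.2 (not_lt.1 hle))
        omega
      have := hs hmem
      simp at this
  -- Each `p` moves inside its own column to the row named by its entry.
  let γ : ι → ι := fun p => T.symm ⟨x p, colOf T p, hlt p⟩
  have hγ : Function.Injective γ := by
    intro p q hpq
    have := T.symm.injective hpq
    rw [Sigma.mk.injEq] at this
    refine hx p q ?_ this.1
    have h5 : colOf T (γ p) = colOf T (γ q) := by rw [hpq]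
    simpa only [γ, colOf_symm] using h5
  refine ⟨Equiv.ofBijective γ (Finite.injective_iff_bijective.1 hγ), ?_, ?_⟩
  · rw [mem_fiberPerms]
    intro p
    exact colOf_symm T _
  · funext p
    exact rowOf_symm T _

theorem card_rowOf_lt_eq_sum (T : ι ≃ Boxes lam) (i : ℕ) :
    (Finset.univ.filter fun p => (rowOf T p : ℕ) < i).card =
      ∑ k ∈ Finset.univ.filter (fun k : Fin d => (k : ℕ) < i), lam k := by
  rw [Finset.card_eq_sum_card_fiberwise (f := rowOf T)
    (t := Finset.univ.filter (fun k : Fin d => (k : ℕ) < i))]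
  · refine Finset.sum_congr rfl fun k hk => ?_
    rw [← card_rowOf_eq T k, Finset.filter_filter]
    congr 1
    ext p
    simp only [Finset.mem_filter, Finset.mem_univ, true_and] at hk ⊢
    constructor
    · exact fun h => h.2
    · rintro rfl
      exact ⟨hk, rfl⟩
  · intro p hp
    simpa using hp

end Numberings

/-! ### The primitive idempotents attached to Young diagrams -/

section GroupAlgebra

variable {ι : Type*} [Fintype ι] [DecidableEq ι]

theorem eq_sum_coeff_gr (y : MonoidAlgebra ℂ (Equiv.Perm ι)) :
    y = ∑ σ, y.coeff σ • gr σ := by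
  ext τ
  simp [gr, MonoidAlgebra.coeff_sum]

theorem coeff_mul_gr (y : MonoidAlgebra ℂ (Equiv.Perm ι)) (σ τ : Equiv.Perm ι) :
    (y * gr σ).coeff τ = y.coeff (τ * σ⁻¹) := by
  simp [gr]

theorem coeff_gr_mul (y : MonoidAlgebra ℂ (Equiv.Perm ι)) (σ τ : Equiv.Perm ι) :
    (gr σ * y).coeff τ = y.coeff (σ⁻¹ * τ) := by
  simp [gr]

/-- The coefficient at the identity is, up to the order of the group, the trace of the regular
representation. It serves below as the trace on the group algebra. -/
theorem coeff_one_mul_comm (x y : MonoidAlgebra ℂ (Equiv.Perm ι)) :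
    (x * y).coeff 1 = (y * x).coeff 1 := by
  rw [eq_sum_coeff_gr x]
  simp only [Finset.sum_mul, Finset.mul_sum, MonoidAlgebra.coeff_sum, Finsupp.finsetSum_apply,
    smul_mul_assoc, mul_smul_comm, MonoidAlgebra.coeff_smul, Finsupp.smul_apply, coeff_mul_gr,
    coeff_gr_mul]
  simp

theorem coeff_one_mul (x y : MonoidAlgebra ℂ (Equiv.Perm ι)) :
    (x * y).coeff 1 = ∑ σ, x.coeff σ * y.coeff σ⁻¹ := by
  conv_lhs => rw [eq_sum_coeff_gr x]
  simp only [Finset.sum_mul, MonoidAlgebra.coeff_sum, Finsupp.finsetSum_apply,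
    smul_mul_assoc, MonoidAlgebra.coeff_smul, Finsupp.smul_apply, coeff_gr_mul, smul_eq_mul]
  simp

instance finiteDimensional_groupAlgebra :
    FiniteDimensional ℂ (MonoidAlgebra ℂ (Equiv.Perm ι)) :=
  Module.Finite.of_basis (MonoidAlgebra.basis (Equiv.Perm ι) ℂ)

/-- All diagonal entries agree, since σ y has at σ the coefficient of y at 1. This links the
coefficient of a symmetrizer at 1 with the dimension of the left ideal it generates. -/
theorem trace_mulRight (y : MonoidAlgebra ℂ (Equiv.Perm ι)) :
    LinearMap.trace ℂ _ (LinearMap.mulRight ℂ y) =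
      (Fintype.card (Equiv.Perm ι) : ℂ) * y.coeff 1 := by
  rw [LinearMap.trace_eq_matrix_trace ℂ (MonoidAlgebra.basis (Equiv.Perm ι) ℂ), Matrix.trace]
  have h : ∀ σ, (LinearMap.toMatrix (MonoidAlgebra.basis (Equiv.Perm ι) ℂ)
      (MonoidAlgebra.basis (Equiv.Perm ι) ℂ) (LinearMap.mulRight ℂ y)).diag σ = y.coeff 1 := by
    intro σ
    rw [Matrix.diag_apply, LinearMap.toMatrix_apply, LinearMap.mulRight_apply]
    have : (MonoidAlgebra.basis (Equiv.Perm ι) ℂ) σ = gr σ := by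
      simp [gr]
    rw [this]
    change (gr σ * y).coeff σ = _
    rw [coeff_gr_mul, inv_mul_cancel]
  rw [Finset.sum_congr rfl fun σ _ => h σ]
  simp

end GroupAlgebra

/-! ### Primitivity and mutual orthogonality of Young idempotents -/

section YoungIdempotent

variable {ι : Type*} [Fintype ι] [DecidableEq ι] {d : ℕ} {lam mu : Fin d → ℕ}

/-- A permutation preserving both rows and columns is trivial, so only the product of the two
identities contributes. -/
theorem coeff_one_youngSymmetrizer (T : ι ≃ Boxes lam) : (youngSymmetrizer T).coeff 1 = 1 := by
  rw [youngSymmetrizer_eq, rowSum, Finset.sum_mul]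
  simp only [MonoidAlgebra.coeff_sum, Finsupp.finsetSum_apply, coeff_gr_mul]
  rw [Finset.sum_eq_single 1]
  · simp only [colSum, MonoidAlgebra.coeff_sum, Finsupp.finsetSum_apply,
      MonoidAlgebra.coeff_smul, Finsupp.smul_apply, MonoidAlgebra.coeff_single, Finsupp.single_apply]
    rw [Finset.sum_eq_single 1]
    · simp
    · intro γ _ hγ
      rw [if_neg (by simpa using hγ)]
      simp
    · exact fun h => absurd (one_mem_fiberPerms _) h
  · intro ρ hρ hne
    simp only [colSum, MonoidAlgebra.coeff_sum, Finsupp.finsetSum_apply,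
      MonoidAlgebra.coeff_smul, Finsupp.smul_apply, MonoidAlgebra.coeff_single, Finsupp.single_apply]
    refine Finset.sum_eq_zero fun γ hγ => ?_
    rw [if_neg, smul_zero]
    intro h
    apply hne
    rw [mul_one] at h
    subst h
    have hρ' := inv_mem_fiberPerms hρ
    rw [mem_fiberPerms] at hρ' hγ
    have : ρ⁻¹ = 1 := Equiv.ext fun p => eq_of_row_col T (hρ' p) (hγ p)
    simpa using this
  · exact fun h => absurd (one_mem_fiberPerms _) h

/-- Von Neumann's lemma. Either σ sends two elements of one column into one row, and the product
vanishes; or σ = ργ with ρ preserving rows and γ preserving columns, and both are absorbed, γ up to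
its sign. -/
theorem exists_rowSum_gr_colSum (T : ι ≃ Boxes lam) (hlam : Antitone lam) (σ : Equiv.Perm ι) :
    ∃ z : ℂ, rowSum (rowOf T) * gr σ * colSum (colOf T) = z • youngSymmetrizer T := by
  by_cases h : ∃ p q, p ≠ q ∧ rowOf T (σ p) = rowOf T (σ q) ∧ colOf T p = colOf T q
  · obtain ⟨p, q, hpq, hr, hc⟩ := h
    exact ⟨0, by rw [rowSum_gr_colSum_eq_zero σ hpq hr hc, zero_smul]⟩
  · obtain ⟨γ, hγ, hx⟩ := exists_col_perm T hlam (rowOf T ∘ σ)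
      (fun p q hc hr => by
        by_contra hne
        exact h ⟨p, q, hne, hr, hc⟩)
      (fun i => Finset.card_bij (fun p _ => σ p) (by simp) (by simp)
        (fun q hq => ⟨σ⁻¹ q, by simpa using hq⟩))
    have hρ : σ * γ⁻¹ ∈ fiberPerms (rowOf T) := by
      rw [mem_fiberPerms]
      intro p
      have := congrFun hx (γ⁻¹ p)
      simpa using this.symm
    refine ⟨sgn γ, ?_⟩
    have h1 : gr σ = gr (σ * γ⁻¹) * gr γ := by rw [← gr_mul]; simp
    rw [h1, ← mul_assoc, rowSum_mul_gr hρ, mul_assoc, gr_mul_colSum hγ, mul_smul_comm,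
      youngSymmetrizer_eq]

theorem exists_rowSum_mul_colSum (T : ι ≃ Boxes lam) (hlam : Antitone lam)
    (y : MonoidAlgebra ℂ (Equiv.Perm ι)) :
    ∃ z : ℂ, rowSum (rowOf T) * y * colSum (colOf T) = z • youngSymmetrizer T := by
  choose z hz using exists_rowSum_gr_colSum T hlam
  refine ⟨∑ σ, y.coeff σ * z σ, ?_⟩
  conv_lhs => rw [eq_sum_coeff_gr y]
  simp only [Finset.mul_sum, Finset.sum_mul, mul_smul_comm, smul_mul_assoc, hz, smul_smul,
    Finset.sum_smul]

/-- The dimension of the left ideal generated by a Young symmetrizer. -/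
noncomputable def symDim (T : ι ≃ Boxes lam) : ℕ :=
  Module.finrank ℂ (LinearMap.range (LinearMap.mulRight ℂ (youngSymmetrizer T)))

theorem finrank_irrepSym {m : ℕ} (h : m = ∑ i, lam i) :
    symDim ((finCongr h).trans (standardNumbering lam)) = Module.finrank ℂ (irrepSym lam) := by
  subst h
  rfl

theorem youngSymmetrizer_ne_zero (T : ι ≃ Boxes lam) : youngSymmetrizer T ≠ 0 := by
  intro h
  have := coeff_one_youngSymmetrizer T
  rw [h] at this
  simp at this

theorem symDim_pos (T : ι ≃ Boxes lam) : 0 < symDim T := by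
  rw [symDim, Module.finrank_pos_iff, Submodule.nontrivial_iff_ne_bot, Ne, LinearMap.range_eq_bot]
  intro h
  apply youngSymmetrizer_ne_zero T
  have := LinearMap.congr_fun h 1
  simpa using this

theorem card_perm_ne_zero : (Fintype.card (Equiv.Perm ι) : ℂ) ≠ 0 :=
  Nat.cast_ne_zero.2 Fintype.card_ne_zero

theorem symDim_ne_zero (T : ι ≃ Boxes lam) : (symDim T : ℂ) ≠ 0 :=
  Nat.cast_ne_zero.2 (symDim_pos T).ne'

theorem card_fiberPerms_ne_zero {α : Type*} [DecidableEq α] (r : ι → α) :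
    ((fiberPerms r).card : ℂ) ≠ 0 :=
  Nat.cast_ne_zero.2 (Finset.card_ne_zero_of_mem (one_mem_fiberPerms r))

/-- Von Neumann's lemma gives c² = h c. Right multiplication by c has trace n!, so it is not
nilpotent and h ≠ 0; divided by h it projects onto the left ideal of c, and comparing traces gives
n!/h = dim. -/
theorem youngSymmetrizer_mul_self (T : ι ≃ Boxes lam) (hlam : Antitone lam) :
    youngSymmetrizer T * youngSymmetrizer T =
      ((Fintype.card (Equiv.Perm ι) : ℂ) / symDim T) • youngSymmetrizer T := by
  obtain ⟨h, hh⟩ := exists_rowSum_mul_colSum T hlam (colSum (colOf T) * rowSum (rowOf T))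
  have hsq : youngSymmetrizer T * youngSymmetrizer T = h • youngSymmetrizer T := by
    rw [← hh, youngSymmetrizer_eq]
    simp only [mul_assoc]
  rw [hsq]
  congr 1
  have htr := trace_mulRight (youngSymmetrizer T)
  rw [coeff_one_youngSymmetrizer, mul_one] at htr
  have hne : h ≠ 0 := by
    rintro rfl
    have hnil : IsNilpotent (LinearMap.mulRight ℂ (youngSymmetrizer T)) := by
      refine ⟨2, ?_⟩
      refine LinearMap.ext fun x => ?_
      rw [pow_two, Module.End.mul_apply, LinearMap.mulRight_apply, LinearMap.mulRight_apply,
        mul_assoc, hsq]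
      simp
    have h0 := (LinearMap.isNilpotent_trace_of_isNilpotent hnil).eq_zero
    rw [htr] at h0
    exact card_perm_ne_zero h0
  have hproj : LinearMap.IsProj (LinearMap.range (LinearMap.mulRight ℂ (youngSymmetrizer T)))
      (h⁻¹ • LinearMap.mulRight ℂ (youngSymmetrizer T)) := by
    constructor
    · intro x
      exact Submodule.smul_mem _ _ (LinearMap.mem_range_self _ _)
    · rintro _ ⟨x, rfl⟩
      simp only [LinearMap.smul_apply, LinearMap.mulRight_apply, mul_assoc, hsq]
      rw [mul_smul_comm, smul_smul, inv_mul_cancel₀ hne, one_smul]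
  have h2 := hproj.trace
  rw [map_smul, htr, smul_eq_mul] at h2
  rw [symDim, ← h2]
  field_simp [card_perm_ne_zero (ι := ι)]

/-- The self-adjoint primitive idempotent proportional to `a_T b_T a_T`. -/
noncomputable def youngIdem (T : ι ≃ Boxes lam) : MonoidAlgebra ℂ (Equiv.Perm ι) :=
  ((symDim T : ℂ) / ((Fintype.card (Equiv.Perm ι) : ℂ) * ((fiberPerms (rowOf T)).card : ℂ))) •
    (youngSymmetrizer T * rowSum (rowOf T))

/-- The normalisation comes from c a c = |R| c², where a is the row sum and R its group. The element
a b a is preferred to c = a b because it acts by self-adjoint operators, while multiplication from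
the left still has the same range. -/
theorem youngIdem_mul_youngSymmetrizer (T : ι ≃ Boxes lam) (hlam : Antitone lam) :
    youngIdem T * youngSymmetrizer T = youngSymmetrizer T := by
  have h1 : youngSymmetrizer T * rowSum (rowOf T) * youngSymmetrizer T =
      ((fiberPerms (rowOf T)).card : ℂ) •
        (((Fintype.card (Equiv.Perm ι) : ℂ) / symDim T) • youngSymmetrizer T) := by
    rw [← youngSymmetrizer_mul_self T hlam, ← mul_smul_comm, mul_assoc]
    congr 1
    rw [youngSymmetrizer_eq, ← mul_assoc, rowSum_mul_rowSum, smul_mul_assoc]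
  rw [youngIdem, smul_mul_assoc, h1, smul_smul, smul_smul]
  have h2 := symDim_ne_zero T
  have h3 := card_fiberPerms_ne_zero (rowOf T)
  have h4 := card_perm_ne_zero (ι := ι)
  convert one_smul ℂ _ using 2
  field_simp

theorem youngIdem_mul_self (T : ι ≃ Boxes lam) (hlam : Antitone lam) :
    youngIdem T * youngIdem T = youngIdem T := by
  conv_lhs => enter [2]; rw [youngIdem]
  rw [mul_smul_comm, ← mul_assoc, youngIdem_mul_youngSymmetrizer T hlam]
  rfl

theorem coeff_one_youngIdem (T : ι ≃ Boxes lam) :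
    (youngIdem T).coeff 1 = (symDim T : ℂ) / Fintype.card (Equiv.Perm ι) := by
  have h1 : (youngSymmetrizer T * rowSum (rowOf T)).coeff 1 = (fiberPerms (rowOf T)).card := by
    rw [coeff_one_mul_comm, youngSymmetrizer_eq, ← mul_assoc, rowSum_mul_rowSum, smul_mul_assoc,
      ← youngSymmetrizer_eq, MonoidAlgebra.coeff_smul, Finsupp.smul_apply,
      coeff_one_youngSymmetrizer, smul_eq_mul, mul_one]
  rw [youngIdem, MonoidAlgebra.coeff_smul, Finsupp.smul_apply, h1, smul_eq_mul]
  have h3 := card_fiberPerms_ne_zero (rowOf T)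
  have h4 := card_perm_ne_zero (ι := ι)
  field_simp

/-- The scalar by which `y` is compressed by a Young idempotent. -/
noncomputable def youngChar (T : ι ≃ Boxes lam) (y : MonoidAlgebra ℂ (Equiv.Perm ι)) : ℂ :=
  ((Fintype.card (Equiv.Perm ι) : ℂ) / symDim T) * (youngIdem T * y).coeff 1

/-- Primitivity. The product contains a row sum, an arbitrary element and a column sum in this
order, so von Neumann's lemma makes it a multiple of the idempotent; the multiple is found by
comparing coefficients at 1. -/
theorem youngIdem_mul_mul (T : ι ≃ Boxes lam) (hlam : Antitone lam)
    (y : MonoidAlgebra ℂ (Equiv.Perm ι)) :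
    youngIdem T * y * youngIdem T = youngChar T y • youngIdem T := by
  have h : ∃ z : ℂ, youngIdem T * y * youngIdem T = z • youngIdem T := by
    obtain ⟨z, hz⟩ := exists_rowSum_mul_colSum T hlam
      (colSum (colOf T) * rowSum (rowOf T) * y * rowSum (rowOf T))
    refine ⟨z * ((symDim T : ℂ) / ((Fintype.card (Equiv.Perm ι) : ℂ) *
      ((fiberPerms (rowOf T)).card : ℂ))), ?_⟩
    have h1 : youngSymmetrizer T * rowSum (rowOf T) * y *
        (youngSymmetrizer T * rowSum (rowOf T)) =
        z • (youngSymmetrizer T * rowSum (rowOf T)) := by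
      rw [← smul_mul_assoc, ← hz, youngSymmetrizer_eq]
      simp only [mul_assoc]
    simp only [youngIdem, smul_mul_assoc, mul_smul_comm, h1, smul_smul]
    congr 1
    ring
  obtain ⟨z, hz⟩ := h
  have h1 := congrArg (fun x : MonoidAlgebra ℂ (Equiv.Perm ι) => x.coeff 1) hz
  rw [coeff_one_mul_comm, ← mul_assoc, youngIdem_mul_self T hlam, MonoidAlgebra.coeff_smul,
    Finsupp.smul_apply, coeff_one_youngIdem, smul_eq_mul] at h1
  rw [hz, youngChar, h1]
  congr 1
  have h2 := symDim_ne_zero T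
  have h4 := card_perm_ne_zero (ι := ι)
  field_simp

theorem youngChar_gr (T : ι ≃ Boxes lam) (σ : Equiv.Perm ι) :
    youngChar T (gr σ) =
      ((Fintype.card (Equiv.Perm ι) : ℂ) / symDim T) * (youngIdem T).coeff σ⁻¹ := by
  rw [youngChar, coeff_mul_gr, one_mul]

/-- Schur orthogonality for one diagonal matrix coefficient of V_lam. It is the relation e² = e read
at the identity, because the compression of σ is n!/dim times the coefficient of e at σ⁻¹. -/
theorem sum_youngChar_mul (T : ι ≃ Boxes lam) (hlam : Antitone lam) :
    ∑ σ : Equiv.Perm ι, youngChar T (gr σ) * youngChar T (gr σ⁻¹) =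
      (Fintype.card (Equiv.Perm ι) : ℂ) / symDim T := by
  have h1 := coeff_one_mul (youngIdem T) (youngIdem T)
  rw [youngIdem_mul_self T hlam, coeff_one_youngIdem] at h1
  have h2 := symDim_ne_zero T
  have h4 := card_perm_ne_zero (ι := ι)
  calc _ = ((Fintype.card (Equiv.Perm ι) : ℂ) / symDim T) ^ 2 *
      ∑ σ : Equiv.Perm ι, (youngIdem T).coeff σ * (youngIdem T).coeff σ⁻¹ := by
        rw [Finset.mul_sum]
        refine Finset.sum_congr rfl fun σ _ => ?_
        rw [youngChar_gr, youngChar_gr, inv_inv]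
        ring
    _ = _ := by
      rw [← h1]
      field_simp

/-- Young idempotents of different diagrams are orthogonal, also up to permutations. -/
theorem youngIdem_mul_gr_mul_eq_zero (T : ι ≃ Boxes lam) (S : ι ≃ Boxes mu) (hlam : Antitone lam)
    (hmu : Antitone mu) (hne : lam ≠ mu) (y : MonoidAlgebra ℂ (Equiv.Perm ι)) :
    youngIdem T * y * youngIdem S = 0 := by
  -- If both alternatives failed, the rows of each diagram would fill the other one with distinct
  -- entries in every column. Each diagram would then dominate the other, and equal partial sums
  -- give equal diagrams.
  have hcase : (∀ σ : Equiv.Perm ι, ∃ p q, p ≠ q ∧ rowOf T (σ p) = rowOf T (σ q) ∧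
      colOf S p = colOf S q) ∨ (∀ σ : Equiv.Perm ι, ∃ p q, p ≠ q ∧ rowOf S (σ p) = rowOf S (σ q) ∧
      colOf T p = colOf T q) := by
    by_contra hcon
    push Not at hcon
    obtain ⟨⟨σ, hσ⟩, ⟨τ, hτ⟩⟩ := hcon
    have key : ∀ {lam mu : Fin d → ℕ} (T : ι ≃ Boxes lam) (S : ι ≃ Boxes mu) (hmu : Antitone mu)
        (σ : Equiv.Perm ι) (hσ : ∀ p q, p ≠ q → rowOf T (σ p) = rowOf T (σ q) →
          colOf S p ≠ colOf S q) (i : ℕ),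
        ∑ k ∈ Finset.univ.filter (fun k : Fin d => (k : ℕ) < i), lam k ≤
        ∑ k ∈ Finset.univ.filter (fun k : Fin d => (k : ℕ) < i), mu k := by
      intro lam mu T S hmu σ hσ i
      rw [← card_rowOf_lt_eq_sum S, ← card_rowOf_lt_eq_sum T]
      refine le_trans (le_of_eq ?_) (card_lt_le S hmu (rowOf T ∘ σ) (fun p q hc hr => ?_) i)
      · exact Finset.card_bij (fun p _ => σ⁻¹ p) (by simp) (by simp)
          (fun q hq => ⟨σ q, by simpa using hq⟩)
      · by_contra hpq
        exact hσ p q hpq hr hc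
    apply hne
    have heq : ∀ i, ∑ k ∈ Finset.univ.filter (fun k : Fin d => (k : ℕ) < i), lam k =
        ∑ k ∈ Finset.univ.filter (fun k : Fin d => (k : ℕ) < i), mu k :=
      fun i => le_antisymm (key T S hmu σ hσ i) (key S T hlam τ hτ i)
    funext k
    have h1 := heq k
    have h2 := heq (k + 1)
    have h3 : Finset.univ.filter (fun j : Fin d => (j : ℕ) < k + 1) =
        insert k (Finset.univ.filter (fun j : Fin d => (j : ℕ) < k)) := by
      ext j
      simp only [Finset.mem_filter, Finset.mem_univ, true_and, Finset.mem_insert, Fin.ext_iff]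
      omega
    rw [h3, Finset.sum_insert (by simp), Finset.sum_insert (by simp), h1] at h2
    exact Nat.add_right_cancel h2
  -- An idempotent a b a contains row sums on both sides of its column sum. So it is enough that a_T
  -- y b_S vanishes for all y, or that b_T y a_S does.
  rcases hcase with h | h
  · have h0 : ∀ y, rowSum (rowOf T) * y * colSum (colOf S) = 0 := by
      intro y
      rw [eq_sum_coeff_gr y]
      simp only [Finset.mul_sum, Finset.sum_mul, mul_smul_comm, smul_mul_assoc]
      refine Finset.sum_eq_zero fun σ _ => ?_
      obtain ⟨p, q, hpq, hr, hc⟩ := h σ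
      rw [rowSum_gr_colSum_eq_zero σ hpq hr hc, smul_zero]
    simp only [youngIdem, smul_mul_assoc, mul_smul_comm, youngSymmetrizer_eq]
    have h3 : rowSum (rowOf T) * colSum (colOf T) * rowSum (rowOf T) * y *
        (rowSum (rowOf S) * colSum (colOf S) * rowSum (rowOf S)) =
        rowSum (rowOf T) * colSum (colOf T) * (rowSum (rowOf T) * (y * rowSum (rowOf S)) *
        colSum (colOf S)) * rowSum (rowOf S) := by
      simp only [mul_assoc]
    rw [h3, h0]
    simp
  · have h0 : ∀ y, colSum (colOf T) * y * rowSum (rowOf S) = 0 := by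
      intro y
      rw [eq_sum_coeff_gr y]
      simp only [Finset.mul_sum, Finset.sum_mul, mul_smul_comm, smul_mul_assoc]
      refine Finset.sum_eq_zero fun σ _ => ?_
      obtain ⟨p, q, hpq, hr, hc⟩ := h σ⁻¹
      rw [colSum_gr_rowSum_eq_zero σ (p := σ⁻¹ p) (q := σ⁻¹ q) (by simpa using hpq) hr
        (by simpa using hc), smul_zero]
    have h2 : colSum (colOf T) * (rowSum (rowOf T) * y * rowSum (rowOf S)) = 0 := by
      rw [← mul_assoc, h0]
    simp only [youngIdem, smul_mul_assoc, mul_smul_comm, youngSymmetrizer_eq]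
    have h3 : rowSum (rowOf T) * colSum (colOf T) * rowSum (rowOf T) * y *
        (rowSum (rowOf S) * colSum (colOf S) * rowSum (rowOf S)) =
        rowSum (rowOf T) * (colSum (colOf T) * (rowSum (rowOf T) * y * rowSum (rowOf S))) *
        colSum (colOf S) * rowSum (rowOf S) := by
      simp only [mul_assoc]
    rw [h3, h2]
    simp

end YoungIdempotent

/-! ### Completeness of the Young idempotents -/

section Completeness

/-- The conjugate of a partition, as a non-increasing tuple: the `j`-th entry is the number of parts
exceeding `j`. -/
def partitionShape {n : ℕ} (p : n.Partition) (j : Fin n) : ℕ :=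
  p.parts.countP (fun v => (j : ℕ) < v)

theorem antitone_partitionShape {n : ℕ} (p : n.Partition) : Antitone (partitionShape p) := by
  intro i j hij
  have hij' : (i : ℕ) ≤ j := hij
  simp only [partitionShape, Multiset.countP_eq_card_filter]
  exact Multiset.card_le_card (Multiset.monotone_filter_right _ fun v hv => by omega)

theorem sum_partitionShape {n : ℕ} (p : n.Partition) : ∑ j, partitionShape p j = n := by
  -- Double counting of the pairs (part v, j < v). The bound `v ≤ n` ensures that `Fin n` contains
  -- every such `j`.
  have key : ∀ s : Multiset ℕ, (∀ v ∈ s, v ≤ n) →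
      ∑ j : Fin n, s.countP (fun v => (j : ℕ) < v) = s.sum := by
    intro s
    induction s using Multiset.induction_on with
    | empty => simp
    | cons a s ih =>
      intro h
      rw [Multiset.sum_cons, ← ih fun v hv => h v (Multiset.mem_cons_of_mem hv)]
      simp only [Multiset.countP_cons, Finset.sum_add_distrib]
      rw [add_comm]
      congr 1
      rw [Finset.sum_boole, Nat.cast_id]
      have ha := h a (Multiset.mem_cons_self a s)
      have : Finset.univ.filter (fun j : Fin n => (j : ℕ) < a) =
          Finset.univ.map (Fin.castLEEmb ha) := by
        ext j
        simp only [Finset.mem_filter, Finset.mem_univ, true_and, Finset.mem_map]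
        exact ⟨fun hj => ⟨⟨j, hj⟩, rfl⟩, by rintro ⟨i, rfl⟩; exact i.2⟩
      rw [this, Finset.card_map, Finset.card_univ, Fintype.card_fin]
  have h := key p.parts fun v hv => by
    have := Multiset.single_le_sum (fun x _ => Nat.zero_le x) v hv
    rwa [p.parts_sum] at this
  rw [p.parts_sum] at h
  exact h

/-- The shape records how many parts exceed each `j < n`, and no part exceeds a larger `j`.
Differences of consecutive counts are the multiplicities of the parts. -/
theorem partitionShape_injective {n : ℕ} :
    Function.Injective (partitionShape : n.Partition → Fin n → ℕ) := by
  intro p q hpq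
  have hle : ∀ (p : n.Partition) (j : ℕ), n ≤ j → p.parts.countP (fun v => j < v) = 0 := by
    intro p j hj
    rw [Multiset.countP_eq_zero]
    intro v hv
    have := Multiset.single_le_sum (fun x _ => Nat.zero_le x) v hv
    rw [p.parts_sum] at this
    omega
  have h : ∀ j, p.parts.countP (fun v => j < v) = q.parts.countP (fun v => j < v) := by
    intro j
    by_cases hj : j < n
    · exact congrFun hpq ⟨j, hj⟩
    · rw [hle p j (not_lt.1 hj), hle q j (not_lt.1 hj)]
  have hcount : ∀ (s : Multiset ℕ) (v : ℕ),
      s.count (v + 1) + s.countP (fun x => v + 1 < x) = s.countP (fun x => v < x) := by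
    intro s v
    induction s using Multiset.induction_on with
    | empty => simp
    | cons a s ih =>
      simp only [Multiset.count_cons, Multiset.countP_cons]
      split_ifs <;> omega
  apply Nat.Partition.ext
  ext v
  rcases v with _ | v
  · rw [Multiset.count_eq_zero_of_notMem, Multiset.count_eq_zero_of_notMem]
    · exact fun h => absurd (q.parts_pos h) (lt_irrefl 0)
    · exact fun h => absurd (p.parts_pos h) (lt_irrefl 0)
  · have h1 := hcount p.parts v
    have h2 := hcount q.parts v
    rw [h, h] at h1
    omega

variable {n : ℕ}

/-- The elements of the group algebra commuting with all permutations. -/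
noncomputable def centerSubmodule (ι : Type*) [Fintype ι] [DecidableEq ι] :
    Submodule ℂ (MonoidAlgebra ℂ (Equiv.Perm ι)) where
  carrier := {x | ∀ σ, gr σ * x = x * gr σ}
  zero_mem' := by simp
  add_mem' := fun {x y} hx hy σ => by
    have h1 := hx σ
    have h2 := hy σ
    rw [mul_add, add_mul, h1, h2]
  smul_mem' := fun c x hx σ => by
    have h1 := hx σ
    rw [mul_smul_comm, smul_mul_assoc, h1]

/-- Central elements are class functions, and conjugacy classes of permutations are told apart by
cycle type. Values at one representative for each partition therefore determine a central element;
the choice made at a partition that is not a cycle type would be harmless. -/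
theorem finrank_centerSubmodule_le (ι : Type*) [Fintype ι] [DecidableEq ι] :
    Module.finrank ℂ (centerSubmodule ι) ≤ Fintype.card (Fintype.card ι).Partition := by
  let f : centerSubmodule ι →ₗ[ℂ] ((Fintype.card ι).Partition → ℂ) :=
    { toFun := fun x p => (x : MonoidAlgebra ℂ (Equiv.Perm ι)).coeff
        (Function.invFun Equiv.Perm.partition p)
      map_add' := fun x y => by ext; simp
      map_smul' := fun c x => by ext; simp }
  have hf : Function.Injective f := by
    rw [← LinearMap.ker_eq_bot, LinearMap.ker_eq_bot']
    rintro ⟨x, hx⟩ h0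
    apply Subtype.ext
    ext σ
    have h1 := congrFun h0 σ.partition
    have h2 : IsConj (Function.invFun Equiv.Perm.partition σ.partition) σ := by
      rw [Equiv.Perm.partition_eq_of_isConj]
      exact Function.invFun_eq ⟨σ, rfl⟩
    obtain ⟨τ, hτ⟩ := isConj_iff.1 h2
    have h3 := congrArg (fun y : MonoidAlgebra ℂ (Equiv.Perm ι) => y.coeff (σ * τ)) (hx τ)
    simp only [coeff_gr_mul, coeff_mul_gr] at h3
    rw [mul_inv_cancel_right, ← hτ] at h3
    simp only [mul_assoc, inv_mul_cancel_left, inv_mul_cancel, mul_one] at h3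
    change x.coeff σ = 0
    rw [← hτ]
    simp only [mul_assoc]
    rw [← h3]
    exact h1
  have := LinearMap.finrank_le_finrank_of_injective hf
  simpa using this

/-- A numbering of the boxes of `lam` by `Fin m`, `m` being the number of boxes. -/
noncomputable def numbering {m d : ℕ} (lam : Fin d → ℕ) (h : m = ∑ i, lam i) :
    Fin m ≃ Boxes lam :=
  (finCongr h).trans (standardNumbering lam)

/-! ### Central elements obtained by averaging Young idempotents -/

section Central

variable {ι : Type*} [Fintype ι] [DecidableEq ι] {d : ℕ} {lam mu : Fin d → ℕ}

/-- The sum of the conjugates of a Young idempotent. -/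
noncomputable def youngCentral (T : ι ≃ Boxes lam) : MonoidAlgebra ℂ (Equiv.Perm ι) :=
  ∑ σ : Equiv.Perm ι, gr σ * youngIdem T * gr σ⁻¹

theorem youngCentral_mem (T : ι ≃ Boxes lam) : youngCentral T ∈ centerSubmodule ι := by
  intro τ
  simp only [youngCentral, Finset.mul_sum, Finset.sum_mul]
  refine Fintype.sum_equiv (Equiv.mulLeft τ) _ _ fun σ => ?_
  simp only [Equiv.coe_mulLeft, ← mul_assoc, ← gr_mul]
  rw [mul_assoc _ _ (gr τ), ← gr_mul]
  simp

theorem youngCentral_mul_of_ne (T : ι ≃ Boxes lam) (S : ι ≃ Boxes mu) (hlam : Antitone lam)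
    (hmu : Antitone mu) (hne : lam ≠ mu) : youngCentral T * youngCentral S = 0 := by
  simp only [youngCentral, Finset.sum_mul, Finset.mul_sum]
  refine Finset.sum_eq_zero fun σ _ => Finset.sum_eq_zero fun τ _ => ?_
  have h := youngIdem_mul_gr_mul_eq_zero T S hlam hmu hne (gr τ⁻¹ * gr σ)
  have h2 : gr τ * youngIdem T * gr τ⁻¹ * (gr σ * youngIdem S * gr σ⁻¹) =
      gr τ * (youngIdem T * (gr τ⁻¹ * gr σ) * youngIdem S) * gr σ⁻¹ := by
    simp only [mul_assoc]
  rw [h2, h]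
  simp

/-- The coefficient of z² at 1 is n! times that of z e, as this coefficient is a trace and z is
central. Compressing z by e gives ∑ χ(σ) χ(σ⁻¹) e = (n!/dim) e, and e has coefficient dim/n! at 1.
So z² has coefficient n! there. -/
theorem youngCentral_mul_self_ne_zero (T : ι ≃ Boxes lam) (hlam : Antitone lam) :
    youngCentral T * youngCentral T ≠ 0 := by
  intro h0
  have h1 : (youngCentral T * youngCentral T).coeff 1 =
      (Fintype.card (Equiv.Perm ι) : ℂ) * (youngCentral T * youngIdem T).coeff 1 := by
    conv_lhs => enter [1, 1, 2]; rw [youngCentral]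
    simp only [Finset.mul_sum, MonoidAlgebra.coeff_sum, Finsupp.finsetSum_apply]
    rw [Finset.sum_congr rfl (g := fun _ => (youngCentral T * youngIdem T).coeff 1)]
    · simp
    · intro σ _
      rw [coeff_one_mul_comm, mul_assoc, mul_assoc, coeff_one_mul_comm, mul_assoc, mul_assoc,
        ← youngCentral_mem T σ, ← mul_assoc (gr σ⁻¹), ← gr_mul, inv_mul_cancel, gr_one, one_mul,
        coeff_one_mul_comm]
  have h2 : (youngCentral T * youngIdem T).coeff 1 =
      ∑ σ : Equiv.Perm ι, youngChar T (gr σ) * youngChar T (gr σ⁻¹) * (youngIdem T).coeff 1 := by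
    rw [youngCentral]
    simp only [Finset.sum_mul, MonoidAlgebra.coeff_sum, Finsupp.finsetSum_apply]
    refine Finset.sum_congr rfl fun σ _ => ?_
    have h3 : youngIdem T * (gr σ * youngIdem T * gr σ⁻¹ * youngIdem T) =
        (youngChar T (gr σ) * youngChar T (gr σ⁻¹)) • youngIdem T := by
      rw [← mul_assoc, ← mul_assoc, ← mul_assoc, youngIdem_mul_mul T hlam, smul_mul_assoc,
        smul_mul_assoc, youngIdem_mul_mul T hlam, smul_smul]
    have h4 : gr σ * youngIdem T * gr σ⁻¹ * youngIdem T =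
        gr σ * youngIdem T * gr σ⁻¹ * youngIdem T * youngIdem T := by
      rw [mul_assoc _ (youngIdem T) (youngIdem T), youngIdem_mul_self T hlam]
    rw [h4, coeff_one_mul_comm, h3, MonoidAlgebra.coeff_smul, Finsupp.smul_apply, smul_eq_mul]
  rw [h0, h2, ← Finset.sum_mul, sum_youngChar_mul T hlam, coeff_one_youngIdem] at h1
  have h3 := symDim_ne_zero T
  have h4 := card_perm_ne_zero (ι := ι)
  simp [h3, h4] at h1
  exact h4 h1.symm

end Central

/-- Elements of different diagrams annihilate each other and have nonzero squares, so they are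
linearly independent in the centre. There is one for each partition, which is also an upper bound
for the dimension of the centre, so they span it. -/
theorem one_mem_span_youngCentral (n : ℕ) :
    (1 : MonoidAlgebra ℂ (Equiv.Perm (Fin n))) ∈ Submodule.span ℂ
      (Set.range fun p : n.Partition =>
        youngCentral (numbering (partitionShape p) (sum_partitionShape p).symm)) := by
  let u : n.Partition → centerSubmodule (Fin n) := fun p =>
    ⟨youngCentral (numbering (partitionShape p) (sum_partitionShape p).symm), youngCentral_mem _⟩
  have hli : LinearIndependent ℂ u := by
    rw [Fintype.linearIndependent_iff]
    intro g hg q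
    have h1 := congrArg (fun x : centerSubmodule (Fin n) =>
      (x : MonoidAlgebra ℂ (Equiv.Perm (Fin n))) * (u q : MonoidAlgebra ℂ (Equiv.Perm (Fin n)))) hg
    simp only [Submodule.coe_sum, Submodule.coe_smul, Finset.sum_mul, smul_mul_assoc,
      Submodule.coe_zero, zero_mul] at h1
    rw [Finset.sum_eq_single q] at h1
    · exact (smul_eq_zero.1 h1).resolve_right
        (youngCentral_mul_self_ne_zero _ (antitone_partitionShape q))
    · intro p _ hpq
      rw [youngCentral_mul_of_ne _ _ (antitone_partitionShape p) (antitone_partitionShape q)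
        (fun h => hpq (partitionShape_injective h)), smul_zero]
    · simp
  have hcard : Fintype.card n.Partition = Module.finrank ℂ (centerSubmodule (Fin n)) := by
    apply le_antisymm hli.fintype_card_le_finrank
    have h := finrank_centerSubmodule_le (Fin n)
    rwa [Fintype.card_fin] at h
  have htop := hli.span_eq_top_of_card_eq_finrank' hcard
  have h1 : (⟨1, fun σ => by simp⟩ : centerSubmodule (Fin n)) ∈
      Submodule.span ℂ (Set.range u) := by
    rw [htop]
    trivial
  have h2 := Submodule.mem_map_of_mem (f := (centerSubmodule (Fin n)).subtype) h1
  rw [Submodule.map_span, ← Set.range_comp] at h2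
  exact h2

end Completeness

/-! ### The action of the group algebra on tensors -/

section Action

variable {ι κ : Type*} [Fintype ι] [DecidableEq ι] [Fintype κ] [DecidableEq κ]

theorem groupAlgebraOp_mul (a b : MonoidAlgebra ℂ (Equiv.Perm ι)) :
    groupAlgebraOp κ (a * b) = groupAlgebraOp κ a * groupAlgebraOp κ b :=
  map_mul (MonoidAlgebra.lift ℂ _ _ (permOp ι κ)) a b

theorem groupAlgebraOp_smul (z : ℂ) (a : MonoidAlgebra ℂ (Equiv.Perm ι)) :
    groupAlgebraOp κ (z • a) = z • groupAlgebraOp κ a :=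
  map_smul (MonoidAlgebra.lift ℂ _ _ (permOp ι κ)) z a

theorem groupAlgebraOp_sum {α : Type*} (s : Finset α) (f : α → MonoidAlgebra ℂ (Equiv.Perm ι)) :
    groupAlgebraOp κ (∑ i ∈ s, f i) = ∑ i ∈ s, groupAlgebraOp κ (f i) :=
  map_sum (MonoidAlgebra.lift ℂ _ _ (permOp ι κ)) f s

theorem groupAlgebraOp_gr (σ : Equiv.Perm ι) : groupAlgebraOp κ (gr σ) = permOp ι κ σ := by
  simp [groupAlgebraOp, gr]

theorem groupAlgebraOp_one : groupAlgebraOp κ (1 : MonoidAlgebra ℂ (Equiv.Perm ι)) = 1 :=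
  map_one (MonoidAlgebra.lift ℂ _ _ (permOp ι κ))

theorem permOp_apply (σ : Equiv.Perm ι) (x y : ι → κ) :
    permOp ι κ σ x y = if x = y ∘ σ.symm then 1 else 0 := rfl

theorem eq_comp_symm_iff (σ : Equiv.Perm ι) (x y : ι → κ) : x = y ∘ σ.symm ↔ x ∘ σ = y := by
  constructor
  · rintro rfl
    funext p
    simp
  · rintro rfl
    funext p
    simp

theorem permOp_mul_apply {μ : Type*} (σ : Equiv.Perm ι) (M : Matrix (ι → κ) μ ℂ)
    (x : ι → κ) (y : μ) : (permOp ι κ σ * M) x y = M (x ∘ σ) y := by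
  simp only [Matrix.mul_apply, permOp_apply, eq_comp_symm_iff, ite_mul, one_mul, zero_mul]
  simp

theorem mul_permOp_apply {μ : Type*} (σ : Equiv.Perm ι) (M : Matrix μ (ι → κ) ℂ)
    (x : μ) (y : ι → κ) : (M * permOp ι κ σ) x y = M x (y ∘ σ.symm) := by
  simp [Matrix.mul_apply, permOp_apply]

theorem permOp_conjTranspose (σ : Equiv.Perm ι) : (permOp ι κ σ)ᴴ = permOp ι κ σ⁻¹ := by
  ext x y
  rw [Matrix.conjTranspose_apply, permOp_apply, permOp_apply]
  have : y = x ∘ σ.symm ↔ x = y ∘ (σ⁻¹).symm := by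
    rw [eq_comp_symm_iff]
    exact eq_comm
  simp only [this]
  split_ifs <;> simp

theorem permOp_mul_permOp_inv (σ : Equiv.Perm ι) : permOp ι κ σ * permOp ι κ σ⁻¹ = 1 := by
  rw [← map_mul, mul_inv_cancel, map_one]

theorem permOp_inv_mul_permOp (σ : Equiv.Perm ι) : permOp ι κ σ⁻¹ * permOp ι κ σ = 1 := by
  rw [← map_mul, inv_mul_cancel, map_one]

theorem groupAlgebraOp_rowSum_conjTranspose {α : Type*} [DecidableEq α] (r : ι → α) :
    (groupAlgebraOp κ (rowSum r))ᴴ = groupAlgebraOp κ (rowSum r) := by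
  simp only [rowSum, groupAlgebraOp_sum, Matrix.conjTranspose_sum, groupAlgebraOp_gr,
    permOp_conjTranspose]
  exact Finset.sum_bij' (fun σ _ => σ⁻¹) (fun σ _ => σ⁻¹) (fun _ h => inv_mem_fiberPerms h)
    (fun _ h => inv_mem_fiberPerms h) (by simp) (by simp) (by simp)

theorem groupAlgebraOp_colSum_conjTranspose {α : Type*} [DecidableEq α] (c : ι → α) :
    (groupAlgebraOp κ (colSum c))ᴴ = groupAlgebraOp κ (colSum c) := by
  simp only [colSum, groupAlgebraOp_sum, Matrix.conjTranspose_sum, groupAlgebraOp_gr,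
    permOp_conjTranspose, groupAlgebraOp_smul, Matrix.conjTranspose_smul]
  refine Finset.sum_bij' (fun σ _ => σ⁻¹) (fun σ _ => σ⁻¹) (fun _ h => inv_mem_fiberPerms h)
    (fun _ h => inv_mem_fiberPerms h) (by simp) (by simp) ?_
  intro σ _
  rw [sgn_inv]
  congr 1
  simp [sgn]

variable {d : ℕ} {lam mu : Fin d → ℕ}

theorem groupAlgebraOp_youngIdem_conjTranspose (T : ι ≃ Boxes lam) :
    (groupAlgebraOp κ (youngIdem T))ᴴ = groupAlgebraOp κ (youngIdem T) := by
  rw [youngIdem, youngSymmetrizer_eq, groupAlgebraOp_smul, groupAlgebraOp_mul, groupAlgebraOp_mul,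
    Matrix.conjTranspose_smul, Matrix.conjTranspose_mul, Matrix.conjTranspose_mul,
    groupAlgebraOp_rowSum_conjTranspose, groupAlgebraOp_colSum_conjTranspose, Matrix.mul_assoc]
  congr 1
  simp

/-- The numbering obtained by renaming the numbers through a permutation. -/
def permNumbering (T : ι ≃ Boxes lam) (σ : Equiv.Perm ι) : ι ≃ Boxes lam := σ.symm.trans T

theorem gr_mul_youngSymmetrizer (T : ι ≃ Boxes lam) (σ : Equiv.Perm ι) :
    gr σ * youngSymmetrizer T = youngSymmetrizer (permNumbering T σ) * gr σ := by
  have hr : rowOf T = rowOf (permNumbering T σ) ∘ σ := by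
    funext p
    simp [rowOf, permNumbering]
  have hc : colOf T = colOf (permNumbering T σ) ∘ σ := by
    funext p
    change _ = ((T (σ.symm (σ p))).2 : ℕ)
    rw [σ.symm_apply_apply]
  rw [youngSymmetrizer_eq, youngSymmetrizer_eq, hr, hc, ← mul_assoc, gr_mul_rowSum_comp,
    mul_assoc, gr_mul_colSum_comp, mul_assoc]

/-- The transposition (p q) fixes the basis tensor `y`, but changes the sign of the column sum. -/
theorem colSum_op_apply_eq_zero {c : ι → ℕ} (x y : ι → κ) {p q : ι} (hpq : p ≠ q)
    (hc : c p = c q) (hy : y p = y q) : groupAlgebraOp κ (colSum c) x y = 0 := by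
  have h1 : groupAlgebraOp κ (colSum c) = -(groupAlgebraOp κ (colSum c) *
      permOp ι κ (Equiv.swap p q)) := by
    rw [← groupAlgebraOp_gr, ← groupAlgebraOp_mul, colSum_mul_gr (swap_mem_fiberPerms hc),
      groupAlgebraOp_smul]
    simp [sgn, Equiv.Perm.sign_swap hpq]
  have h2 := congrFun (congrFun h1 x) y
  rw [Matrix.neg_apply, mul_permOp_apply] at h2
  have h3 : y ∘ (Equiv.swap p q).symm = y := by
    rw [Equiv.symm_swap]
    exact funext (mem_fiberPerms.1 (swap_mem_fiberPerms hy))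
  rw [h3] at h2
  exact eq_zero_of_eq_neg h2

theorem fiberPerms_congr {α β : Type*} [DecidableEq α] [DecidableEq β] {r : ι → α} {s : ι → β}
    (h : ∀ p q, r p = r q ↔ s p = s q) : fiberPerms r = fiberPerms s := by
  ext σ
  simp only [mem_fiberPerms, h]

/-- A symmetrizer depends only on the division into rows and columns, so empty rows may be added or
removed. This compares diagrams with different numbers of admissible rows. -/
theorem youngSymmetrizer_congr {d' : ℕ} {nu : Fin d' → ℕ} (T : ι ≃ Boxes lam) (S : ι ≃ Boxes nu)
    (hr : ∀ p, (rowOf T p : ℕ) = rowOf S p) (hc : ∀ p, colOf T p = colOf S p) :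
    youngSymmetrizer T = youngSymmetrizer S := by
  rw [youngSymmetrizer_eq, youngSymmetrizer_eq, rowSum, rowSum, colSum, colSum,
    fiberPerms_congr (r := rowOf T) (s := rowOf S) (fun p q => by simp only [Fin.ext_iff, hr]),
    fiberPerms_congr (r := colOf T) (s := colOf S) (fun p q => by simp only [hc])]

end Action

/-! ### Completeness of the Schur–Weyl decomposition -/

section SchurWeyl

theorem mem_diagrams {n d : ℕ} {lam : Fin d → ℕ} :
    lam ∈ diagrams n d ↔ ∑ i, lam i = n ∧ Antitone lam := by
  classical
  simp [diagrams, types]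

theorem card_boxes_eq {n d : ℕ} {lam : Fin d → ℕ} (T : Fin n ≃ Boxes lam) : ∑ i, lam i = n := by
  have := Fintype.card_congr T
  simpa using this.symm

/-- With more than d nonempty rows the first column has more than d boxes, so a basis tensor over d
letters repeats an entry in it and the symmetrizer acts as zero. Otherwise the diagram becomes one
with d rows by cutting off or appending empty rows. -/
theorem range_youngSymmetrizer_le {n d d' : ℕ} {nu : Fin d' → ℕ} (hnu : Antitone nu)
    (T : Fin n ≃ Boxes nu) :
    LinearMap.range (Matrix.toEuclideanLin (groupAlgebraOp (Fin d) (youngSymmetrizer T))) ≤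
      ⨆ lam ∈ diagrams n d, schurWeylSummand (Fin n) lam := by
  by_cases h : ∃ i : Fin d', d ≤ (i : ℕ) ∧ 0 < nu i
  · obtain ⟨i, hi, hpos⟩ := h
    have hpos' : ∀ j : Fin (d + 1), 0 < nu ⟨j, by omega⟩ := fun j =>
      hpos.trans_le (hnu (Fin.le_def.2 (by simp only; omega)))
    have h0 : groupAlgebraOp (Fin d) (youngSymmetrizer T) = 0 := by
      rw [youngSymmetrizer_eq, groupAlgebraOp_mul]
      convert Matrix.mul_zero _
      ext x y
      obtain ⟨j, k, hjk, hy⟩ := Fintype.exists_ne_map_eq_of_card_lt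
        (fun j : Fin (d + 1) => y (T.symm ⟨⟨j, by omega⟩, ⟨0, hpos' j⟩⟩)) (by simp)
      refine colSum_op_apply_eq_zero x y ?_ ?_ hy
      · intro hcon
        have h1 := congrArg (rowOf T) hcon
        simp only [rowOf_symm, Fin.mk.injEq] at h1
        exact hjk (Fin.ext h1)
      · simp only [colOf_symm]
    rw [h0]
    simp
  · push Not at h
    let lam : Fin d → ℕ := fun i => if h : (i : ℕ) < d' then nu ⟨i, h⟩ else 0
    have hrow : ∀ b : Boxes nu, (b.1 : ℕ) < d := fun b => by
      by_contra hcon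
      have h1 := h b.1 (not_lt.1 hcon)
      have h2 := b.2.2
      omega
    have hrow' : ∀ b : Boxes lam, (b.1 : ℕ) < d' := fun b => by
      by_contra hb
      exact absurd b.2.2 (by simp [lam, hb])
    let f : Boxes nu ≃ Boxes lam :=
      { toFun := fun b => ⟨⟨b.1, hrow b⟩, ⟨b.2, by
          have h2 := b.2.2
          have h3 := b.1.2
          simp only [lam, h3, dif_pos]
          exact h2⟩⟩
        invFun := fun b => ⟨⟨b.1, hrow' b⟩, ⟨b.2, by
            have h2 := b.2.2
            simp only [lam, hrow' b, dif_pos] at h2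
            exact h2⟩⟩
        left_inv := fun b => rfl
        right_inv := fun b => rfl }
    have heq : youngSymmetrizer T = youngSymmetrizer (T.trans f) :=
      youngSymmetrizer_congr T (T.trans f) (fun p => rfl) (fun p => rfl)
    rw [heq]
    have hmem : lam ∈ diagrams n d := by
      rw [mem_diagrams]
      refine ⟨card_boxes_eq (T.trans f), fun i j hij => ?_⟩
      have hij' : (i : ℕ) ≤ j := hij
      simp only [lam]
      split_ifs with h1 h2
      · exact hnu (Fin.le_def.2 hij')
      · omega
      · exact Nat.zero_le _
      · exact le_rfl
    refine le_trans ?_ (le_biSup (fun lam : Fin d → ℕ => schurWeylSummand (Fin n) lam) hmem)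
    exact le_iSup (fun T : Fin n ≃ Boxes lam => LinearMap.range (Matrix.toEuclideanLin
      (groupAlgebraOp (Fin d) (youngSymmetrizer T)))) (T.trans f)

/-- The Schur-Weyl summands span the tensor power. -/
theorem iSup_schurWeylSummand (n d : ℕ) :
    ⨆ lam ∈ diagrams n d, schurWeylSummand (Fin n) lam =
      (⊤ : Submodule ℂ (EuclideanSpace ℂ (Fin n → Fin d))) := by
  rw [eq_top_iff]
  intro w _
  let Φ : MonoidAlgebra ℂ (Equiv.Perm (Fin n)) →ₗ[ℂ] EuclideanSpace ℂ (Fin n → Fin d) :=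
    (LinearMap.applyₗ w ∘ₗ (Matrix.toEuclideanLin :
      Matrix (Fin n → Fin d) (Fin n → Fin d) ℂ ≃ₗ[ℂ] _).toLinearMap) ∘ₗ
      (MonoidAlgebra.lift ℂ _ _ (permOp (Fin n) (Fin d))).toLinearMap
  have hΦ : ∀ a, Φ a = Matrix.toEuclideanLin (groupAlgebraOp (Fin d) a) w := fun a => rfl
  have h1 : Φ 1 = w := by
    rw [hΦ, groupAlgebraOp_one]
    ext x
    simp
  rw [← h1]
  have h2 := Submodule.mem_map_of_mem (f := Φ) (one_mem_span_youngCentral n)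
  rw [Submodule.map_span] at h2
  refine Submodule.span_le.2 ?_ h2
  rintro _ ⟨_, ⟨p, rfl⟩, rfl⟩
  -- The identity is a combination of conjugates of Young idempotents. Moving σ past the symmetrizer
  -- turns each conjugate into the symmetrizer of the renumbered diagram followed by something, so
  -- its image lies in one summand.
  simp only [youngCentral, map_sum]
  refine Submodule.sum_mem _ fun σ _ => ?_
  refine range_youngSymmetrizer_le (antitone_partitionShape p)
    (permNumbering (numbering (partitionShape p) (sum_partitionShape p).symm) σ) ?_
  rw [youngIdem, mul_smul_comm, smul_mul_assoc, map_smul, ← mul_assoc, gr_mul_youngSymmetrizer,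
    hΦ, mul_assoc, mul_assoc, groupAlgebraOp_mul]
  refine Submodule.smul_mem _ _ ?_
  rw [Matrix.toLpLin_mul_same]
  exact LinearMap.mem_range_self _ _

end SchurWeyl

/-! ### The Casimir equation for traces on tensor powers -/

section Casimir

open MvPolynomial

variable {ι : Type*} [Fintype ι] [DecidableEq ι] {d : ℕ}

/-- The derivation action of the matrix unit `|i⟩⟨j|` on tensors. -/
noncomputable def raiseOp (ι : Type*) [Fintype ι] [DecidableEq ι] {d : ℕ} (i j : Fin d) :
    Matrix (ι → Fin d) (ι → Fin d) ℂ :=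
  Matrix.of fun x y => ∑ p, if y p = j ∧ x = Function.update y p i then 1 else 0

/-- The sum over the positions `p`, `q` with entries `i`, `j` of the interchange of `p`, `q`. -/
noncomputable def swapOp (ι : Type*) [Fintype ι] [DecidableEq ι] {d : ℕ} (i j : Fin d) :
    Matrix (ι → Fin d) (ι → Fin d) ℂ :=
  Matrix.of fun z x => ∑ p, ∑ q, if x p = i ∧ x q = j ∧ z = x ∘ Equiv.swap p q then 1 else 0

/-- The number of positions with a given entry. -/
def content (x : ι → Fin d) (i : Fin d) : ℕ := (Finset.univ.filter fun p => x p = i).card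

/-- The monomial of a basis tensor. -/
noncomputable def tensorMonomial (x : ι → Fin d) : MvPolynomial (Fin d) ℂ := ∏ p, X (x p)

/-- The trace of `B t^{⊗ ι}` for a diagonal matrix `t` of indeterminates. -/
noncomputable def tracePoly (B : Matrix (ι → Fin d) (ι → Fin d) ℂ) : MvPolynomial (Fin d) ℂ :=
  ∑ x, C (B x x) * tensorMonomial x

theorem tracePoly_add (A B : Matrix (ι → Fin d) (ι → Fin d) ℂ) :
    tracePoly (A + B) = tracePoly A + tracePoly B := by
  simp [tracePoly, add_mul, Finset.sum_add_distrib]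

theorem tracePoly_smul (z : ℂ) (B : Matrix (ι → Fin d) (ι → Fin d) ℂ) :
    tracePoly (z • B) = C z * tracePoly B := by
  simp [tracePoly, Finset.mul_sum, mul_assoc]

theorem tracePoly_sum {α : Type*} (s : Finset α) (f : α → Matrix (ι → Fin d) (ι → Fin d) ℂ) :
    tracePoly (∑ a ∈ s, f a) = ∑ a ∈ s, tracePoly (f a) := by
  simp only [tracePoly, Matrix.sum_apply, map_sum, Finset.sum_mul]
  exact Finset.sum_comm

/-- The exponent of a basis tensor. -/
noncomputable def exponent (x : ι → Fin d) : Fin d →₀ ℕ := ∑ p, Finsupp.single (x p) 1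

theorem exponent_apply (x : ι → Fin d) (i : Fin d) : exponent x i = content x i := by
  simp [exponent, content, Finsupp.single_apply]

theorem tensorMonomial_eq (x : ι → Fin d) :
    tensorMonomial x = monomial (exponent x) (1 : ℂ) := by
  rw [exponent, monomial_sum_one]
  rfl

/-- The Euler operator `t_i ∂ / ∂ t_i`. -/
noncomputable def euler (i : Fin d) : Derivation ℂ (MvPolynomial (Fin d) ℂ)
    (MvPolynomial (Fin d) ℂ) := (X i : MvPolynomial (Fin d) ℂ) • pderiv i

theorem euler_monomial (i : Fin d) (α : Fin d →₀ ℕ) (z : ℂ) :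
    euler i (monomial α z) = C (α i : ℂ) * monomial α z := by
  rw [euler, Derivation.smul_apply, smul_eq_mul, X_mul_pderiv_monomial]
  rw [← Nat.cast_smul_eq_nsmul ℂ, MvPolynomial.smul_eq_C_mul]

theorem euler_C_mul (i : Fin d) (z : ℂ) (f : MvPolynomial (Fin d) ℂ) :
    euler i (C z * f) = C z * euler i f := by
  rw [← MvPolynomial.smul_eq_C_mul, Derivation.map_smul, MvPolynomial.smul_eq_C_mul]

theorem coeff_euler (i : Fin d) (f : MvPolynomial (Fin d) ℂ) (α : Fin d →₀ ℕ) :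
    coeff α (euler i f) = α i * coeff α f := by
  induction f using MvPolynomial.induction_on' with
  | monomial β z =>
    rw [euler_monomial, coeff_C_mul, coeff_monomial]
    split_ifs with h
    · rw [h]
    · simp
  | add f g hf hg => rw [map_add, coeff_add, coeff_add, hf, hg, mul_add]

theorem euler_tracePoly (i : Fin d) (B : Matrix (ι → Fin d) (ι → Fin d) ℂ) :
    euler i (tracePoly B) =
      tracePoly (B * Matrix.diagonal fun x => (content x i : ℂ)) := by
  simp only [tracePoly, map_sum, euler_C_mul, tensorMonomial_eq, euler_monomial,
    Matrix.mul_diagonal, map_mul, exponent_apply, mul_assoc]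

theorem X_mul_tensorMonomial (x : ι → Fin d) (p : ι) (i : Fin d) :
    X (x p) * tensorMonomial (Function.update x p i) = X i * tensorMonomial x := by
  rw [tensorMonomial, tensorMonomial, ← Finset.mul_prod_erase _ _ (Finset.mem_univ p),
    ← Finset.mul_prod_erase Finset.univ (fun q => (X (x q) : MvPolynomial (Fin d) ℂ))
      (Finset.mem_univ p), Function.update_self, mul_left_comm]
  congr 2
  refine Finset.prod_congr rfl fun q hq => ?_
  rw [Function.update_of_ne (Finset.ne_of_mem_erase hq)]

theorem raiseOp_mul_X (i j : Fin d) (z x : ι → Fin d) :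
    C (raiseOp ι i j z x) * (X j * tensorMonomial z) =
      C (raiseOp ι i j z x) * (X i * tensorMonomial x) := by
  simp only [raiseOp, Matrix.of_apply, map_sum, Finset.sum_mul]
  refine Finset.sum_congr rfl fun p _ => ?_
  split_ifs with h
  · obtain ⟨h1, h2⟩ := h
    rw [h2, ← h1, X_mul_tensorMonomial]
  · simp

/-- Cyclicity of the trace, twisted by the weights: |j⟩⟨i| changes one letter i into j, so passing
it through t^{⊗n} costs a factor t_j / t_i. The denominators are cleared. -/
theorem X_mul_tracePoly_raiseOp (i j : Fin d) (M : Matrix (ι → Fin d) (ι → Fin d) ℂ) :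
    X j * tracePoly (M * raiseOp ι j i) = X i * tracePoly (raiseOp ι j i * M) := by
  simp only [tracePoly, Matrix.mul_apply, map_sum, map_mul, Finset.sum_mul, Finset.mul_sum]
  rw [Finset.sum_comm]
  refine Finset.sum_congr rfl fun z _ => Finset.sum_congr rfl fun x _ => ?_
  have h := raiseOp_mul_X j i z x
  linear_combination (-C (M x z)) * h

theorem permOp_mul_raiseOp (σ : Equiv.Perm ι) (i j : Fin d) :
    permOp ι (Fin d) σ * raiseOp ι i j = raiseOp ι i j * permOp ι (Fin d) σ := by
  ext x y
  rw [permOp_mul_apply, mul_permOp_apply, raiseOp, Matrix.of_apply, Matrix.of_apply]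
  refine Fintype.sum_equiv σ _ _ fun p => ?_
  have h2 : Function.update (y ∘ σ.symm) (σ p) i = (Function.update y p i) ∘ σ.symm := by
    funext q
    simp only [Function.update_apply, Function.comp, Equiv.symm_apply_eq]
  rw [h2]
  simp only [Function.comp_apply, Equiv.symm_apply_apply]
  congr 1
  rw [eq_iff_iff, eq_comp_symm_iff]

theorem groupAlgebraOp_mul_raiseOp (a : MonoidAlgebra ℂ (Equiv.Perm ι)) (i j : Fin d) :
    groupAlgebraOp (Fin d) a * raiseOp ι i j = raiseOp ι i j * groupAlgebraOp (Fin d) a := by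
  rw [eq_sum_coeff_gr a]
  simp only [groupAlgebraOp_sum, groupAlgebraOp_smul, groupAlgebraOp_gr, Finset.sum_mul,
    Finset.mul_sum, smul_mul_assoc, mul_smul_comm, permOp_mul_raiseOp]

theorem update_update_eq_swap {x : ι → Fin d} {p q : ι} {i j : Fin d} (hpq : p ≠ q)
    (hp : x p = i) (hq : x q = j) :
    Function.update (Function.update x p j) q i = x ∘ Equiv.swap p q := by
  funext s
  simp only [Function.update_apply, Function.comp_apply, Equiv.swap_apply_def]
  split_ifs <;> simp_all

/-- The product is a sum over two positions. Equal positions restore the tensor and count its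
letters i; different positions p, q exchange a letter i at p with a letter j at q. Equal positions
do not occur in `swapOp` because i ≠ j. -/
theorem raiseOp_mul_raiseOp {i j : Fin d} (hij : i ≠ j) :
    raiseOp ι i j * raiseOp ι j i =
      Matrix.diagonal (fun x => (content x i : ℂ)) + swapOp ι i j := by
  ext z x
  have h1 : (raiseOp ι i j * raiseOp ι j i) z x = ∑ p, ∑ q,
      if x p = i ∧ (Function.update x p j) q = j ∧
        z = Function.update (Function.update x p j) q i then (1 : ℂ) else 0 := by
    simp only [Matrix.mul_apply, raiseOp, Matrix.of_apply, Finset.mul_sum]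
    rw [Finset.sum_comm]
    refine Finset.sum_congr rfl fun p _ => ?_
    rw [Finset.sum_eq_single (Function.update x p j)]
    · rw [Finset.sum_mul]
      refine Finset.sum_congr rfl fun q _ => ?_
      by_cases hp : x p = i <;> simp [hp]
    · intro y _ hy
      simp [hy]
    · simp
  rw [h1, Matrix.add_apply, swapOp, Matrix.of_apply]
  have h2 : Matrix.diagonal (fun x : ι → Fin d => (content x i : ℂ)) z x =
      ∑ p, if x p = i ∧ z = x then (1 : ℂ) else 0 := by
    rw [Matrix.diagonal_apply]
    split_ifs with h
    · subst h
      simp [content]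
    · simp [h]
  rw [h2, ← Finset.sum_add_distrib]
  refine Finset.sum_congr rfl fun p _ => ?_
  by_cases hp : x p = i
  · rw [← Finset.add_sum_erase _ _ (Finset.mem_univ p),
      ← Finset.add_sum_erase Finset.univ (fun q => if x p = i ∧ x q = j ∧
        z = x ∘ Equiv.swap p q then (1 : ℂ) else 0) (Finset.mem_univ p)]
    have h3 : Function.update (Function.update x p j) p i = x := by
      rw [Function.update_idem, ← hp, Function.update_eq_self]
    rw [h3, Function.update_self]
    have h4 : ¬ (x p = i ∧ x p = j ∧ z = x ∘ Equiv.swap p p) := by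
      rintro ⟨h5, h6, -⟩
      exact hij (h5.symm.trans h6)
    rw [if_neg h4, zero_add]
    simp only [hp, true_and]
    congr 1
    refine Finset.sum_congr rfl fun q hq => ?_
    have hqp := Finset.ne_of_mem_erase hq
    rw [Function.update_of_ne hqp]
    by_cases hq : x q = j
    · rw [update_update_eq_swap hqp.symm hp hq]
    · simp [hq]
  · simp [hp]

theorem tracePoly_mul_swapOp_comm (B : Matrix (ι → Fin d) (ι → Fin d) ℂ) (i j : Fin d) :
    tracePoly (B * swapOp ι i j) = tracePoly (B * swapOp ι j i) := by
  congr 2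
  ext z x
  simp only [swapOp, Matrix.of_apply]
  rw [Finset.sum_comm]
  refine Finset.sum_congr rfl fun p _ => Finset.sum_congr rfl fun q _ => ?_
  rw [Equiv.swap_comm]
  congr 1
  rw [eq_iff_iff]
  tauto

/-- Twisted cyclicity for B |i⟩⟨j|: both orders of the two raising operators give a content, which
is an Euler operator on the trace, plus the same exchange term. -/
theorem X_sub_X_mul_tracePoly_swapOp {B : Matrix (ι → Fin d) (ι → Fin d) ℂ}
    (hB : ∀ i j, B * raiseOp ι i j = raiseOp ι i j * B) {i j : Fin d} (hij : i ≠ j) :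
    (X i - X j) * tracePoly (B * swapOp ι i j) =
      X j * euler i (tracePoly B) - X i * euler j (tracePoly B) := by
  have h := X_mul_tracePoly_raiseOp i j (B * raiseOp ι i j)
  rw [← mul_assoc (raiseOp ι j i), ← hB j i, mul_assoc, mul_assoc, raiseOp_mul_raiseOp hij,
    raiseOp_mul_raiseOp hij.symm, mul_add, mul_add, tracePoly_add, tracePoly_add,
    ← euler_tracePoly, ← euler_tracePoly, tracePoly_mul_swapOp_comm B j i] at h
  linear_combination -h

/-- The sum of all `(p q)`, `p, q ∈ ι`, in the group algebra. -/
noncomputable def swapSum (ι : Type*) [Fintype ι] [DecidableEq ι] :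
    MonoidAlgebra ℂ (Equiv.Perm ι) := ∑ p, ∑ q, gr (Equiv.swap p q)

theorem sum_swapOp : ∑ i : Fin d, ∑ j, swapOp ι i j = groupAlgebraOp (Fin d) (swapSum ι) := by
  ext z x
  simp only [swapSum, groupAlgebraOp_sum, groupAlgebraOp_gr, Matrix.sum_apply, swapOp,
    Matrix.of_apply, permOp_apply, Equiv.symm_swap]
  have h1 : ∀ i : Fin d, ∑ j : Fin d, ∑ p, ∑ q,
      (if x p = i ∧ x q = j ∧ z = x ∘ Equiv.swap p q then (1 : ℂ) else 0) =
      ∑ p, ∑ q, if x p = i ∧ z = x ∘ Equiv.swap p q then (1 : ℂ) else 0 := by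
    intro i
    rw [Finset.sum_comm]
    refine Finset.sum_congr rfl fun p _ => ?_
    rw [Finset.sum_comm]
    refine Finset.sum_congr rfl fun q _ => ?_
    rw [Finset.sum_eq_single (x q)]
    · simp
    · intro j _ hj
      simp [hj.symm]
    · simp
  simp only [h1]
  rw [Finset.sum_comm]
  refine Finset.sum_congr rfl fun p _ => ?_
  rw [Finset.sum_comm]
  refine Finset.sum_congr rfl fun q _ => ?_
  rw [Finset.sum_eq_single (x p)]
  · by_cases h : z = x ∘ Equiv.swap p q <;> simp [h]
  · intro j _ hj
    simp [hj.symm]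
  · simp

theorem swapOp_self (i : Fin d) :
    swapOp ι i i = Matrix.diagonal (fun x => (content x i : ℂ)) *
      Matrix.diagonal (fun x => (content x i : ℂ)) := by
  ext z x
  rw [Matrix.diagonal_mul_diagonal, Matrix.diagonal_apply, swapOp, Matrix.of_apply]
  have h1 : ∀ p q, (if x p = i ∧ x q = i ∧ z = x ∘ Equiv.swap p q then (1 : ℂ) else 0) =
      if z = x then (if x p = i then 1 else 0) * (if x q = i then 1 else 0) else 0 := by
    intro p q
    by_cases hp : x p = i <;> by_cases hq : x q = i <;> simp [hp, hq]
    have : x ∘ Equiv.swap p q = x :=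
      funext (mem_fiberPerms.1 (swap_mem_fiberPerms (hp.trans hq.symm)))
    rw [this]
  simp only [h1]
  split_ifs with h
  · subst h
    simp only [← Finset.mul_sum, ← Finset.sum_mul]
    simp [content]
  · simp

/-- Over all pairs of letters the exchanges add up to the sum of all (p q), which multiplies B by
the scalar c. The pairs i = j contribute squared contents, i.e. second-order Euler terms. -/
theorem sum_tracePoly_swapOp {B : Matrix (ι → Fin d) (ι → Fin d) ℂ} {c : ℂ}
    (hc : B * groupAlgebraOp (Fin d) (swapSum ι) = c • B) :
    ∑ i : Fin d, ∑ j ∈ Finset.univ.erase i, tracePoly (B * swapOp ι i j) =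
      C c * tracePoly B - ∑ i, euler i (euler i (tracePoly B)) := by
  have h1 : ∑ i : Fin d, ∑ j, tracePoly (B * swapOp ι i j) = C c * tracePoly B := by
    simp only [← tracePoly_sum, ← Finset.mul_sum]
    rw [sum_swapOp, hc, tracePoly_smul]
  rw [← h1, ← Finset.sum_sub_distrib]
  refine Finset.sum_congr rfl fun i _ => ?_
  rw [← Finset.add_sum_erase _ _ (Finset.mem_univ i), swapOp_self, euler_tracePoly,
    euler_tracePoly, mul_assoc, add_sub_cancel_left]

theorem sum_content (x : ι → Fin d) : ∑ i, content x i = Fintype.card ι := by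
  simp only [content]
  rw [← Finset.card_univ, ← Finset.card_eq_sum_card_fiberwise (f := x) (t := Finset.univ)]
  simp

theorem sum_euler_tracePoly (B : Matrix (ι → Fin d) (ι → Fin d) ℂ) :
    ∑ i, euler i (tracePoly B) = C (Fintype.card ι : ℂ) * tracePoly B := by
  simp only [euler_tracePoly, ← tracePoly_sum, ← Finset.mul_sum, ← tracePoly_smul]
  congr 1
  ext x y
  simp only [Matrix.mul_sum, Matrix.sum_apply, Matrix.mul_diagonal, Matrix.smul_apply, smul_eq_mul]
  rw [← Finset.mul_sum, mul_comm, ← Nat.cast_sum, sum_content]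

theorem derivation_prod {α : Type*} [DecidableEq α] (D : Derivation ℂ (MvPolynomial (Fin d) ℂ)
    (MvPolynomial (Fin d) ℂ)) (s : Finset α) (f : α → MvPolynomial (Fin d) ℂ) :
    D (∏ a ∈ s, f a) = ∑ a ∈ s, (∏ b ∈ s.erase a, f b) * D (f a) := by
  induction s using Finset.induction_on with
  | empty => simp
  | insert a s ha ih =>
    rw [Finset.prod_insert ha, Derivation.leibniz, ih, Finset.sum_insert ha,
      Finset.erase_insert ha, smul_eq_mul, smul_eq_mul, Finset.mul_sum, add_comm]
    congr 1
    refine Finset.sum_congr rfl fun b hb => ?_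
    have hab : a ≠ b := fun h => ha (h ▸ hb)
    rw [Finset.erase_insert_of_ne hab, Finset.prod_insert (fun h => ha (Finset.mem_of_mem_erase h)),
      mul_assoc]

/-- The pairs `(i, j)` with `i < j`. -/
def ltPairs (d : ℕ) : Finset (Fin d × Fin d) := Finset.univ.filter fun a => a.1 < a.2

/-- The Vandermonde product `∏_{i < j} (X_i - X_j)`. -/
noncomputable def vandermondeProd (d : ℕ) : MvPolynomial (Fin d) ℂ :=
  ∏ a ∈ ltPairs d, (X a.1 - X a.2)

theorem two_mul_sum_ltPairs {M : Type*} [CommRing M] (h : Fin d → Fin d → M)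
    (hs : ∀ i j, h i j = h j i) :
    2 * ∑ a ∈ ltPairs d, h a.1 a.2 = ∑ i, ∑ j ∈ Finset.univ.erase i, h i j := by
  have h1 : ∑ i, ∑ j ∈ Finset.univ.erase i, h i j =
      ∑ a ∈ Finset.univ.filter (fun a : Fin d × Fin d => a.1 ≠ a.2), h a.1 a.2 := by
    rw [Finset.sum_filter, Fintype.sum_prod_type]
    refine Finset.sum_congr rfl fun i _ => ?_
    rw [← Finset.sum_filter]
    refine Finset.sum_congr ?_ fun _ _ => rfl
    ext j
    simp [eq_comm]
  have h2 : Finset.univ.filter (fun a : Fin d × Fin d => a.1 ≠ a.2) =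
      ltPairs d ∪ Finset.univ.filter (fun a : Fin d × Fin d => a.2 < a.1) := by
    ext a
    simp [ltPairs]
  have h3 : ∑ a ∈ Finset.univ.filter (fun a : Fin d × Fin d => a.2 < a.1), h a.1 a.2 =
      ∑ a ∈ ltPairs d, h a.1 a.2 :=
    Finset.sum_bij' (fun a _ => a.swap) (fun a _ => a.swap) (by simp [ltPairs]) (by simp [ltPairs])
      (by simp) (by simp) (fun a _ => hs _ _)
  rw [h1, h2, Finset.sum_union, h3, two_mul]
  rw [ltPairs, Finset.disjoint_filter]
  intro a _ h4 h5
  exact lt_asymm h4 h5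

theorem euler_X (i k : Fin d) : euler i (X k) = if i = k then X i else 0 := by
  rw [euler, Derivation.smul_apply, pderiv_X, smul_eq_mul]
  by_cases h : i = k
  · subst h
    simp
  · simp [h]

theorem sum_euler_X_mul (k : Fin d) (F : Fin d → MvPolynomial (Fin d) ℂ) :
    ∑ i, euler i (X k) * F i = X k * F k := by
  simp [euler_X]

/-- Write θ_i for the Euler operators and F for the trace. The logarithmic derivative of the
Vandermonde product gives, for each pair, (X_i θ_i F - X_j θ_j F)/(X_i - X_j). By
`X_sub_X_mul_tracePoly_swapOp` this quotient is the polynomial θ_i F + θ_j F plus the exchange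
trace. Doubling turns pairs into ordered pairs, and each of the two first-order terms then adds (d -
1) n F. -/
theorem sum_euler_vandermonde_mul {B : Matrix (ι → Fin d) (ι → Fin d) ℂ} {c : ℂ}
    (hB : ∀ i j, B * raiseOp ι i j = raiseOp ι i j * B)
    (hc : B * groupAlgebraOp (Fin d) (swapSum ι) = c • B) :
    2 * ∑ i, euler i (vandermondeProd d) * euler i (tracePoly B) =
      vandermondeProd d * (C (c + 2 * (d - 1) * Fintype.card ι) * tracePoly B -
        ∑ i, euler i (euler i (tracePoly B))) := by
  set F := tracePoly B with hF
  have h1 : ∑ i, euler i (vandermondeProd d) * euler i F =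
      ∑ a ∈ ltPairs d, vandermondeProd d *
        (euler a.1 F + euler a.2 F + tracePoly (B * swapOp ι a.1 a.2)) := by
    simp only [vandermondeProd, derivation_prod, Finset.sum_mul]
    rw [Finset.sum_comm]
    refine Finset.sum_congr rfl fun a ha => ?_
    have hne : a.1 ≠ a.2 := (Finset.mem_filter.1 ha).2.ne
    have h2 := X_sub_X_mul_tracePoly_swapOp hB hne
    have h3 : ∑ i, euler i (X a.1 - X a.2) * euler i F =
        X a.1 * euler a.1 F - X a.2 * euler a.2 F := by
      simp only [map_sub, sub_mul, Finset.sum_sub_distrib]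
      rw [sum_euler_X_mul a.1 (fun i => euler i F), sum_euler_X_mul a.2 (fun i => euler i F)]
    simp only [mul_assoc, ← Finset.mul_sum]
    rw [h3, ← Finset.mul_prod_erase _ _ ha]
    linear_combination (-∏ b ∈ (ltPairs d).erase a, (X b.1 - X b.2)) * h2
  rw [h1, ← Finset.mul_sum, mul_left_comm]
  congr 1
  rw [two_mul_sum_ltPairs (fun i j => euler i F + euler j F + tracePoly (B * swapOp ι i j))]
  · simp only [Finset.sum_add_distrib]
    rw [sum_tracePoly_swapOp hc]
    have h4 : ∑ i : Fin d, ∑ j ∈ Finset.univ.erase i, euler i F =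
        C ((d : ℂ) - 1) * (C (Fintype.card ι : ℂ) * F) := by
      rw [hF, ← sum_euler_tracePoly, Finset.mul_sum]
      refine Finset.sum_congr rfl fun i _ => ?_
      rw [Finset.sum_const, Finset.card_erase_of_mem (Finset.mem_univ i), Finset.card_univ,
        Fintype.card_fin, nsmul_eq_mul, Nat.cast_sub i.pos]
      simp
    have h5 : ∑ i : Fin d, ∑ j ∈ Finset.univ.erase i, euler j F =
        C ((d : ℂ) - 1) * (C (Fintype.card ι : ℂ) * F) := by
      rw [← h4]
      have h6 : ∀ G : Fin d → MvPolynomial (Fin d) ℂ, ∀ i,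
          ∑ j ∈ Finset.univ.erase i, G j = ∑ j, G j - G i := fun G i => by
        rw [← Finset.add_sum_erase _ _ (Finset.mem_univ i), add_sub_cancel_left]
      simp only [h6, Finset.sum_sub_distrib]
      rw [Finset.sum_comm]
    rw [h4, h5]
    simp only [map_add, map_mul, map_sub, map_one, map_ofNat]
    ring
  · intro i j
    rw [tracePoly_mul_swapOp_comm B i j]
    ring

/-- The Casimir equation: the product of the Vandermonde determinant with the trace of `B t^{⊗ n}`
is an eigenvector of `∑ (t_i ∂ / ∂ t_i)²`. -/
theorem sum_euler_euler_mul {B : Matrix (ι → Fin d) (ι → Fin d) ℂ} {c s : ℂ}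
    (hB : ∀ i j, B * raiseOp ι i j = raiseOp ι i j * B)
    (hc : B * groupAlgebraOp (Fin d) (swapSum ι) = c • B)
    (hs : ∑ i, euler i (euler i (vandermondeProd d)) = C s * vandermondeProd d) :
    ∑ i, euler i (euler i (vandermondeProd d * tracePoly B)) =
      C (s + c + 2 * (d - 1) * Fintype.card ι) * (vandermondeProd d * tracePoly B) := by
  have h1 := sum_euler_vandermonde_mul hB hc
  have h2 : ∀ i, euler i (euler i (vandermondeProd d * tracePoly B)) =
      euler i (euler i (vandermondeProd d)) * tracePoly B +
      2 * (euler i (vandermondeProd d) * euler i (tracePoly B)) +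
      vandermondeProd d * euler i (euler i (tracePoly B)) := by
    intro i
    simp only [Derivation.leibniz, map_add, smul_eq_mul]
    ring
  simp only [h2, Finset.sum_add_distrib, ← Finset.sum_mul, ← Finset.mul_sum]
  rw [h1, hs]
  simp only [map_add, map_mul, map_sub, map_one, map_ofNat]
  ring

end Casimir

/-! ### Partial sums and dominance -/

section PartialSums

variable {d : ℕ}

/-- The sum of the first `i` entries of a tuple. -/
def partialSum (f : Fin d → ℕ) (i : ℕ) : ℕ :=
  ∑ k ∈ Finset.univ.filter (fun k : Fin d => (k : ℕ) < i), f k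

theorem partialSum_zero (f : Fin d → ℕ) : partialSum f 0 = 0 := by simp [partialSum]

theorem partialSum_succ (f : Fin d → ℕ) {i : ℕ} (h : i < d) :
    partialSum f (i + 1) = partialSum f i + f ⟨i, h⟩ := by
  have h3 : Finset.univ.filter (fun j : Fin d => (j : ℕ) < i + 1) =
      insert ⟨i, h⟩ (Finset.univ.filter (fun j : Fin d => (j : ℕ) < i)) := by
    ext j
    simp only [Finset.mem_filter, Finset.mem_univ, true_and, Finset.mem_insert, Fin.ext_iff]
    omega
  rw [partialSum, h3, Finset.sum_insert (by simp), add_comm]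
  rfl

theorem partialSum_of_le (f : Fin d → ℕ) {i : ℕ} (h : d ≤ i) : partialSum f i = ∑ k, f k := by
  rw [partialSum, Finset.filter_true_of_mem fun k _ => k.2.trans_le h]

theorem partialSum_add (f g : Fin d → ℕ) (i : ℕ) :
    partialSum (f + g) i = partialSum f i + partialSum g i := by
  simp [partialSum, Finset.sum_add_distrib]

theorem eq_of_partialSum_eq {f g : Fin d → ℕ} (h : ∀ i, partialSum f i = partialSum g i) :
    f = g := by
  funext k
  have h1 := h (k + 1)
  rw [partialSum_succ f k.2, partialSum_succ g k.2, h k] at h1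
  exact Nat.add_left_cancel h1

theorem sum_by_parts (f γ D : ℕ → ℤ) (h0 : D 0 = 0) (hD : ∀ i, D (i + 1) = D i + f i) (m : ℕ) :
    ∑ k ∈ Finset.range m, f k * γ k =
      γ m * D m + ∑ k ∈ Finset.range m, (γ k - γ (k + 1)) * D (k + 1) := by
  induction m with
  | zero => simp [h0]
  | succ m ih =>
    rw [Finset.sum_range_succ, Finset.sum_range_succ, ih, hD]
    ring

/-- A strictly decreasing tuple dominated by another one of the same norm is equal to it. -/
theorem eq_of_dominated {α β : Fin d → ℕ} (hα : StrictAnti α) (hβ : StrictAnti β)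
    (hle : ∀ i, partialSum α i ≤ partialSum β i) (htot : ∑ i, α i = ∑ i, β i)
    (hsq : ∑ i, α i ^ 2 = ∑ i, β i ^ 2) : α = β := by
  -- Abel summation applied to ∑ (β - α)(β + α) = 0. The boundary term vanishes as the totals agree,
  -- the steps of α + β are strictly positive, and the excess `D` of the partial sums is
  -- nonnegative; so `D = 0`.
  let f : ℕ → ℤ := fun k => if h : k < d then (β ⟨k, h⟩ : ℤ) - α ⟨k, h⟩ else 0
  let γ : ℕ → ℤ := fun k => if h : k < d then (β ⟨k, h⟩ : ℤ) + α ⟨k, h⟩ else 0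
  let D : ℕ → ℤ := fun i => (partialSum β i : ℤ) - partialSum α i
  have hD0 : D 0 = 0 := by simp [D, partialSum_zero]
  have hDd : ∀ i, d ≤ i → D i = 0 := fun i hi => by
    simp only [D, partialSum_of_le _ hi, htot, sub_self]
  have hD : ∀ i, D (i + 1) = D i + f i := by
    intro i
    by_cases h : i < d
    · simp only [D, f, partialSum_succ _ h, h, dif_pos]
      push_cast
      ring
    · rw [hDd i (not_lt.1 h), hDd (i + 1) (by omega)]
      simp [f, h]
  have h1 := sum_by_parts f γ D hD0 hD d
  have h2 : ∑ k ∈ Finset.range d, f k * γ k = 0 := by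
    rw [Finset.sum_range]
    have : ∀ k : Fin d, f k * γ k = (β k : ℤ) ^ 2 - (α k : ℤ) ^ 2 := fun k => by
      simp only [f, γ, k.2, dif_pos]
      ring
    simp only [this, Finset.sum_sub_distrib]
    rw [sub_eq_zero]
    exact_mod_cast hsq.symm
  rw [h2, hDd d le_rfl, mul_zero, zero_add] at h1
  have hpos : ∀ k, k + 1 < d → 0 < γ k - γ (k + 1) := by
    intro k hk
    have hk' : k < d := by omega
    have h3 : α ⟨k + 1, hk⟩ < α ⟨k, hk'⟩ := hα (Fin.lt_def.2 (Nat.lt_succ_self k))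
    have h4 : β ⟨k + 1, hk⟩ < β ⟨k, hk'⟩ := hβ (Fin.lt_def.2 (Nat.lt_succ_self k))
    simp only [γ, hk, hk', dif_pos]
    omega
  have hnonneg : ∀ i, 0 ≤ D i := fun i => by
    have := hle i
    simp only [D]
    omega
  have hterm : ∀ k ∈ Finset.range d, 0 ≤ (γ k - γ (k + 1)) * D (k + 1) := by
    intro k _
    by_cases hk : k + 1 < d
    · exact mul_nonneg (hpos k hk).le (hnonneg _)
    · rw [hDd (k + 1) (not_lt.1 hk), mul_zero]
  have h5 := (Finset.sum_eq_zero_iff_of_nonneg hterm).1 h1.symm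
  apply eq_of_partialSum_eq
  intro i
  have h6 : D i = 0 := by
    rcases i with _ | k
    · exact hD0
    · by_cases hk : k + 1 < d
      · have := h5 k (Finset.mem_range.2 (by omega))
        exact (mul_eq_zero.1 this).resolve_left (hpos k hk).ne'
      · exact hDd _ (not_lt.1 hk)
  simp only [D] at h6
  omega

/-- The staircase `(d - 1, …, 1, 0)`. -/
def staircase (d : ℕ) (j : Fin d) : ℕ := d - 1 - (j : ℕ)

theorem strictAnti_staircase (d : ℕ) : StrictAnti (staircase d) := by
  intro i j hij
  have h1 : (i : ℕ) < j := hij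
  have h2 := j.2
  simp only [staircase]
  omega

/-- Rearrangement inequality against the indicator of the first `i` places. -/
theorem partialSum_comp_perm_le {f : Fin d → ℕ} (hf : Antitone f) (σ : Equiv.Perm (Fin d))
    (i : ℕ) : partialSum (f ∘ σ) i ≤ partialSum f i := by
  let g : Fin d → ℤ := fun k => if (k : ℕ) < i then 1 else 0
  have hmono : Monovary (fun k => (f k : ℤ)) g := by
    intro a b hab
    simp only [g] at hab
    by_cases ha : (a : ℕ) < i
    · rw [if_pos ha] at hab
      split_ifs at hab <;> omega
    · by_cases hb : (b : ℕ) < i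
      · have h5 : f a ≤ f b := hf (Fin.le_def.2 (by omega))
        exact Nat.cast_le.2 h5
      · rw [if_neg ha, if_neg hb] at hab
        omega
  have h1 := hmono.sum_comp_perm_mul_le_sum_mul (σ := σ)
  have h2 : ∀ f : Fin d → ℕ, (partialSum f i : ℤ) = ∑ k, (f k : ℤ) * g k := by
    intro f
    simp only [partialSum, g, mul_ite, mul_one, mul_zero]
    rw [← Finset.sum_filter]
    push_cast
    rfl
  have h3 := h2 (f ∘ σ)
  simp only [Function.comp_apply] at h3
  rw [← h3, ← h2] at h1
  exact_mod_cast h1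

theorem perm_eq_one_of_strictAnti {f : Fin d → ℕ} (hf : StrictAnti f) {σ : Equiv.Perm (Fin d)}
    (h : StrictAnti (f ∘ σ)) : σ = 1 := by
  have hmono : StrictMono σ := fun i j hij => hf.lt_iff_gt.1 (h hij)
  have h1 : (OrderIso.refl (Fin d)).toOrderEmbedding = OrderEmbedding.ofStrictMono σ hmono := by
    have := Subsingleton.elim (OrderIso.refl (Fin d))
      (hmono.orderIsoOfSurjective σ σ.surjective)
    ext i
    exact congrArg (fun e : Fin d ≃o Fin d => ((e i : Fin d) : ℕ)) this
  ext i
  have := congrArg (fun e : Fin d ↪o Fin d => ((e i : Fin d) : ℕ)) h1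
  exact this.symm

end PartialSums

/-! ### Alternants -/

section Alternants

open MvPolynomial

variable {d : ℕ}

/-- A tuple of exponents as a finitely supported function. -/
noncomputable abbrev toExp (f : Fin d → ℕ) : Fin d →₀ ℕ := Finsupp.equivFunOnFinite.symm f

/-- The alternant over the complex numbers. -/
noncomputable def complexAlternant (lam : Fin d → ℕ) : MvPolynomial (Fin d) ℂ :=
  MvPolynomial.map (algebraMap ℝ ℂ) (alternant lam)

theorem complexAlternant_eq_det (lam : Fin d → ℕ) : complexAlternant lam =
    Matrix.det (Matrix.of fun i j : Fin d =>
      (X i : MvPolynomial (Fin d) ℂ) ^ (lam j + staircase d j)) := by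
  rw [complexAlternant, alternant, RingHom.map_det]
  congr 1
  ext1 i j
  simp [RingHom.mapMatrix_apply, staircase]

theorem complexAlternant_eq_sum (lam : Fin d → ℕ) : complexAlternant lam =
    ∑ σ : Equiv.Perm (Fin d), C (sgn σ) * monomial (toExp ((lam + staircase d) ∘ σ.symm)) 1 := by
  rw [complexAlternant_eq_det, Matrix.det_apply']
  refine Finset.sum_congr rfl fun σ _ => ?_
  rw [show C (sgn σ) = ((((Equiv.Perm.sign σ : ℤˣ) : ℤ)) : MvPolynomial (Fin d) ℂ) by simp [sgn]]
  congr 1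
  rw [monomial_eq]
  simp only [map_one, one_mul]
  rw [Finsupp.prod_fintype _ _ (by simp)]
  refine Fintype.prod_equiv σ _ _ fun i => ?_
  simp

theorem coeff_complexAlternant (lam α : Fin d → ℕ) : coeff (toExp α) (complexAlternant lam) =
    ∑ σ : Equiv.Perm (Fin d), if (lam + staircase d) ∘ σ.symm = α then sgn σ else 0 := by
  rw [complexAlternant_eq_sum]
  simp only [coeff_sum, coeff_C_mul, coeff_monomial, EmbeddingLike.apply_eq_iff_eq, mul_ite,
    mul_one, mul_zero]

theorem rename_complexAlternant (lam : Fin d → ℕ) (τ : Equiv.Perm (Fin d)) :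
    rename τ (complexAlternant lam) = C (sgn τ) * complexAlternant lam := by
  rw [complexAlternant_eq_det, AlgHom.map_det]
  have h := Matrix.det_permute τ (Matrix.of fun i j : Fin d =>
      (X i : MvPolynomial (Fin d) ℂ) ^ (lam j + staircase d j))
  have h2 : C (sgn τ) = ((((Equiv.Perm.sign τ : ℤˣ) : ℤ)) : MvPolynomial (Fin d) ℂ) := by
    simp [sgn]
  rw [h2, ← h]
  congr 1
  ext1 i j
  simp

theorem complexAlternant_zero : complexAlternant (0 : Fin d → ℕ) = vandermondeProd d := by
  have := Matrix.det_projVandermonde (R := MvPolynomial (Fin d) ℂ) (fun _ => 1) (fun i => X i)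
  simp only [one_mul] at this
  have h2 : vandermondeProd d = ∏ i : Fin d, ∏ j ∈ Finset.Ioi i, (X i - X j) := by
    rw [vandermondeProd, ltPairs, Finset.prod_filter, Fintype.prod_prod_type]
    refine Finset.prod_congr rfl fun i _ => ?_
    rw [← Finset.prod_filter]
    refine Finset.prod_congr ?_ fun _ _ => rfl
    ext j
    simp
  rw [h2, ← this, complexAlternant_eq_det]
  congr 1
  ext1 i j
  simp [Matrix.projVandermonde_apply, Fin.rev, staircase]
  congr 1
  omega

theorem vandermondeProd_ne_zero : vandermondeProd d ≠ 0 := by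
  rw [vandermondeProd, Finset.prod_ne_zero_iff]
  intro a ha h
  have hne : a.1 ≠ a.2 := (Finset.mem_filter.1 ha).2.ne
  rw [sub_eq_zero] at h
  exact hne (X_injective h)

theorem coeff_toExp_comp {G : MvPolynomial (Fin d) ℂ}
    (hG : ∀ τ : Equiv.Perm (Fin d), rename τ G = C (sgn τ) * G) (α : Fin d → ℕ)
    (τ : Equiv.Perm (Fin d)) : coeff (toExp (α ∘ τ.symm)) G = sgn τ * coeff (toExp α) G := by
  have h1 := coeff_rename_mapDomain τ τ.injective G (toExp α)
  rw [hG τ, coeff_C_mul] at h1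
  have h2 : Finsupp.mapDomain τ (toExp α) = toExp (α ∘ τ.symm) := by
    ext i
    rw [← Finsupp.equivMapDomain_eq_mapDomain]
    simp
  rw [h2] at h1
  rw [← h1, ← mul_assoc, sgn_mul_self, one_mul]

/-- An antisymmetric polynomial vanishes if its coefficients at strictly decreasing exponents
do. -/
theorem eq_zero_of_antisymmetric {G : MvPolynomial (Fin d) ℂ}
    (hG : ∀ τ : Equiv.Perm (Fin d), rename τ G = C (sgn τ) * G)
    (h0 : ∀ α : Fin d → ℕ, StrictAnti α → coeff (toExp α) G = 0) : G = 0 := by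
  ext α
  obtain ⟨α, rfl⟩ := Finsupp.equivFunOnFinite.symm.surjective α
  rw [coeff_zero]
  by_cases hinj : Function.Injective α
  · let ρ : Equiv.Perm (Fin d) := Tuple.sort α * Fin.revPerm
    have hanti : StrictAnti (α ∘ ρ) := by
      refine Antitone.strictAnti_of_injective (fun i j hij => ?_) (hinj.comp ρ.injective)
      exact Tuple.monotone_sort α (Fin.rev_le_rev.2 hij)
    have h1 := coeff_toExp_comp hG α ρ.symm
    rw [Equiv.symm_symm, h0 _ hanti] at h1
    refine (mul_eq_zero.1 h1.symm).resolve_left ?_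
    intro h
    have := sgn_mul_self ρ.symm
    rw [h, zero_mul] at this
    exact zero_ne_one this
  · rw [Function.Injective] at hinj
    push Not at hinj
    obtain ⟨i, j, hij, hne⟩ := hinj
    have h1 := coeff_toExp_comp hG α (Equiv.swap i j)
    have h2 : α ∘ (Equiv.swap i j).symm = α := by
      rw [Equiv.symm_swap]
      exact funext (mem_fiberPerms.1 (swap_mem_fiberPerms hij))
    rw [h2] at h1
    simp only [sgn, Equiv.Perm.sign_swap hne] at h1
    apply eq_zero_of_eq_neg (M := ℂ)
    simpa using h1

end Alternants

/-! ### The character formula -/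

section Character

open MvPolynomial

variable {ι : Type*} [Fintype ι] [DecidableEq ι] {d : ℕ} {lam : Fin d → ℕ}

theorem partialSum_content (x : ι → Fin d) (i : ℕ) :
    partialSum (content x) i = (Finset.univ.filter fun p => (x p : ℕ) < i).card := by
  rw [partialSum, Finset.card_eq_sum_card_fiberwise (f := x)
    (t := Finset.univ.filter (fun k : Fin d => (k : ℕ) < i))]
  · refine Finset.sum_congr rfl fun k hk => ?_
    rw [content, Finset.filter_filter]
    congr 1
    ext p
    simp only [Finset.mem_filter, Finset.mem_univ, true_and] at hk ⊢
    constructor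
    · rintro rfl
      exact ⟨hk, rfl⟩
    · exact fun h => h.2
  · intro p hp
    simpa using hp

theorem content_rowOf (T : ι ≃ Boxes lam) : content (rowOf T) = lam :=
  funext (card_rowOf_eq T)

theorem content_comp (x : ι → Fin d) (σ : Equiv.Perm ι) : content (x ∘ σ) = content x := by
  funext i
  exact Finset.card_bij (fun p _ => σ p) (by simp) (by simp)
    (fun q hq => ⟨σ.symm q, by simpa using hq⟩)

theorem groupAlgebraOp_apply_eq_zero (a : MonoidAlgebra ℂ (Equiv.Perm ι)) {x y : ι → Fin d}
    (h : content x ≠ content y) : groupAlgebraOp (Fin d) a x y = 0 := by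
  rw [eq_sum_coeff_gr a]
  simp only [groupAlgebraOp_sum, groupAlgebraOp_smul, groupAlgebraOp_gr, Matrix.sum_apply,
    Matrix.smul_apply, permOp_apply]
  refine Finset.sum_eq_zero fun σ _ => ?_
  rw [if_neg, smul_zero]
  rintro rfl
  exact h (content_comp y σ.symm)

theorem youngSymmetrizer_op_apply_ne_zero {T : ι ≃ Boxes lam} {x z : ι → Fin d}
    (h : groupAlgebraOp (Fin d) (youngSymmetrizer T) x z ≠ 0) :
    ∀ p q, colOf T p = colOf T q → z p = z q → p = q := by
  intro p q hc hz
  by_contra hpq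
  apply h
  rw [youngSymmetrizer_eq, groupAlgebraOp_mul, Matrix.mul_apply]
  refine Finset.sum_eq_zero fun y _ => ?_
  rw [colSum_op_apply_eq_zero y z hpq hc hz, mul_zero]

theorem youngIdem_op_apply (T : ι ≃ Boxes lam) (x y : ι → Fin d) :
    groupAlgebraOp (Fin d) (youngIdem T) x y =
      ∑ z, groupAlgebraOp (Fin d) (youngSymmetrizer T) x z *
        ((symDim T : ℂ) / ((Fintype.card (Equiv.Perm ι) : ℂ) * ((fiberPerms (rowOf T)).card : ℂ)) *
          groupAlgebraOp (Fin d) (rowSum (rowOf T)) z y) := by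
  rw [youngIdem, groupAlgebraOp_smul, groupAlgebraOp_mul, Matrix.smul_apply, Matrix.mul_apply,
    smul_eq_mul, Finset.mul_sum]
  refine Finset.sum_congr rfl fun z _ => ?_
  ring

/-- The weights of the trace of a Young idempotent are dominated by the diagram. -/
theorem partialSum_content_le {T : ι ≃ Boxes lam} (hlam : Antitone lam) {x : ι → Fin d}
    (h : groupAlgebraOp (Fin d) (youngIdem T) x x ≠ 0) (i : ℕ) :
    partialSum (content x) i ≤ partialSum lam i := by
  rw [youngIdem_op_apply] at h
  obtain ⟨z, -, hz⟩ := Finset.exists_ne_zero_of_sum_ne_zero h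
  have h1 := left_ne_zero_of_mul hz
  have h2 := right_ne_zero_of_mul (right_ne_zero_of_mul hz)
  have h3 : content z = content x := by
    by_contra hne
    exact h2 (groupAlgebraOp_apply_eq_zero _ hne)
  rw [← h3, ← content_rowOf T, partialSum_content, partialSum_content]
  exact card_lt_le T hlam z (youngSymmetrizer_op_apply_ne_zero h1) i

/-- On the filling by row indices, only the trivial column permutation returns to it, while every
row permutation fixes it. The entry is thus the order of the row group. -/
theorem youngSymmetrizer_op_apply_rowOf_ne_zero (T : ι ≃ Boxes lam) :
    groupAlgebraOp (Fin d) (youngSymmetrizer T) (rowOf T) (rowOf T) ≠ 0 := by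
  have h1 : groupAlgebraOp (Fin d) (colSum (colOf T)) (rowOf T) (rowOf T) = 1 := by
    simp only [colSum, groupAlgebraOp_sum, groupAlgebraOp_smul, groupAlgebraOp_gr,
      Matrix.sum_apply, Matrix.smul_apply, permOp_apply]
    rw [Finset.sum_eq_single 1]
    · have : rowOf T = rowOf T ∘ (Equiv.symm (1 : Equiv.Perm ι)) := rfl
      rw [if_pos this]
      simp
    · intro γ hγ hne
      rw [if_neg, smul_zero]
      intro h
      apply hne
      rw [eq_comp_symm_iff] at h
      exact Equiv.ext fun p => eq_of_row_col T (congrFun h p) (mem_fiberPerms.1 hγ p)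
    · exact fun h => absurd (one_mem_fiberPerms _) h
  rw [youngSymmetrizer_eq, rowSum, Finset.sum_mul, groupAlgebraOp_sum, Matrix.sum_apply]
  simp only [groupAlgebraOp_mul, groupAlgebraOp_gr, permOp_mul_apply]
  rw [Finset.sum_congr rfl (g := fun _ => (1 : ℂ))]
  · simpa using card_fiberPerms_ne_zero (rowOf T)
  · intro ρ hρ
    have : rowOf T ∘ ρ = rowOf T := funext (mem_fiberPerms.1 hρ)
    rw [this, h1]

/-- The highest weight has multiplicity one. A filling of content lam with distinct entries in each
column is a column permutation of the row filling, so on this weight space the symmetrizer has rank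
one, with image spanned by its value v at the row filling. The idempotent has the form |v⟩⟨ψ| there,
and fixes v. -/
theorem sum_content_eq_youngIdem (T : ι ≃ Boxes lam) (hlam : Antitone lam) :
    ∑ x ∈ Finset.univ.filter (fun x : ι → Fin d => content x = lam),
      groupAlgebraOp (Fin d) (youngIdem T) x x = 1 := by
  set v : (ι → Fin d) → ℂ := fun y =>
    groupAlgebraOp (Fin d) (youngSymmetrizer T) y (rowOf T) with hv
  have h1 : ∀ z : ι → Fin d, content z = lam → ∃ ψ : ℂ, ∀ y,
      groupAlgebraOp (Fin d) (youngSymmetrizer T) y z = v y * ψ := by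
    intro z hz
    by_cases hinj : ∀ p q, colOf T p = colOf T q → z p = z q → p = q
    · obtain ⟨γ, hγ, hγz⟩ := exists_col_perm T hlam z hinj fun i => by
        rw [← partialSum_content, ← partialSum_content, hz, content_rowOf]
      refine ⟨sgn γ⁻¹, fun y => ?_⟩
      have h2 := mul_permOp_apply (κ := Fin d) γ⁻¹
        (groupAlgebraOp (Fin d) (youngSymmetrizer T)) y (rowOf T)
      have h3 : rowOf T ∘ (γ⁻¹).symm = z := hγz
      rw [h3, ← groupAlgebraOp_gr, ← groupAlgebraOp_mul, youngSymmetrizer_eq, mul_assoc,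
        colSum_mul_gr (inv_mem_fiberPerms hγ), mul_smul_comm, groupAlgebraOp_smul,
        ← youngSymmetrizer_eq, Matrix.smul_apply, smul_eq_mul, mul_comm] at h2
      exact h2.symm
    · refine ⟨0, fun y => ?_⟩
      rw [mul_zero]
      by_contra hne
      exact hinj (youngSymmetrizer_op_apply_ne_zero hne)
  have h2 : ∀ x : ι → Fin d, content x = lam → ∃ ψ : ℂ, ∀ y,
      groupAlgebraOp (Fin d) (youngIdem T) y x = v y * ψ := by
    intro x hx
    have h3 : ∀ z, ∃ ψ : ℂ, ∀ y, groupAlgebraOp (Fin d) (youngSymmetrizer T) y z *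
        ((symDim T : ℂ) / ((Fintype.card (Equiv.Perm ι) : ℂ) *
          ((fiberPerms (rowOf T)).card : ℂ)) *
          groupAlgebraOp (Fin d) (rowSum (rowOf T)) z x) = v y * ψ := by
      intro z
      by_cases hz : content z = lam
      · obtain ⟨ψ, hψ⟩ := h1 z hz
        exact ⟨ψ * _, fun y => by rw [hψ y, mul_assoc]⟩
      · refine ⟨0, fun y => ?_⟩
        rw [groupAlgebraOp_apply_eq_zero (rowSum (rowOf T)) (x := z) (y := x) (by rwa [hx])]
        simp
    choose ψ hψ using h3
    refine ⟨∑ z, ψ z, fun y => ?_⟩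
    rw [youngIdem_op_apply, Finset.mul_sum]
    exact Finset.sum_congr rfl fun z _ => hψ z y
  choose! ψ hψ using h2
  have h3 : v (rowOf T) = ∑ x, groupAlgebraOp (Fin d) (youngIdem T) (rowOf T) x * v x := by
    simp only [hv]
    rw [← Matrix.mul_apply, ← groupAlgebraOp_mul, youngIdem_mul_youngSymmetrizer T hlam]
  rw [← Finset.sum_filter_add_sum_filter_not Finset.univ (fun x => content x = lam)] at h3
  have h4 : ∑ x ∈ Finset.univ.filter (fun x : ι → Fin d => ¬ content x = lam),
      groupAlgebraOp (Fin d) (youngIdem T) (rowOf T) x * v x = 0 := by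
    refine Finset.sum_eq_zero fun x hx => ?_
    have hx' := (Finset.mem_filter.1 hx).2
    rw [groupAlgebraOp_apply_eq_zero (youngIdem T) (by rw [content_rowOf]; exact Ne.symm hx'),
      zero_mul]
  rw [h4, add_zero] at h3
  -- The equation e v = v is read at the row filling; with e y x = v y * ψ x, the factor `v (rowOf
  -- T)` splits off and leaves the diagonal sum.
  have h5 : v (rowOf T) * 1 = v (rowOf T) *
      ∑ x ∈ Finset.univ.filter (fun x : ι → Fin d => content x = lam),
        groupAlgebraOp (Fin d) (youngIdem T) x x := by
    rw [mul_one, Finset.mul_sum]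
    conv_lhs => rw [h3]
    refine Finset.sum_congr rfl fun x hx => ?_
    have hx' := (Finset.mem_filter.1 hx).2
    rw [hψ x hx', hψ x hx']
    ring
  exact (mul_left_cancel₀ (youngSymmetrizer_op_apply_rowOf_ne_zero T) h5).symm

theorem rename_tracePoly (a : MonoidAlgebra ℂ (Equiv.Perm ι)) (τ : Equiv.Perm (Fin d)) :
    rename τ (tracePoly (groupAlgebraOp (Fin d) a)) = tracePoly (groupAlgebraOp (Fin d) a) := by
  simp only [tracePoly, map_sum, map_mul, rename_C, tensorMonomial, map_prod, rename_X]
  refine Fintype.sum_equiv (Equiv.arrowCongr (Equiv.refl ι) τ) _ _ fun x => ?_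
  congr 2
  rw [eq_sum_coeff_gr a]
  simp only [groupAlgebraOp_sum, groupAlgebraOp_smul, groupAlgebraOp_gr, Matrix.sum_apply,
    Matrix.smul_apply, permOp_apply]
  refine Finset.sum_congr rfl fun σ _ => ?_
  congr 1
  have : ((Equiv.arrowCongr (Equiv.refl ι) τ) x = (Equiv.arrowCongr (Equiv.refl ι) τ) x ∘ σ.symm)
      ↔ x = x ∘ σ.symm := by
    simp only [funext_iff, Function.comp, Equiv.arrowCongr_apply, Equiv.refl_symm, Equiv.refl_apply,
      τ.injective.eq_iff]
  simp only [this]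

theorem gr_mul_swapSum (σ : Equiv.Perm ι) : gr σ * swapSum ι = swapSum ι * gr σ := by
  simp only [swapSum, Finset.mul_sum, Finset.sum_mul, ← gr_mul]
  refine Fintype.sum_equiv σ _ _ fun p => Fintype.sum_equiv σ _ _ fun q => ?_
  rw [Equiv.Perm.mul_def, Equiv.Perm.mul_def]
  congr 1
  ext s
  simp only [Equiv.trans_apply]
  rw [Equiv.swap_apply_def, Equiv.swap_apply_def]
  simp only [EmbeddingLike.apply_eq_iff_eq]
  split_ifs <;> rfl

theorem mul_swapSum (a : MonoidAlgebra ℂ (Equiv.Perm ι)) : a * swapSum ι = swapSum ι * a := by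
  rw [eq_sum_coeff_gr a]
  simp only [Finset.mul_sum, Finset.sum_mul, smul_mul_assoc, mul_smul_comm, gr_mul_swapSum]

theorem sum_comp_perm_staircase (σ : Equiv.Perm (Fin d)) (f : ℕ → ℕ) :
    ∑ i, f ((staircase d ∘ σ) i) = ∑ i, f (staircase d i) :=
  Equiv.sum_comp σ (fun i => f (staircase d i))

theorem coeff_sum_euler_euler (f : MvPolynomial (Fin d) ℂ) (α : Fin d → ℕ) :
    coeff (toExp α) (∑ i, euler i (euler i f)) =
      ((∑ i, α i ^ 2 : ℕ) : ℂ) * coeff (toExp α) f := by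
  simp only [coeff_sum, coeff_euler]
  push_cast
  rw [Finset.sum_mul]
  refine Finset.sum_congr rfl fun i _ => ?_
  simp only [Finsupp.equivFunOnFinite_symm_apply_apply]
  ring

/-- All exponents of the Vandermonde product are permutations of the staircase, so their sums of
squares agree. -/
theorem sum_euler_euler_vandermonde :
    ∑ i, euler i (euler i (vandermondeProd d)) =
      C ((∑ i, staircase d i ^ 2 : ℕ) : ℂ) * vandermondeProd d := by
  ext α
  obtain ⟨α, rfl⟩ := Finsupp.equivFunOnFinite.symm.surjective α
  rw [coeff_sum_euler_euler, coeff_C_mul]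
  by_cases h : coeff (toExp α) (vandermondeProd d) = 0
  · rw [h, mul_zero, mul_zero]
  · rw [← complexAlternant_zero, coeff_complexAlternant] at h
    obtain ⟨σ, -, hσ⟩ := Finset.exists_ne_zero_of_sum_ne_zero h
    have h1 : (0 + staircase d) ∘ σ.symm = α := by
      by_contra hne
      rw [if_neg hne] at hσ
      exact hσ rfl
    rw [zero_add] at h1
    rw [← h1, sum_comp_perm_staircase σ.symm (fun k => k ^ 2)]

theorem coeff_vandermonde_mul_tracePoly (B : Matrix (ι → Fin d) (ι → Fin d) ℂ) (α : Fin d → ℕ) :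
    coeff (toExp α) (vandermondeProd d * tracePoly B) =
      ∑ σ : Equiv.Perm (Fin d), ∑ x : ι → Fin d,
        if staircase d ∘ σ.symm + content x = α then sgn σ * B x x else 0 := by
  rw [← complexAlternant_zero, complexAlternant_eq_sum, tracePoly, Finset.sum_mul_sum]
  simp only [coeff_sum]
  refine Finset.sum_congr rfl fun σ _ => Finset.sum_congr rfl fun x _ => ?_
  have h : C (sgn σ) * monomial (toExp ((0 + staircase d) ∘ σ.symm)) (1 : ℂ) *
      (C (B x x) * tensorMonomial x) =
      C (sgn σ * B x x) * monomial (toExp (staircase d ∘ σ.symm + content x)) 1 := by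
    have h2 : toExp (staircase d ∘ σ.symm + content x) =
        toExp (staircase d ∘ σ.symm) + exponent x := by
      ext i
      simp [exponent_apply]
    rw [tensorMonomial_eq, h2, zero_add, map_mul, ← one_mul (1 : ℂ), ← monomial_mul, one_mul]
    ring
  rw [h, coeff_C_mul, coeff_monomial]
  simp only [EmbeddingLike.apply_eq_iff_eq, mul_ite, mul_one, mul_zero]

/-- Both sides are antisymmetric, so strictly decreasing exponents suffice. Those on the left are
dominated by lam + δ, δ being the staircase, with the same total; by the Casimir equation they have
the same sum of squares, hence equal lam + δ. The coefficient there is 1 because the highest weight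
has multiplicity one. -/
theorem vandermonde_mul_tracePoly (T : ι ≃ Boxes lam) (hlam : Antitone lam) :
    vandermondeProd d * tracePoly (groupAlgebraOp (Fin d) (youngIdem T)) =
      complexAlternant lam := by
  set B := groupAlgebraOp (Fin d) (youngIdem T) with hB
  have hβ : StrictAnti (lam + staircase d) := fun i j hij =>
    add_lt_add_of_le_of_lt (hlam hij.le) (strictAnti_staircase d hij)
  have htotal : ∀ x : ι → Fin d, ∑ i, content x i = ∑ i, lam i := fun x => by
    rw [sum_content, ← content_rowOf T, sum_content]
  have hdom : ∀ (σ : Equiv.Perm (Fin d)) (x : ι → Fin d), B x x ≠ 0 → ∀ i,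
      partialSum (staircase d ∘ σ.symm + content x) i ≤ partialSum (lam + staircase d) i := by
    intro σ x hx i
    rw [partialSum_add, partialSum_add, add_comm]
    exact add_le_add (partialSum_content_le hlam hx i)
      (partialSum_comp_perm_le (strictAnti_staircase d).antitone σ.symm i)
  have hlead : coeff (toExp (lam + staircase d)) (vandermondeProd d * tracePoly B) = 1 := by
    rw [coeff_vandermonde_mul_tracePoly, ← sum_content_eq_youngIdem T hlam,
      Finset.sum_eq_single 1]
    · rw [Finset.sum_filter]
      refine Finset.sum_congr rfl fun x _ => ?_
      have h1 : (staircase d ∘ (Equiv.symm (1 : Equiv.Perm (Fin d))) + content x = lam + staircase d) ↔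
          content x = lam := by
        have : staircase d ∘ (Equiv.symm (1 : Equiv.Perm (Fin d))) = staircase d := rfl
        rw [this, add_comm lam]
        exact add_right_inj _
      simp only [h1]
      simp [sgn, hB]
    · intro σ _ hσ
      refine Finset.sum_eq_zero fun x _ => ?_
      split_ifs with h
      · by_cases hx : B x x = 0
        · rw [hx, mul_zero]
        · exfalso
          apply hσ
          -- Dominance holds separately for the permuted staircase and for the content. Equality of
          -- the sums forces equality in both.
          have h1 : staircase d ∘ σ.symm = staircase d := by
            apply eq_of_partialSum_eq
            intro i
            have h2 := congrArg (fun f => partialSum f i) h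
            simp only [partialSum_add] at h2
            have h3 := partialSum_content_le hlam hx i
            have h4 := partialSum_comp_perm_le (strictAnti_staircase d).antitone σ.symm i
            omega
          have h5 : σ.symm = 1 := perm_eq_one_of_strictAnti (strictAnti_staircase d)
            (by rw [h1]; exact strictAnti_staircase d)
          rw [← Equiv.symm_symm σ, h5]
          rfl
      · rfl
    · simp
  have hcas := sum_euler_euler_mul (c := youngChar T (swapSum ι)) (B := B)
    (fun i j => groupAlgebraOp_mul_raiseOp _ i j)
    (by
      -- The sum z of transpositions is central, so e z = e z e, which is a multiple of e by
      -- primitivity.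
      rw [hB, ← groupAlgebraOp_mul, ← groupAlgebraOp_smul]
      congr 1
      rw [← youngIdem_mul_mul T hlam, mul_assoc, ← mul_swapSum, ← mul_assoc,
        youngIdem_mul_self T hlam])
    sum_euler_euler_vandermonde
  set K : ℂ := ((∑ i, staircase d i ^ 2 : ℕ) : ℂ) + youngChar T (swapSum ι) +
    2 * (d - 1) * Fintype.card ι
  have hK : ∀ α : Fin d → ℕ, coeff (toExp α) (vandermondeProd d * tracePoly B) ≠ 0 →
      ((∑ i, α i ^ 2 : ℕ) : ℂ) = K := by
    intro α hα
    have h1 := congrArg (coeff (toExp α)) hcas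
    rw [coeff_sum_euler_euler, coeff_C_mul] at h1
    exact mul_right_cancel₀ hα h1
  have hKβ := hK (lam + staircase d) (by rw [hlead]; exact one_ne_zero)
  rw [← sub_eq_zero]
  apply eq_zero_of_antisymmetric
  · intro τ
    rw [map_sub, map_mul, rename_complexAlternant, ← complexAlternant_zero,
      rename_complexAlternant, rename_tracePoly]
    ring
  · intro α hα
    rw [coeff_sub, sub_eq_zero]
    by_cases hαβ : lam + staircase d = α
    · rw [← hαβ, hlead, coeff_complexAlternant, Finset.sum_eq_single 1]
      · have h2 : (lam + staircase d) ∘ (Equiv.symm (1 : Equiv.Perm (Fin d))) =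
            lam + staircase d := rfl
        rw [if_pos h2]
        simp [sgn]
      · intro σ _ hσ
        rw [if_neg]
        intro h
        apply hσ
        have h5 : σ.symm = 1 := perm_eq_one_of_strictAnti hβ (by rw [h]; exact hβ)
        rw [← Equiv.symm_symm σ, h5]
        rfl
      · simp
    · have h1 : coeff (toExp α) (complexAlternant lam) = 0 := by
        rw [coeff_complexAlternant]
        refine Finset.sum_eq_zero fun σ _ => ?_
        rw [if_neg]
        intro h
        have h5 : σ.symm = 1 := perm_eq_one_of_strictAnti hβ (by rw [h]; exact hα)
        rw [h5] at h
        exact hαβ h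
      rw [h1]
      by_contra hne
      apply hαβ
      have h2 := hK α hne
      rw [coeff_vandermonde_mul_tracePoly] at hne
      obtain ⟨σ, -, hσ⟩ := Finset.exists_ne_zero_of_sum_ne_zero hne
      obtain ⟨x, -, hx⟩ := Finset.exists_ne_zero_of_sum_ne_zero hσ
      have h3 : staircase d ∘ σ.symm + content x = α := by
        by_contra hne
        rw [if_neg hne] at hx
        exact hx rfl
      rw [if_pos h3] at hx
      refine (eq_of_dominated hα hβ (fun i => ?_) ?_ ?_).symm
      · rw [← h3]
        exact hdom σ x (right_ne_zero_of_mul hx) i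
      · rw [← h3]
        simp only [Pi.add_apply, Finset.sum_add_distrib, htotal]
        rw [sum_comp_perm_staircase σ.symm (fun k => k), add_comm]
      · rw [← hKβ] at h2
        exact_mod_cast h2

/-- The character formula: the trace of a Young idempotent on `t^{⊗ n}` is the Schur polynomial. -/
theorem tracePoly_youngIdem (T : ι ≃ Boxes lam) (hlam : Antitone lam) :
    tracePoly (groupAlgebraOp (Fin d) (youngIdem T)) =
      MvPolynomial.map (algebraMap ℝ ℂ) (schurPoly lam) := by
  apply mul_left_cancel₀ (vandermondeProd_ne_zero (d := d))
  rw [vandermonde_mul_tracePoly T hlam, complexAlternant, alternant_eq_mul_schurPoly, map_mul,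
    ← complexAlternant, complexAlternant_zero]

theorem sum_youngIdem_mul_prod (T : ι ≃ Boxes lam) (hlam : Antitone lam) (t : Fin d → ℝ) :
    ∑ x : ι → Fin d, groupAlgebraOp (Fin d) (youngIdem T) x x * ∏ p, (t (x p) : ℂ) =
      ((MvPolynomial.eval t (schurPoly lam) : ℝ) : ℂ) := by
  have h := congrArg (MvPolynomial.eval fun i => (t i : ℂ)) (tracePoly_youngIdem T hlam)
  simp only [tracePoly, tensorMonomial, map_sum, map_mul, map_prod, eval_C, eval_X] at h
  rw [h, MvPolynomial.eval_map]
  rw [MvPolynomial.eval₂_eq', MvPolynomial.eval_eq']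
  push_cast
  rfl

theorem youngIdem_op_posSemidef (T : ι ≃ Boxes lam) (hlam : Antitone lam) :
    (groupAlgebraOp (Fin d) (youngIdem T)).PosSemidef := by
  have h : groupAlgebraOp (Fin d) (youngIdem T) =
      (groupAlgebraOp (Fin d) (youngIdem T))ᴴ * groupAlgebraOp (Fin d) (youngIdem T) := by
    rw [groupAlgebraOp_youngIdem_conjTranspose, ← groupAlgebraOp_mul, youngIdem_mul_self T hlam]
  rw [h]
  exact Matrix.posSemidef_conjTranspose_mul_self _

/-- The Schur polynomial is positive at the normalized row lengths. -/
theorem eval_schurPoly_pos (T : ι ≃ Boxes lam) (hlam : Antitone lam) {t : Fin d → ℝ}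
    (ht : ∀ i, 0 ≤ t i) (hpos : ∀ i, lam i ≠ 0 → 0 < t i) :
    0 < MvPolynomial.eval t (schurPoly lam) := by
  have hdiag : ∀ x : ι → Fin d, 0 ≤ groupAlgebraOp (Fin d) (youngIdem T) x x :=
    fun x => (youngIdem_op_posSemidef T hlam).diag_nonneg
  have h1 := sum_youngIdem_mul_prod T hlam t
  have hterm : ∀ x : ι → Fin d,
      0 ≤ groupAlgebraOp (Fin d) (youngIdem T) x x * ∏ p, (t (x p) : ℂ) := by
    intro x
    refine mul_nonneg (hdiag x) (Finset.prod_nonneg fun p _ => ?_)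
    exact_mod_cast ht _
  -- All terms of the trace formula are nonnegative. One of weight `lam` is nonzero, and its letters
  -- are rows with `lam i ≠ 0`, where `t` is positive.
  have h2 : ∃ x ∈ Finset.univ.filter (fun x : ι → Fin d => content x = lam),
      groupAlgebraOp (Fin d) (youngIdem T) x x ≠ 0 := by
    apply Finset.exists_ne_zero_of_sum_ne_zero
    rw [sum_content_eq_youngIdem T hlam]
    exact one_ne_zero
  obtain ⟨x, hx, hne⟩ := h2
  have hx' := (Finset.mem_filter.1 hx).2
  have h3 : 0 < groupAlgebraOp (Fin d) (youngIdem T) x x * ∏ p, (t (x p) : ℂ) := by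
    refine mul_pos ((hdiag x).lt_of_ne' hne) (Finset.prod_pos fun p _ => ?_)
    have : 0 < t (x p) := by
      apply hpos
      rw [← hx', content, Finset.card_ne_zero]
      exact ⟨p, by simp⟩
    exact_mod_cast this
  have h4 : (0 : ℂ) < ((MvPolynomial.eval t (schurPoly lam) : ℝ) : ℂ) := by
    rw [← h1]
    exact Finset.sum_pos' (fun x _ => hterm x) ⟨x, Finset.mem_univ x, h3⟩
  exact_mod_cast h4

end Character

/-! ### Projections and supports -/

section Projections

variable {I : Type*} [Fintype I] [DecidableEq I]

theorem toEuclideanLin_projMatrix (W : Submodule ℂ (EuclideanSpace ℂ I)) :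
    Matrix.toEuclideanLin (projMatrix W) = (W.starProjection : _ →ₗ[ℂ] _) := by
  refine (EuclideanSpace.basisFun I ℂ).toBasis.ext fun b => ?_
  ext a
  simp [projMatrix, Matrix.toLpLin_apply]

theorem projMatrix_isStarProjection (W : Submodule ℂ (EuclideanSpace ℂ I)) :
    IsStarProjection (projMatrix W) := by
  have h1 : Matrix.toEuclideanCLM (n := I) (𝕜 := ℂ) (projMatrix W) = W.starProjection := by
    ext1 v
    exact LinearMap.congr_fun (toEuclideanLin_projMatrix W) v
  have h2 : IsStarProjection W.starProjection := isStarProjection_starProjection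
  rw [← h1] at h2
  constructor
  · have h3 := h2.isIdempotentElem
    rw [IsIdempotentElem, ← map_mul] at h3
    exact EquivLike.injective (Matrix.toEuclideanCLM (n := I) (𝕜 := ℂ)) h3
  · have h3 := h2.isSelfAdjoint
    rw [IsSelfAdjoint, ← map_star] at h3
    exact EquivLike.injective (Matrix.toEuclideanCLM (n := I) (𝕜 := ℂ)) h3

theorem range_toEuclideanLin_projMatrix (W : Submodule ℂ (EuclideanSpace ℂ I)) :
    LinearMap.range (Matrix.toEuclideanLin (projMatrix W)) = W := by
  rw [toEuclideanLin_projMatrix]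
  exact Submodule.range_starProjection W

theorem toEuclideanLin_mul_apply {I J K : Type*} [Fintype I] [DecidableEq I] [Fintype J]
    [DecidableEq J] [Fintype K] [DecidableEq K] (A : Matrix I J ℂ) (B : Matrix J K ℂ)
    (v : EuclideanSpace ℂ K) : Matrix.toEuclideanLin (A * B) v =
      Matrix.toEuclideanLin A (Matrix.toEuclideanLin B v) := by
  rw [Matrix.toLpLin_mul_same]
  rfl

theorem mul_eq_of_range_le {P A : Matrix I I ℂ} (hP : P * P = P)
    (h : LinearMap.range (Matrix.toEuclideanLin A) ≤ LinearMap.range (Matrix.toEuclideanLin P)) :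
    P * A = A := by
  apply Matrix.toEuclideanLin.injective
  refine LinearMap.ext fun v => ?_
  obtain ⟨w, hw⟩ := h (LinearMap.mem_range_self _ v)
  rw [toEuclideanLin_mul_apply, ← hw, ← toEuclideanLin_mul_apply, hP]

theorem range_mul_le (A B : Matrix I I ℂ) : LinearMap.range (Matrix.toEuclideanLin (A * B)) ≤
    LinearMap.range (Matrix.toEuclideanLin A) := by
  rintro _ ⟨v, rfl⟩
  rw [toEuclideanLin_mul_apply]
  exact LinearMap.mem_range_self _ _

theorem eq_projMatrix {P : Matrix I I ℂ} {W : Submodule ℂ (EuclideanSpace ℂ I)} (hP : P * P = P)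
    (hPs : Pᴴ = P) (hW : LinearMap.range (Matrix.toEuclideanLin P) = W) : P = projMatrix W := by
  have hQ := projMatrix_isStarProjection W
  have h1 : projMatrix W * P = P := by
    refine mul_eq_of_range_le hQ.isIdempotentElem ?_
    rw [range_toEuclideanLin_projMatrix, hW]
  have h2 : P * projMatrix W = projMatrix W := by
    refine mul_eq_of_range_le hP ?_
    rw [range_toEuclideanLin_projMatrix, hW]
  have h3 := congrArg Matrix.conjTranspose h1
  have h4 : (projMatrix W)ᴴ = projMatrix W := hQ.isSelfAdjoint
  rw [Matrix.conjTranspose_mul, hPs, h4, h2] at h3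
  exact h3.symm

theorem posSemidef_of_projection {P : Matrix I I ℂ} (hP : P * P = P) (hPs : Pᴴ = P) :
    P.PosSemidef := by
  have h : P = Pᴴ * P := by rw [hPs, hP]
  rw [h]
  exact Matrix.posSemidef_conjTranspose_mul_self P

open scoped MatrixOrder in
theorem exists_eq_conjTranspose_mul_self {τ : Matrix I I ℂ} (hτ : τ.PosSemidef) :
    ∃ B : Matrix I I ℂ, τ = Bᴴ * B := by
  obtain ⟨B, hB⟩ := CStarAlgebra.nonneg_iff_eq_star_mul_self.1 hτ.nonneg
  exact ⟨B, hB⟩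

/-- With τ = B†B, the difference of the traces is the squared Hilbert–Schmidt norm of B(1 - Q). -/
theorem mul_eq_of_trace_mul_eq {τ Q : Matrix I I ℂ} (hτ : τ.PosSemidef) (hQ : IsStarProjection Q)
    (htr : (Q * τ).trace = τ.trace) : Q * τ = τ := by
  obtain ⟨B, rfl⟩ := exists_eq_conjTranspose_mul_self hτ
  have hQs : Qᴴ = Q := hQ.isSelfAdjoint
  have hQ2 : Q * Q = Q := hQ.isIdempotentElem
  have h1 : ((B * (1 - Q))ᴴ * (B * (1 - Q))).trace = 0 := by
    rw [Matrix.conjTranspose_mul, Matrix.conjTranspose_sub, Matrix.conjTranspose_one, hQs,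
      Matrix.mul_assoc, Matrix.trace_mul_comm]
    have h2 : Bᴴ * (B * (1 - Q)) * (1 - Q) = Bᴴ * B - Bᴴ * B * Q := by
      have : (1 - Q) * (1 - Q) = 1 - Q := by
        rw [sub_mul, mul_sub, mul_sub, hQ2]
        simp
      rw [Matrix.mul_assoc, Matrix.mul_assoc, this, ← Matrix.mul_assoc, mul_sub, mul_one]
    rw [h2, Matrix.trace_sub, Matrix.trace_mul_comm _ Q, htr, sub_self]
  rw [Matrix.trace_conjTranspose_mul_self_eq_zero_iff, mul_sub, mul_one, sub_eq_zero] at h1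
  have h3 := congrArg Matrix.conjTranspose h1
  rw [Matrix.conjTranspose_mul, hQs] at h3
  rw [← Matrix.mul_assoc, ← h3]

/-- The projection onto the range of τ works: any competitor fixes τ from the left, hence fixes its
range. -/
theorem exists_isSupportProjection {τ : Matrix I I ℂ} (hτ : τ.PosSemidef) :
    ∃ Q, IsSupportProjection τ Q := by
  set W := LinearMap.range (Matrix.toEuclideanLin τ) with hW
  have hQ := projMatrix_isStarProjection W
  have hQτ : projMatrix W * τ = τ := by
    refine mul_eq_of_range_le hQ.isIdempotentElem ?_
    rw [range_toEuclideanLin_projMatrix]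
  refine ⟨projMatrix W, hQ, by rw [hQτ], fun Q' hQ' htr => ?_⟩
  have h1 := mul_eq_of_trace_mul_eq hτ hQ' htr
  have h2 : Q' * projMatrix W = projMatrix W := by
    refine mul_eq_of_range_le hQ'.isIdempotentElem ?_
    rw [range_toEuclideanLin_projMatrix, hW, ← h1]
    exact range_mul_le _ _
  have hs : (projMatrix W)ᴴ = projMatrix W := hQ.isSelfAdjoint
  have hs' : Q'ᴴ = Q' := hQ'.isSelfAdjoint
  have h3 : projMatrix W * Q' = projMatrix W := by
    have := congrArg Matrix.conjTranspose h2
    rwa [Matrix.conjTranspose_mul, hs, hs'] at this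
  have hi : projMatrix W * projMatrix W = projMatrix W := hQ.isIdempotentElem
  have hi' : Q' * Q' = Q' := hQ'.isIdempotentElem
  refine posSemidef_of_projection ?_ ?_
  · rw [sub_mul, mul_sub, mul_sub, hi, hi', h2, h3]
    simp
  · rw [Matrix.conjTranspose_sub, hs, hs']

end Projections

/-! ### Kraus maps -/

section Kraus

variable {I J : Type*} [Fintype I] [DecidableEq I] [Fintype J] [DecidableEq J]

/-- Maps of the form `X ↦ ∑ₖ Kₖ X Kₖ†`. -/
def IsKraus (S : Matrix I I ℂ →ₗ[ℂ] Matrix I I ℂ) : Prop :=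
  ∃ (N : ℕ) (K : Fin N → Matrix I I ℂ), ∀ X, S X = ∑ k, K k * X * (K k)ᴴ

theorem isKraus_of_fintype {α : Type*} [Fintype α] {S : Matrix I I ℂ →ₗ[ℂ] Matrix I I ℂ}
    (K : α → Matrix I I ℂ) (h : ∀ X, S X = ∑ k, K k * X * (K k)ᴴ) : IsKraus S :=
  ⟨Fintype.card α, fun i => K ((Fintype.equivFin α).symm i), fun X => by
    rw [h X]
    exact (Equiv.sum_comp (Fintype.equivFin α).symm (fun k => K k * X * (K k)ᴴ)).symm⟩

theorem tensorId_complex (S : Matrix I I ℂ →ₗ[ℂ] Matrix I I ℂ) (X : Matrix I I ℂ) :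
    tensorId S X = S X := by
  conv_rhs => rw [Matrix.matrix_eq_sum_single X]
  ext a b
  have h : ∀ c d, Matrix.single c d (X c d) = X c d • Matrix.single c d (1 : ℂ) := fun c d => by
    rw [Matrix.smul_single, smul_eq_mul, mul_one]
  simp only [tensorId, Matrix.of_apply, map_sum, Matrix.sum_apply, h, map_smul, Matrix.smul_apply,
    smul_eq_mul, mul_comm]

/-- Linear functionals of the second system pass through S ⊗ Id. This reduces all claims about an
arbitrary second system to claims about matrices with scalar entries. -/
theorem map_tensorId {M : Type*} [AddCommGroup M] [Module ℂ M]
    (S : Matrix I I ℂ →ₗ[ℂ] Matrix I I ℂ) (φ : M →ₗ[ℂ] ℂ) (X : Matrix I I M) :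
    (tensorId S X).map φ = S (X.map φ) := by
  rw [← tensorId_complex]
  ext a b
  simp [tensorId]

/-- The ampliation of S has the Kraus operators K ⊗ 1, and each conjugation preserves positivity. -/
theorem IsKraus.isCPTP {S : Matrix I I ℂ →ₗ[ℂ] Matrix I I ℂ} (hS : IsKraus S)
    (htr : ∀ X, (S X).trace = X.trace) : IsCPTP S := by
  obtain ⟨N, K, hK⟩ := hS
  refine ⟨fun l X hX => ?_, htr⟩
  have h : Matrix.comp I I (Fin l) (Fin l) ℂ (tensorId S X) =
      ∑ k, (K k ⊗ₖ (1 : Matrix (Fin l) (Fin l) ℂ)) * Matrix.comp I I (Fin l) (Fin l) ℂ X *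
        (K k ⊗ₖ (1 : Matrix (Fin l) (Fin l) ℂ))ᴴ := by
    ext ⟨a, i⟩ ⟨b, j⟩
    have h1 : S (X.map fun Y => Y i j) a b = ∑ k, ∑ d, (∑ c, K k a c * X c d i j) *
        star (K k b d) := by
      rw [hK]
      simp [Matrix.sum_apply, Matrix.mul_apply]
    have h2 := congrFun (congrFun (map_tensorId S
      (Matrix.entryLinearMap ℂ ℂ i j) X) a) b
    have h3 : Matrix.comp I I (Fin l) (Fin l) ℂ (tensorId S X) (a, i) (b, j) =
        S (X.map fun Y => Y i j) a b := h2
    rw [h3, h1, Matrix.sum_apply]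
    refine Finset.sum_congr rfl fun k _ => ?_
    simp only [Matrix.mul_apply, Fintype.sum_prod_type, Matrix.kroneckerMap_apply,
      Matrix.conjTranspose_apply, Matrix.comp_apply, star_mul', Matrix.one_apply]
    refine Finset.sum_congr rfl fun d _ => ?_
    rw [Finset.sum_eq_single j]
    · simp
    · intro j' _ hj'
      simp [hj'.symm]
    · simp
  rw [h]
  exact Matrix.posSemidef_sum _ fun k _ => hX.mul_mul_conjTranspose_same _

end Kraus

/-! ### Twirling over a family of Kraus operators -/

/-- A family of Kraus operators whose twirling map is a trace-preserving unital projection onto the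
commutant of the family. -/
structure TwirlFamily (I 𝒦 : Type*) [Fintype I] [DecidableEq I] [Fintype 𝒦] where
  /-- the operators -/
  K : 𝒦 → Matrix I I ℂ
  /-- the weights -/
  c : 𝒦 → ℝ
  nonneg : ∀ k, 0 ≤ c k
  unital : ∑ k, (c k : ℂ) • (K k * (K k)ᴴ) = 1
  tracePreserving : ∑ k, (c k : ℂ) • ((K k)ᴴ * K k) = 1
  comm : ∀ X k, K k * (∑ l, (c l : ℂ) • (K l * X * (K l)ᴴ)) =
    (∑ l, (c l : ℂ) • (K l * X * (K l)ᴴ)) * K k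
  comm_star : ∀ Z, (∀ k, K k * Z = Z * K k) → ∀ k, (K k)ᴴ * Z = Z * (K k)ᴴ

namespace TwirlFamily

variable {I 𝒦 : Type*} [Fintype I] [DecidableEq I] [Fintype 𝒦] (F : TwirlFamily I 𝒦)

/-- The commutant of the family. -/
def Mem (Z : Matrix I I ℂ) : Prop := ∀ k, F.K k * Z = Z * F.K k

/-- The twirling map. -/
noncomputable def twirl : Matrix I I ℂ →ₗ[ℂ] Matrix I I ℂ where
  toFun X := ∑ k, (F.c k : ℂ) • (F.K k * X * (F.K k)ᴴ)
  map_add' X Y := by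
    simp [mul_add, add_mul, Finset.sum_add_distrib]
  map_smul' z X := by
    simp only [mul_smul_comm, smul_mul_assoc, RingHom.id_apply, Finset.smul_sum]
    exact Finset.sum_congr rfl fun k _ => smul_comm _ _ _

theorem twirl_apply (X : Matrix I I ℂ) :
    F.twirl X = ∑ k, (F.c k : ℂ) • (F.K k * X * (F.K k)ᴴ) := rfl

theorem twirl_mem (X : Matrix I I ℂ) : F.Mem (F.twirl X) := F.comm X

variable {F} in
theorem Mem.twirl_mul {Z : Matrix I I ℂ} (hZ : F.Mem Z) (X : Matrix I I ℂ) :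
    F.twirl (Z * X) = Z * F.twirl X := by
  rw [twirl_apply, twirl_apply, Finset.mul_sum]
  refine Finset.sum_congr rfl fun k _ => ?_
  rw [mul_smul_comm, ← Matrix.mul_assoc, hZ k, Matrix.mul_assoc, Matrix.mul_assoc, Matrix.mul_assoc]

variable {F} in
theorem Mem.mul_twirl {Z : Matrix I I ℂ} (hZ : F.Mem Z) (X : Matrix I I ℂ) :
    F.twirl (X * Z) = F.twirl X * Z := by
  rw [twirl_apply, twirl_apply, Finset.sum_mul]
  refine Finset.sum_congr rfl fun k _ => ?_
  rw [smul_mul_assoc, Matrix.mul_assoc, Matrix.mul_assoc, ← F.comm_star Z hZ k]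
  simp only [Matrix.mul_assoc]

theorem twirl_one : F.twirl 1 = 1 := by
  rw [twirl_apply]
  simpa using F.unital

variable {F} in
theorem Mem.twirl_eq {Z : Matrix I I ℂ} (hZ : F.Mem Z) : F.twirl Z = Z := by
  have := hZ.twirl_mul 1
  rwa [F.twirl_one, mul_one] at this

theorem trace_twirl (X : Matrix I I ℂ) : (F.twirl X).trace = X.trace := by
  have h : (F.twirl X).trace = ((∑ k, (F.c k : ℂ) • ((F.K k)ᴴ * F.K k)) * X).trace := by
    rw [twirl_apply, Finset.sum_mul, Matrix.trace_sum, Matrix.trace_sum]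
    refine Finset.sum_congr rfl fun k _ => ?_
    rw [smul_mul_assoc, Matrix.trace_smul, Matrix.trace_smul, Matrix.trace_mul_comm,
      Matrix.mul_assoc]
  rw [h, F.tracePreserving, one_mul]

theorem sqrt_smul_conj {c : ℝ} (hc : 0 ≤ c) (A X : Matrix I I ℂ) :
    ((Real.sqrt c : ℝ) : ℂ) • A * X * (((Real.sqrt c : ℝ) : ℂ) • A)ᴴ = (c : ℂ) • (A * X * Aᴴ) := by
  rw [Matrix.conjTranspose_smul, smul_mul_assoc, smul_mul_assoc, mul_smul_comm, smul_smul]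
  congr 1
  rw [Complex.star_def, Complex.conj_ofReal, ← Complex.ofReal_mul, Real.mul_self_sqrt hc]

theorem isKraus_twirl : IsKraus F.twirl :=
  isKraus_of_fintype (fun k => ((Real.sqrt (F.c k) : ℝ) : ℂ) • F.K k) fun X => by
    rw [twirl_apply]
    exact Finset.sum_congr rfl fun k _ => (sqrt_smul_conj (F.nonneg k) _ _).symm

theorem conjTranspose_twirl (X : Matrix I I ℂ) : (F.twirl X)ᴴ = F.twirl Xᴴ := by
  simp only [twirl_apply, Matrix.conjTranspose_sum, Matrix.conjTranspose_smul,
    Matrix.conjTranspose_mul, Matrix.conjTranspose_conjTranspose, Matrix.mul_assoc,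
    Complex.star_def, Complex.conj_ofReal]

/-- Minimal projections, one in each simple summand of the algebra generated by the family. -/
structure Blocks (β : Type*) [Fintype β] [DecidableEq β] where
  /-- the minimal projections -/
  e : β → Matrix I I ℂ
  /-- the dimensions of the corresponding irreducible representations -/
  D : β → ℝ
  /-- the compressions of the operators -/
  χ : β → 𝒦 → ℂ
  D_pos : ∀ b, 0 < D b
  idem : ∀ b, e b * e b = e b
  selfAdjoint : ∀ b, (e b)ᴴ = e b
  comm : ∀ b Z, F.Mem Z → e b * Z = Z * e b
  compress : ∀ b k, e b * F.K k * e b = χ b k • e b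
  orth : ∀ b b' k, b ≠ b' → e b * F.K k * e b' = 0
  sum_χ : ∀ b, ∑ k, (F.c k : ℂ) * (χ b k * star (χ b k)) = ((D b : ℝ) : ℂ)⁻¹
  complete : (⨆ b, ⨆ k, LinearMap.range (Matrix.toEuclideanLin (F.K k * e b))) = ⊤

namespace Blocks

variable {F} {β : Type*} [Fintype β] [DecidableEq β] (B : F.Blocks β)

theorem D_ne_zero (b : β) : (B.D b : ℂ) ≠ 0 := by
  exact_mod_cast (B.D_pos b).ne'

/-- The central projection of a block. -/
noncomputable def P (b : β) : Matrix I I ℂ := (B.D b : ℂ) • F.twirl (B.e b)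

theorem P_mem (b : β) : F.Mem (B.P b) := fun k => by
  rw [P, mul_smul_comm, smul_mul_assoc, F.twirl_mem]

theorem P_comm (b : β) {Z : Matrix I I ℂ} (hZ : F.Mem Z) : B.P b * Z = Z * B.P b := by
  rw [P, smul_mul_assoc, mul_smul_comm, ← hZ.mul_twirl, ← hZ.twirl_mul, B.comm b Z hZ]

theorem compress_star (b : β) (k : 𝒦) :
    B.e b * (F.K k)ᴴ * B.e b = star (B.χ b k) • B.e b := by
  have h := congrArg Matrix.conjTranspose (B.compress b k)
  simpa only [Matrix.conjTranspose_mul, Matrix.conjTranspose_smul, B.selfAdjoint,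
    Matrix.mul_assoc] using h

/-- Inside the corner of e_b, every Kraus operator and its adjoint become scalars, and the weighted
sum of |χ|² is 1/D. -/
theorem compress_twirl (b : β) (X : Matrix I I ℂ) :
    B.e b * F.twirl (B.e b * X * B.e b) * B.e b = ((B.D b : ℝ) : ℂ)⁻¹ • (B.e b * X * B.e b) := by
  rw [twirl_apply, Finset.mul_sum, Finset.sum_mul, ← B.sum_χ, Finset.sum_smul]
  refine Finset.sum_congr rfl fun k _ => ?_
  have h : B.e b * (F.K k * (B.e b * X * B.e b) * (F.K k)ᴴ) * B.e b =
      (B.e b * F.K k * B.e b) * X * (B.e b * (F.K k)ᴴ * B.e b) := by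
    simp only [Matrix.mul_assoc]
  rw [mul_smul_comm, smul_mul_assoc, h, B.compress, B.compress_star]
  simp only [smul_mul_assoc, mul_smul_comm, smul_smul]
  congr 1
  ring

/-- The twirl of e_b commutes with e_b, so it may be compressed; by `compress_twirl` it acts on e_b
as 1/D, which is why `P` carries the factor D. -/
theorem P_mul_e (b : β) : B.P b * B.e b = B.e b := by
  have h1 : F.twirl (B.e b) * B.e b = B.e b * F.twirl (B.e b * 1 * B.e b) * B.e b := by
    rw [mul_one, B.idem, B.comm b _ (F.twirl_mem _), Matrix.mul_assoc, B.idem]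
  rw [P, smul_mul_assoc, h1, B.compress_twirl, smul_smul, mul_inv_cancel₀ (B.D_ne_zero b),
    one_smul, mul_one, B.idem]

theorem e_mul_P (b : β) : B.e b * B.P b = B.e b := by
  rw [B.comm b _ (B.P_mem b), B.P_mul_e]

theorem e_mul_P_of_ne {b b' : β} (h : b ≠ b') : B.e b * B.P b' = 0 := by
  have h1 : B.e b * F.twirl (B.e b') = 0 := by
    have h2 : B.e b * F.twirl (B.e b') = B.e b * F.twirl (B.e b') * B.e b := by
      rw [Matrix.mul_assoc, ← B.comm b _ (F.twirl_mem _), ← Matrix.mul_assoc, B.idem]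
    rw [h2, twirl_apply, Finset.mul_sum, Finset.sum_mul]
    refine Finset.sum_eq_zero fun k _ => ?_
    have h3 : B.e b * (F.K k * B.e b' * (F.K k)ᴴ) * B.e b =
        (B.e b * F.K k * B.e b') * (F.K k)ᴴ * B.e b := by
      simp only [Matrix.mul_assoc]
    rw [mul_smul_comm, smul_mul_assoc, h3, B.orth b b' k h]
    simp
  rw [P, mul_smul_comm, h1, smul_zero]

theorem P_mul_self (b : β) : B.P b * B.P b = B.P b := by
  conv_lhs => enter [1]; rw [P]
  rw [smul_mul_assoc, ← (B.P_mem b).mul_twirl, B.e_mul_P]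
  rfl

theorem P_mul_of_ne {b b' : β} (h : b ≠ b') : B.P b * B.P b' = 0 := by
  conv_lhs => enter [1]; rw [P]
  rw [smul_mul_assoc, ← (B.P_mem b').mul_twirl, B.e_mul_P_of_ne h, map_zero, smul_zero]

theorem P_selfAdjoint (b : β) : (B.P b)ᴴ = B.P b := by
  rw [P, Matrix.conjTranspose_smul, F.conjTranspose_twirl, B.selfAdjoint, Complex.star_def,
    Complex.conj_ofReal]

/-- One inclusion is the definition of the twirl. For the other, P_b commutes with every K and fixes
e_b, so it fixes K e_b. -/
theorem range_P (b : β) : LinearMap.range (Matrix.toEuclideanLin (B.P b)) =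
    ⨆ k, LinearMap.range (Matrix.toEuclideanLin (F.K k * B.e b)) := by
  apply le_antisymm
  · rintro _ ⟨v, rfl⟩
    rw [P, twirl_apply, map_smul, map_sum, LinearMap.smul_apply, LinearMap.sum_apply]
    refine Submodule.smul_mem _ _ (Submodule.sum_mem _ fun k _ => ?_)
    rw [map_smul, LinearMap.smul_apply]
    refine Submodule.smul_mem _ _ (Submodule.mem_iSup_of_mem k ?_)
    rw [toEuclideanLin_mul_apply]
    exact LinearMap.mem_range_self _ _
  · refine iSup_le fun k => ?_
    have h : F.K k * B.e b = B.P b * (F.K k * B.e b) := by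
      rw [← Matrix.mul_assoc, ← B.P_mem b k, Matrix.mul_assoc, B.P_mul_e]
    rw [h]
    exact range_mul_le _ _

theorem sum_P : ∑ b, B.P b = 1 := by
  have h0 : LinearMap.range (Matrix.toEuclideanLin (1 : Matrix I I ℂ)) ≤
      LinearMap.range (Matrix.toEuclideanLin (∑ b, B.P b)) := by
    refine le_trans le_top ?_
    rw [← B.complete]
    refine iSup_le fun b => ?_
    rw [← B.range_P]
    have h : B.P b = (∑ b, B.P b) * B.P b := by
      rw [Finset.sum_mul, Finset.sum_eq_single b (fun b' _ h => B.P_mul_of_ne h) (by simp),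
        B.P_mul_self]
    rw [h]
    exact range_mul_le _ _
  have h1 : (∑ b, B.P b) * ∑ b, B.P b = ∑ b, B.P b := by
    rw [Finset.sum_mul_sum]
    refine Finset.sum_congr rfl fun b _ => ?_
    rw [Finset.sum_eq_single b (fun b' _ h => B.P_mul_of_ne h.symm) (by simp), B.P_mul_self]
  have := mul_eq_of_range_le h1 h0
  rwa [mul_one] at this

/-- The pinching identity. -/
theorem eq_sum_P_mul_mul {X : Matrix I I ℂ} (hX : F.Mem X) : X = ∑ b, B.P b * X * B.P b := by
  have h : ∀ b, B.P b * X * B.P b = B.P b * X := fun b => by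
    rw [Matrix.mul_assoc, ← B.P_comm b hX, ← Matrix.mul_assoc, B.P_mul_self]
  rw [Finset.sum_congr rfl fun b _ => h b, ← Finset.sum_mul, B.sum_P, one_mul]

/-- The map discarding the multiplicity of the blocks. -/
noncomputable def reduce : Matrix I I ℂ →ₗ[ℂ] Matrix I I ℂ where
  toFun X := ∑ b, (B.D b : ℂ) • (B.e b * F.twirl X * B.e b)
  map_add' X Y := by
    simp [mul_add, add_mul, Finset.sum_add_distrib]
  map_smul' z X := by
    simp only [map_smul, mul_smul_comm, smul_mul_assoc, RingHom.id_apply, Finset.smul_sum]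
    exact Finset.sum_congr rfl fun k _ => smul_comm _ _ _

theorem reduce_apply (X : Matrix I I ℂ) :
    B.reduce X = ∑ b, (B.D b : ℂ) • (B.e b * F.twirl X * B.e b) := rfl

/-- The averaging can be shifted onto e_b: D tr(e_b 𝓔(X)) = tr(P_b 𝓔(X)), and the P_b sum to 1. -/
theorem trace_reduce (X : Matrix I I ℂ) : (B.reduce X).trace = X.trace := by
  have h : (B.reduce X).trace = ((∑ b, B.P b) * F.twirl X).trace := by
    rw [reduce_apply, Finset.sum_mul, Matrix.trace_sum, Matrix.trace_sum]
    refine Finset.sum_congr rfl fun b _ => ?_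
    rw [Matrix.trace_smul, Matrix.mul_assoc, Matrix.trace_mul_comm, Matrix.mul_assoc, B.idem,
      Matrix.trace_mul_comm, ← F.trace_twirl, (F.twirl_mem X).mul_twirl, P, smul_mul_assoc,
      Matrix.trace_smul]
  rw [h, B.sum_P, one_mul, F.trace_twirl]

theorem isKraus_reduce : IsKraus B.reduce :=
  isKraus_of_fintype (fun a : β × 𝒦 => ((Real.sqrt (B.D a.1) : ℝ) : ℂ) •
      (B.e a.1 * (((Real.sqrt (F.c a.2) : ℝ) : ℂ) • F.K a.2))) fun X => by
    rw [reduce_apply, Fintype.sum_prod_type]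
    refine Finset.sum_congr rfl fun b _ => ?_
    rw [twirl_apply, Finset.mul_sum, Finset.sum_mul, Finset.smul_sum]
    refine Finset.sum_congr rfl fun k _ => ?_
    rw [sqrt_smul_conj (B.D_pos b).le, ← sqrt_smul_conj (F.nonneg k), Matrix.conjTranspose_mul,
      B.selfAdjoint]
    simp only [Matrix.mul_assoc]

theorem reduce_P_mul_mul (b : β) (X : Matrix I I ℂ) :
    B.reduce (B.P b * X * B.P b) = B.P b * B.reduce X * B.P b := by
  rw [reduce_apply, reduce_apply, (B.P_mem b).mul_twirl, (B.P_mem b).twirl_mul, Finset.mul_sum,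
    Finset.sum_mul]
  refine Finset.sum_congr rfl fun b' _ => ?_
  have h := B.comm b' _ (B.P_mem b)
  have h1 : B.e b' * (B.P b * F.twirl X * B.P b) * B.e b' =
      (B.e b' * B.P b) * F.twirl X * (B.P b * B.e b') := by
    simp only [Matrix.mul_assoc]
  have h2 : B.P b * (B.e b' * F.twirl X * B.e b') * B.P b =
      (B.P b * B.e b') * F.twirl X * (B.e b' * B.P b) := by
    simp only [Matrix.mul_assoc]
  rw [mul_smul_comm, smul_mul_assoc, h1, h2, h]

theorem reduce_of_mem {X : Matrix I I ℂ} (hX : F.Mem X) :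
    B.reduce X = ∑ b, (B.D b : ℂ) • (X * B.e b) := by
  rw [reduce_apply]
  refine Finset.sum_congr rfl fun b _ => ?_
  rw [hX.twirl_eq, B.comm b X hX, Matrix.mul_assoc, B.idem]

/-- Each term D X e_b averages to X P_b, so the twirl alone undoes the reduction. -/
theorem twirl_reduce {X : Matrix I I ℂ} (hX : F.Mem X) : F.twirl (B.reduce X) = X := by
  rw [B.reduce_of_mem hX, map_sum]
  have h : ∀ b, F.twirl ((B.D b : ℂ) • (X * B.e b)) = X * B.P b := fun b => by
    rw [map_smul, hX.twirl_mul, P, mul_smul_comm]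
  rw [Finset.sum_congr rfl fun b _ => h b, ← Finset.mul_sum, B.sum_P, mul_one]

/-- Elements of the centre of the commutant act as scalars on the minimal projections. -/
theorem exists_scalar {A : Matrix I I ℂ} (hA : F.Mem A)
    (hc : ∀ Z, F.Mem Z → A * Z = Z * A) (b : β) : ∃ z : ℂ, A * B.e b = z • B.e b := by
  by_cases h0 : B.e b = 0
  · exact ⟨0, by simp [h0]⟩
  -- Every operator of the corner is D times the compression of an element of the commutant. So A,
  -- which commutes with e_b and with the commutant, commutes with the full matrix algebra of the
  -- corner.
  have key : ∀ X, A * (B.e b * X * B.e b) = (B.e b * X * B.e b) * A := by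
    intro X
    have h1 := B.compress_twirl b X
    have h2 : B.e b * X * B.e b = (B.D b : ℂ) •
        (B.e b * F.twirl (B.e b * X * B.e b) * B.e b) := by
      rw [h1, smul_smul, mul_inv_cancel₀ (B.D_ne_zero b), one_smul]
    have h3 := B.comm b A hA
    rw [h2, mul_smul_comm, smul_mul_assoc]
    congr 1
    rw [← Matrix.mul_assoc, ← Matrix.mul_assoc, ← h3, Matrix.mul_assoc (B.e b) A,
      hc _ (F.twirl_mem _), Matrix.mul_assoc (B.e b * _) (B.e b) A, h3]
    simp only [Matrix.mul_assoc]
  obtain ⟨i, j, hij⟩ : ∃ i j, B.e b i j ≠ 0 := by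
    by_contra hcon
    push Not at hcon
    exact h0 (Matrix.ext hcon)
  refine ⟨(B.e b * A) i j / B.e b i j, ?_⟩
  ext x y
  -- On a matrix unit the commutation reads (A e)_{xy} e_{ij} = e_{xy} (e A)_{ij}; with e_{ij} ≠ 0
  -- this displays the scalar.
  have h4 := congrFun (congrFun (key (Matrix.single y i 1)) x) j
  rw [← Matrix.mul_assoc, ← Matrix.mul_assoc, Matrix.mul_assoc _ (B.e b) A] at h4
  have h5 : ∀ M N : Matrix I I ℂ, (M * Matrix.single y i (1 : ℂ) * N) x j = M x y * N i j := by
    intro M N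
    rw [Matrix.mul_assoc, Matrix.mul_apply, Finset.sum_eq_single y]
    · simp
    · intro z _ hz
      rw [Matrix.single_mul_apply_of_ne _ _ _ _ _ hz, mul_zero]
    · simp
  rw [h5, h5] at h4
  rw [Matrix.smul_apply, smul_eq_mul]
  field_simp
  rw [h4]
  ring

theorem e_posSemidef (b : β) : (B.e b).PosSemidef :=
  posSemidef_of_projection (B.idem b) (B.selfAdjoint b)

/-- The bound on the support of a reduced block. -/
theorem exists_support_le {A ρ : Matrix I I ℂ} (hA : F.Mem A) (hc : ∀ Z, F.Mem Z → A * Z = Z * A)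
    (hρ : F.Mem ρ) (hρ0 : ρ.PosSemidef) (b : β) {f : ℝ} (hf : 0 ≤ f)
    (hnonneg : ∀ b, 0 ≤ (B.e b * A).trace)
    (hb : (f : ℂ) * ((B.D b : ℂ) * (B.e b * A).trace) = (B.e b).trace) :
    ∃ Q, IsSupportProjection (B.reduce (B.P b * ρ * B.P b)) Q ∧
      ((f : ℂ) • B.reduce A - Q).PosSemidef := by
  -- Other blocks are annihilated by P_b, and e_b absorbs it.
  have hred : B.reduce (B.P b * ρ * B.P b) = (B.D b : ℂ) • (B.e b * ρ * B.e b) := by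
    have hmem : F.Mem (B.P b * ρ * B.P b) := by
      rw [Matrix.mul_assoc, ← B.P_comm b hρ, ← Matrix.mul_assoc, B.P_mul_self]
      intro k
      rw [← Matrix.mul_assoc, B.P_mem b k, Matrix.mul_assoc, hρ k, Matrix.mul_assoc]
    rw [B.reduce_of_mem hmem, Finset.sum_eq_single b]
    · rw [Matrix.mul_assoc, B.P_mul_e, Matrix.mul_assoc, ← B.comm b ρ hρ, ← Matrix.mul_assoc,
        B.P_mul_e, Matrix.mul_assoc, ← B.comm b ρ hρ, ← Matrix.mul_assoc, B.idem]
    · intro b' _ hne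
      rw [Matrix.mul_assoc, ← B.comm b' _ (B.P_mem b), B.e_mul_P_of_ne hne, mul_zero, smul_zero]
    · simp
  have hpsd : (B.reduce (B.P b * ρ * B.P b)).PosSemidef := by
    rw [hred]
    refine Matrix.PosSemidef.smul ?_ (by exact_mod_cast (B.D_pos b).le)
    have := hρ0.mul_mul_conjTranspose_same (B.e b)
    rwa [B.selfAdjoint] at this
  obtain ⟨Q, hQ⟩ := exists_isSupportProjection hpsd
  refine ⟨Q, hQ, ?_⟩
  have hQe : (B.e b - Q).PosSemidef := by
    refine hQ.2.2 (B.e b) ⟨B.idem b, B.selfAdjoint b⟩ ?_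
    rw [hred, mul_smul_comm, ← Matrix.mul_assoc, ← Matrix.mul_assoc, B.idem]
  choose z hz using B.exists_scalar hA hc
  -- The sign of the scalar follows from the trace. If e_b = 0 the scalar is undetermined and 0 is
  -- taken.
  have hz0 : ∀ b, ∃ w : ℂ, 0 ≤ w ∧ A * B.e b = w • B.e b := by
    intro b
    have h1 : (B.e b * A).trace = z b * (B.e b).trace := by
      rw [B.comm b A hA, hz b, Matrix.trace_smul, smul_eq_mul]
    have h2 := hnonneg b
    rcases (B.e_posSemidef b).trace_nonneg.eq_or_lt with h3 | h3
    · have h4 : B.e b = 0 := (B.e_posSemidef b).trace_eq_zero_iff.1 h3.symm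
      exact ⟨0, le_rfl, by simp [h4]⟩
    · refine ⟨z b, ?_, hz b⟩
      rw [h1] at h2
      by_contra hneg
      have h5 : z b = (z b * (B.e b).trace) * (B.e b).trace⁻¹ := by
        rw [mul_assoc, mul_inv_cancel₀ h3.ne', mul_one]
      apply hneg
      rw [h5]
      have h6 : 0 ≤ (B.e b).trace⁻¹ := by
        obtain ⟨h7, h8⟩ := Complex.pos_iff.1 h3
        have h9 : (B.e b).trace = (((B.e b).trace.re : ℝ) : ℂ) := by
          apply Complex.ext <;> simp [← h8]
        rw [h9, ← Complex.ofReal_inv]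
        exact_mod_cast (inv_pos.2 h7).le
      exact mul_nonneg h2 h6
  choose w hw0 hw using hz0
  -- The coefficient of e_b becomes 1 by the normalisation `hb`, unless e_b = 0; the other blocks
  -- have nonnegative coefficients and only help.
  have hexp : (f : ℂ) • B.reduce A - Q =
      (∑ b' ∈ Finset.univ.erase b, ((f : ℂ) * ((B.D b' : ℂ) * w b')) • B.e b') + (B.e b - Q) := by
    have h1 : (f : ℂ) • B.reduce A = ∑ b', ((f : ℂ) * ((B.D b' : ℂ) * w b')) • B.e b' := by
      rw [B.reduce_of_mem hA, Finset.smul_sum]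
      refine Finset.sum_congr rfl fun b' _ => ?_
      rw [hw b', smul_smul, smul_smul, mul_assoc]
    have h2 : ((f : ℂ) * ((B.D b : ℂ) * w b)) • B.e b = B.e b := by
      by_cases he : (B.e b).trace = 0
      · rw [(B.e_posSemidef b).trace_eq_zero_iff.1 he, smul_zero]
      · have h3 : (B.e b * A).trace = w b * (B.e b).trace := by
          rw [B.comm b A hA, hw b, Matrix.trace_smul, smul_eq_mul]
        rw [h3] at hb
        have h4 : (f : ℂ) * ((B.D b : ℂ) * w b) = 1 := by
          apply mul_right_cancel₀ he
          rw [one_mul, mul_assoc, mul_assoc]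
          exact hb
        rw [h4, one_smul]
    rw [h1, ← Finset.add_sum_erase _ _ (Finset.mem_univ b), h2]
    abel
  rw [hexp]
  refine Matrix.PosSemidef.add (Matrix.posSemidef_sum _ fun b' _ => ?_) hQe
  refine (B.e_posSemidef b').smul ?_
  exact mul_nonneg (by exact_mod_cast hf)
    (mul_nonneg (by exact_mod_cast (B.D_pos b').le) (hw0 b'))

end Blocks

end TwirlFamily

/-! ### Tensor products of matrices -/

section Tensor

variable {ι κ κ' κ'' : Type*} [Fintype ι] [DecidableEq ι] [Fintype κ] [DecidableEq κ] [Fintype κ']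
  [DecidableEq κ']

theorem tensorMatrix_apply (A : ι → Matrix κ κ' ℂ) (x : ι → κ) (y : ι → κ') :
    tensorMatrix A x y = ∏ p, A p (x p) (y p) := rfl

theorem tensorMatrix_mul (A : ι → Matrix κ κ' ℂ) (B : ι → Matrix κ' κ'' ℂ) :
    (tensorMatrix A * tensorMatrix B : Matrix (ι → κ) (ι → κ'') ℂ) =
      tensorMatrix fun p => A p * B p := by
  ext x y
  simp only [Matrix.mul_apply, tensorMatrix_apply, Finset.prod_univ_sum, Fintype.piFinset_univ,
    Finset.prod_mul_distrib]

theorem tensorMatrix_conjTranspose (A : ι → Matrix κ κ' ℂ) :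
    (tensorMatrix A)ᴴ = tensorMatrix fun p => (A p)ᴴ := by
  ext x y
  simp [tensorMatrix_apply]

theorem tensorMatrix_one : tensorMatrix (fun _ : ι => (1 : Matrix κ κ ℂ)) = 1 := by
  ext x y
  rw [tensorMatrix_apply]
  by_cases h : x = y
  · subst h
    simp
  · obtain ⟨p, hp⟩ := Function.ne_iff.1 h
    rw [Matrix.one_apply_ne h, Finset.prod_eq_zero (Finset.mem_univ p)]
    exact Matrix.one_apply_ne hp

theorem tensorMatrix_smul (c : ι → ℂ) (A : ι → Matrix κ κ' ℂ) :
    tensorMatrix (fun p => c p • A p) = (∏ p, c p) • tensorMatrix A := by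
  ext x y
  simp [tensorMatrix_apply, Finset.prod_mul_distrib]

theorem tensorMatrix_sum {α : Type*} [Fintype α] (A : ι → α → Matrix κ κ' ℂ) :
    tensorMatrix (fun p => ∑ a, A p a) = ∑ f : ι → α, tensorMatrix fun p => A p (f p) := by
  ext x y
  simp only [tensorMatrix_apply, Matrix.sum_apply, Finset.prod_univ_sum, Fintype.piFinset_univ]

theorem tensorMatrix_single (x : ι → κ) (y : ι → κ') :
    tensorMatrix (fun p => Matrix.single (x p) (y p) (1 : ℂ)) = Matrix.single x y 1 := by
  ext a b
  rw [tensorMatrix_apply]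
  by_cases h : x = a ∧ y = b
  · simp [h.1, h.2]
  · rw [Matrix.single_apply, if_neg h]
    have : ∃ p, ¬ (x p = a p ∧ y p = b p) := by
      by_contra hcon
      push Not at hcon
      exact h ⟨funext fun p => (hcon p).1, funext fun p => (hcon p).2⟩
    obtain ⟨p, hp⟩ := this
    exact Finset.prod_eq_zero (Finset.mem_univ p) (by rw [Matrix.single_apply, if_neg hp])

theorem permOp_mul_tensorMatrix (σ : Equiv.Perm ι) (A : ι → Matrix κ κ ℂ) :
    permOp ι κ σ * tensorMatrix A = tensorMatrix (fun p => A (σ.symm p)) * permOp ι κ σ := by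
  ext x y
  rw [permOp_mul_apply, mul_permOp_apply, tensorMatrix_apply, tensorMatrix_apply]
  conv_rhs => rw [← Equiv.prod_comp σ]
  simp

theorem permOp_mul_tensorMatrix_const (σ : Equiv.Perm ι) (A : Matrix κ κ' ℂ) :
    permOp ι κ σ * tensorMatrix (fun _ : ι => A) =
      tensorMatrix (fun _ : ι => A) * permOp ι κ' σ := by
  ext x y
  simp only [permOp, MonoidHom.coe_mk, OneHom.coe_mk, Matrix.mul_apply, Matrix.of_apply,
    ite_mul, one_mul, zero_mul, mul_ite, mul_one, mul_zero]
  rw [Finset.sum_eq_single (x ∘ σ), Finset.sum_eq_single (y ∘ σ.symm), if_pos, if_pos rfl,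
    tensorMatrix_apply, tensorMatrix_apply]
  · conv_rhs => rw [← Equiv.prod_comp σ]
    simp
  · funext p; simp
  · exact fun z _ hz => if_neg hz
  · simp
  · intro z _ hz
    refine if_neg fun h => hz ?_
    rw [h]
    funext p
    simp
  · simp

/-- The tensor product of matrices of different sizes. -/
def piTensor {ι : Type*} [Fintype ι] {κ κ' : ι → Type*} (A : ∀ j, Matrix (κ j) (κ' j) ℂ) :
    Matrix (∀ j, κ j) (∀ j, κ' j) ℂ :=
  Matrix.of fun x y => ∏ j, A j (x j) (y j)

/-! ### Tensor products of factors of different sizes -/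

section Pi

variable {μ μ' μ'' : ι → Type*} [∀ j, Fintype (μ j)] [∀ j, DecidableEq (μ j)]
  [∀ j, Fintype (μ' j)]

theorem piTensor_apply (A : ∀ j, Matrix (μ j) (μ' j) ℂ) (x : ∀ j, μ j) (y : ∀ j, μ' j) :
    piTensor A x y = ∏ j, A j (x j) (y j) := rfl

theorem piTensor_mul (A : ∀ j, Matrix (μ j) (μ' j) ℂ) (B : ∀ j, Matrix (μ' j) (μ'' j) ℂ) :
    (piTensor A * piTensor B : Matrix (∀ j, μ j) (∀ j, μ'' j) ℂ) = piTensor fun j => A j * B j := by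
  ext x y
  simp only [Matrix.mul_apply, piTensor_apply, Finset.prod_univ_sum, Fintype.piFinset_univ,
    Finset.prod_mul_distrib]

theorem piTensor_conjTranspose (A : ∀ j, Matrix (μ j) (μ' j) ℂ) :
    (piTensor A)ᴴ = piTensor fun j => (A j)ᴴ := by
  ext x y
  simp [piTensor_apply]

theorem piTensor_smul (c : ι → ℂ) (A : ∀ j, Matrix (μ j) (μ' j) ℂ) :
    piTensor (fun j => c j • A j) = (∏ j, c j) • piTensor A := by
  ext x y
  simp [piTensor_apply, Finset.prod_mul_distrib]

theorem piTensor_sum {α : ι → Type*} [∀ j, Fintype (α j)] (A : ∀ j, α j → Matrix (μ j) (μ' j) ℂ) :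
    piTensor (fun j => ∑ a, A j a) = ∑ f : ∀ j, α j, piTensor fun j => A j (f j) := by
  ext x y
  simp only [piTensor_apply, Matrix.sum_apply, Finset.prod_univ_sum, Fintype.piFinset_univ]

theorem piTensor_eq_zero {A : ∀ j, Matrix (μ j) (μ' j) ℂ} {j : ι} (h : A j = 0) :
    piTensor A = 0 := by
  ext x y
  rw [piTensor_apply, Finset.prod_eq_zero (Finset.mem_univ j)] <;> simp [h]

theorem trace_piTensor (A : ∀ j, Matrix (μ j) (μ j) ℂ) :
    (piTensor A).trace = ∏ j, (A j).trace := by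
  simp only [Matrix.trace, Matrix.diag_apply, piTensor_apply, Finset.prod_univ_sum,
    Fintype.piFinset_univ]

end Pi

end Tensor

/-! ### The local matrix units and their twirling family -/

section Site

variable {k : ℕ} {r deg : Fin k → ℕ}

/-- The basis of `⨁_j ℂ^{r_j} ⊗ ℂ^{d_j}`. -/
abbrev Site (r deg : Fin k → ℕ) : Type := Σ j, Fin (r j) × Fin (deg j)

/-- The labels of the matrix units of `⨁_j M_{r_j}`. -/
abbrev UnitLabel (r : Fin k → ℕ) : Type := Σ j, Fin (r j) × Fin (r j)

/-- The matrix unit `|a⟩⟨b| ⊗ 1` of the `j`-th summand. -/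
noncomputable def siteUnit (deg : Fin k → ℕ) (f : UnitLabel r) :
    Matrix (Site r deg) (Site r deg) ℂ :=
  ∑ s : Fin (deg f.1), Matrix.single ⟨f.1, f.2.1, s⟩ ⟨f.1, f.2.2, s⟩ 1

theorem siteUnit_conjTranspose (j : Fin k) (a b : Fin (r j)) :
    (siteUnit deg ⟨j, a, b⟩)ᴴ = siteUnit deg ⟨j, b, a⟩ := by
  simp [siteUnit, Matrix.conjTranspose_sum]

theorem siteUnit_mul (j : Fin k) (a b c : Fin (r j)) :
    siteUnit deg ⟨j, a, b⟩ * siteUnit deg ⟨j, b, c⟩ = siteUnit deg ⟨j, a, c⟩ := by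
  simp only [siteUnit, Finset.sum_mul_sum]
  refine Finset.sum_congr rfl fun s _ => ?_
  rw [Finset.sum_eq_single s]
  · simp
  · intro t _ ht
    rw [Matrix.single_mul_single_of_ne]
    simpa using ht.symm
  · simp

theorem siteUnit_mul_of_ne {f g : UnitLabel r}
    (h : (⟨f.1, f.2.2⟩ : Σ j, Fin (r j)) ≠ ⟨g.1, g.2.1⟩) :
    siteUnit deg f * siteUnit deg g = 0 := by
  simp only [siteUnit, Finset.sum_mul_sum]
  refine Finset.sum_eq_zero fun s _ => Finset.sum_eq_zero fun t _ => ?_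
  rw [Matrix.single_mul_single_of_ne]
  intro heq
  apply h
  have := congrArg (fun x : Site r deg => (⟨x.1, x.2.1⟩ : Σ j, Fin (r j))) heq
  simpa using this

theorem siteUnit_apply_of_ne_zero {f : UnitLabel r} {x y : Site r deg}
    (h : siteUnit deg f x y ≠ 0) : ∃ s, x = ⟨f.1, f.2.1, s⟩ ∧ y = ⟨f.1, f.2.2, s⟩ := by
  rw [siteUnit, Matrix.sum_apply] at h
  obtain ⟨s, _, hs⟩ := Finset.exists_ne_zero_of_sum_ne_zero h
  refine ⟨s, ?_⟩
  by_contra hcon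
  refine hs (Matrix.single_apply_of_ne _ _ _ _ _ ?_)
  rintro ⟨h1, h2⟩
  exact hcon ⟨h1.symm, h2.symm⟩

theorem siteUnit_apply (j : Fin k) (a b : Fin (r j)) (s t : Fin (deg j)) :
    siteUnit deg ⟨j, a, b⟩ ⟨j, a, s⟩ ⟨j, b, t⟩ = if s = t then 1 else 0 := by
  rw [siteUnit, Matrix.sum_apply, Finset.sum_eq_single s]
  · simp [Matrix.single_apply]
  · intro u _ hu
    rw [Matrix.single_apply, if_neg]
    rintro ⟨h1, -⟩
    simp at h1
    exact hu h1
  · simp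

theorem sum_siteUnit_diag : ∑ q : Σ j, Fin (r j), siteUnit deg ⟨q.1, q.2, q.2⟩ = 1 := by
  rw [← Matrix.sum_single_one]
  simp only [siteUnit, Fintype.sum_sigma, Fintype.sum_prod_type]

/-- The weight of a matrix unit. -/
noncomputable def unitWeight (f : UnitLabel r) : ℝ := ((r f.1 : ℝ))⁻¹

theorem sum_unitLabel {M : Type*} [AddCommMonoid M] (g : UnitLabel r → M) :
    ∑ f, g f = ∑ j, ∑ a, ∑ b, g ⟨j, a, b⟩ := by
  simp only [Fintype.sum_sigma, Fintype.sum_prod_type]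

/-- For fixed j and a, the r_j units |a⟩⟨b| all give the same projection |a⟩⟨a| ⊗ 1, which explains
the weight 1/r_j. -/
theorem sum_smul_siteUnit_mul_conj :
    ∑ f : UnitLabel r, ((unitWeight f : ℝ) : ℂ) • (siteUnit deg f * (siteUnit deg f)ᴴ) = 1 := by
  rw [sum_unitLabel, ← sum_siteUnit_diag, Fintype.sum_sigma]
  refine Finset.sum_congr rfl fun j _ => Finset.sum_congr rfl fun a _ => ?_
  have hr : (r j : ℂ) ≠ 0 := by exact_mod_cast (Fin.pos a).ne'
  simp only [siteUnit_conjTranspose, siteUnit_mul, unitWeight, Finset.sum_const, Finset.card_univ,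
    Fintype.card_fin]
  rw [← Nat.cast_smul_eq_nsmul ℂ, smul_smul]
  push_cast
  rw [mul_inv_cancel₀ hr, one_smul]

theorem sum_smul_conj_mul_siteUnit :
    ∑ f : UnitLabel r, ((unitWeight f : ℝ) : ℂ) • ((siteUnit deg f)ᴴ * siteUnit deg f) = 1 := by
  rw [← sum_smul_siteUnit_mul_conj (r := r), sum_unitLabel, sum_unitLabel]
  refine Finset.sum_congr rfl fun j _ => ?_
  rw [Finset.sum_comm]
  simp only [siteUnit_conjTranspose, siteUnit_mul, unitWeight]

/-- Averaging over the matrix units of one site. -/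
noncomputable def siteTwirl (X : Matrix (Site r deg) (Site r deg) ℂ) :
    Matrix (Site r deg) (Site r deg) ℂ :=
  ∑ f : UnitLabel r, ((unitWeight f : ℝ) : ℂ) • (siteUnit deg f * X * (siteUnit deg f)ᴴ)

/-- Multiplication by |a⟩⟨b| from either side leaves the same expression, the average over c of
|a⟩⟨c| X |c⟩⟨b|. -/
theorem siteUnit_mul_siteTwirl (g : UnitLabel r) (X : Matrix (Site r deg) (Site r deg) ℂ) :
    siteUnit deg g * siteTwirl X = siteTwirl X * siteUnit deg g := by
  obtain ⟨j, a, b⟩ := g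
  have hl : siteUnit deg ⟨j, a, b⟩ * siteTwirl X =
      ∑ c, ((r j : ℂ))⁻¹ • (siteUnit deg ⟨j, a, c⟩ * X * siteUnit deg ⟨j, c, b⟩) := by
    rw [siteTwirl, sum_unitLabel, Finset.mul_sum, Finset.sum_eq_single j]
    · rw [Finset.mul_sum, Finset.sum_eq_single b]
      · rw [Finset.mul_sum]
        refine Finset.sum_congr rfl fun c _ => ?_
        rw [mul_smul_comm, ← Matrix.mul_assoc, ← Matrix.mul_assoc, siteUnit_mul,
          siteUnit_conjTranspose, unitWeight]
        push_cast
        rfl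
      · intro b' _ hb'
        rw [Finset.mul_sum]
        refine Finset.sum_eq_zero fun c _ => ?_
        rw [mul_smul_comm, ← Matrix.mul_assoc, ← Matrix.mul_assoc, siteUnit_mul_of_ne, zero_mul,
          zero_mul, smul_zero]
        simpa using hb'.symm
      · simp
    · intro j' _ hj'
      rw [Finset.mul_sum]
      refine Finset.sum_eq_zero fun c _ => ?_
      rw [Finset.mul_sum]
      refine Finset.sum_eq_zero fun d _ => ?_
      rw [mul_smul_comm, ← Matrix.mul_assoc, ← Matrix.mul_assoc, siteUnit_mul_of_ne, zero_mul,
        zero_mul, smul_zero]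
      intro h
      exact hj' (congrArg Sigma.fst h).symm
    · simp
  have hr : siteTwirl X * siteUnit deg ⟨j, a, b⟩ =
      ∑ c, ((r j : ℂ))⁻¹ • (siteUnit deg ⟨j, a, c⟩ * X * siteUnit deg ⟨j, c, b⟩) := by
    rw [siteTwirl, sum_unitLabel, Finset.sum_mul, Finset.sum_eq_single j]
    · rw [Finset.sum_mul, Finset.sum_eq_single a]
      · rw [Finset.sum_mul]
        refine Finset.sum_congr rfl fun c _ => ?_
        rw [smul_mul_assoc, Matrix.mul_assoc, siteUnit_conjTranspose, siteUnit_mul, unitWeight]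
        push_cast
        rfl
      · intro b' _ hb'
        rw [Finset.sum_mul]
        refine Finset.sum_eq_zero fun c _ => ?_
        rw [smul_mul_assoc, Matrix.mul_assoc, siteUnit_conjTranspose, siteUnit_mul_of_ne, mul_zero,
          smul_zero]
        simpa using hb'
      · simp
    · intro j' _ hj'
      rw [Finset.sum_mul]
      refine Finset.sum_eq_zero fun c _ => ?_
      rw [Finset.sum_mul]
      refine Finset.sum_eq_zero fun d _ => ?_
      rw [smul_mul_assoc, Matrix.mul_assoc, siteUnit_conjTranspose, siteUnit_mul_of_ne, mul_zero,
        smul_zero]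
      intro h
      exact hj' (congrArg Sigma.fst h)
    · simp
  rw [hl, hr]

variable {n : ℕ}

/-- The tensor product of matrix units. -/
noncomputable def unitTensor (deg : Fin k → ℕ) (f : Fin n → UnitLabel r) :
    Matrix (Fin n → Site r deg) (Fin n → Site r deg) ℂ :=
  tensorMatrix fun p => siteUnit deg (f p)

/-- The product of the weights of the matrix units. -/
noncomputable def tensorWeight (f : Fin n → UnitLabel r) : ℝ := ∏ p, unitWeight (f p)

/-- The label of the adjoint matrix unit. -/
def UnitLabel.swap (f : UnitLabel r) : UnitLabel r := ⟨f.1, f.2.2, f.2.1⟩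

theorem unitTensor_conjTranspose (f : Fin n → UnitLabel r) :
    (unitTensor deg f)ᴴ = unitTensor deg fun p => (f p).swap := by
  rw [unitTensor, tensorMatrix_conjTranspose]
  exact congrArg tensorMatrix (funext fun p => siteUnit_conjTranspose _ _ _)

theorem permOp_mul_unitTensor (σ : Equiv.Perm (Fin n)) (f : Fin n → UnitLabel r) :
    permOp (Fin n) (Site r deg) σ * unitTensor deg f =
      unitTensor deg (fun p => f (σ.symm p)) * permOp (Fin n) (Site r deg) σ :=
  permOp_mul_tensorMatrix σ _

/-- Averaging over the matrix units of all sites. -/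
noncomputable def tensorTwirl (X : Matrix (Fin n → Site r deg) (Fin n → Site r deg) ℂ) :
    Matrix (Fin n → Site r deg) (Fin n → Site r deg) ℂ :=
  ∑ f : Fin n → UnitLabel r,
    ((tensorWeight f : ℝ) : ℂ) • (unitTensor deg f * X * (unitTensor deg f)ᴴ)

/-- On product operators the average factorises over the systems; by linearity this reduces its
properties to a single system. -/
theorem tensorTwirl_single (x y : Fin n → Site r deg) : tensorTwirl (Matrix.single x y 1) =
    tensorMatrix fun p => siteTwirl (Matrix.single (x p) (y p) (1 : ℂ)) := by
  simp only [siteTwirl, tensorMatrix_sum, tensorTwirl]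
  refine Finset.sum_congr rfl fun f _ => ?_
  rw [tensorMatrix_smul, unitTensor, tensorMatrix_conjTranspose, ← tensorMatrix_single,
    tensorMatrix_mul, tensorMatrix_mul, tensorWeight]
  push_cast
  rfl

theorem tensorTwirl_eq_sum (X : Matrix (Fin n → Site r deg) (Fin n → Site r deg) ℂ) :
    tensorTwirl X = ∑ x, ∑ y, X x y • tensorTwirl (Matrix.single x y 1) := by
  conv_lhs => rw [Matrix.matrix_eq_sum_single X]
  simp only [tensorTwirl, Finset.smul_sum, Finset.mul_sum, Finset.sum_mul]
  rw [Finset.sum_comm]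
  refine Finset.sum_congr rfl fun x _ => ?_
  rw [Finset.sum_comm]
  refine Finset.sum_congr rfl fun y _ => Finset.sum_congr rfl fun f _ => ?_
  have h : Matrix.single x y (X x y) = X x y • Matrix.single x y (1 : ℂ) := by
    rw [Matrix.smul_single, smul_eq_mul, mul_one]
  rw [h, mul_smul_comm, smul_mul_assoc, smul_comm]

theorem unitTensor_mul_tensorTwirl (g : Fin n → UnitLabel r)
    (X : Matrix (Fin n → Site r deg) (Fin n → Site r deg) ℂ) :
    unitTensor deg g * tensorTwirl X = tensorTwirl X * unitTensor deg g := by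
  rw [tensorTwirl_eq_sum, Finset.mul_sum, Finset.sum_mul]
  refine Finset.sum_congr rfl fun x _ => ?_
  rw [Finset.mul_sum, Finset.sum_mul]
  refine Finset.sum_congr rfl fun y _ => ?_
  rw [mul_smul_comm, smul_mul_assoc, tensorTwirl_single, unitTensor, tensorMatrix_mul,
    tensorMatrix_mul]
  congr 2
  funext p
  exact siteUnit_mul_siteTwirl _ _

theorem sum_smul_unitTensor_mul_conj : ∑ f : Fin n → UnitLabel r,
    ((tensorWeight f : ℝ) : ℂ) • (unitTensor deg f * (unitTensor deg f)ᴴ) = 1 := by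
  rw [← tensorMatrix_one]
  simp only [← sum_smul_siteUnit_mul_conj (r := r) (deg := deg), tensorMatrix_sum]
  refine Finset.sum_congr rfl fun f _ => ?_
  rw [tensorMatrix_smul, unitTensor, tensorMatrix_conjTranspose, tensorMatrix_mul, tensorWeight]
  push_cast
  rfl

theorem sum_smul_conj_mul_unitTensor : ∑ f : Fin n → UnitLabel r,
    ((tensorWeight f : ℝ) : ℂ) • ((unitTensor deg f)ᴴ * unitTensor deg f) = 1 := by
  rw [← tensorMatrix_one]
  simp only [← sum_smul_conj_mul_siteUnit (r := r) (deg := deg), tensorMatrix_sum]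
  refine Finset.sum_congr rfl fun f _ => ?_
  rw [tensorMatrix_smul, unitTensor, tensorMatrix_conjTranspose, tensorMatrix_mul, tensorWeight]
  push_cast
  rfl

theorem sum_unitTensor_diag :
    ∑ q : Fin n → Σ j, Fin (r j), unitTensor deg (fun p => ⟨(q p).1, (q p).2, (q p).2⟩) = 1 := by
  rw [← tensorMatrix_one]
  simp only [← sum_siteUnit_diag (r := r) (deg := deg), tensorMatrix_sum]
  rfl

/-- The operators `V_σ (⨂ matrix units)`. -/
noncomputable def twirlOp (deg : Fin k → ℕ) (a : Equiv.Perm (Fin n) × (Fin n → UnitLabel r)) :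
    Matrix (Fin n → Site r deg) (Fin n → Site r deg) ℂ :=
  permOp (Fin n) (Site r deg) a.1 * unitTensor deg a.2

/-- The weight of `V_σ (⨂ matrix units)`. -/
noncomputable def twirlWeight (a : Equiv.Perm (Fin n) × (Fin n → UnitLabel r)) : ℝ :=
  ((n.factorial : ℝ))⁻¹ * tensorWeight a.2

/-- The diagonal unit tensors resolve the identity, so V_σ is a sum of the operators V_σ (⨂ units);
the unit tensors themselves occur with σ = 1. -/
theorem twirlOp_comm_iff (Z : Matrix (Fin n → Site r deg) (Fin n → Site r deg) ℂ) :
    (∀ a : Equiv.Perm (Fin n) × (Fin n → UnitLabel r), twirlOp deg a * Z = Z * twirlOp deg a) ↔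
      (∀ σ, permOp (Fin n) (Site r deg) σ * Z = Z * permOp (Fin n) (Site r deg) σ) ∧
        ∀ f : Fin n → UnitLabel r, unitTensor deg f * Z = Z * unitTensor deg f := by
  constructor
  · intro h
    constructor
    · intro σ
      have h1 : permOp (Fin n) (Site r deg) σ =
          ∑ q : Fin n → Σ j, Fin (r j), twirlOp deg (σ, fun p => ⟨(q p).1, (q p).2, (q p).2⟩) := by
        simp only [twirlOp]
        rw [← Finset.mul_sum, sum_unitTensor_diag, mul_one]
      rw [h1, Finset.sum_mul, Finset.mul_sum]
      exact Finset.sum_congr rfl fun q _ => h _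
    · intro f
      have h1 := h (1, f)
      simpa [twirlOp] using h1
  · rintro ⟨h1, h2⟩ a
    rw [twirlOp, Matrix.mul_assoc, h2, ← Matrix.mul_assoc, h1, Matrix.mul_assoc]

theorem sum_twirlOp (X : Matrix (Fin n → Site r deg) (Fin n → Site r deg) ℂ) :
    ∑ a : Equiv.Perm (Fin n) × (Fin n → UnitLabel r),
        ((twirlWeight a : ℝ) : ℂ) • (twirlOp deg a * X * (twirlOp deg a)ᴴ) =
      ((n.factorial : ℂ))⁻¹ • ∑ σ, permOp (Fin n) (Site r deg) σ * tensorTwirl X *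
        (permOp (Fin n) (Site r deg) σ)ᴴ := by
  rw [Fintype.sum_prod_type, Finset.smul_sum]
  refine Finset.sum_congr rfl fun σ _ => ?_
  rw [tensorTwirl, Finset.mul_sum, Finset.sum_mul, Finset.smul_sum]
  refine Finset.sum_congr rfl fun f _ => ?_
  rw [mul_smul_comm, smul_mul_assoc, smul_smul, twirlWeight, twirlOp, Matrix.conjTranspose_mul]
  push_cast
  simp only [Matrix.mul_assoc]

/-- The twirling family generated by the permutations and the local matrix units. -/
noncomputable def localFamily (n : ℕ) (r deg : Fin k → ℕ) :
    TwirlFamily (Fin n → Site r deg) (Equiv.Perm (Fin n) × (Fin n → UnitLabel r)) where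
  K := twirlOp deg
  c := twirlWeight
  nonneg a := mul_nonneg (by positivity)
    (Finset.prod_nonneg fun p _ => inv_nonneg.2 (Nat.cast_nonneg _))
  unital := by
    have h := sum_twirlOp (n := n) (r := r) (deg := deg) 1
    simp only [mul_one] at h
    rw [h]
    have h1 : tensorTwirl (1 : Matrix (Fin n → Site r deg) (Fin n → Site r deg) ℂ) = 1 := by
      simpa [tensorTwirl] using sum_smul_unitTensor_mul_conj (n := n) (r := r) (deg := deg)
    have hn : (n.factorial : ℂ) ≠ 0 := by exact_mod_cast n.factorial_ne_zero
    simp [h1, permOp_conjTranspose, permOp_mul_permOp_inv, Fintype.card_perm,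
      ← Nat.cast_smul_eq_nsmul ℂ, smul_smul, hn]
  tracePreserving := by
    have hn : (n.factorial : ℂ) ≠ 0 := by exact_mod_cast n.factorial_ne_zero
    have h : ∀ a : Equiv.Perm (Fin n) × (Fin n → UnitLabel r),
        ((twirlWeight a : ℝ) : ℂ) • ((twirlOp deg a)ᴴ * twirlOp deg a) = ((n.factorial : ℂ))⁻¹ •
          (((tensorWeight a.2 : ℝ) : ℂ) • ((unitTensor deg a.2)ᴴ * unitTensor deg a.2)) := by
      intro a
      rw [twirlOp, Matrix.conjTranspose_mul, permOp_conjTranspose, Matrix.mul_assoc,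
        ← Matrix.mul_assoc (permOp _ _ _) (permOp _ _ _), permOp_inv_mul_permOp, one_mul,
        smul_smul, twirlWeight]
      push_cast
      rfl
    rw [Finset.sum_congr rfl fun a _ => h a, ← Finset.smul_sum, Fintype.sum_prod_type]
    simp only [sum_smul_conj_mul_unitTensor]
    simp [Fintype.card_perm, ← Nat.cast_smul_eq_nsmul ℂ, smul_smul, hn]
  -- V_τ only shifts the sum over σ. A unit tensor moved past V_σ becomes another unit tensor, which
  -- commutes with the inner average.
  comm X := by
    rw [twirlOp_comm_iff, sum_twirlOp]
    constructor
    · intro τ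
      rw [mul_smul_comm, smul_mul_assoc, Finset.mul_sum, Finset.sum_mul,
        ← Equiv.sum_comp (Equiv.mulLeft τ)
          (fun σ => permOp (Fin n) (Site r deg) σ * tensorTwirl X *
            (permOp (Fin n) (Site r deg) σ)ᴴ * permOp (Fin n) (Site r deg) τ)]
      congr 1
      refine Finset.sum_congr rfl fun σ _ => ?_
      simp only [Equiv.coe_mulLeft, permOp_conjTranspose, Matrix.mul_assoc, ← map_mul, mul_inv_rev,
        inv_mul_cancel_right]
      rw [← Matrix.mul_assoc, ← map_mul]
    · intro f
      rw [mul_smul_comm, smul_mul_assoc, Finset.mul_sum, Finset.sum_mul]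
      congr 1
      refine Finset.sum_congr rfl fun σ _ => ?_
      have h1 := permOp_mul_unitTensor (deg := deg) σ (fun p => f (σ p))
      simp only [Equiv.apply_symm_apply] at h1
      have h2 := permOp_mul_unitTensor (deg := deg) σ⁻¹ f
      have h3 : (fun p => f ((σ⁻¹).symm p)) = fun p => f (σ p) := rfl
      rw [h3] at h2
      rw [← Matrix.mul_assoc, ← Matrix.mul_assoc, ← h1, Matrix.mul_assoc _ (unitTensor _ _),
        unitTensor_mul_tensorTwirl, permOp_conjTranspose, Matrix.mul_assoc _ _ (unitTensor deg f),
        h2]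
      simp only [Matrix.mul_assoc]
  comm_star Z hZ a := by
    rw [twirlOp_comm_iff] at hZ
    rw [twirlOp, Matrix.conjTranspose_mul, permOp_conjTranspose, unitTensor_conjTranspose,
      Matrix.mul_assoc, hZ.1, ← Matrix.mul_assoc, hZ.2, Matrix.mul_assoc]

theorem localFamily_mem_iff (Z : Matrix (Fin n → Site r deg) (Fin n → Site r deg) ℂ) :
    (localFamily n r deg).Mem Z ↔
      (∀ σ, permOp (Fin n) (Site r deg) σ * Z = Z * permOp (Fin n) (Site r deg) σ) ∧
        ∀ f : Fin n → UnitLabel r, unitTensor deg f * Z = Z * unitTensor deg f :=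
  twirlOp_comm_iff Z

end Site

/-! ### Placing slots in systems -/

section Placement

variable {n k : ℕ} {r deg m m' : Fin k → ℕ}

/-- The basis vector in which slot `(j, i)` is in the state `(j, a_j i, b_j i)`. -/
def place (e : (Σ j, Fin (m j)) ≃ Fin n) (a : ∀ j, Fin (m j) → Fin (r j))
    (b : ∀ j, Fin (m j) → Fin (deg j)) : Fin n → Site r deg :=
  (fun q : Σ j, Fin (m j) => (⟨q.1, a q.1 q.2, b q.1 q.2⟩ : Site r deg)) ∘ e.symm

theorem place_apply (e : (Σ j, Fin (m j)) ≃ Fin n) (a : ∀ j, Fin (m j) → Fin (r j))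
    (b : ∀ j, Fin (m j) → Fin (deg j)) (q : Σ j, Fin (m j)) :
    place e a b (e q) = ⟨q.1, a q.1 q.2, b q.1 q.2⟩ := by
  rw [place, Function.comp_apply, Equiv.symm_apply_apply]

theorem eq_place_iff {e : (Σ j, Fin (m j)) ≃ Fin n} {a : ∀ j, Fin (m j) → Fin (r j)}
    {b : ∀ j, Fin (m j) → Fin (deg j)} {x : Fin n → Site r deg} :
    x = place e a b ↔ ∀ q : Σ j, Fin (m j), x (e q) = ⟨q.1, a q.1 q.2, b q.1 q.2⟩ := by
  constructor
  · rintro rfl q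
    exact place_apply e a b q
  · intro h
    funext p
    obtain ⟨q, rfl⟩ := e.surjective p
    rw [h, place_apply]

theorem place_inj {e : (Σ j, Fin (m j)) ≃ Fin n} {a a' : ∀ j, Fin (m j) → Fin (r j)}
    {b b' : ∀ j, Fin (m j) → Fin (deg j)} :
    place e a b = place e a' b' ↔ a = a' ∧ b = b' := by
  constructor
  · intro h
    rw [eq_place_iff] at h
    constructor
    · funext j i
      have := h ⟨j, i⟩
      rw [place_apply] at this
      simpa using congrArg (fun x : Site r deg => (⟨x.1, x.2.1⟩ : Σ j, Fin (r j))) this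
    · funext j i
      have := h ⟨j, i⟩
      rw [place_apply] at this
      simpa using congrArg (fun x : Site r deg => (⟨x.1, x.2.2⟩ : Σ j, Fin (deg j))) this
  · rintro ⟨rfl, rfl⟩
    rfl

/-- The isometry `|b⟩ ↦ |place e a b⟩`. -/
noncomputable def placeMatrix (deg : Fin k → ℕ) (e : (Σ j, Fin (m j)) ≃ Fin n)
    (a : ∀ j, Fin (m j) → Fin (r j)) :
    Matrix (Fin n → Site r deg) (∀ j, Fin (m j) → Fin (deg j)) ℂ :=
  Matrix.of fun x b => if x = place e a b then 1 else 0

theorem placeMatrix_apply (e : (Σ j, Fin (m j)) ≃ Fin n) (a : ∀ j, Fin (m j) → Fin (r j))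
    (x : Fin n → Site r deg) (b : ∀ j, Fin (m j) → Fin (deg j)) :
    placeMatrix deg e a x b = if x = place e a b then 1 else 0 := rfl

theorem mul_placeMatrix_apply {μ : Type*} (M : Matrix μ (Fin n → Site r deg) ℂ)
    (e : (Σ j, Fin (m j)) ≃ Fin n) (a : ∀ j, Fin (m j) → Fin (r j)) (x : μ)
    (b : ∀ j, Fin (m j) → Fin (deg j)) :
    (M * placeMatrix deg e a) x b = M x (place e a b) := by
  simp [Matrix.mul_apply, placeMatrix_apply]

theorem conj_placeMatrix_apply (M : Matrix (Fin n → Site r deg) (Fin n → Site r deg) ℂ)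
    (e : (Σ j, Fin (m j)) ≃ Fin n) (a : ∀ j, Fin (m j) → Fin (r j))
    (e' : (Σ j, Fin (m' j)) ≃ Fin n) (a' : ∀ j, Fin (m' j) → Fin (r j))
    (b : ∀ j, Fin (m j) → Fin (deg j)) (b' : ∀ j, Fin (m' j) → Fin (deg j)) :
    ((placeMatrix deg e a)ᴴ * M * placeMatrix deg e' a') b b' =
      M (place e a b) (place e' a' b') := by
  rw [mul_placeMatrix_apply]
  simp [Matrix.mul_apply, placeMatrix_apply, Matrix.conjTranspose_apply]

theorem placeMatrix_star_mul_self (e : (Σ j, Fin (m j)) ≃ Fin n)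
    (a : ∀ j, Fin (m j) → Fin (r j)) : (placeMatrix deg e a)ᴴ * placeMatrix deg e a = 1 := by
  ext b b'
  have h := conj_placeMatrix_apply (deg := deg) 1 e a e a b b'
  rw [Matrix.mul_one] at h
  rw [h, Matrix.one_apply, Matrix.one_apply]
  simp [place_inj]

/-- The labels of the matrix units taking `place e a b` to `place e c b`. -/
def placeUnits (e : (Σ j, Fin (m j)) ≃ Fin n) (c a : ∀ j, Fin (m j) → Fin (r j)) :
    Fin n → UnitLabel r :=
  (fun q : Σ j, Fin (m j) => (⟨q.1, c q.1 q.2, a q.1 q.2⟩ : UnitLabel r)) ∘ e.symm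

theorem placeUnits_apply (e : (Σ j, Fin (m j)) ≃ Fin n) (c a : ∀ j, Fin (m j) → Fin (r j))
    (q : Σ j, Fin (m j)) : placeUnits e c a (e q) = ⟨q.1, c q.1 q.2, a q.1 q.2⟩ := by
  rw [placeUnits, Function.comp_apply, Equiv.symm_apply_apply]

theorem eq_placeUnits_iff {e : (Σ j, Fin (m j)) ≃ Fin n} {c a : ∀ j, Fin (m j) → Fin (r j)}
    {f : Fin n → UnitLabel r} :
    f = placeUnits e c a ↔ ∀ q : Σ j, Fin (m j), f (e q) = ⟨q.1, c q.1 q.2, a q.1 q.2⟩ := by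
  constructor
  · rintro rfl q
    exact placeUnits_apply e c a q
  · intro h
    funext p
    obtain ⟨q, rfl⟩ := e.surjective p
    rw [h, placeUnits_apply]

theorem unitTensor_apply_of_ne_zero {f : Fin n → UnitLabel r} {x y : Fin n → Site r deg}
    (h : unitTensor deg f x y ≠ 0) (p : Fin n) :
    ∃ s, x p = ⟨(f p).1, (f p).2.1, s⟩ ∧ y p = ⟨(f p).1, (f p).2.2, s⟩ := by
  rw [unitTensor, tensorMatrix_apply, Finset.prod_ne_zero_iff] at h
  exact siteUnit_apply_of_ne_zero (h p (Finset.mem_univ p))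

/-- A tensor of units fitted to the slots acts on the ℂ^{r_j} parts as |c⟩⟨a| and leaves the
multiplicity parts alone, so it factors through them. -/
theorem unitTensor_placeUnits (e : (Σ j, Fin (m j)) ≃ Fin n)
    (c a : ∀ j, Fin (m j) → Fin (r j)) :
    unitTensor deg (placeUnits e c a) = placeMatrix deg e c * (placeMatrix deg e a)ᴴ := by
  ext x y
  rw [Matrix.mul_apply]
  by_cases h : ∃ b, x = place e c b ∧ y = place e a b
  · obtain ⟨b, rfl, rfl⟩ := h
    rw [Finset.sum_eq_single b]
    · rw [unitTensor, tensorMatrix_apply, ← Equiv.prod_comp e]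
      simp only [placeUnits_apply, place_apply, siteUnit_apply, if_true, Finset.prod_const_one]
      simp [placeMatrix_apply]
    · intro b' _ hb'
      rw [placeMatrix_apply, if_neg, zero_mul]
      rw [place_inj]
      exact fun h => hb' h.2.symm
    · simp
  · rw [Finset.sum_eq_zero]
    · by_contra hne
      have h1 := unitTensor_apply_of_ne_zero hne
      have h2 : ∀ q : Σ j, Fin (m j), ∃ s : Fin (deg q.1), x (e q) = ⟨q.1, c q.1 q.2, s⟩ ∧
          y (e q) = ⟨q.1, a q.1 q.2, s⟩ := by
        intro q
        have h3 := h1 (e q)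
        rw [placeUnits_apply] at h3
        exact h3
      choose s hs using h2
      exact h ⟨fun j i => s ⟨j, i⟩, eq_place_iff.2 fun q => (hs q).1,
        eq_place_iff.2 fun q => (hs q).2⟩
    · intro b _
      rw [placeMatrix_apply, Matrix.conjTranspose_apply, placeMatrix_apply]
      by_cases h1 : x = place e c b
      · rw [if_neg (c := y = place e a b) fun h2 => h ⟨b, h1, h2⟩]
        simp
      · rw [if_neg h1, zero_mul]

theorem permOp_mul_placeMatrix (σ : Equiv.Perm (Fin n)) (e : (Σ j, Fin (m j)) ≃ Fin n)
    (a : ∀ j, Fin (m j) → Fin (r j)) :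
    permOp (Fin n) (Site r deg) σ * placeMatrix deg e a = placeMatrix deg (e.trans σ) a := by
  ext x b
  rw [permOp_mul_apply, placeMatrix_apply, placeMatrix_apply]
  congr 1
  rw [eq_place_iff, eq_place_iff]
  rfl

/-- The permutation of the systems permuting the slots of each type. -/
def placePerm (e : (Σ j, Fin (m j)) ≃ Fin n) (s : ∀ j, Equiv.Perm (Fin (m j))) :
    Equiv.Perm (Fin n) :=
  e.permCongr (Equiv.Perm.sigmaCongrRightHom _ s)

theorem placePerm_apply (e : (Σ j, Fin (m j)) ≃ Fin n) (s : ∀ j, Equiv.Perm (Fin (m j)))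
    (q : Σ j, Fin (m j)) : placePerm e s (e q) = e ⟨q.1, s q.1 q.2⟩ := by
  simp [placePerm, Equiv.permCongr_apply]

theorem placePerm_injective (e : (Σ j, Fin (m j)) ≃ Fin n) :
    Function.Injective (placePerm e) := fun _ _ h =>
  Equiv.Perm.sigmaCongrRightHom_injective (e.permCongr.injective h)

/-- A permutation that keeps the type of each slot lies in the Young subgroup ∏ S_{m_j}. -/
theorem exists_eq_placePerm {e : (Σ j, Fin (m j)) ≃ Fin n} {σ : Equiv.Perm (Fin n)}
    (h : ∀ q, (e.symm (σ (e q))).1 = q.1) : ∃ s, σ = placePerm e s := by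
  have h1 : ∀ j (i : Fin (m j)), ∃ i' : Fin (m j), σ (e ⟨j, i⟩) = e ⟨j, i'⟩ := by
    intro j i
    have h2 := h ⟨j, i⟩
    have h3 : σ (e ⟨j, i⟩) = e (e.symm (σ (e ⟨j, i⟩))) := by simp
    generalize e.symm (σ (e ⟨j, i⟩)) = q at h2 h3
    obtain ⟨j', i'⟩ := q
    dsimp only at h2
    subst h2
    exact ⟨i', h3⟩
  choose g hg using h1
  have hinj : ∀ j, Function.Injective (g j) := by
    intro j i i' hii
    have h4 : σ (e ⟨j, i⟩) = σ (e ⟨j, i'⟩) := by rw [hg, hg, hii]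
    simpa using e.injective (σ.injective h4)
  refine ⟨fun j => Equiv.ofBijective (g j) (Finite.injective_iff_bijective.1 (hinj j)), ?_⟩
  ext p
  obtain ⟨⟨j, i⟩, rfl⟩ := e.surjective p
  rw [placePerm_apply, hg]
  rfl

/-- Changing the placement by slot permutations is the same as permuting the multiplicity indices,
provided the indices in ℂ^{r_j} are carried along. -/
theorem placeMatrix_placePerm (e : (Σ j, Fin (m j)) ≃ Fin n) (a : ∀ j, Fin (m j) → Fin (r j))
    (s : ∀ j, Equiv.Perm (Fin (m j))) :
    placeMatrix deg (e.trans (placePerm e s)) (fun j => a j ∘ s j) = placeMatrix deg e a *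
      piTensor fun j => permOp (Fin (m j)) (Fin (deg j)) (s j) := by
  ext x b
  have h1 : place (e.trans (placePerm e s)) (fun j => a j ∘ s j) b =
      place (deg := deg) e a fun j => b j ∘ (s j).symm := by
    rw [eq_place_iff]
    rintro ⟨j, i⟩
    have h2 := place_apply (e.trans (placePerm e s)) (fun j => a j ∘ s j) b ⟨j, (s j).symm i⟩
    rw [Equiv.trans_apply, placePerm_apply] at h2
    simpa using h2
  rw [placeMatrix_apply, h1, Matrix.mul_apply, Finset.sum_eq_single fun j => b j ∘ (s j).symm]
  · rw [placeMatrix_apply, piTensor_apply]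
    simp [permOp]
  · intro b' _ hb'
    obtain ⟨j, hj⟩ := Function.ne_iff.1 hb'
    rw [piTensor_apply, Finset.prod_eq_zero (Finset.mem_univ j), mul_zero]
    simp [permOp, hj]
  · simp

theorem permOp_mul_unitTensor_placeUnits (e : (Σ j, Fin (m j)) ≃ Fin n)
    (a : ∀ j, Fin (m j) → Fin (r j)) (s : ∀ j, Equiv.Perm (Fin (m j)))
    (ha : ∀ j, a j ∘ s j = a j) :
    permOp (Fin n) (Site r deg) (placePerm e s) * unitTensor deg (placeUnits e a a) =
      placeMatrix deg e a * (piTensor fun j => permOp (Fin (m j)) (Fin (deg j)) (s j)) *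
        (placeMatrix deg e a)ᴴ := by
  rw [unitTensor_placeUnits, ← Matrix.mul_assoc, permOp_mul_placeMatrix, ← placeMatrix_placePerm]
  simp only [ha]

/-- A nonzero entry needs each matrix unit to match the chosen basis vectors on both sides, and the
permutation to respect types. Together with `exists_eq_placePerm`, only the Young subgroup survives
in the corner of a fixed placement. -/
theorem conj_twirlOp_ne_zero {e : (Σ j, Fin (m j)) ≃ Fin n} {e' : (Σ j, Fin (m' j)) ≃ Fin n}
    {a : ∀ j, Fin (r j)} {σ : Equiv.Perm (Fin n)} {f : Fin n → UnitLabel r}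
    (h : (placeMatrix deg e fun j _ => a j)ᴴ * twirlOp deg (σ, f) *
      (placeMatrix deg e' fun j _ => a j) ≠ 0) :
    (∀ q, (e.symm (σ (e' q))).1 = q.1) ∧ f = placeUnits e' (fun j _ => a j) fun j _ => a j := by
  obtain ⟨b, b', hb⟩ : ∃ b b', ((placeMatrix deg e fun j _ => a j)ᴴ * twirlOp deg (σ, f) *
      (placeMatrix deg e' fun j _ => a j)) b b' ≠ 0 := by
    by_contra hcon
    push Not at hcon
    exact h (Matrix.ext hcon)
  rw [conj_placeMatrix_apply, twirlOp, permOp_mul_apply] at hb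
  have h1 := unitTensor_apply_of_ne_zero hb
  have h2 : ∀ q : Σ j, Fin (m' j), (e.symm (σ (e' q))).1 = q.1 ∧
      f (e' q) = ⟨q.1, a q.1, a q.1⟩ := by
    intro q
    obtain ⟨s, hs1, hs2⟩ := h1 (e' q)
    rw [place_apply] at hs2
    have hs1' : (⟨(e.symm (σ (e' q))).1, a _⟩ : Σ j, Fin (r j)) = ⟨(f (e' q)).1, (f (e' q)).2.1⟩ :=
      congrArg (fun x : Site r deg => (⟨x.1, x.2.1⟩ : Σ j, Fin (r j))) hs1
    have hs2' : (⟨q.1, a q.1⟩ : Σ j, Fin (r j)) = ⟨(f (e' q)).1, (f (e' q)).2.2⟩ :=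
      congrArg (fun x : Site r deg => (⟨x.1, x.2.1⟩ : Σ j, Fin (r j))) hs2
    generalize e.symm (σ (e' q)) = q' at hs1' ⊢
    generalize f (e' q) = u at hs1' hs2' ⊢
    obtain ⟨j, c, c'⟩ := u
    obtain ⟨j', i'⟩ := q'
    obtain ⟨j'', i''⟩ := q
    simp only [Sigma.mk.injEq] at hs1' hs2'
    obtain ⟨rfl, hc⟩ := hs1'
    obtain ⟨rfl, hc'⟩ := hs2'
    simp only [heq_eq_eq] at hc hc'
    subst hc hc'
    simp
  exact ⟨fun q => (h2 q).1, eq_placeUnits_iff.2 fun q => (h2 q).2⟩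

theorem eq_of_symm_fst_eq {e : (Σ j, Fin (m j)) ≃ Fin n} {e' : (Σ j, Fin (m' j)) ≃ Fin n}
    {σ : Equiv.Perm (Fin n)} (h : ∀ q, (e.symm (σ (e' q))).1 = q.1) : m = m' := by
  funext j
  have h1 : Fintype.card {q : Σ j, Fin (m' j) // q.1 = j} =
      Fintype.card {q : Σ j, Fin (m j) // q.1 = j} := by
    refine Fintype.card_congr ((e'.trans (σ.trans e.symm)).subtypeEquiv fun q => ?_)
    simp [h]
  have h2 : ∀ m : Fin k → ℕ, Fintype.card {q : Σ j, Fin (m j) // q.1 = j} = m j := fun m => by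
    rw [Fintype.card_congr (Equiv.sigmaSubtype j)]
    exact Fintype.card_fin _
  rw [h2, h2] at h1
  exact h1.symm

end Placement

/-! ### The minimal projections -/

theorem youngIdem_op_ne_zero {ι : Type*} [Fintype ι] [DecidableEq ι] {d : ℕ} {lam : Fin d → ℕ}
    (T : ι ≃ Boxes lam) (hlam : Antitone lam) : groupAlgebraOp (Fin d) (youngIdem T) ≠ 0 := by
  intro h
  have h1 := sum_youngIdem_mul_prod T hlam 1
  have h2 := eval_schurPoly_pos T hlam (t := 1) (fun _ => zero_le_one) (fun _ _ => one_pos)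
  rw [h] at h1
  simp only [Matrix.zero_apply, zero_mul, Finset.sum_const_zero] at h1
  exact h2.ne (by exact_mod_cast h1)

/-- Take adjoints in e V_σ e = χ(σ) e on the tensor space, where e is self-adjoint, nonzero, and V_σ
is unitary. -/
theorem star_youngChar_gr {ι : Type*} [Fintype ι] [DecidableEq ι] {d : ℕ} {lam : Fin d → ℕ}
    (T : ι ≃ Boxes lam) (hlam : Antitone lam) (σ : Equiv.Perm ι) :
    star (youngChar T (gr σ)) = youngChar T (gr σ⁻¹) := by
  have h1 : ∀ τ : Equiv.Perm ι, groupAlgebraOp (Fin d) (youngIdem T) * permOp ι (Fin d) τ *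
      groupAlgebraOp (Fin d) (youngIdem T) =
        youngChar T (gr τ) • groupAlgebraOp (Fin d) (youngIdem T) := by
    intro τ
    rw [← groupAlgebraOp_gr, ← groupAlgebraOp_mul, ← groupAlgebraOp_mul, youngIdem_mul_mul T hlam,
      groupAlgebraOp_smul]
  have h2 := congrArg Matrix.conjTranspose (h1 σ)
  rw [Matrix.conjTranspose_mul, Matrix.conjTranspose_mul, Matrix.conjTranspose_smul,
    groupAlgebraOp_youngIdem_conjTranspose, permOp_conjTranspose, ← Matrix.mul_assoc, h1] at h2
  exact (smul_left_injective ℂ (youngIdem_op_ne_zero T hlam) h2).symm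

section Blocks

variable {n k : ℕ} {r deg : Fin k → ℕ}

/-- The slots of each type occupying consecutive systems. -/
def slotEquiv (m : Fin k → ℕ) (hm : ∑ j, m j = n) : (Σ j, Fin (m j)) ≃ Fin n :=
  finSigmaFinEquiv.trans (finCongr hm)

/-- The tensor product of the Young projections of a family of diagrams. -/
noncomputable def youngTensor {m : Fin k → ℕ} (lam : ∀ j, Fin (deg j) → ℕ)
    (hl : ∀ j, m j = ∑ i, lam j i) :
    Matrix (∀ j, Fin (m j) → Fin (deg j)) (∀ j, Fin (m j) → Fin (deg j)) ℂ :=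
  piTensor fun j => groupAlgebraOp (Fin (deg j)) (youngIdem (numbering (lam j) (hl j)))

section

variable {m : Fin k → ℕ} {lam : ∀ j, Fin (deg j) → ℕ} (hl : ∀ j, m j = ∑ i, lam j i)

theorem youngTensor_mul_self (hlam : ∀ j, Antitone (lam j)) :
    youngTensor lam hl * youngTensor lam hl = youngTensor lam hl := by
  rw [youngTensor, piTensor_mul]
  congr 1
  funext j
  rw [← groupAlgebraOp_mul, youngIdem_mul_self _ (hlam j)]

theorem youngTensor_conjTranspose : (youngTensor lam hl)ᴴ = youngTensor lam hl := by
  rw [youngTensor, piTensor_conjTranspose]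
  simp only [groupAlgebraOp_youngIdem_conjTranspose]

theorem youngTensor_mul_mul (hlam : ∀ j, Antitone (lam j)) (s : ∀ j, Equiv.Perm (Fin (m j))) :
    youngTensor lam hl * (piTensor fun j => permOp (Fin (m j)) (Fin (deg j)) (s j)) *
      youngTensor lam hl =
        (∏ j, youngChar (numbering (lam j) (hl j)) (gr (s j))) • youngTensor lam hl := by
  rw [youngTensor, piTensor_mul, piTensor_mul, ← piTensor_smul]
  congr 1
  funext j
  rw [← groupAlgebraOp_gr, ← groupAlgebraOp_mul, ← groupAlgebraOp_mul,
    youngIdem_mul_mul _ (hlam j), groupAlgebraOp_smul]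

theorem youngTensor_mul_mul_eq_zero {mu : ∀ j, Fin (deg j) → ℕ} (hl' : ∀ j, m j = ∑ i, mu j i)
    (hlam : ∀ j, Antitone (lam j)) (hmu : ∀ j, Antitone (mu j)) (hne : lam ≠ mu)
    (s : ∀ j, Equiv.Perm (Fin (m j))) :
    youngTensor lam hl * (piTensor fun j => permOp (Fin (m j)) (Fin (deg j)) (s j)) *
      youngTensor mu hl' = 0 := by
  obtain ⟨j, hj⟩ := Function.ne_iff.1 hne
  rw [youngTensor, youngTensor, piTensor_mul, piTensor_mul]
  refine piTensor_eq_zero (j := j) ?_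
  rw [← groupAlgebraOp_gr, ← groupAlgebraOp_mul, ← groupAlgebraOp_mul,
    youngIdem_mul_gr_mul_eq_zero _ _ (hlam j) (hmu j) hj]
  exact map_zero _

theorem youngTensor_eq_sum : youngTensor lam hl = ∑ s : ∀ j, Equiv.Perm (Fin (m j)),
    (∏ j, (youngIdem (numbering (lam j) (hl j))).coeff (s j)) •
      piTensor fun j => permOp (Fin (m j)) (Fin (deg j)) (s j) := by
  simp only [← piTensor_smul]
  rw [← piTensor_sum fun j (σ : Equiv.Perm (Fin (m j))) =>
    (youngIdem (numbering (lam j) (hl j))).coeff σ • permOp (Fin (m j)) (Fin (deg j)) σ,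
    youngTensor]
  congr 1
  funext j
  conv_lhs => rw [eq_sum_coeff_gr (youngIdem (numbering (lam j) (hl j)))]
  rw [groupAlgebraOp_sum]
  simp only [groupAlgebraOp_smul, groupAlgebraOp_gr]

variable (r)

/-- A minimal projection of the algebra generated by the permutations and the local matrix units. -/
noncomputable def minimalProj (hr : ∀ j, 0 < r j) (hm : ∑ j, m j = n) :
    Matrix (Fin n → Site r deg) (Fin n → Site r deg) ℂ :=
  placeMatrix deg (slotEquiv m hm) (fun j _ => (⟨0, hr j⟩ : Fin (r j))) * youngTensor lam hl *
    (placeMatrix deg (slotEquiv m hm) (fun j _ => (⟨0, hr j⟩ : Fin (r j))))ᴴ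

/-- The labels of the matrix units projecting on the range of `placeMatrix`. -/
def baseUnits (hr : ∀ j, 0 < r j) (hm : ∑ j, m j = n) : Fin n → UnitLabel r :=
  placeUnits (slotEquiv m hm) (fun j _ => (⟨0, hr j⟩ : Fin (r j))) fun j _ => ⟨0, hr j⟩

variable {r}

theorem twirlOp_placePerm_baseUnits (hr : ∀ j, 0 < r j) (hm : ∑ j, m j = n)
    (s : ∀ j, Equiv.Perm (Fin (m j))) :
    twirlOp deg (placePerm (slotEquiv m hm) s, baseUnits r hr hm) =
      placeMatrix deg (slotEquiv m hm) (fun j _ => (⟨0, hr j⟩ : Fin (r j))) *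
        (piTensor fun j => permOp (Fin (m j)) (Fin (deg j)) (s j)) *
        (placeMatrix deg (slotEquiv m hm) (fun j _ => (⟨0, hr j⟩ : Fin (r j))))ᴴ :=
  permOp_mul_unitTensor_placeUnits _ _ _ fun _ => rfl

theorem conj_twirlOp_placePerm (hr : ∀ j, 0 < r j) (hm : ∑ j, m j = n)
    (s : ∀ j, Equiv.Perm (Fin (m j))) :
    (placeMatrix deg (slotEquiv m hm) (fun j _ => (⟨0, hr j⟩ : Fin (r j))))ᴴ *
      twirlOp deg (placePerm (slotEquiv m hm) s, baseUnits r hr hm) *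
      (placeMatrix deg (slotEquiv m hm) (fun j _ => (⟨0, hr j⟩ : Fin (r j)))) =
        piTensor fun j => permOp (Fin (m j)) (Fin (deg j)) (s j) := by
  rw [twirlOp_placePerm_baseUnits, Matrix.mul_assoc, Matrix.mul_assoc, placeMatrix_star_mul_self,
    ← Matrix.mul_assoc, ← Matrix.mul_assoc, placeMatrix_star_mul_self, Matrix.one_mul,
    Matrix.mul_one]

/-- The compression coefficients of the minimal projections. -/
noncomputable def compressCoeff (hr : ∀ j, 0 < r j) (hm : ∑ j, m j = n) :
    Equiv.Perm (Fin n) × (Fin n → UnitLabel r) → ℂ :=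
  Function.extend (fun s => (placePerm (slotEquiv m hm) s, baseUnits r hr hm))
    (fun s => ∏ j, youngChar (numbering (lam j) (hl j)) (gr (s j))) 0

theorem placePerm_prod_injective (hr : ∀ j, 0 < r j) (hm : ∑ j, m j = n) :
    Function.Injective fun s => (placePerm (slotEquiv m hm) s, baseUnits r hr hm) :=
  fun _ _ h => placePerm_injective _ (Prod.ext_iff.1 h).1

theorem minimalProj_mul_twirlOp_mul {m' : Fin k → ℕ} {mu : ∀ j, Fin (deg j) → ℕ}
    (hl' : ∀ j, m' j = ∑ i, mu j i) (hr : ∀ j, 0 < r j) (hm : ∑ j, m j = n) (hm' : ∑ j, m' j = n)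
    (a : Equiv.Perm (Fin n) × (Fin n → UnitLabel r)) :
    minimalProj r hl hr hm * twirlOp deg a * minimalProj r hl' hr hm' =
      placeMatrix deg (slotEquiv m hm) (fun j _ => (⟨0, hr j⟩ : Fin (r j))) *
        (youngTensor lam hl * ((placeMatrix deg (slotEquiv m hm) (fun j _ => ⟨0, hr j⟩))ᴴ *
          twirlOp deg a * placeMatrix deg (slotEquiv m' hm') (fun j _ => ⟨0, hr j⟩)) *
          youngTensor mu hl') *
        (placeMatrix deg (slotEquiv m' hm') (fun j _ => (⟨0, hr j⟩ : Fin (r j))))ᴴ := by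
  simp only [minimalProj, Matrix.mul_assoc]

/-- Generators from the Young subgroup compress to ⨂ V_{s_j}, on which each Young idempotent yields
a scalar by primitivity. All other generators compress to zero, the default value of the
coefficient. -/
theorem minimalProj_compress (hlam : ∀ j, Antitone (lam j)) (hr : ∀ j, 0 < r j)
    (hm : ∑ j, m j = n) (a : Equiv.Perm (Fin n) × (Fin n → UnitLabel r)) :
    minimalProj r hl hr hm * twirlOp deg a * minimalProj r hl hr hm =
      compressCoeff hl hr hm a • minimalProj r hl hr hm := by
  rw [minimalProj_mul_twirlOp_mul]
  by_cases h : ∃ s, (placePerm (slotEquiv m hm) s, baseUnits r hr hm) = a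
  · obtain ⟨s, rfl⟩ := h
    rw [conj_twirlOp_placePerm, youngTensor_mul_mul hl hlam, compressCoeff,
      (placePerm_prod_injective hr hm).extend_apply, Matrix.mul_smul, Matrix.smul_mul]
    rfl
  · rw [compressCoeff, Function.extend_apply' _ _ _ h]
    have h0 : (placeMatrix deg (slotEquiv m hm) (fun j _ => (⟨0, hr j⟩ : Fin (r j))))ᴴ *
        twirlOp deg a * placeMatrix deg (slotEquiv m hm) (fun j _ => ⟨0, hr j⟩) = 0 := by
      by_contra hne
      obtain ⟨h1, h2⟩ := conj_twirlOp_ne_zero (a := fun j => (⟨0, hr j⟩ : Fin (r j))) hne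
      obtain ⟨s, hs⟩ := exists_eq_placePerm h1
      exact h ⟨s, Prod.ext hs.symm h2.symm⟩
    rw [h0]
    simp

/-- A surviving generator matches slots of equal type, which forces `m = m'`. Then some pair of
diagrams differs, and their Young idempotents annihilate each other across any permutation. -/
theorem minimalProj_orth {m' : Fin k → ℕ} {mu : ∀ j, Fin (deg j) → ℕ}
    (hl' : ∀ j, m' j = ∑ i, mu j i) (hlam : ∀ j, Antitone (lam j)) (hmu : ∀ j, Antitone (mu j))
    (hr : ∀ j, 0 < r j) (hm : ∑ j, m j = n) (hm' : ∑ j, m' j = n) (hne : ¬ (m = m' ∧ lam = mu))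
    (a : Equiv.Perm (Fin n) × (Fin n → UnitLabel r)) :
    minimalProj r hl hr hm * twirlOp deg a * minimalProj r hl' hr hm' = 0 := by
  rw [minimalProj_mul_twirlOp_mul]
  by_cases h0 : (placeMatrix deg (slotEquiv m hm) (fun j _ => (⟨0, hr j⟩ : Fin (r j))))ᴴ *
      twirlOp deg a * placeMatrix deg (slotEquiv m' hm') (fun j _ => ⟨0, hr j⟩) = 0
  · rw [h0]
    simp
  · obtain ⟨h1, h2⟩ := conj_twirlOp_ne_zero (a := fun j => (⟨0, hr j⟩ : Fin (r j))) h0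
    obtain rfl := eq_of_symm_fst_eq h1
    obtain ⟨s, hs⟩ := exists_eq_placePerm h1
    obtain ⟨σ, f⟩ := a
    dsimp only at hs h2
    subst hs h2
    have h3 := conj_twirlOp_placePerm (deg := deg) hr hm s
    rw [baseUnits] at h3
    rw [h3, youngTensor_mul_mul_eq_zero hl hl' hlam hmu fun h => hne ⟨rfl, h⟩]
    simp

theorem minimalProj_mul_self (hlam : ∀ j, Antitone (lam j)) (hr : ∀ j, 0 < r j)
    (hm : ∑ j, m j = n) :
    minimalProj r hl hr hm * minimalProj r hl hr hm = minimalProj r hl hr hm := by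
  rw [minimalProj, Matrix.mul_assoc, Matrix.mul_assoc,
    ← Matrix.mul_assoc _ (placeMatrix deg (slotEquiv m hm) _ * _),
    ← Matrix.mul_assoc _ (placeMatrix deg (slotEquiv m hm) _), placeMatrix_star_mul_self,
    Matrix.one_mul, ← Matrix.mul_assoc (youngTensor lam hl), youngTensor_mul_self hl hlam,
    Matrix.mul_assoc]

theorem minimalProj_conjTranspose (hr : ∀ j, 0 < r j) (hm : ∑ j, m j = n) :
    (minimalProj r hl hr hm)ᴴ = minimalProj r hl hr hm := by
  rw [minimalProj, Matrix.conjTranspose_mul, Matrix.conjTranspose_mul,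
    Matrix.conjTranspose_conjTranspose, youngTensor_conjTranspose, Matrix.mul_assoc]

/-- Exhibits the projection as an element of the algebra spanned by the generators, so that it
commutes with their commutant. -/
theorem minimalProj_eq_sum (hr : ∀ j, 0 < r j) (hm : ∑ j, m j = n) :
    minimalProj r hl hr hm = ∑ s : ∀ j, Equiv.Perm (Fin (m j)),
      (∏ j, (youngIdem (numbering (lam j) (hl j))).coeff (s j)) •
        twirlOp deg (placePerm (slotEquiv m hm) s, baseUnits r hr hm) := by
  rw [minimalProj, youngTensor_eq_sum, Matrix.mul_sum, Matrix.sum_mul]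
  refine Finset.sum_congr rfl fun s _ => ?_
  rw [twirlOp_placePerm_baseUnits, Matrix.mul_smul, Matrix.smul_mul]

/-- The dimension of the irreducible representation attached to a block. -/
noncomputable def blockDim (r : Fin k → ℕ) (m : Fin k → ℕ) (lam : ∀ j, Fin (deg j) → ℕ) : ℝ :=
  ((∑ j, m j).factorial : ℝ) / (∏ j, ((m j).factorial : ℝ)) * (∏ j, (r j : ℝ) ^ m j) *
    ∏ j, (Module.finrank ℂ (irrepSym (lam j)) : ℝ)

theorem blockDim_pos (hr : ∀ j, 0 < r j) (lam : ∀ j, Fin (deg j) → ℕ) :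
    0 < blockDim r m lam := by
  refine mul_pos (mul_pos (div_pos (by positivity) (by positivity)) ?_) ?_
  · exact Finset.prod_pos fun j _ => pow_pos (by exact_mod_cast hr j) _
  · refine Finset.prod_pos fun j _ => ?_
    rw [← finrank_irrepSym rfl]
    exact_mod_cast symDim_pos _

theorem tensorWeight_baseUnits (hr : ∀ j, 0 < r j) (hm : ∑ j, m j = n) :
    tensorWeight (baseUnits r hr hm) = ∏ j, ((r j : ℝ) ^ m j)⁻¹ := by
  rw [tensorWeight, ← Equiv.prod_comp (slotEquiv m hm), Fintype.prod_sigma]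
  refine Finset.prod_congr rfl fun j _ => ?_
  simp only [baseUnits, placeUnits_apply, unitWeight]
  simp

/-- Only the Young subgroup contributes, each element with weight 1/(n! ∏ r_j^{m_j}). The sum
factorises over the types, and Schur orthogonality gives m_j!/dim V_{lam_j} for each. -/
theorem sum_compressCoeff (hlam : ∀ j, Antitone (lam j)) (hr : ∀ j, 0 < r j)
    (hm : ∑ j, m j = n) :
    ∑ a, ((twirlWeight a : ℝ) : ℂ) * (compressCoeff hl hr hm a * star (compressCoeff hl hr hm a)) =
      ((blockDim r m lam : ℝ) : ℂ)⁻¹ := by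
  have h1 : ∑ a, ((twirlWeight a : ℝ) : ℂ) *
      (compressCoeff hl hr hm a * star (compressCoeff hl hr hm a)) =
      ∑ s : ∀ j, Equiv.Perm (Fin (m j)), ((n.factorial : ℂ)⁻¹ * ∏ j, ((r j : ℂ) ^ m j)⁻¹) *
        ∏ j, (youngChar (numbering (lam j) (hl j)) (gr (s j)) *
          youngChar (numbering (lam j) (hl j)) (gr (s j)⁻¹)) := by
    symm
    refine Finset.sum_of_injOn (fun s => (placePerm (slotEquiv m hm) s, baseUnits r hr hm))
      (placePerm_prod_injective hr hm).injOn (fun _ _ => by simp) ?_ ?_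
    · intro a _ ha
      rw [compressCoeff, Function.extend_apply' _ _ _ (by simpa using ha)]
      simp
    · intro s _
      rw [compressCoeff, (placePerm_prod_injective hr hm).extend_apply, twirlWeight]
      dsimp only
      rw [tensorWeight_baseUnits, star_prod, ← Finset.prod_mul_distrib]
      push_cast
      simp only [star_youngChar_gr _ (hlam _)]
  rw [h1, ← Finset.mul_sum, ← Fintype.piFinset_univ, ← Finset.prod_univ_sum (fun _ => Finset.univ)
    fun j σ => youngChar (numbering (lam j) (hl j)) (gr σ) *
      youngChar (numbering (lam j) (hl j)) (gr σ⁻¹)]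
  simp only [sum_youngChar_mul _ (hlam _)]
  rw [blockDim, hm]
  push_cast
  have h2 : ∀ j, symDim (numbering (lam j) (hl j)) = Module.finrank ℂ (irrepSym (lam j)) :=
    fun j => finrank_irrepSym (hl j)
  simp only [h2, Fintype.card_perm, Fintype.card_fin, Finset.prod_div_distrib, mul_inv, inv_div,
    Finset.prod_inv_distrib]
  ring

end

end Blocks

/-! ### The ranges of the block projections -/

section ProductVector

variable {ι : Type*} [Fintype ι] [DecidableEq ι] {μ : ι → Type*} [∀ j, Fintype (μ j)]
  [∀ j, DecidableEq (μ j)]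

/-- The product vector `⨂_j u_j`. -/
noncomputable def productVector (u : ∀ j, EuclideanSpace ℂ (μ j)) : EuclideanSpace ℂ (∀ j, μ j) :=
  WithLp.toLp 2 fun b => ∏ j, u j (b j)

theorem productVector_apply (u : ∀ j, EuclideanSpace ℂ (μ j)) (b : ∀ j, μ j) :
    productVector u b = ∏ j, u j (b j) := rfl

theorem toEuclideanLin_apply' {I J : Type*} [Fintype J] [DecidableEq J] (A : Matrix I J ℂ)
    (v : EuclideanSpace ℂ J) (i : I) : Matrix.toEuclideanLin A v i = ∑ j, A i j * v j := by
  rw [Matrix.toLpLin_apply]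
  rfl

theorem toEuclideanLin_piTensor (A : ∀ j, Matrix (μ j) (μ j) ℂ)
    (u : ∀ j, EuclideanSpace ℂ (μ j)) : Matrix.toEuclideanLin (piTensor A) (productVector u) =
      productVector fun j => Matrix.toEuclideanLin (A j) (u j) := by
  ext b
  simp only [toEuclideanLin_apply', productVector_apply, piTensor_apply, Finset.prod_univ_sum,
    Fintype.piFinset_univ, Finset.prod_mul_distrib]

theorem productVector_sum {α : ι → Type*} (s : ∀ j, Finset (α j))
    (w : ∀ j, α j → EuclideanSpace ℂ (μ j)) :
    productVector (fun j => ∑ i ∈ s j, w j i) =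
      ∑ i ∈ Fintype.piFinset s, productVector fun j => w j (i j) := by
  ext b
  simp only [productVector_apply, WithLp.ofLp_sum, Finset.sum_apply, Finset.prod_univ_sum]

theorem single_eq_productVector (b : ∀ j, μ j) : EuclideanSpace.single b (1 : ℂ) =
    productVector fun j => EuclideanSpace.single (b j) (1 : ℂ) := by
  ext c
  rw [productVector_apply]
  by_cases h : c = b
  · subst h
    simp
  · obtain ⟨j, hj⟩ := Function.ne_iff.1 h
    rw [Finset.prod_eq_zero (Finset.mem_univ j)] <;> simp [h, hj]

end ProductVector

/-! ### Schur–Weyl summands as spans of translates of one idempotent -/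

section SchurWeyl

variable {ι : Type*} [Fintype ι] [DecidableEq ι] {d : ℕ} {lam : Fin d → ℕ}

theorem range_youngIdem_le (T : ι ≃ Boxes lam) :
    LinearMap.range (Matrix.toEuclideanLin (groupAlgebraOp (Fin d) (youngIdem T))) ≤
      schurWeylSummand ι lam := by
  refine le_trans ?_ (le_iSup (fun T : ι ≃ Boxes lam =>
    LinearMap.range (Matrix.toEuclideanLin (groupAlgebraOp (Fin d) (youngSymmetrizer T)))) T)
  rw [youngIdem, ← mul_smul_comm, groupAlgebraOp_mul]
  exact range_mul_le _ _

/-- Any two numberings differ by a permutation σ, and c_S = V_σ e_T c_T V_σ⁻¹. So translates of a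
single idempotent suffice. -/
theorem exists_eq_sum_of_mem_schurWeylSummand (T : ι ≃ Boxes lam) (hlam : Antitone lam)
    {w : EuclideanSpace ℂ (ι → Fin d)} (hw : w ∈ schurWeylSummand ι lam) :
    ∃ u : Equiv.Perm ι → EuclideanSpace ℂ (ι → Fin d), w = ∑ σ, Matrix.toEuclideanLin
      (permOp ι (Fin d) σ * groupAlgebraOp (Fin d) (youngIdem T)) (u σ) := by
  let Φ : (Equiv.Perm ι → EuclideanSpace ℂ (ι → Fin d)) →ₗ[ℂ] EuclideanSpace ℂ (ι → Fin d) :=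
    ∑ σ, (Matrix.toEuclideanLin
      (permOp ι (Fin d) σ * groupAlgebraOp (Fin d) (youngIdem T))).comp (LinearMap.proj σ)
  have h : schurWeylSummand ι lam ≤ LinearMap.range Φ := by
    refine iSup_le fun S => ?_
    rintro _ ⟨v, rfl⟩
    let σ : Equiv.Perm ι := T.trans S.symm
    have h1 : permNumbering T σ = S := Equiv.ext fun p => by simp [permNumbering, σ]
    have h2 := gr_mul_youngSymmetrizer T σ
    rw [h1] at h2
    have h3 : groupAlgebraOp (Fin d) (youngSymmetrizer S) = permOp ι (Fin d) σ *
        groupAlgebraOp (Fin d) (youngIdem T) * (groupAlgebraOp (Fin d) (youngSymmetrizer T) *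
          permOp ι (Fin d) σ⁻¹) := by
      have h4 := congrArg (groupAlgebraOp (Fin d)) h2
      rw [← youngIdem_mul_youngSymmetrizer T hlam] at h4
      simp only [groupAlgebraOp_mul, groupAlgebraOp_gr] at h4
      rw [← Matrix.mul_assoc, Matrix.mul_assoc (permOp ι (Fin d) σ), h4, Matrix.mul_assoc,
        permOp_mul_permOp_inv, mul_one]
    refine ⟨Pi.single σ (Matrix.toEuclideanLin (groupAlgebraOp (Fin d) (youngSymmetrizer T) *
          permOp ι (Fin d) σ⁻¹) v), ?_⟩
    rw [h3, toEuclideanLin_mul_apply]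
    simp only [Φ, LinearMap.sum_apply, LinearMap.comp_apply, LinearMap.proj_apply]
    rw [Finset.sum_eq_single σ]
    · simp
    · intro τ _ hτ
      simp [hτ]
    · simp
  obtain ⟨u, hu⟩ := h hw
  exact ⟨u, by simpa [Φ] using hu.symm⟩

end SchurWeyl

/-! ### Identification of the block spaces, and their completeness -/

section Blocks

variable {n k : ℕ} {r deg m : Fin k → ℕ} {lam : ∀ j, Fin (deg j) → ℕ}

theorem placedVector_eq_sum (e : (Σ j, Fin (m j)) ≃ Fin n)
    (v : ∀ j, EuclideanSpace ℂ (Fin (m j) → Fin (r j)))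
    (w : ∀ j, EuclideanSpace ℂ (Fin (m j) → Fin (deg j))) :
    placedVector e v w = ∑ a : ∀ j, Fin (m j) → Fin (r j),
      (∏ j, v j (a j)) • Matrix.toEuclideanLin (placeMatrix deg e a) (productVector w) := by
  ext x
  simp only [WithLp.ofLp_sum, Finset.sum_apply, WithLp.ofLp_smul, Pi.smul_apply,
    toEuclideanLin_apply', placedVector, productVector_apply, placeMatrix_apply, smul_eq_mul,
    Finset.mul_sum, ite_mul, one_mul, zero_mul, mul_ite, mul_zero, Finset.prod_mul_distrib]
  rfl

theorem placedVector_single (e : (Σ j, Fin (m j)) ≃ Fin n) (a : ∀ j, Fin (m j) → Fin (r j))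
    (w : ∀ j, EuclideanSpace ℂ (Fin (m j) → Fin (deg j))) :
    placedVector e (fun j => EuclideanSpace.single (a j) 1) w =
      Matrix.toEuclideanLin (placeMatrix deg e a) (productVector w) := by
  rw [placedVector_eq_sum, Finset.sum_eq_single a]
  · simp
  · intro b _ hb
    obtain ⟨j, hj⟩ := Function.ne_iff.1 hb
    rw [Finset.prod_eq_zero (Finset.mem_univ j), zero_smul]
    simp [hj]
  · simp

/-- Matrix units whose sources fit the indices `a` replace them by their targets; a single mismatch
annihilates. -/
theorem unitTensor_mul_placeMatrix (e : (Σ j, Fin (m j)) ≃ Fin n) (f : Fin n → UnitLabel r)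
    (a : ∀ j, Fin (m j) → Fin (r j)) : unitTensor deg f * placeMatrix deg e a = 0 ∨
      ∃ c, unitTensor deg f * placeMatrix deg e a = placeMatrix deg e c := by
  by_cases h : ∃ c, f = placeUnits e c a
  · obtain ⟨c, rfl⟩ := h
    refine Or.inr ⟨c, ?_⟩
    rw [unitTensor_placeUnits, Matrix.mul_assoc, placeMatrix_star_mul_self, Matrix.mul_one]
  · left
    ext x b
    rw [mul_placeMatrix_apply, Matrix.zero_apply]
    by_contra hne
    have h1 := unitTensor_apply_of_ne_zero hne
    have h2 : ∀ q : Σ j, Fin (m j), ∃ c : Fin (r q.1), f (e q) = ⟨q.1, c, a q.1 q.2⟩ := by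
      intro q
      obtain ⟨s, -, hs⟩ := h1 (e q)
      rw [place_apply] at hs
      have hs' : (⟨q.1, a q.1 q.2⟩ : Σ j, Fin (r j)) = ⟨(f (e q)).1, (f (e q)).2.2⟩ :=
        congrArg (fun x : Site r deg => (⟨x.1, x.2.1⟩ : Σ j, Fin (r j))) hs
      generalize f (e q) = u at hs' ⊢
      generalize a q.1 q.2 = a' at hs' ⊢
      obtain ⟨j, c, c'⟩ := u
      obtain ⟨j', i'⟩ := q
      simp only [Sigma.mk.injEq] at hs'
      obtain ⟨rfl, hc⟩ := hs'
      simp only [heq_eq_eq] at hc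
      subst hc
      exact ⟨c, rfl⟩
    choose c hc using h2
    exact h ⟨fun j i => c ⟨j, i⟩, eq_placeUnits_iff.2 hc⟩

theorem range_twirlOp_mul_minimalProj_le (hl : ∀ j, m j = ∑ i, lam j i) (hr : ∀ j, 0 < r j)
    (hm : ∑ j, m j = n) (a : Equiv.Perm (Fin n) × (Fin n → UnitLabel r)) :
    LinearMap.range (Matrix.toEuclideanLin (twirlOp deg a * minimalProj r hl hr hm)) ≤
      blockSpace n r m lam := by
  obtain ⟨σ, f⟩ := a
  rintro _ ⟨v, rfl⟩
  have h1 : twirlOp deg (σ, f) * minimalProj r hl hr hm = permOp (Fin n) (Site r deg) σ *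
      (unitTensor deg f * placeMatrix deg (slotEquiv m hm) (fun j _ => (⟨0, hr j⟩ : Fin (r j)))) *
        (youngTensor lam hl *
          (placeMatrix deg (slotEquiv m hm) (fun j _ => (⟨0, hr j⟩ : Fin (r j))))ᴴ) := by
    simp only [twirlOp, minimalProj, Matrix.mul_assoc]
  rcases unitTensor_mul_placeMatrix (deg := deg) (slotEquiv m hm) f
    (fun j _ => (⟨0, hr j⟩ : Fin (r j))) with h | ⟨c, h⟩
  · rw [h1, h]
    simp
  · rw [h1, h, permOp_mul_placeMatrix, toEuclideanLin_mul_apply, toEuclideanLin_mul_apply]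
    generalize Matrix.toEuclideanLin
      (placeMatrix deg (slotEquiv m hm) (fun j _ => (⟨0, hr j⟩ : Fin (r j))))ᴴ v = z
    have hz : z = ∑ b, z b • EuclideanSpace.single b (1 : ℂ) := by
      ext b
      simp [Pi.single_apply]
    rw [hz, map_sum, map_sum]
    refine Submodule.sum_mem _ fun b _ => ?_
    rw [map_smul, map_smul]
    refine Submodule.smul_mem _ _ (Submodule.subset_span ?_)
    rw [single_eq_productVector, youngTensor, toEuclideanLin_piTensor, ← placedVector_single]
    exact ⟨_, _, _, fun j => range_youngIdem_le _ (LinearMap.mem_range_self _ _), rfl⟩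

/-- One generator carries the standard placement with base indices to an arbitrary one: its units
turn the base indices into `a`, and its permutation moves the slots to `e`. -/
theorem toEuclideanLin_placeMatrix_mem (hl : ∀ j, m j = ∑ i, lam j i) (hr : ∀ j, 0 < r j)
    (hm : ∑ j, m j = n) (e : (Σ j, Fin (m j)) ≃ Fin n) (a : ∀ j, Fin (m j) → Fin (r j))
    (u : EuclideanSpace ℂ (∀ j, Fin (m j) → Fin (deg j))) :
    Matrix.toEuclideanLin (placeMatrix deg e a) (Matrix.toEuclideanLin (youngTensor lam hl) u) ∈
      ⨆ a, LinearMap.range (Matrix.toEuclideanLin (twirlOp deg a * minimalProj r hl hr hm)) := by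
  have h1 : placeMatrix deg e a = twirlOp deg ((slotEquiv m hm).symm.trans e,
      placeUnits (slotEquiv m hm) a fun j _ => ⟨0, hr j⟩) *
        placeMatrix deg (slotEquiv m hm) (fun j _ => (⟨0, hr j⟩ : Fin (r j))) := by
    rw [twirlOp, Matrix.mul_assoc, unitTensor_placeUnits, Matrix.mul_assoc,
      placeMatrix_star_mul_self, Matrix.mul_one, permOp_mul_placeMatrix]
    congr 1
    ext q
    simp
  refine Submodule.mem_iSup_of_mem ((slotEquiv m hm).symm.trans e,
      placeUnits (slotEquiv m hm) a fun j _ => ⟨0, hr j⟩) ⟨Matrix.toEuclideanLin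
        (placeMatrix deg (slotEquiv m hm) (fun j _ => (⟨0, hr j⟩ : Fin (r j)))) u, ?_⟩
  rw [h1, ← toEuclideanLin_mul_apply, ← toEuclideanLin_mul_apply]
  congr 2
  rw [minimalProj]
  simp only [Matrix.mul_assoc]
  rw [placeMatrix_star_mul_self, Matrix.mul_one]

theorem iSup_range_twirlOp_mul_minimalProj (hl : ∀ j, m j = ∑ i, lam j i)
    (hlam : ∀ j, Antitone (lam j)) (hr : ∀ j, 0 < r j) (hm : ∑ j, m j = n) :
    ⨆ a, LinearMap.range (Matrix.toEuclideanLin (twirlOp deg a * minimalProj r hl hr hm)) =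
      blockSpace n r m lam := by
  apply le_antisymm
  · exact iSup_le fun a => range_twirlOp_mul_minimalProj_le hl hr hm a
  · refine Submodule.span_le.2 ?_
    rintro _ ⟨e, v, w, hw, rfl⟩
    rw [placedVector_eq_sum]
    refine Submodule.sum_mem _ fun a _ => Submodule.smul_mem _ _ ?_
    choose u hu using fun j => exists_eq_sum_of_mem_schurWeylSummand (numbering (lam j) (hl j))
      (hlam j) (hw j)
    have hw' : w = fun j => ∑ σ, Matrix.toEuclideanLin (permOp (Fin (m j)) (Fin (deg j)) σ *
        groupAlgebraOp (Fin (deg j)) (youngIdem (numbering (lam j) (hl j)))) (u j σ) := funext hu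
    rw [hw', productVector_sum, map_sum]
    refine Submodule.sum_mem _ fun s _ => ?_
    -- The permutations of the multiplicity factors are absorbed into a new placement, which leaves
    -- only the Young idempotents.
    rw [← toEuclideanLin_piTensor, ← piTensor_mul, toEuclideanLin_mul_apply,
      ← toEuclideanLin_mul_apply (placeMatrix deg e a), ← placeMatrix_placePerm]
    exact toEuclideanLin_placeMatrix_mem hl hr hm _ _ _

/-- The labels of the blocks. -/
abbrev BlockIndex (n : ℕ) (deg : Fin k → ℕ) : Type :=
  ↥((types n k).sigma fun m => Fintype.piFinset fun j => diagrams (m j) (deg j))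

namespace BlockIndex

variable (b : BlockIndex n deg)

theorem sum_eq : ∑ j, b.1.1 j = n := by
  have h : b.1.1 ∈ Finset.piAntidiag Finset.univ n := (Finset.mem_sigma.1 b.2).1
  exact (Finset.mem_piAntidiag.1 h).1

theorem eq_sum (j : Fin k) : b.1.1 j = ∑ i, b.1.2 j i :=
  (mem_diagrams.1 (Fintype.mem_piFinset.1 (Finset.mem_sigma.1 b.2).2 j)).1.symm

theorem antitone (j : Fin k) : Antitone (b.1.2 j) :=
  (mem_diagrams.1 (Fintype.mem_piFinset.1 (Finset.mem_sigma.1 b.2).2 j)).2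

end BlockIndex

theorem exists_eq_place (x : Fin n → Site r deg) :
    ∃ (m : Fin k → ℕ) (e : (Σ j, Fin (m j)) ≃ Fin n) (a : ∀ j, Fin (m j) → Fin (r j))
      (b : ∀ j, Fin (m j) → Fin (deg j)), x = place e a b := by
  let e : (Σ j, Fin (Fintype.card {p // (x p).1 = j})) ≃ Fin n :=
    (Equiv.sigmaCongrRight fun j => (Fintype.equivFin {p // (x p).1 = j}).symm).trans
      (Equiv.sigmaFiberEquiv fun p => (x p).1)
  have h : ∀ q, (x (e q)).1 = q.1 := fun q =>
    ((Fintype.equivFin {p // (x p).1 = q.1}).symm q.2).2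
  have h1 : ∀ q : Σ j, Fin (Fintype.card {p // (x p).1 = j}), ∃ ab : Fin (r q.1) × Fin (deg q.1),
      x (e q) = ⟨q.1, ab⟩ := by
    intro q
    have h2 := h q
    generalize x (e q) = y at h2 ⊢
    obtain ⟨j, ab⟩ := y
    dsimp only at h2
    subst h2
    exact ⟨ab, rfl⟩
  choose ab hab using h1
  exact ⟨_, e, fun j i => (ab ⟨j, i⟩).1, fun j i => (ab ⟨j, i⟩).2, eq_place_iff.2 hab⟩

/-- Sorting the systems by type makes every basis tensor a placed product vector. Its multiplicity
part is then expanded, type by type, by `iSup_schurWeylSummand`. -/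
theorem iSup_blockSpace (n : ℕ) (r deg : Fin k → ℕ) :
    ⨆ b : BlockIndex n deg, blockSpace n r b.1.1 b.1.2 = ⊤ := by
  rw [eq_top_iff]
  intro z _
  have hz : z = ∑ x, z x • EuclideanSpace.single x (1 : ℂ) := by
    ext b
    simp [Pi.single_apply]
  rw [hz]
  refine Submodule.sum_mem _ fun x _ => Submodule.smul_mem _ _ ?_
  obtain ⟨m, e, a, b, rfl⟩ := exists_eq_place x
  have h1 : EuclideanSpace.single (place e a b) (1 : ℂ) = Matrix.toEuclideanLin
      (placeMatrix deg e a) (EuclideanSpace.single b (1 : ℂ)) := by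
    ext y
    rw [toEuclideanLin_apply', Finset.sum_eq_single b]
    · simp [placeMatrix_apply]
    · intro b' _ hb'
      simp [hb']
    · simp
  have h2 : ∀ j, ∃ w : (Fin (deg j) → ℕ) → EuclideanSpace ℂ (Fin (m j) → Fin (deg j)),
      (∀ lam, w lam ∈ schurWeylSummand (Fin (m j)) lam) ∧
        EuclideanSpace.single (b j) (1 : ℂ) = ∑ lam ∈ diagrams (m j) (deg j), w lam := by
    intro j
    have h3 : EuclideanSpace.single (b j) (1 : ℂ) ∈
        ⨆ lam ∈ diagrams (m j) (deg j), schurWeylSummand (Fin (m j)) lam := by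
      rw [iSup_schurWeylSummand]
      trivial
    rw [Submodule.mem_iSup_finset_iff_exists_sum] at h3
    obtain ⟨w, hw⟩ := h3
    exact ⟨fun lam => w lam, fun lam => (w lam).2, hw.symm⟩
  choose w hw hw' using h2
  rw [h1, single_eq_productVector]
  have h4 : (fun j => EuclideanSpace.single (b j) (1 : ℂ)) =
      fun j => ∑ lam ∈ diagrams (m j) (deg j), w j lam := funext hw'
  rw [h4, productVector_sum, map_sum]
  refine Submodule.sum_mem _ fun lam hlam => ?_
  have hm : m ∈ types n k := by
    rw [types, Finset.mem_piAntidiag]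
    have := Fintype.card_congr e
    simpa using this
  refine Submodule.mem_iSup_of_mem ⟨⟨m, lam⟩, Finset.mem_sigma.2 ⟨hm, hlam⟩⟩ ?_
  rw [← placedVector_single]
  exact Submodule.subset_span ⟨e, _, _, fun j => hw j (lam j), rfl⟩

/-- The block structure of the local family. -/
noncomputable def localBlocks (n : ℕ) (r deg : Fin k → ℕ) (hr : ∀ j, 0 < r j) :
    (localFamily n r deg).Blocks (BlockIndex n deg) where
  e b := minimalProj r b.eq_sum hr b.sum_eq
  D b := blockDim r b.1.1 b.1.2
  χ b := compressCoeff b.eq_sum hr b.sum_eq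
  D_pos b := blockDim_pos hr _
  idem b := minimalProj_mul_self b.eq_sum b.antitone hr b.sum_eq
  selfAdjoint b := minimalProj_conjTranspose b.eq_sum hr b.sum_eq
  comm b Z hZ := by
    rw [minimalProj_eq_sum, Finset.sum_mul, Finset.mul_sum]
    refine Finset.sum_congr rfl fun s _ => ?_
    rw [smul_mul_assoc, mul_smul_comm]
    congr 1
    exact hZ _
  compress b a := minimalProj_compress b.eq_sum b.antitone hr b.sum_eq a
  orth b b' a hne := minimalProj_orth b.eq_sum b'.eq_sum b.antitone b'.antitone hr b.sum_eq
    b'.sum_eq (fun h => hne (Subtype.ext (Sigma.ext h.1 (heq_of_eq h.2)))) a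
  sum_χ b := sum_compressCoeff b.eq_sum b.antitone hr b.sum_eq
  complete := by
    rw [← iSup_blockSpace n r deg]
    exact iSup_congr fun b =>
      iSup_range_twirlOp_mul_minimalProj b.eq_sum b.antitone hr b.sum_eq

theorem localBlocks_P (hr : ∀ j, 0 < r j) (b : BlockIndex n deg) :
    (localBlocks n r deg hr).P b = projMatrix (blockSpace n r b.1.1 b.1.2) :=
  eq_projMatrix ((localBlocks n r deg hr).P_mul_self b) ((localBlocks n r deg hr).P_selfAdjoint b)
    (((localBlocks n r deg hr).range_P b).trans
      (iSup_range_twirlOp_mul_minimalProj b.eq_sum b.antitone hr b.sum_eq))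

end Blocks

/-! ### Traces of the minimal projections -/

section SchurValues

variable {ι : Type*} [Fintype ι] [DecidableEq ι] {d : ℕ} {lam : Fin d → ℕ}

theorem trace_eq_finrank_range {I : Type*} [Fintype I] [DecidableEq I] {A : Matrix I I ℂ}
    (hA : A * A = A) :
    A.trace = (Module.finrank ℂ (LinearMap.range (Matrix.toEuclideanLin A)) : ℂ) := by
  have h1 : IsIdempotentElem (Matrix.toEuclideanLin A) := by
    rw [IsIdempotentElem]
    refine LinearMap.ext fun v => ?_
    rw [Module.End.mul_apply, ← toEuclideanLin_mul_apply, hA]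
  rw [← (LinearMap.IsIdempotentElem.isProj_range _ h1).trace]
  exact (Matrix.trace_toLin_eq A (PiLp.basisFun 2 ℂ I)).symm

/-- The idempotent and the symmetrizer are left multiples of each other in range, and the trace of
an idempotent is its rank. -/
theorem trace_youngIdem (T : ι ≃ Boxes lam) (hlam : Antitone lam) :
    (groupAlgebraOp (Fin d) (youngIdem T)).trace = (Module.finrank ℂ (LinearMap.range
      (Matrix.toEuclideanLin (groupAlgebraOp (Fin d) (youngSymmetrizer T)))) : ℂ) := by
  have h : LinearMap.range (Matrix.toEuclideanLin (groupAlgebraOp (Fin d) (youngIdem T))) =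
      LinearMap.range (Matrix.toEuclideanLin (groupAlgebraOp (Fin d) (youngSymmetrizer T))) := by
    apply le_antisymm
    · rw [youngIdem, ← mul_smul_comm, groupAlgebraOp_mul]
      exact range_mul_le _ _
    · rw [← youngIdem_mul_youngSymmetrizer T hlam, groupAlgebraOp_mul]
      exact range_mul_le _ _
  rw [trace_eq_finrank_range (by rw [← groupAlgebraOp_mul, youngIdem_mul_self T hlam]), h]

theorem trace_youngIdem_numbering {m : ℕ} (h : m = ∑ i, lam i) (hlam : Antitone lam) :
    (groupAlgebraOp (Fin d) (youngIdem (numbering lam h))).trace =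
      (Module.finrank ℂ (irrepUnitary lam) : ℂ) := by
  subst h
  exact trace_youngIdem _ hlam

/-- Homogeneity is visible in the trace formula, where every term has one factor for each box. -/
theorem eval_schurPoly_smul (T : ι ≃ Boxes lam) (hlam : Antitone lam) (c : ℝ) (t : Fin d → ℝ) :
    MvPolynomial.eval (fun i => c * t i) (schurPoly lam) =
      c ^ Fintype.card ι * MvPolynomial.eval t (schurPoly lam) := by
  have h1 := sum_youngIdem_mul_prod T hlam t
  have h2 := sum_youngIdem_mul_prod T hlam fun i => c * t i
  have h3 : (MvPolynomial.eval (fun i => c * t i) (schurPoly lam) : ℂ) =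
      (c : ℂ) ^ Fintype.card ι * (MvPolynomial.eval t (schurPoly lam) : ℝ) := by
    rw [← h1, ← h2, Finset.mul_sum]
    refine Finset.sum_congr rfl fun x _ => ?_
    push_cast
    rw [Finset.prod_mul_distrib, Finset.prod_const, Finset.card_univ]
    ring
  exact_mod_cast h3

theorem eval_schurPoly_nonneg (T : ι ≃ Boxes lam) (hlam : Antitone lam) {t : Fin d → ℝ}
    (ht : ∀ i, 0 ≤ t i) : 0 ≤ MvPolynomial.eval t (schurPoly lam) := by
  have h1 := sum_youngIdem_mul_prod T hlam t
  have h2 : (0 : ℂ) ≤ ((MvPolynomial.eval t (schurPoly lam) : ℝ) : ℂ) := by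
    rw [← h1]
    refine Finset.sum_nonneg fun x _ => mul_nonneg ((youngIdem_op_posSemidef T hlam).diag_nonneg)
      (Finset.prod_nonneg fun p _ => ?_)
    exact_mod_cast ht _
  exact_mod_cast h2

end SchurValues

/-! ### Traces against the i.i.d. state and the prefactors -/

section Blocks

variable {n k : ℕ} {r deg m : Fin k → ℕ} {lam : ∀ j, Fin (deg j) → ℕ}

theorem trace_minimalProj_mul (hl : ∀ j, m j = ∑ i, lam j i) (hr : ∀ j, 0 < r j)
    (hm : ∑ j, m j = n) (M : Matrix (Fin n → Site r deg) (Fin n → Site r deg) ℂ) :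
    (minimalProj r hl hr hm * M).trace = (youngTensor lam hl *
      ((placeMatrix deg (slotEquiv m hm) (fun j _ => (⟨0, hr j⟩ : Fin (r j))))ᴴ * M *
        placeMatrix deg (slotEquiv m hm) (fun j _ => (⟨0, hr j⟩ : Fin (r j))))).trace := by
  rw [minimalProj, Matrix.mul_assoc, Matrix.mul_assoc, Matrix.trace_mul_comm]
  simp only [Matrix.mul_assoc]

theorem trace_minimalProj (hl : ∀ j, m j = ∑ i, lam j i) (hlam : ∀ j, Antitone (lam j))
    (hr : ∀ j, 0 < r j) (hm : ∑ j, m j = n) :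
    (minimalProj r hl hr hm).trace = ∏ j, (Module.finrank ℂ (irrepUnitary (lam j)) : ℂ) := by
  have h := trace_minimalProj_mul hl hr hm 1
  rw [mul_one, Matrix.mul_one, placeMatrix_star_mul_self, Matrix.mul_one] at h
  rw [h, youngTensor, trace_piTensor]
  exact Finset.prod_congr rfl fun j _ => trace_youngIdem_numbering _ (hlam j)

/-- The operator `⨁_j (1 / r_j) ⊗ diag t_j`. -/
noncomputable def siteDiag (r : Fin k → ℕ) (t : ∀ j, Fin (deg j) → ℝ) :
    Matrix (Site r deg) (Site r deg) ℂ :=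
  Matrix.diagonal fun x => ((r x.1 : ℂ))⁻¹ * (t x.1 x.2.2 : ℂ)

/-- In a fixed placement the diagonal tensor power stays diagonal and factorises over the types.
Each type leaves r_j^{-m_j} and the trace of a Young idempotent against diag(t_j)^{⊗m_j}, which is a
Schur polynomial. -/
theorem trace_minimalProj_mul_siteDiag (hl : ∀ j, m j = ∑ i, lam j i)
    (hlam : ∀ j, Antitone (lam j)) (hr : ∀ j, 0 < r j) (hm : ∑ j, m j = n)
    (t : ∀ j, Fin (deg j) → ℝ) :
    (minimalProj r hl hr hm * tensorMatrix fun _ : Fin n => siteDiag r t).trace =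
      ((∏ j, ((r j : ℝ) ^ m j)⁻¹ * MvPolynomial.eval (t j) (schurPoly (lam j)) : ℝ) : ℂ) := by
  have h1 : (placeMatrix deg (slotEquiv m hm) (fun j _ => (⟨0, hr j⟩ : Fin (r j))))ᴴ *
      (tensorMatrix fun _ : Fin n => siteDiag r t) *
        placeMatrix deg (slotEquiv m hm) (fun j _ => (⟨0, hr j⟩ : Fin (r j))) =
      Matrix.diagonal fun b => ∏ j, ((r j : ℂ) ^ m j)⁻¹ * ∏ i, (t j (b j i) : ℂ) := by
    ext b b'
    rw [conj_placeMatrix_apply, tensorMatrix_apply, ← Equiv.prod_comp (slotEquiv m hm)]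
    simp only [place_apply, siteDiag]
    by_cases h : b = b'
    · subst h
      simp only [Matrix.diagonal_apply_eq, Fintype.prod_sigma, Finset.prod_mul_distrib,
        Finset.prod_const, Finset.card_univ, Fintype.card_fin, inv_pow]
    · rw [Matrix.diagonal_apply_ne _ h]
      obtain ⟨j, hj⟩ := Function.ne_iff.1 h
      obtain ⟨i, hi⟩ := Function.ne_iff.1 hj
      refine Finset.prod_eq_zero (Finset.mem_univ ⟨j, i⟩) (Matrix.diagonal_apply_ne _ ?_)
      simpa using hi
  rw [trace_minimalProj_mul, h1, Matrix.trace]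
  simp only [Matrix.diag_apply, Matrix.mul_diagonal, youngTensor, piTensor_apply,
    ← Finset.prod_mul_distrib]
  rw [← Fintype.piFinset_univ, ← Finset.prod_univ_sum (fun _ => Finset.univ)
    fun j b => groupAlgebraOp (Fin (deg j)) (youngIdem (numbering (lam j) (hl j))) b b *
      (((r j : ℂ) ^ m j)⁻¹ * ∏ i, (t j (b i) : ℂ))]
  push_cast
  refine Finset.prod_congr rfl fun j _ => ?_
  rw [← sum_youngIdem_mul_prod (numbering (lam j) (hl j)) (hlam j), Finset.mul_sum]
  exact Finset.sum_congr rfl fun x _ => by ring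

/-- The product of the prefactors is the ratio of the traces. -/
theorem prefactor_mul_trace (hl : ∀ j, m j = ∑ i, lam j i)
    (hlam : ∀ j, Antitone (lam j)) (hr : ∀ j, 0 < r j) (hm : ∑ j, m j = n) :
    fc m * (∏ j, fq (lam j)) * (blockDim r m lam *
      ∏ j, ((r j : ℝ) ^ m j)⁻¹ *
        MvPolynomial.eval (fun i => (lam j i : ℝ) / n) (schurPoly (lam j))) =
      ∏ j, (Module.finrank ℂ (irrepUnitary (lam j)) : ℝ) := by
  -- Homogeneity splits off (m_j / n)^{m_j}, which cancels against the multinomial probability in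
  -- `fc`, and leaves the Schur value at lam_j / m_j that occurs in `fq`. For m_j = 0 all row
  -- lengths vanish, so division by zero does no harm.
  have h1 : ∀ j, MvPolynomial.eval (fun i => (lam j i : ℝ) / n) (schurPoly (lam j)) =
      ((m j : ℝ) / n) ^ m j *
        MvPolynomial.eval (fun i => (lam j i : ℝ) / (m j : ℝ)) (schurPoly (lam j)) := by
    intro j
    have h2 := eval_schurPoly_smul (numbering (lam j) (hl j)) (hlam j) ((m j : ℝ) / n)
      fun i => (lam j i : ℝ) / (m j : ℝ)
    rw [Fintype.card_fin] at h2
    rw [← h2]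
    congr 2
    funext i
    by_cases h0 : m j = 0
    · have h3 : lam j i = 0 := by
        have := hl j
        rw [h0, eq_comm, Finset.sum_eq_zero_iff] at this
        exact this i (Finset.mem_univ i)
      simp [h0, h3]
    · have h0' : (m j : ℝ) ≠ 0 := by exact_mod_cast h0
      field_simp
  have hs : ∀ j, MvPolynomial.eval (fun i => (lam j i : ℝ) / (m j : ℝ)) (schurPoly (lam j)) ≠ 0 := by
    intro j
    refine (eval_schurPoly_pos (numbering (lam j) (hl j)) (hlam j) (fun i => by positivity)
      fun i hi => ?_).ne'
    have h4 : lam j i ≤ m j := by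
      rw [hl j]
      exact Finset.single_le_sum (f := lam j) (fun _ _ => Nat.zero_le _) (Finset.mem_univ i)
    have h5 : 0 < lam j i := Nat.pos_of_ne_zero hi
    exact div_pos (by exact_mod_cast h5) (by exact_mod_cast h5.trans_le h4)
  -- For an absent type this is the convention 0 ^ 0 = 1.
  have hp : ∀ j, ((m j : ℝ) / n) ^ m j ≠ 0 := by
    intro j
    by_cases h0 : m j = 0
    · simp [h0]
    · have h4 : m j ≤ n := by
        rw [← hm]
        exact Finset.single_le_sum (f := m) (fun _ _ => Nat.zero_le _) (Finset.mem_univ j)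
      have h5 : 0 < m j := Nat.pos_of_ne_zero h0
      exact (pow_pos (div_pos (by exact_mod_cast h5) (by exact_mod_cast h5.trans_le h4)) _).ne'
  have hV : ∀ j, (Module.finrank ℂ (irrepSym (lam j)) : ℝ) ≠ 0 := by
    intro j
    rw [← finrank_irrepSym rfl]
    exact_mod_cast (symDim_pos _).ne'
  have hR : ∀ j, ((r j : ℝ) ^ m j) ≠ 0 := fun j => pow_ne_zero _ (by exact_mod_cast (hr j).ne')
  simp only [h1, fc, fq, multinomialPdf, blockDim, ← hl, hm, Finset.prod_mul_distrib,
    Finset.prod_div_distrib, mul_inv, Finset.prod_inv_distrib]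
  have e1 := Finset.prod_ne_zero_iff.2 fun j (_ : j ∈ Finset.univ) => hs j
  have e2 := Finset.prod_ne_zero_iff.2 fun j (_ : j ∈ Finset.univ) => hp j
  have e3 := Finset.prod_ne_zero_iff.2 fun j (_ : j ∈ Finset.univ) => hV j
  have e4 := Finset.prod_ne_zero_iff.2 fun j (_ : j ∈ Finset.univ) => hR j
  have e5 : (n.factorial : ℝ) ≠ 0 := by exact_mod_cast n.factorial_ne_zero
  have e6 : (∏ j, ((m j).factorial : ℝ)) ≠ 0 :=
    Finset.prod_ne_zero_iff.2 fun j _ => by exact_mod_cast (m j).factorial_ne_zero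
  generalize (∏ j, MvPolynomial.eval (fun i => (lam j i : ℝ) / (m j : ℝ)) (schurPoly (lam j))) = x1
    at *
  generalize (∏ j, ((m j : ℝ) / n) ^ m j) = x2 at *
  generalize (∏ j, (Module.finrank ℂ (irrepSym (lam j)) : ℝ)) = x3 at *
  generalize (∏ j, ((r j : ℝ) ^ m j)) = x4 at *
  generalize (∏ j, ((m j).factorial : ℝ)) = x6 at *
  field_simp

theorem prefactor_nonneg (hl : ∀ j, m j = ∑ i, lam j i)
    (hlam : ∀ j, Antitone (lam j)) : 0 ≤ fc m * ∏ j, fq (lam j) := by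
  refine mul_nonneg ?_ (Finset.prod_nonneg fun j _ => ?_)
  · rw [fc, multinomialPdf]
    positivity
  · rw [fq]
    refine div_nonneg (Nat.cast_nonneg _) (mul_nonneg ?_ (Nat.cast_nonneg _))
    exact eval_schurPoly_nonneg (numbering (lam j) (hl j)) (hlam j) fun i => by positivity

end Blocks

/-! ### Operators on the multiplicity spaces -/

section BlockOp

variable {k : ℕ} {r deg : Fin k → ℕ}

/-- The operator `⨁_j 1 ⊗ B_j`. -/
noncomputable def blockOp (r : Fin k → ℕ) (B : ∀ j, Matrix (Fin (deg j)) (Fin (deg j)) ℂ) :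
    Matrix (Site r deg) (Site r deg) ℂ :=
  Matrix.blockDiagonal' fun j => (1 : Matrix (Fin (r j)) (Fin (r j)) ℂ) ⊗ₖ B j

theorem blockOp_mul (B C : ∀ j, Matrix (Fin (deg j)) (Fin (deg j)) ℂ) :
    blockOp r B * blockOp r C = blockOp r fun j => B j * C j := by
  rw [blockOp, blockOp, ← Matrix.blockDiagonal'_mul]
  simp only [← Matrix.mul_kronecker_mul, mul_one]
  rfl

theorem blockOp_apply_same (B : ∀ j, Matrix (Fin (deg j)) (Fin (deg j)) ℂ) (j : Fin k)
    (a a' : Fin (r j)) (s s' : Fin (deg j)) :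
    blockOp r B ⟨j, a, s⟩ ⟨j, a', s'⟩ = if a = a' then B j s s' else 0 := by
  simp [blockOp, Matrix.blockDiagonal'_apply, Matrix.one_apply]

theorem blockOp_apply_ne (B : ∀ j, Matrix (Fin (deg j)) (Fin (deg j)) ℂ) {x y : Site r deg}
    (h : x.1 ≠ y.1) : blockOp r B x y = 0 := by
  simp [blockOp, Matrix.blockDiagonal'_apply, h]

theorem blockOp_diagonal (t : ∀ j, Fin (deg j) → ℂ) :
    blockOp r (fun j => Matrix.diagonal (t j)) =
      Matrix.diagonal fun x : Site r deg => t x.1 x.2.2 := by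
  ext ⟨j, a, s⟩ ⟨j', a', s'⟩
  by_cases h : j = j'
  · subst h
    rw [blockOp_apply_same, Matrix.diagonal_apply, Matrix.diagonal_apply]
    by_cases h1 : a = a' <;> by_cases h2 : s = s' <;> simp [h1, h2]
  · rw [blockOp_apply_ne _ h, Matrix.diagonal_apply_ne]
    simp [h]

theorem blockOp_one : blockOp r (fun j => (1 : Matrix (Fin (deg j)) (Fin (deg j)) ℂ)) = 1 := by
  have h := blockOp_diagonal (r := r) (deg := deg) fun _ _ => 1
  simpa using h

/-- `blockOp` as a linear map. -/
noncomputable def blockOpLin (r : Fin k → ℕ) :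
    (∀ j, Matrix (Fin (deg j)) (Fin (deg j)) ℂ) →ₗ[ℂ] Matrix (Site r deg) (Site r deg) ℂ where
  toFun := blockOp r
  map_add' B C := by
    ext ⟨j, a, s⟩ ⟨j', a', s'⟩
    rw [Matrix.add_apply]
    by_cases h : j = j'
    · subst h
      rw [blockOp_apply_same, blockOp_apply_same, blockOp_apply_same]
      by_cases h1 : a = a' <;> simp [h1]
    · rw [blockOp_apply_ne _ h, blockOp_apply_ne _ h, blockOp_apply_ne _ h, add_zero]
  map_smul' z B := by
    ext ⟨j, a, s⟩ ⟨j', a', s'⟩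
    rw [Matrix.smul_apply]
    by_cases h : j = j'
    · subst h
      rw [blockOp_apply_same, blockOp_apply_same]
      by_cases h1 : a = a' <;> simp [h1]
    · rw [blockOp_apply_ne _ h, blockOp_apply_ne _ h, smul_zero]

theorem blockOpLin_apply (B : ∀ j, Matrix (Fin (deg j)) (Fin (deg j)) ℂ) :
    blockOpLin r B = blockOp r B := rfl

theorem siteUnit_mul_apply (j : Fin k) (a b : Fin (r j)) (M : Matrix (Site r deg) (Site r deg) ℂ)
    (s : Fin (deg j)) (y : Site r deg) :
    (siteUnit deg ⟨j, a, b⟩ * M) ⟨j, a, s⟩ y = M ⟨j, b, s⟩ y := by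
  rw [Matrix.mul_apply, Finset.sum_eq_single ⟨j, b, s⟩]
  · rw [siteUnit_apply, if_pos rfl, one_mul]
  · intro x _ hx
    by_contra hne
    obtain ⟨t, h1, h2⟩ := siteUnit_apply_of_ne_zero (left_ne_zero_of_mul hne)
    simp only [Sigma.mk.injEq, heq_eq_eq, Prod.mk.injEq, true_and] at h1
    subst h1
    exact hx h2
  · simp

theorem siteUnit_mul_apply_ne (f : UnitLabel r) (M : Matrix (Site r deg) (Site r deg) ℂ)
    (x y : Site r deg) (h : (⟨x.1, x.2.1⟩ : Σ j, Fin (r j)) ≠ ⟨f.1, f.2.1⟩) :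
    (siteUnit deg f * M) x y = 0 := by
  rw [Matrix.mul_apply]
  refine Finset.sum_eq_zero fun z _ => ?_
  by_contra hne
  obtain ⟨t, h1, h2⟩ := siteUnit_apply_of_ne_zero (left_ne_zero_of_mul hne)
  subst h1
  exact h rfl

theorem mul_siteUnit_apply (j : Fin k) (a b : Fin (r j)) (M : Matrix (Site r deg) (Site r deg) ℂ)
    (s : Fin (deg j)) (x : Site r deg) :
    (M * siteUnit deg ⟨j, a, b⟩) x ⟨j, b, s⟩ = M x ⟨j, a, s⟩ := by
  have h := siteUnit_mul_apply j b a Mᴴ s x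
  rw [← siteUnit_conjTranspose, ← Matrix.conjTranspose_mul, Matrix.conjTranspose_apply,
    Matrix.conjTranspose_apply] at h
  exact star_injective h

theorem mul_siteUnit_apply_ne (f : UnitLabel r) (M : Matrix (Site r deg) (Site r deg) ℂ)
    (x y : Site r deg) (h : (⟨y.1, y.2.1⟩ : Σ j, Fin (r j)) ≠ ⟨f.1, f.2.2⟩) :
    (M * siteUnit deg f) x y = 0 := by
  rw [Matrix.mul_apply]
  refine Finset.sum_eq_zero fun z _ => ?_
  by_contra hne
  obtain ⟨t, h1, h2⟩ := siteUnit_apply_of_ne_zero (right_ne_zero_of_mul hne)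
  subst h2
  exact h rfl

theorem siteUnit_mul_blockOp (f : UnitLabel r)
    (B : ∀ j, Matrix (Fin (deg j)) (Fin (deg j)) ℂ) :
    siteUnit deg f * blockOp r B = blockOp r B * siteUnit deg f := by
  obtain ⟨j, a, b⟩ := f
  ext x y
  by_cases hx : (⟨x.1, x.2.1⟩ : Σ j, Fin (r j)) = ⟨j, a⟩
  · obtain ⟨jx, ax, sx⟩ := x
    simp only [Sigma.mk.injEq] at hx
    obtain ⟨rfl, hx⟩ := hx
    simp only [heq_eq_eq] at hx
    subst hx
    rw [siteUnit_mul_apply]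
    by_cases hy : (⟨y.1, y.2.1⟩ : Σ j, Fin (r j)) = ⟨jx, b⟩
    · obtain ⟨jy, ay, sy⟩ := y
      simp only [Sigma.mk.injEq] at hy
      obtain ⟨rfl, hy⟩ := hy
      simp only [heq_eq_eq] at hy
      subst hy
      rw [mul_siteUnit_apply, blockOp_apply_same, blockOp_apply_same, if_pos rfl, if_pos rfl]
    · rw [mul_siteUnit_apply_ne _ _ _ _ hy]
      obtain ⟨jy, ay, sy⟩ := y
      by_cases hj : jx = jy
      · subst hj
        rw [blockOp_apply_same, if_neg]
        rintro rfl
        exact hy rfl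
      · exact blockOp_apply_ne _ hj
  · rw [siteUnit_mul_apply_ne _ _ _ _ hx]
    by_cases hy : (⟨y.1, y.2.1⟩ : Σ j, Fin (r j)) = ⟨j, b⟩
    · obtain ⟨jy, ay, sy⟩ := y
      simp only [Sigma.mk.injEq] at hy
      obtain ⟨rfl, hy⟩ := hy
      simp only [heq_eq_eq] at hy
      subst hy
      rw [mul_siteUnit_apply]
      obtain ⟨jx, ax, sx⟩ := x
      by_cases hj : jx = jy
      · subst hj
        rw [blockOp_apply_same, if_neg]
        rintro rfl
        exact hx rfl
      · exact (blockOp_apply_ne _ hj).symm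
    · rw [mul_siteUnit_apply_ne _ _ _ _ hy]

/-- Commuting with the units |a⟩⟨a| kills entries between different (j, a); commuting with |0⟩⟨a|
identifies the remaining diagonal blocks of type j with the one at index 0. -/
theorem exists_eq_blockOp (hr : ∀ j, 0 < r j) {M : Matrix (Site r deg) (Site r deg) ℂ}
    (hM : ∀ f, siteUnit deg f * M = M * siteUnit deg f) : ∃ B, M = blockOp r B := by
  refine ⟨fun j => Matrix.of fun s s' => M ⟨j, ⟨0, hr j⟩, s⟩ ⟨j, ⟨0, hr j⟩, s'⟩, ?_⟩
  have hne : ∀ (x y : Site r deg), (⟨x.1, x.2.1⟩ : Σ j, Fin (r j)) ≠ ⟨y.1, y.2.1⟩ → M x y = 0 := by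
    rintro ⟨j, a, s⟩ y hxy
    have h := congrFun (congrFun (hM ⟨j, a, a⟩) ⟨j, a, s⟩) y
    rwa [siteUnit_mul_apply, mul_siteUnit_apply_ne _ _ _ _ hxy.symm] at h
  ext ⟨j, a, s⟩ ⟨j', a', s'⟩
  by_cases hj : j = j'
  · subst hj
    rw [blockOp_apply_same]
    split_ifs with ha
    · subst ha
      have h := congrFun (congrFun (hM ⟨j, ⟨0, hr j⟩, a⟩) ⟨j, ⟨0, hr j⟩, s⟩) ⟨j, a, s'⟩
      rwa [siteUnit_mul_apply, mul_siteUnit_apply] at h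
    · refine hne _ _ fun h => ha ?_
      simpa using h
  · rw [blockOp_apply_ne _ hj]
    exact hne _ _ fun h => hj (congrArg Sigma.fst h)

end BlockOp

/-! ### Polarization -/

section Polarization

variable {n : ℕ} {κ : Type*} [Fintype κ] [DecidableEq κ]

/-- Inclusion–exclusion: the power for T expands over the maps g : Fin n → Fin n whose image avoids
T, and the alternating sum over T retains only surjective g, i.e. permutations. -/
theorem sum_tensorMatrix_perm (X : Fin n → Matrix κ κ ℂ) :
    ∑ σ : Equiv.Perm (Fin n), tensorMatrix (fun p => X (σ p)) =
      ∑ T : Finset (Fin n), ((-1 : ℤ) ^ T.card) • tensorMatrix fun _ : Fin n => ∑ p ∈ Tᶜ, X p := by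
  have h1 : ∀ T : Finset (Fin n), tensorMatrix (fun _ : Fin n => ∑ p ∈ Tᶜ, X p) =
      ∑ g : Fin n → Fin n, if T ⊆ (Finset.univ.image g)ᶜ then tensorMatrix (fun p => X (g p))
        else 0 := by
    intro T
    have h2 : ∀ p, ∑ p ∈ Tᶜ, X p =
        ∑ q : Fin n, (fun (_ q : Fin n) => if q ∈ Tᶜ then X q else 0) p q := by
      intro p
      rw [← Finset.sum_filter]
      congr 1
      ext q
      simp
    rw [funext h2, tensorMatrix_sum]
    refine Finset.sum_congr rfl fun g _ => ?_
    split_ifs with h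
    · congr 1
      funext p
      rw [if_pos]
      rw [Finset.mem_compl]
      intro hp
      have := Finset.mem_compl.1 (h hp)
      exact this (Finset.mem_image_of_mem g (Finset.mem_univ p))
    · rw [Finset.not_subset] at h
      obtain ⟨q, hq, hq'⟩ := h
      rw [Finset.mem_compl, not_not, Finset.mem_image] at hq'
      obtain ⟨p, -, rfl⟩ := hq'
      ext x y
      rw [tensorMatrix_apply, Finset.prod_eq_zero (Finset.mem_univ p)]
      · rfl
      · rw [if_neg (by simpa using hq)]
        rfl
  simp only [h1, Finset.smul_sum]
  rw [Finset.sum_comm]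
  have h3 : ∀ g : Fin n → Fin n, ∑ T : Finset (Fin n), ((-1 : ℤ) ^ T.card) •
      (if T ⊆ (Finset.univ.image g)ᶜ then tensorMatrix (fun p => X (g p)) else 0) =
        if Function.Bijective g then tensorMatrix (fun p => X (g p)) else 0 := by
    intro g
    have h4 : ∑ T : Finset (Fin n), ((-1 : ℤ) ^ T.card) •
        (if T ⊆ (Finset.univ.image g)ᶜ then tensorMatrix (fun p => X (g p)) else 0) =
        (∑ T ∈ ((Finset.univ.image g)ᶜ).powerset, (-1 : ℤ) ^ T.card) •
          tensorMatrix (fun p => X (g p)) := by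
      rw [Finset.sum_smul, ← Finset.sum_filter_add_sum_filter_not Finset.univ
        fun T => T ⊆ (Finset.univ.image g)ᶜ]
      rw [Finset.sum_congr rfl fun T hT => by rw [if_pos (Finset.mem_filter.1 hT).2],
        Finset.sum_eq_zero (s := Finset.univ.filter fun T => ¬ T ⊆ (Finset.univ.image g)ᶜ)
          fun T hT => by rw [if_neg (Finset.mem_filter.1 hT).2, smul_zero], add_zero]
      refine Finset.sum_congr ?_ fun _ _ => rfl
      ext T
      simp [Finset.mem_powerset]
    rw [h4, Finset.sum_powerset_neg_one_pow_card]
    have h5 : (Finset.univ.image g)ᶜ = ∅ ↔ Function.Bijective g := by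
      rw [Finset.compl_eq_empty_iff, ← Finite.surjective_iff_bijective]
      simp [Finset.eq_univ_iff_forall, Function.Surjective]
    by_cases h6 : Function.Bijective g
    · rw [if_pos (h5.2 h6), if_pos h6, one_smul]
    · rw [if_neg (fun h => h6 (h5.1 h)), if_neg h6, zero_smul]
  simp only [h3]
  rw [← Finset.sum_filter]
  refine Finset.sum_bij' (fun σ _ => (σ : Fin n → Fin n))
    (fun g hg => Equiv.ofBijective g (Finset.mem_filter.1 hg).2) ?_ ?_ ?_ ?_ ?_
  · intro σ _
    exact Finset.mem_filter.2 ⟨Finset.mem_univ _, σ.bijective⟩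
  · intros
    exact Finset.mem_univ _
  · intros
    ext
    rfl
  · intros
    rfl
  · intros
    rfl

end Polarization

/-! ### Operators commuting with all tensor powers of block unitaries -/

section Commutant

variable {n k : ℕ} {r deg : Fin k → ℕ}

/-- The tensor power of `⨁_j 1 ⊗ B_j`. -/
noncomputable def blockPow (n : ℕ) (r : Fin k → ℕ)
    (B : ∀ j, Matrix (Fin (deg j)) (Fin (deg j)) ℂ) :
    Matrix (Fin n → Site r deg) (Fin n → Site r deg) ℂ :=
  tensorMatrix fun _ => blockOp r B

theorem blockPow_mul (B C : ∀ j, Matrix (Fin (deg j)) (Fin (deg j)) ℂ) :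
    blockPow n r B * blockPow n r C = blockPow n r fun j => B j * C j := by
  rw [blockPow, blockPow, tensorMatrix_mul]
  simp only [blockOp_mul]
  rfl

theorem blockPow_one :
    blockPow n r (fun j => (1 : Matrix (Fin (deg j)) (Fin (deg j)) ℂ)) = 1 := by
  rw [blockPow, blockOp_one, tensorMatrix_one]

theorem blockPow_diagonal (t : ∀ j, Fin (deg j) → ℂ) :
    blockPow n r (fun j => Matrix.diagonal (t j)) =
      Matrix.diagonal fun x : Fin n → Site r deg => ∏ p, t (x p).1 (x p).2.2 := by
  ext x y
  rw [blockPow, tensorMatrix_apply, blockOp_diagonal]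
  by_cases h : x = y
  · subst h
    simp only [Matrix.diagonal_apply_eq]
  · rw [Matrix.diagonal_apply_ne _ h]
    obtain ⟨p, hp⟩ := Function.ne_iff.1 h
    exact Finset.prod_eq_zero (Finset.mem_univ p) (Matrix.diagonal_apply_ne _ hp)

theorem blockPow_mem (B : ∀ j, Matrix (Fin (deg j)) (Fin (deg j)) ℂ) :
    (localFamily n r deg).Mem (blockPow n r B) := by
  rw [localFamily_mem_iff]
  refine ⟨fun σ => permOp_mul_tensorMatrix σ _, fun f => ?_⟩
  rw [unitTensor, blockPow, tensorMatrix_mul, tensorMatrix_mul]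
  simp only [siteUnit_mul_blockOp]

theorem diagonal_mem_unitaryGroup {l : ℕ} {u : Fin l → ℂ} (hu : ∀ i, u i * star (u i) = 1) :
    Matrix.diagonal u ∈ Matrix.unitaryGroup (Fin l) ℂ := by
  rw [Matrix.mem_unitaryGroup_iff, Matrix.star_eq_conjTranspose, Matrix.diagonal_conjTranspose,
    Matrix.diagonal_mul_diagonal, ← Matrix.diagonal_one]
  congr 1
  funext i
  exact hu i

/-- Taking u to be a primitive root of unity of order n + 1 at one letter and 1 elsewhere reveals
how often the letter occurs, since that number is at most n. Equal counts give equal products for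
all t. -/
theorem prod_eq_prod_of_forall_unit {q : Type*} [Fintype q] [DecidableEq q] {x y : Fin n → q}
    (h : ∀ u : q → ℂ, (∀ i, u i * star (u i) = 1) → ∏ p, u (x p) = ∏ p, u (y p)) (t : q → ℂ) :
    ∏ p, t (x p) = ∏ p, t (y p) := by
  have hζ := Complex.isPrimitiveRoot_exp (n + 1) n.succ_ne_zero
  set ζ := Complex.exp (2 * Real.pi * Complex.I / ((n + 1 : ℕ) : ℂ)) with hζdef
  have hζ1 : ζ * star ζ = 1 := by
    have h1 : ‖ζ‖ = 1 := hζ.norm'_eq_one n.succ_ne_zero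
    rw [Complex.star_def, Complex.mul_conj, Complex.normSq_eq_norm_sq, h1]
    simp
  have hprod : ∀ (z : Fin n → q) (i : q), ∏ p, (if z p = i then ζ else 1) =
      ζ ^ (Finset.univ.filter fun p => z p = i).card := by
    intro z i
    rw [Finset.prod_ite, Finset.prod_const, Finset.prod_const_one, mul_one]
  have hcard : ∀ i, (Finset.univ.filter fun p => x p = i).card =
      (Finset.univ.filter fun p => y p = i).card := by
    intro i
    have h2 := h (fun j => if j = i then ζ else 1) (fun j => by
      by_cases hj : j = i
      · simpa [hj] using hζ1
      · simp [hj])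
    rw [hprod, hprod] at h2
    have hle : ∀ z : Fin n → q, (Finset.univ.filter fun p => z p = i).card < n + 1 := fun z =>
      Nat.lt_succ_of_le ((Finset.card_filter_le _ _).trans (by simp))
    exact hζ.pow_inj (hle x) (hle y) h2
  have hfib : ∀ z : Fin n → q, ∏ p, t (z p) =
      ∏ i, t i ^ (Finset.univ.filter fun p => z p = i).card := by
    intro z
    rw [← Finset.prod_fiberwise Finset.univ z fun p => t (z p)]
    refine Finset.prod_congr rfl fun i _ => Finset.prod_eq_pow_card fun p hp => ?_
    rw [(Finset.mem_filter.1 hp).2]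
  rw [hfib, hfib]
  simp only [hcard]

variable {A : Matrix (Fin n → Site r deg) (Fin n → Site r deg) ℂ}

/-- At a nonzero entry of A the products of phases along the two indices agree, hence so do the
products of arbitrary diagonal entries. -/
theorem comm_blockPow_diagonal
    (hA : ∀ V : ∀ j, Matrix.unitaryGroup (Fin (deg j)) ℂ,
      A * blockPow n r (fun j => (V j : Matrix (Fin (deg j)) (Fin (deg j)) ℂ)) =
        blockPow n r (fun j => (V j : Matrix (Fin (deg j)) (Fin (deg j)) ℂ)) * A)
    (t : ∀ j, Fin (deg j) → ℂ) : A * blockPow n r (fun j => Matrix.diagonal (t j)) =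
      blockPow n r (fun j => Matrix.diagonal (t j)) * A := by
  rw [blockPow_diagonal]
  ext x y
  rw [Matrix.mul_diagonal, Matrix.diagonal_mul]
  by_cases h0 : A x y = 0
  · rw [h0, zero_mul, mul_zero]
  have h1 := prod_eq_prod_of_forall_unit
    (x := fun p => (⟨(x p).1, (x p).2.2⟩ : Σ j, Fin (deg j)))
    (y := fun p => (⟨(y p).1, (y p).2.2⟩ : Σ j, Fin (deg j))) (fun u hu => by
      have h2 := hA fun j => ⟨Matrix.diagonal fun i => u ⟨j, i⟩,
        diagonal_mem_unitaryGroup fun i => hu ⟨j, i⟩⟩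
      dsimp only at h2
      rw [blockPow_diagonal] at h2
      have h3 := congrFun (congrFun h2 x) y
      rw [Matrix.mul_diagonal, Matrix.diagonal_mul, mul_comm] at h3
      exact (mul_right_cancel₀ h0 h3).symm) fun q => t q.1 q.2
  dsimp only at h1
  rw [h1, mul_comm]

theorem comm_blockPow_isHermitian
    (hA : ∀ V : ∀ j, Matrix.unitaryGroup (Fin (deg j)) ℂ,
      A * blockPow n r (fun j => (V j : Matrix (Fin (deg j)) (Fin (deg j)) ℂ)) =
        blockPow n r (fun j => (V j : Matrix (Fin (deg j)) (Fin (deg j)) ℂ)) * A)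
    {B : ∀ j, Matrix (Fin (deg j)) (Fin (deg j)) ℂ} (hB : ∀ j, (B j).IsHermitian) :
    A * blockPow n r B = blockPow n r B * A := by
  let V : ∀ j, Matrix.unitaryGroup (Fin (deg j)) ℂ := fun j => (hB j).eigenvectorUnitary
  let t : ∀ j, Fin (deg j) → ℂ := fun j => RCLike.ofReal ∘ (hB j).eigenvalues
  have h1 : blockPow n r B = blockPow n r (fun j => (V j : Matrix (Fin (deg j)) (Fin (deg j)) ℂ)) *
      blockPow n r (fun j => Matrix.diagonal (t j)) *
      blockPow n r (fun j => ((V⁻¹) j : Matrix (Fin (deg j)) (Fin (deg j)) ℂ)) := by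
    rw [blockPow_mul, blockPow_mul]
    congr 1
    funext j
    conv_lhs => rw [(hB j).spectral_theorem]
    rw [Unitary.conjStarAlgAut_apply]
    rfl
  rw [h1, ← Matrix.mul_assoc, ← Matrix.mul_assoc, hA, Matrix.mul_assoc (blockPow n r _) A,
    comm_blockPow_diagonal hA, Matrix.mul_assoc, Matrix.mul_assoc (blockPow n r _) A, hA]
  simp only [Matrix.mul_assoc]

theorem comm_sum_tensorMatrix_isHermitian
    (hA : ∀ V : ∀ j, Matrix.unitaryGroup (Fin (deg j)) ℂ,
      A * blockPow n r (fun j => (V j : Matrix (Fin (deg j)) (Fin (deg j)) ℂ)) =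
        blockPow n r (fun j => (V j : Matrix (Fin (deg j)) (Fin (deg j)) ℂ)) * A)
    {B : Fin n → ∀ j, Matrix (Fin (deg j)) (Fin (deg j)) ℂ} (hB : ∀ p j, (B p j).IsHermitian) :
    A * ∑ σ : Equiv.Perm (Fin n), tensorMatrix (fun p => blockOp r (B (σ p))) =
      (∑ σ : Equiv.Perm (Fin n), tensorMatrix (fun p => blockOp r (B (σ p)))) * A := by
  rw [sum_tensorMatrix_perm fun p => blockOp r (B p), Finset.mul_sum, Finset.sum_mul]
  refine Finset.sum_congr rfl fun T _ => ?_
  rw [mul_smul_comm, smul_mul_assoc]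
  congr 1
  have h : ∑ p ∈ Tᶜ, blockOp r (B p) = blockOp r (∑ p ∈ Tᶜ, B p) := by
    simp only [← blockOpLin_apply]
    rw [map_sum]
  rw [h]
  refine comm_blockPow_isHermitian hA fun j => ?_
  rw [Finset.sum_apply, Matrix.IsHermitian, Matrix.conjTranspose_sum]
  exact Finset.sum_congr rfl fun p _ => hB p j

theorem exists_isHermitian_decomposition {l : ℕ} (B : Matrix (Fin l) (Fin l) ℂ) :
    ∃ H : Bool → Matrix (Fin l) (Fin l) ℂ, (∀ ε, (H ε).IsHermitian) ∧
      B = ∑ ε : Bool, (if ε then Complex.I else 1) • H ε := by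
  refine ⟨fun ε => if ε then (Complex.I / 2) • (Bᴴ - B) else (1 / 2 : ℂ) • (B + Bᴴ), ?_, ?_⟩
  · rintro (_ | _)
    · simp [Matrix.IsHermitian, Matrix.conjTranspose_smul, add_comm]
    · simp only [if_true, Matrix.IsHermitian, Matrix.conjTranspose_smul, Matrix.conjTranspose_sub,
        Matrix.conjTranspose_conjTranspose]
      rw [← neg_sub, smul_neg, ← neg_smul]
      congr 1
      simp
      ring
  · rw [Fintype.sum_bool]
    ext i j
    simp
    linear_combination (1 / 2 * ((starRingEnd ℂ) (B j i) - B i j)) * (-1 : ℂ) * Complex.I_sq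

theorem comm_sum_tensorMatrix
    (hA : ∀ V : ∀ j, Matrix.unitaryGroup (Fin (deg j)) ℂ,
      A * blockPow n r (fun j => (V j : Matrix (Fin (deg j)) (Fin (deg j)) ℂ)) =
        blockPow n r (fun j => (V j : Matrix (Fin (deg j)) (Fin (deg j)) ℂ)) * A)
    (B : Fin n → ∀ j, Matrix (Fin (deg j)) (Fin (deg j)) ℂ) :
    A * ∑ σ : Equiv.Perm (Fin n), tensorMatrix (fun p => blockOp r (B (σ p))) =
      (∑ σ : Equiv.Perm (Fin n), tensorMatrix (fun p => blockOp r (B (σ p)))) * A := by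
  choose H hH hB using fun p j => exists_isHermitian_decomposition (B p j)
  have h1 : ∀ p, blockOp r (B p) =
      ∑ ε : Bool, (if ε then Complex.I else 1) • blockOp r (fun j => H p j ε) := by
    intro p
    have h2 : B p = ∑ ε : Bool, (if ε then Complex.I else (1 : ℂ)) • fun j => H p j ε := by
      funext j
      rw [hB p j, Finset.sum_apply]
      rfl
    conv_lhs => rw [h2]
    simp only [← blockOpLin_apply]
    rw [map_sum]
    simp only [map_smul]
  have h3 : ∑ σ : Equiv.Perm (Fin n), tensorMatrix (fun p => blockOp r (B (σ p))) =
      -- The choice of Hermitian or anti-Hermitian parts is reindexed by σ, so that its scalar no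
      -- longer depends on σ and the inner sum is again symmetrised.
      ∑ η : Fin n → Bool, (∏ p, if η p then Complex.I else (1 : ℂ)) •
        ∑ σ : Equiv.Perm (Fin n), tensorMatrix (fun p => blockOp r fun j => H (σ p) j (η (σ p))) := by
    simp only [h1, tensorMatrix_sum, Finset.smul_sum]
    rw [Finset.sum_comm' (s' := fun _ => Finset.univ) (t' := Finset.univ) (by simp)]
    rw [Finset.sum_comm]
    conv_rhs => rw [Finset.sum_comm]
    refine Finset.sum_congr rfl fun σ _ => ?_
    rw [← Equiv.sum_comp (Equiv.arrowCongr σ.symm (Equiv.refl Bool))]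
    refine Finset.sum_congr rfl fun η _ => ?_
    rw [tensorMatrix_smul]
    have h4 : ∀ q, (Equiv.arrowCongr σ.symm (Equiv.refl Bool)) η q = η (σ q) := fun q => rfl
    simp only [h4]
    congr 1
    exact Equiv.prod_comp σ fun p => if η p then Complex.I else (1 : ℂ)
  rw [h3, Finset.mul_sum, Finset.sum_mul]
  refine Finset.sum_congr rfl fun η _ => ?_
  rw [mul_smul_comm, smul_mul_assoc,
    comm_sum_tensorMatrix_isHermitian hA (B := fun p j => H p j (η p)) fun p j => hH p j _]

/-- An operator commuting with all tensor powers of block unitaries commutes with the commutant of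
the permutations and the local matrix units. -/
theorem comm_of_mem (hr : ∀ j, 0 < r j)
    (hA : ∀ V : ∀ j, Matrix.unitaryGroup (Fin (deg j)) ℂ,
      A * blockPow n r (fun j => (V j : Matrix (Fin (deg j)) (Fin (deg j)) ℂ)) =
        blockPow n r (fun j => (V j : Matrix (Fin (deg j)) (Fin (deg j)) ℂ)) * A)
    {Z : Matrix (Fin n → Site r deg) (Fin n → Site r deg) ℂ} (hZ : (localFamily n r deg).Mem Z) :
    A * Z = Z * A := by
  -- Z equals its own twirl. Expanding Z in matrix units, each averaged one-system unit commutes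
  -- with the local units and so is some ⨁_j 1 ⊗ B_j; hence Z is a combination of symmetrised
  -- products of such operators, with which A commutes.
  have h1 : Z = ((n.factorial : ℂ))⁻¹ • ∑ σ, permOp (Fin n) (Site r deg) σ * tensorTwirl Z *
      (permOp (Fin n) (Site r deg) σ)ᴴ := by
    rw [← sum_twirlOp]
    exact hZ.twirl_eq.symm
  choose B hB using fun x y : Site r deg => exists_eq_blockOp hr
    fun f => siteUnit_mul_siteTwirl f (Matrix.single x y (1 : ℂ))
  have h2 : ∑ σ, permOp (Fin n) (Site r deg) σ * tensorTwirl Z *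
      (permOp (Fin n) (Site r deg) σ)ᴴ = ∑ x : Fin n → Site r deg, ∑ y : Fin n → Site r deg,
        Z x y • ∑ σ : Equiv.Perm (Fin n),
          tensorMatrix (fun p => blockOp r (B (x (σ p)) (y (σ p)))) := by
    have h3 : ∀ σ : Equiv.Perm (Fin n), permOp (Fin n) (Site r deg) σ * tensorTwirl Z *
        (permOp (Fin n) (Site r deg) σ)ᴴ = ∑ x : Fin n → Site r deg, ∑ y : Fin n → Site r deg,
          Z x y • tensorMatrix (fun p => blockOp r (B (x (σ.symm p)) (y (σ.symm p)))) := by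
      intro σ
      rw [tensorTwirl_eq_sum, Finset.mul_sum, Finset.sum_mul]
      refine Finset.sum_congr rfl fun x _ => ?_
      rw [Finset.mul_sum, Finset.sum_mul]
      refine Finset.sum_congr rfl fun y _ => ?_
      rw [mul_smul_comm, smul_mul_assoc, tensorTwirl_single, permOp_mul_tensorMatrix,
        Matrix.mul_assoc, permOp_conjTranspose, permOp_mul_permOp_inv, mul_one]
      simp only [hB]
    simp only [h3]
    rw [Finset.sum_comm]
    refine Finset.sum_congr rfl fun x _ => ?_
    rw [Finset.sum_comm]
    refine Finset.sum_congr rfl fun y _ => ?_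
    rw [Finset.smul_sum, ← Equiv.sum_comp (Equiv.inv (Equiv.Perm (Fin n)))]
    rfl
  rw [h1, h2, mul_smul_comm, smul_mul_assoc, Finset.mul_sum, Finset.sum_mul]
  congr 1
  refine Finset.sum_congr rfl fun x _ => ?_
  rw [Finset.mul_sum, Finset.sum_mul]
  refine Finset.sum_congr rfl fun y _ => ?_
  rw [mul_smul_comm, smul_mul_assoc, comm_sum_tensorMatrix hA fun p => B (x p) (y p)]

end Commutant

/-! ### Haar averages -/

section Haar

open MeasureTheory

instance secondCountableTopology_unitaryGroup (l : ℕ) :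
    SecondCountableTopology (Matrix.unitaryGroup (Fin l) ℂ) :=
  haveI : SecondCountableTopology (Matrix (Fin l) (Fin l) ℂ) :=
    inferInstanceAs (SecondCountableTopology (Fin l → Fin l → ℂ))
  TopologicalSpace.Subtype.secondCountableTopology
    (Matrix.unitaryGroup (Fin l) ℂ : Set (Matrix (Fin l) (Fin l) ℂ))

instance isHaarMeasure_haarUnitary (l : ℕ) : Measure.IsHaarMeasure (haarUnitary l) := by
  unfold haarUnitary
  infer_instance

instance isProbabilityMeasure_haarUnitary (l : ℕ) : IsProbabilityMeasure (haarUnitary l) :=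
  ⟨by
    have h := Measure.haarMeasure_self
      (K₀ := (⊤ : TopologicalSpace.PositiveCompacts (Matrix.unitaryGroup (Fin l) ℂ)))
    simpa [haarUnitary] using h⟩

variable {n k : ℕ} {r deg : Fin k → ℕ}

theorem integrable_haar {f : (∀ j, Matrix.unitaryGroup (Fin (deg j)) ℂ) → ℂ} (hf : Continuous f) :
    Integrable f (Measure.pi fun j => haarUnitary (deg j)) :=
  hf.integrable_of_hasCompactSupport (HasCompactSupport.of_compactSpace f)

/-- The conjugate of the tensor power of `⨁_j 1 ⊗ C_j` by a block unitary. -/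
noncomputable def conjPow (n : ℕ) (r : Fin k → ℕ)
    (C : ∀ j, Matrix (Fin (deg j)) (Fin (deg j)) ℂ)
    (U : ∀ j, Matrix.unitaryGroup (Fin (deg j)) ℂ) :
    Matrix (Fin n → Site r deg) (Fin n → Site r deg) ℂ :=
  blockPow n r fun j => (U j : Matrix (Fin (deg j)) (Fin (deg j)) ℂ) * C j *
    (U j : Matrix (Fin (deg j)) (Fin (deg j)) ℂ)ᴴ

theorem continuous_conjPow (C : ∀ j, Matrix (Fin (deg j)) (Fin (deg j)) ℂ)
    (x y : Fin n → Site r deg) : Continuous fun U => conjPow n r C U x y := by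
  simp only [conjPow, blockPow, tensorMatrix_apply]
  refine continuous_finsetProd _ fun p _ => ?_
  generalize x p = q
  generalize y p = q'
  by_cases h : q.1 = q'.1
  · obtain ⟨j, a, s⟩ := q
    obtain ⟨j', a', s'⟩ := q'
    dsimp only at h
    subst h
    simp only [blockOp_apply_same]
    by_cases h1 : a = a'
    · simp only [if_pos h1]
      have h2 : Continuous fun U : ∀ j, Matrix.unitaryGroup (Fin (deg j)) ℂ =>
          (U j : Matrix (Fin (deg j)) (Fin (deg j)) ℂ) :=
        continuous_subtype_val.comp (continuous_apply j)
      exact ((h2.matrix_mul continuous_const).matrix_mul h2.matrix_conjTranspose).matrix_elem s s'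
    · simp only [if_neg h1]
      exact continuous_const
  · simp only [blockOp_apply_ne _ h]
    exact continuous_const

/-- The Haar average of the conjugates. -/
noncomputable def haarAverage (n : ℕ) (r : Fin k → ℕ)
    (C : ∀ j, Matrix (Fin (deg j)) (Fin (deg j)) ℂ) :
    Matrix (Fin n → Site r deg) (Fin n → Site r deg) ℂ :=
  Matrix.of fun x y => ∫ U, conjPow n r C U x y ∂(Measure.pi fun j => haarUnitary (deg j))

theorem mul_haarAverage_mul_apply {I J : Type*} (C : ∀ j, Matrix (Fin (deg j)) (Fin (deg j)) ℂ)
    (M : Matrix I (Fin n → Site r deg) ℂ) (N : Matrix (Fin n → Site r deg) J ℂ) (x : I) (y : J) :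
    (M * haarAverage n r C * N) x y =
      ∫ U, (M * conjPow n r C U * N) x y ∂(Measure.pi fun j => haarUnitary (deg j)) := by
  simp only [Matrix.mul_apply, haarAverage, Matrix.of_apply, Finset.sum_mul]
  rw [integral_finsetSum]
  · refine Finset.sum_congr rfl fun z _ => ?_
    rw [integral_finsetSum]
    · refine Finset.sum_congr rfl fun w _ => ?_
      rw [integral_mul_const, integral_const_mul]
    · exact fun w _ => ((integrable_haar (continuous_conjPow C w z)).const_mul _).mul_const _
  · exact fun z _ => integrable_finsetSum _ fun w _ =>
      ((integrable_haar (continuous_conjPow C w z)).const_mul _).mul_const _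

theorem haarAverage_mem (C : ∀ j, Matrix (Fin (deg j)) (Fin (deg j)) ℂ) :
    (localFamily n r deg).Mem (haarAverage n r C) := by
  intro a
  ext x y
  have h1 := mul_haarAverage_mul_apply C ((localFamily n r deg).K a) 1 x y
  have h2 := mul_haarAverage_mul_apply C 1 ((localFamily n r deg).K a) x y
  rw [mul_one] at h1
  rw [one_mul] at h2
  rw [h1, h2]
  simp only [mul_one, one_mul]
  congr 1
  funext U
  exact congrFun (congrFun (blockPow_mem _ a) x) y

/-- Conjugation by V replaces the integration variable U by VU, and Haar measure is left invariant.
-/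
theorem haarAverage_comm (C : ∀ j, Matrix (Fin (deg j)) (Fin (deg j)) ℂ)
    (V : ∀ j, Matrix.unitaryGroup (Fin (deg j)) ℂ) :
    haarAverage n r C * blockPow n r (fun j => (V j : Matrix (Fin (deg j)) (Fin (deg j)) ℂ)) =
      blockPow n r (fun j => (V j : Matrix (Fin (deg j)) (Fin (deg j)) ℂ)) *
        haarAverage n r C := by
  have h1 : blockPow n r (fun j => (V j : Matrix (Fin (deg j)) (Fin (deg j)) ℂ)) *
      haarAverage n r C * (blockPow n r fun j => (V j : Matrix (Fin (deg j)) (Fin (deg j)) ℂ)ᴴ) =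
        haarAverage n r C := by
    ext x y
    rw [mul_haarAverage_mul_apply]
    have h2 : ∀ U : ∀ j, Matrix.unitaryGroup (Fin (deg j)) ℂ,
        blockPow n r (fun j => (V j : Matrix (Fin (deg j)) (Fin (deg j)) ℂ)) * conjPow n r C U *
          (blockPow n r fun j => (V j : Matrix (Fin (deg j)) (Fin (deg j)) ℂ)ᴴ) =
        conjPow n r C (V * U) := by
      intro U
      rw [conjPow, conjPow, blockPow_mul, blockPow_mul]
      congr 1
      funext j
      have h3 : ((V * U) j : Matrix (Fin (deg j)) (Fin (deg j)) ℂ) =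
          (V j : Matrix (Fin (deg j)) (Fin (deg j)) ℂ) * (U j : Matrix _ _ ℂ) := rfl
      rw [h3, Matrix.conjTranspose_mul]
      simp only [Matrix.mul_assoc]
    simp only [h2]
    exact integral_mul_left_eq_self (fun U => conjPow n r C U x y) V
  have h4 : (blockPow n r fun j => (V j : Matrix (Fin (deg j)) (Fin (deg j)) ℂ)ᴴ) *
      blockPow n r (fun j => (V j : Matrix (Fin (deg j)) (Fin (deg j)) ℂ)) = 1 := by
    rw [blockPow_mul, ← blockPow_one (n := n) (r := r) (deg := deg)]
    congr 1
    funext j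
    exact Unitary.coe_star_mul_self (V j)
  conv_lhs => rw [← h1]
  rw [Matrix.mul_assoc, h4, mul_one]

/-- Powers of block unitaries lie in the commutant and so commute with `e`. The integrand is
constant, and the measure is a probability measure. -/
theorem trace_mul_haarAverage (C : ∀ j, Matrix (Fin (deg j)) (Fin (deg j)) ℂ)
    {e : Matrix (Fin n → Site r deg) (Fin n → Site r deg) ℂ}
    (he : ∀ Z, (localFamily n r deg).Mem Z → e * Z = Z * e) :
    (e * haarAverage n r C).trace = (e * blockPow n r C).trace := by
  have h1 : ∀ U : ∀ j, Matrix.unitaryGroup (Fin (deg j)) ℂ,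
      (e * conjPow n r C U).trace = (e * blockPow n r C).trace := by
    intro U
    have h2 : conjPow n r C U =
        blockPow n r (fun j => (U j : Matrix (Fin (deg j)) (Fin (deg j)) ℂ)) * blockPow n r C *
          blockPow n r (fun j => (U j : Matrix (Fin (deg j)) (Fin (deg j)) ℂ)ᴴ) := by
      rw [blockPow_mul, blockPow_mul]
      rfl
    have h3 : blockPow n r (fun j => (U j : Matrix (Fin (deg j)) (Fin (deg j)) ℂ)ᴴ) *
        blockPow n r (fun j => (U j : Matrix (Fin (deg j)) (Fin (deg j)) ℂ)) = 1 := by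
      rw [blockPow_mul, ← blockPow_one (n := n) (r := r) (deg := deg)]
      congr 1
      funext j
      exact Unitary.coe_star_mul_self (U j)
    rw [h2, ← Matrix.mul_assoc, Matrix.trace_mul_comm, ← Matrix.mul_assoc, ← Matrix.mul_assoc,
      ← he _ (blockPow_mem _), Matrix.mul_assoc e, h3, mul_one]
  have h5 : (e * haarAverage n r C).trace =
      ∫ U, (e * conjPow n r C U).trace ∂(Measure.pi fun j => haarUnitary (deg j)) := by
    simp only [Matrix.trace, Matrix.diag_apply]
    rw [integral_finsetSum]
    · refine Finset.sum_congr rfl fun x _ => ?_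
      have h6 := mul_haarAverage_mul_apply C e 1 x x
      simpa only [mul_one] using h6
    · intro x _
      simp only [Matrix.mul_apply]
      exact integrable_finsetSum _ fun w _ =>
        (integrable_haar (continuous_conjPow C w x)).const_mul _
  rw [h5]
  simp only [h1, integral_const, probReal_univ, one_smul]

end Haar

/-! ### Schur's lemma for matrix representations -/

section Schur

variable {G : Type*} [Group G] {a b : ℕ} {ρ : G →* Matrix.unitaryGroup (Fin a) ℂ}
  {σ : G →* Matrix.unitaryGroup (Fin b) ℂ}

theorem matrixRep_apply (g : G) (v : Fin a → ℂ) :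
    matrixRep ρ g v = (ρ g : Matrix (Fin a) (Fin a) ℂ) *ᵥ v := rfl

/-- The intertwining map given by a matrix. -/
noncomputable def matrixIntertwiner (N : Matrix (Fin a) (Fin b) ℂ)
    (hN : ∀ g, (ρ g : Matrix (Fin a) (Fin a) ℂ) * N = N * (σ g : Matrix (Fin b) (Fin b) ℂ)) :
    Representation.IntertwiningMap (matrixRep σ) (matrixRep ρ) :=
  LinearMap.intertwiningMap_of_isIntertwiningMap _ _ (Matrix.toLin' N) fun g v => by
    rw [matrixRep_apply, matrixRep_apply, Matrix.toLin'_apply, Matrix.toLin'_apply,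
      Matrix.mulVec_mulVec, Matrix.mulVec_mulVec, hN]

theorem matrixIntertwiner_apply (N : Matrix (Fin a) (Fin b) ℂ)
    (hN : ∀ g, (ρ g : Matrix (Fin a) (Fin a) ℂ) * N = N * (σ g : Matrix (Fin b) (Fin b) ℂ))
    (v : Fin b → ℂ) : matrixIntertwiner N hN v = N *ᵥ v := rfl

theorem matrixIntertwiner_eq_zero (N : Matrix (Fin a) (Fin b) ℂ)
    (hN : ∀ g, (ρ g : Matrix (Fin a) (Fin a) ℂ) * N = N * (σ g : Matrix (Fin b) (Fin b) ℂ))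
    (h : matrixIntertwiner N hN = 0) : N = 0 := by
  ext i j
  have h1 : matrixIntertwiner N hN (Pi.single j 1) = 0 := by
    rw [h]
    rfl
  rw [matrixIntertwiner_apply, Matrix.mulVec_single_one] at h1
  exact congrFun h1 i

theorem eq_zero_of_intertwines (hρ : (matrixRep ρ).IsIrreducible) (hσ : (matrixRep σ).IsIrreducible)
    (he : IsEmpty ((matrixRep σ).Equiv (matrixRep ρ))) (N : Matrix (Fin a) (Fin b) ℂ)
    (hN : ∀ g, (ρ g : Matrix (Fin a) (Fin a) ℂ) * N = N * (σ g : Matrix (Fin b) (Fin b) ℂ)) :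
    N = 0 := by
  have h := Subsingleton.elim (matrixIntertwiner N hN) 0
  exact matrixIntertwiner_eq_zero N hN h

theorem exists_scalar_of_commutes (hρ : (matrixRep ρ).IsIrreducible)
    (N : Matrix (Fin a) (Fin a) ℂ)
    (hN : ∀ g, (ρ g : Matrix (Fin a) (Fin a) ℂ) * N = N * (ρ g : Matrix (Fin a) (Fin a) ℂ)) :
    ∃ z : ℂ, N = z • 1 := by
  obtain ⟨z, hz⟩ := (Representation.IsIrreducible.algebraMap_intertwiningMap_bijective_of_isAlgClosed
    (ρ := matrixRep ρ)).2 (matrixIntertwiner N hN)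
  refine ⟨z, ?_⟩
  ext i j
  have h1 : algebraMap ℂ (Representation.IntertwiningMap (matrixRep ρ) (matrixRep ρ)) z
      (Pi.single j 1) = matrixIntertwiner N hN (Pi.single j 1) := by rw [hz]
  rw [matrixIntertwiner_apply, Matrix.mulVec_single_one] at h1
  have h2 := congrFun h1 i
  rw [Matrix.col_apply] at h2
  rw [← h2, Matrix.smul_apply, Matrix.one_apply]
  change (z • (Pi.single j (1 : ℂ) : Fin a → ℂ)) i = _
  rw [Pi.smul_apply, Pi.single_apply]

theorem pos_of_isIrreducible (hρ : (matrixRep ρ).IsIrreducible) : 0 < a := by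
  rcases Nat.eq_zero_or_pos a with rfl | h
  · exfalso
    obtain ⟨x, y, hxy⟩ := hρ.exists_pair_ne
    refine hxy (Subrepresentation.toSubmodule_injective ?_)
    exact Subsingleton.elim _ _
  · exact h

end Schur

/-! ### Locally invariant operators -/

section Invariant

variable {G : Type*} [Group G] {k n : ℕ} {r deg : Fin k → ℕ}

/-- The representation `⨁_j π_j ⊗ 1`. -/
noncomputable def siteRep (deg : Fin k → ℕ) (ρ : ∀ j, G →* Matrix.unitaryGroup (Fin (r j)) ℂ)
    (g : G) : Matrix (Site r deg) (Site r deg) ℂ :=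
  Matrix.blockDiagonal' fun j => (ρ j g : Matrix (Fin (r j)) (Fin (r j)) ℂ) ⊗ₖ
    (1 : Matrix (Fin (deg j)) (Fin (deg j)) ℂ)

theorem siteRep_one (ρ : ∀ j, G →* Matrix.unitaryGroup (Fin (r j)) ℂ) : siteRep deg ρ 1 = 1 := by
  rw [siteRep]
  simp only [map_one, OneMemClass.coe_one, Matrix.one_kronecker_one]
  exact Matrix.blockDiagonal'_one

theorem siteRep_apply_same (ρ : ∀ j, G →* Matrix.unitaryGroup (Fin (r j)) ℂ) (g : G) (j : Fin k)
    (a a' : Fin (r j)) (s s' : Fin (deg j)) : siteRep deg ρ g ⟨j, a, s⟩ ⟨j, a', s'⟩ =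
      if s = s' then (ρ j g : Matrix (Fin (r j)) (Fin (r j)) ℂ) a a' else 0 := by
  simp [siteRep, Matrix.blockDiagonal'_apply, Matrix.one_apply]

theorem siteRep_apply_ne (ρ : ∀ j, G →* Matrix.unitaryGroup (Fin (r j)) ℂ) (g : G)
    {x y : Site r deg} (h : x.1 ≠ y.1) : siteRep deg ρ g x y = 0 := by
  simp [siteRep, Matrix.blockDiagonal'_apply, h]

theorem siteRep_mul_apply (ρ : ∀ j, G →* Matrix.unitaryGroup (Fin (r j)) ℂ) (g : G)
    (M : Matrix (Site r deg) (Site r deg) ℂ) (j : Fin k) (a : Fin (r j)) (s : Fin (deg j))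
    (y : Site r deg) : (siteRep deg ρ g * M) ⟨j, a, s⟩ y =
      ∑ c, (ρ j g : Matrix (Fin (r j)) (Fin (r j)) ℂ) a c * M ⟨j, c, s⟩ y := by
  rw [Matrix.mul_apply, Fintype.sum_sigma, Finset.sum_eq_single j]
  · rw [Fintype.sum_prod_type]
    refine Finset.sum_congr rfl fun c _ => ?_
    rw [Finset.sum_eq_single s]
    · rw [siteRep_apply_same, if_pos rfl]
    · intro t _ ht
      rw [siteRep_apply_same, if_neg ht.symm, zero_mul]
    · simp
  · intro j' _ hj'
    refine Finset.sum_eq_zero fun q _ => ?_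
    rw [siteRep_apply_ne _ _ (Ne.symm hj'), zero_mul]
  · simp

theorem mul_siteRep_apply {I : Type*} (ρ : ∀ j, G →* Matrix.unitaryGroup (Fin (r j)) ℂ) (g : G)
    (M : Matrix I (Site r deg) ℂ) (j : Fin k) (a : Fin (r j)) (s : Fin (deg j)) (x : I) :
    (M * siteRep deg ρ g) x ⟨j, a, s⟩ =
      ∑ c, M x ⟨j, c, s⟩ * (ρ j g : Matrix (Fin (r j)) (Fin (r j)) ℂ) c a := by
  rw [Matrix.mul_apply, Fintype.sum_sigma, Finset.sum_eq_single j]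
  · rw [Fintype.sum_prod_type]
    refine Finset.sum_congr rfl fun c _ => ?_
    rw [Finset.sum_eq_single s]
    · rw [siteRep_apply_same, if_pos rfl]
    · intro t _ ht
      rw [siteRep_apply_same, if_neg ht, mul_zero]
    · simp
  · intro j' _ hj'
    refine Finset.sum_eq_zero fun q _ => ?_
    rw [siteRep_apply_ne _ _ hj', mul_zero]
  · simp

/-- For fixed multiplicity indices, the block between types j and j' intertwines two irreducible
representations. Schur's lemma makes it zero for j ≠ j' and a scalar for j = j'; these scalars form
B_j. -/
theorem exists_eq_blockOp_of_siteRep {ρ : ∀ j, G →* Matrix.unitaryGroup (Fin (r j)) ℂ}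
    (hirr : ∀ j, (matrixRep (ρ j)).IsIrreducible)
    (hne : ∀ i j, i ≠ j → IsEmpty ((matrixRep (ρ i)).Equiv (matrixRep (ρ j))))
    {M : Matrix (Site r deg) (Site r deg) ℂ}
    (hM : ∀ g, siteRep deg ρ g * M = M * siteRep deg ρ g) : ∃ B, M = blockOp r B := by
  have hblock : ∀ j j' (s : Fin (deg j)) (s' : Fin (deg j')) (g : G),
      (ρ j g : Matrix (Fin (r j)) (Fin (r j)) ℂ) *
        (Matrix.of fun a a' => M ⟨j, a, s⟩ ⟨j', a', s'⟩) =
      (Matrix.of fun a a' => M ⟨j, a, s⟩ ⟨j', a', s'⟩) *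
        (ρ j' g : Matrix (Fin (r j')) (Fin (r j')) ℂ) := by
    intro j j' s s' g
    ext a a'
    have h := congrFun (congrFun (hM g) ⟨j, a, s⟩) ⟨j', a', s'⟩
    rw [siteRep_mul_apply, mul_siteRep_apply] at h
    simpa [Matrix.mul_apply] using h
  have hz : ∀ j (s s' : Fin (deg j)), ∃ z : ℂ,
      (Matrix.of fun a a' => M ⟨j, a, s⟩ ⟨j, a', s'⟩) = z • (1 : Matrix (Fin (r j)) (Fin (r j)) ℂ) :=
    fun j s s' => exists_scalar_of_commutes (hirr j) _ (hblock j j s s')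
  choose B hB using hz
  refine ⟨fun j => Matrix.of (B j), ?_⟩
  ext ⟨j, a, s⟩ ⟨j', a', s'⟩
  by_cases hj : j = j'
  · subst hj
    have h := congrFun (congrFun (hB j s s') a) a'
    rw [Matrix.of_apply] at h
    rw [h, blockOp_apply_same, Matrix.smul_apply, Matrix.one_apply]
    simp
  · rw [blockOp_apply_ne _ hj]
    have h := eq_zero_of_intertwines (hirr j) (hirr j') (hne j' j (Ne.symm hj)) _ (hblock j j' s s')
    exact congrFun (congrFun h a) a'

/-! ### Operators on a single system, and slices -/

section OneSite

variable {κ : Type*} [Fintype κ] [DecidableEq κ]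

/-- The operator acting as `S` on the system `p`. -/
noncomputable def oneSite (p : Fin n) (S : Matrix κ κ ℂ) :
    Matrix (Fin n → κ) (Fin n → κ) ℂ :=
  tensorMatrix (Function.update (fun _ => 1) p S)

theorem oneSite_apply_update (p : Fin n) (S : Matrix κ κ ℂ) (x y : Fin n → κ) (z : κ) :
    oneSite p S (Function.update x p z) y =
      if y = Function.update x p (y p) then S z (y p) else 0 := by
  rw [oneSite, tensorMatrix_apply, ← Finset.mul_prod_erase _ _ (Finset.mem_univ p)]
  rw [Function.update_self, Function.update_self]
  split_ifs with h
  · rw [Finset.prod_eq_one, mul_one]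
    intro q hq
    have hq' := Finset.ne_of_mem_erase hq
    rw [Function.update_of_ne hq', Function.update_of_ne hq', h, Function.update_of_ne hq',
      Matrix.one_apply_eq]
  · obtain ⟨q, hq⟩ := Function.ne_iff.1 h
    have hq' : q ≠ p := by
      rintro rfl
      simp at hq
    rw [Function.update_of_ne hq'] at hq
    rw [Finset.prod_eq_zero (Finset.mem_erase.2 ⟨hq', Finset.mem_univ q⟩), mul_zero]
    rw [Function.update_of_ne hq', Function.update_of_ne hq', Matrix.one_apply_ne hq.symm]

theorem oneSite_mul_apply (p : Fin n) (S : Matrix κ κ ℂ)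
    (X : Matrix (Fin n → κ) (Fin n → κ) ℂ) (x y : Fin n → κ) (z : κ) :
    (oneSite p S * X) (Function.update x p z) y =
      ∑ w, S z w * X (Function.update x p w) y := by
  rw [Matrix.mul_apply]
  symm
  refine Finset.sum_of_injOn (fun w => Function.update x p w)
    (fun w _ w' _ h => Function.update_injective x p h) (fun _ _ => by simp) ?_ ?_
  · intro u _ hu
    rw [oneSite_apply_update, if_neg, zero_mul]
    intro h
    exact hu ⟨u p, by simp, h.symm⟩
  · intro w _
    rw [oneSite_apply_update]
    simp

theorem oneSite_conjTranspose (p : Fin n) (S : Matrix κ κ ℂ) :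
    (oneSite p S)ᴴ = oneSite p Sᴴ := by
  rw [oneSite, tensorMatrix_conjTranspose, oneSite]
  congr 1
  funext q
  by_cases h : q = p
  · subst h
    simp
  · simp [h]

theorem mul_oneSite_apply (p : Fin n) (S : Matrix κ κ ℂ)
    (X : Matrix (Fin n → κ) (Fin n → κ) ℂ) (x y : Fin n → κ) (z : κ) :
    (X * oneSite p S) x (Function.update y p z) =
      ∑ w, X x (Function.update y p w) * S w z := by
  have h := congrArg star (oneSite_mul_apply p Sᴴ Xᴴ y x z)
  rw [← oneSite_conjTranspose, ← Matrix.conjTranspose_mul, Matrix.conjTranspose_apply,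
    star_star] at h
  rw [h]
  simp [mul_comm]

/-- The slice of an operator at the system `p`. -/
def slice (X : Matrix (Fin n → κ) (Fin n → κ) ℂ) (p : Fin n) (x y : Fin n → κ) : Matrix κ κ ℂ :=
  Matrix.of fun z w => X (Function.update x p z) (Function.update y p w)

/-- An operator on system p changes only that coordinate, so the commutation relation separates into
one for each choice of the remaining coordinates. -/
theorem oneSite_comm_iff (p : Fin n) (S : Matrix κ κ ℂ)
    (X : Matrix (Fin n → κ) (Fin n → κ) ℂ) : oneSite p S * X = X * oneSite p S ↔
      ∀ x y, S * slice X p x y = slice X p x y * S := by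
  constructor
  · intro h x y
    ext z w
    have h1 := congrFun (congrFun h (Function.update x p z)) (Function.update y p w)
    rw [oneSite_mul_apply, mul_oneSite_apply] at h1
    exact h1
  · intro h
    ext x y
    have h1 := congrFun (congrFun (h x y) (x p)) (y p)
    have h2 := oneSite_mul_apply p S X x y (x p)
    have h3 := mul_oneSite_apply p S X x y (y p)
    rw [Function.update_eq_self] at h2 h3
    rw [h2, h3]
    simpa [slice, Matrix.mul_apply] using h1

theorem comm_tensorMatrix_of_oneSite {S : Fin n → Matrix κ κ ℂ}
    {X : Matrix (Fin n → κ) (Fin n → κ) ℂ}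
    (h : ∀ p, oneSite p (S p) * X = X * oneSite p (S p)) :
    tensorMatrix S * X = X * tensorMatrix S := by
  have key : ∀ s : Finset (Fin n), tensorMatrix (fun p => if p ∈ s then S p else 1) * X =
      X * tensorMatrix (fun p => if p ∈ s then S p else 1) := by
    intro s
    induction s using Finset.induction_on with
    | empty => simp [tensorMatrix_one]
    | insert p s hp ih =>
      have h1 : tensorMatrix (fun q => if q ∈ insert p s then S q else 1) =
          oneSite p (S p) * tensorMatrix (fun q => if q ∈ s then S q else 1) := by
        rw [oneSite, tensorMatrix_mul]
        congr 1
        funext q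
        by_cases hq : q = p
        · subst hq
          simp [hp]
        · simp [hq]
      rw [h1, Matrix.mul_assoc, ih, ← Matrix.mul_assoc, h p, Matrix.mul_assoc]
  simpa using key Finset.univ

end OneSite

/-- Permutation-invariant and locally invariant operators lie in the commutant of the local
family. -/
theorem localFamily_mem_of_invariant {ρ : ∀ j, G →* Matrix.unitaryGroup (Fin (r j)) ℂ}
    (hirr : ∀ j, (matrixRep (ρ j)).IsIrreducible)
    (hne : ∀ i j, i ≠ j → IsEmpty ((matrixRep (ρ i)).Equiv (matrixRep (ρ j))))
    {X : Matrix (Fin n → Site r deg) (Fin n → Site r deg) ℂ}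
    (hperm : ∀ σ, permOp (Fin n) (Site r deg) σ * X = X * permOp (Fin n) (Site r deg) σ)
    (hloc : ∀ g : Fin n → G, (tensorMatrix fun p => siteRep deg ρ (g p)) * X =
      X * tensorMatrix fun p => siteRep deg ρ (g p)) :
    (localFamily n r deg).Mem X := by
  rw [localFamily_mem_iff]
  refine ⟨hperm, fun f => comm_tensorMatrix_of_oneSite fun p => ?_⟩
  rw [oneSite_comm_iff]
  intro x y
  have h : ∀ g, siteRep deg ρ g * slice X p x y = slice X p x y * siteRep deg ρ g := by
    intro g
    refine (oneSite_comm_iff p (siteRep deg ρ g) X).1 ?_ x y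
    -- Local invariance allows g at system p and the identity of G elsewhere.
    have h1 := hloc (Function.update 1 p g)
    have h2 : (fun q => siteRep deg ρ (Function.update (1 : Fin n → G) p g q)) =
        Function.update (fun _ => 1) p (siteRep deg ρ g) := by
      funext q
      by_cases hq : q = p
      · subst hq
        simp
      · simp [hq, siteRep_one]
    rw [h2] at h1
    exact h1
  obtain ⟨B, hB⟩ := exists_eq_blockOp_of_siteRep hirr hne h
  rw [hB]
  exact siteUnit_mul_blockOp _ _

end Invariant

/-! ### Operators with values in a second system -/

section Extension

variable {I : Type*} [Fintype I] [DecidableEq I] {E : Type*} [NormedAddCommGroup E]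
  [InnerProductSpace ℂ E]

/-- The matrix element of an operator. -/
noncomputable def matrixElement (u v : E) : (E →L[ℂ] E) →ₗ[ℂ] ℂ where
  toFun T := inner ℂ u (T v)
  map_add' S T := by rw [add_apply, inner_add_right]
  map_smul' z T := by rw [smul_apply, inner_smul_right]; rfl

/-- Matrix elements separate bounded operators, and they are linear; no property of E beyond its
inner product enters. -/
theorem eq_of_forall_matrixElement {X Y : Matrix I I (E →L[ℂ] E)}
    (h : ∀ u v : E, X.map (matrixElement u v) = Y.map (matrixElement u v)) : X = Y := by
  ext a b v
  refine ext_inner_left ℂ fun u => ?_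
  exact congrFun (congrFun (h u v) a) b

theorem map_tensorOne_mul (φ : (E →L[ℂ] E) →ₗ[ℂ] ℂ) (A : Matrix I I ℂ)
    (X : Matrix I I (E →L[ℂ] E)) : (tensorOne E A * X).map φ = A * X.map φ := by
  ext a b
  simp only [Matrix.map_apply, Matrix.mul_apply, map_sum, tensorOne]
  refine Finset.sum_congr rfl fun c _ => ?_
  rw [← Algebra.smul_def, map_smul, smul_eq_mul]

theorem map_mul_tensorOne (φ : (E →L[ℂ] E) →ₗ[ℂ] ℂ) (A : Matrix I I ℂ)
    (X : Matrix I I (E →L[ℂ] E)) : (X * tensorOne E A).map φ = X.map φ * A := by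
  ext a b
  simp only [Matrix.map_apply, Matrix.mul_apply, map_sum, tensorOne]
  refine Finset.sum_congr rfl fun c _ => ?_
  rw [← Algebra.commutes, ← Algebra.smul_def, map_smul, smul_eq_mul, mul_comm]

end Extension

/-! ### Transport along isometries -/

section Transport

variable {I J : Type*} [Fintype I] [DecidableEq I] [Fintype J] [DecidableEq J]
  {W : Matrix I J ℂ}

/-- Conjugation of a map on matrices by an isometry. -/
noncomputable def conjMap (W : Matrix I J ℂ) (T : Matrix J J ℂ →ₗ[ℂ] Matrix J J ℂ) :
    Matrix I I ℂ →ₗ[ℂ] Matrix I I ℂ where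
  toFun X := W * T (Wᴴ * X * W) * Wᴴ
  map_add' X Y := by
    rw [Matrix.mul_add, Matrix.add_mul, map_add, Matrix.mul_add, Matrix.add_mul]
  map_smul' z X := by
    rw [Matrix.mul_smul, Matrix.smul_mul, map_smul, Matrix.mul_smul, Matrix.smul_mul]
    rfl

theorem conjMap_apply (T : Matrix J J ℂ →ₗ[ℂ] Matrix J J ℂ) (X : Matrix I I ℂ) :
    conjMap W T X = W * T (Wᴴ * X * W) * Wᴴ := rfl

theorem IsKraus.conjMap {T : Matrix J J ℂ →ₗ[ℂ] Matrix J J ℂ} (hT : IsKraus T)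
    (W : Matrix I J ℂ) : IsKraus (conjMap W T) := by
  obtain ⟨N, K, hK⟩ := hT
  refine ⟨N, fun k => W * K k * Wᴴ, fun X => ?_⟩
  rw [conjMap_apply, hK, Matrix.mul_sum, Matrix.sum_mul]
  refine Finset.sum_congr rfl fun k _ => ?_
  rw [Matrix.conjTranspose_mul, Matrix.conjTranspose_mul, Matrix.conjTranspose_conjTranspose]
  simp only [Matrix.mul_assoc]

theorem conj_mul_conj (hW : Wᴴ * W = 1) (A B : Matrix J J ℂ) :
    (W * A * Wᴴ) * (W * B * Wᴴ) = W * (A * B) * Wᴴ := by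
  rw [Matrix.mul_assoc, Matrix.mul_assoc W B, ← Matrix.mul_assoc Wᴴ, hW, Matrix.one_mul]
  simp only [Matrix.mul_assoc]

theorem star_conj (hW : Wᴴ * W = 1) (A : Matrix J J ℂ) : Wᴴ * (W * A * Wᴴ) * W = A := by
  rw [Matrix.mul_assoc W, ← Matrix.mul_assoc Wᴴ W, hW, Matrix.one_mul, Matrix.mul_assoc, hW,
    Matrix.mul_one]

theorem conj_star (hW : W * Wᴴ = 1) (X : Matrix I I ℂ) : W * (Wᴴ * X * W) * Wᴴ = X := by
  rw [Matrix.mul_assoc Wᴴ, ← Matrix.mul_assoc W Wᴴ, hW, Matrix.one_mul, Matrix.mul_assoc, hW,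
    Matrix.mul_one]

theorem trace_conj (hW : Wᴴ * W = 1) (A : Matrix J J ℂ) : (W * A * Wᴴ).trace = A.trace := by
  rw [Matrix.mul_assoc, Matrix.trace_mul_comm, Matrix.mul_assoc, hW, Matrix.mul_one]

theorem trace_star_conj (hW : W * Wᴴ = 1) (X : Matrix I I ℂ) : (Wᴴ * X * W).trace = X.trace := by
  rw [Matrix.mul_assoc, Matrix.trace_mul_comm, Matrix.mul_assoc, hW, Matrix.mul_one]

theorem conjTranspose_conj (A : Matrix J J ℂ) : (W * A * Wᴴ)ᴴ = W * Aᴴ * Wᴴ := by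
  rw [Matrix.conjTranspose_mul, Matrix.conjTranspose_mul, Matrix.conjTranspose_conjTranspose,
    Matrix.mul_assoc]

theorem IsSupportProjection.conj (h1 : Wᴴ * W = 1) (h2 : W * Wᴴ = 1) {τ Q : Matrix J J ℂ}
    (h : IsSupportProjection τ Q) : IsSupportProjection (W * τ * Wᴴ) (W * Q * Wᴴ) := by
  obtain ⟨hQ, htr, hmin⟩ := h
  refine ⟨⟨?_, ?_⟩, ?_, ?_⟩
  · rw [IsIdempotentElem, conj_mul_conj h1, hQ.isIdempotentElem.eq]
  · rw [IsSelfAdjoint, Matrix.star_eq_conjTranspose, conjTranspose_conj]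
    congr 2
    exact hQ.isSelfAdjoint
  · rw [conj_mul_conj h1, trace_conj h1, trace_conj h1, htr]
  · intro Q' hQ' htr'
    have h3 : IsStarProjection (Wᴴ * Q' * W) := by
      constructor
      · have := conj_mul_conj (W := Wᴴ) (by rwa [Matrix.conjTranspose_conjTranspose]) Q' Q'
        rw [Matrix.conjTranspose_conjTranspose, hQ'.isIdempotentElem.eq] at this
        exact this
      · rw [IsSelfAdjoint, Matrix.star_eq_conjTranspose]
        have := conjTranspose_conj (W := Wᴴ) Q'
        rw [Matrix.conjTranspose_conjTranspose] at this
        rw [this]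
        congr 2
        exact hQ'.isSelfAdjoint
    have h4 := hmin _ h3 (by
      rw [← trace_conj h1 τ, ← htr', ← trace_star_conj h2 (Q' * _)]
      congr 1
      simp only [Matrix.mul_assoc]
      rw [h1, Matrix.mul_one])
    have h5 := h4.mul_mul_conjTranspose_same W
    rwa [Matrix.mul_sub, Matrix.sub_mul, conj_star h2] at h5

end Transport

/-! ### Invariance as commutation, and its passage to matrix elements -/

section Invariance

variable {I J : Type*} [Fintype I] [DecidableEq I] [Fintype J] [DecidableEq J]

theorem comm_of_mul_mul_conjTranspose {U X : Matrix I I ℂ} (hU : Uᴴ * U = 1)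
    (h : U * X * Uᴴ = X) : U * X = X * U := by
  conv_rhs => rw [← h]
  rw [Matrix.mul_assoc, hU, Matrix.mul_one]

theorem star_conj_comm {W : Matrix I J ℂ} (hW : Wᴴ * W = 1) {U : Matrix J J ℂ} {X : Matrix I I ℂ}
    (h : (W * U * Wᴴ) * X = X * (W * U * Wᴴ)) : U * (Wᴴ * X * W) = (Wᴴ * X * W) * U := by
  calc U * (Wᴴ * X * W) = Wᴴ * ((W * U * Wᴴ) * X) * W := by
        rw [Matrix.mul_assoc W U, Matrix.mul_assoc W, ← Matrix.mul_assoc Wᴴ W, hW, Matrix.one_mul]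
        simp only [Matrix.mul_assoc]
    _ = _ := by
        rw [h]
        simp only [Matrix.mul_assoc]
        rw [hW, Matrix.mul_one]

variable {n d : ℕ} {E : Type*} [NormedAddCommGroup E] [InnerProductSpace ℂ E]

theorem PermInvariantExt.map {X : Matrix (Fin n → Fin d) (Fin n → Fin d) (E →L[ℂ] E)}
    (h : PermInvariantExt X) (φ : (E →L[ℂ] E) →ₗ[ℂ] ℂ) : PermInvariant (X.map φ) := by
  intro σ
  conv_rhs => rw [← h σ]
  rw [map_mul_tensorOne, map_tensorOne_mul]

theorem LocallyInvariantExt.map {G : Type*} [Group G] {π : G →* Matrix.unitaryGroup (Fin d) ℂ}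
    {X : Matrix (Fin n → Fin d) (Fin n → Fin d) (E →L[ℂ] E)}
    (h : LocallyInvariantExt π X) (φ : (E →L[ℂ] E) →ₗ[ℂ] ℂ) : LocallyInvariant π (X.map φ) := by
  intro g
  conv_rhs => rw [← h g]
  rw [map_mul_tensorOne, map_tensorOne_mul]

theorem permOp_conjTranspose_mul_self {ι κ : Type*} [Fintype ι] [DecidableEq ι] [Fintype κ]
    [DecidableEq κ] (σ : Equiv.Perm ι) : (permOp ι κ σ)ᴴ * permOp ι κ σ = 1 := by
  rw [permOp_conjTranspose, ← map_mul, inv_mul_cancel, map_one]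

theorem matrix_map_sum {α : Type*} {M : Type*} [AddCommGroup M] [Module ℂ M] (s : Finset α)
    (F : α → Matrix I J M) (φ : M →ₗ[ℂ] ℂ) :
    (∑ i ∈ s, F i).map φ = ∑ i ∈ s, (F i).map φ := by
  ext a b
  simp [Matrix.sum_apply]

end Invariance

/-! ### Transfer to the original space: pinching, channels, support bound -/

namespace LocalDecomposition

variable {G : Type*} [Group G] {d : ℕ} {π : G →* Matrix.unitaryGroup (Fin d) ℂ}
  (D : LocalDecomposition π)

theorem r_pos (j : Fin D.k) : 0 < D.r j := pos_of_isIrreducible (D.irreducible j)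

/-- The unitary identification of the `n`-fold tensor powers. -/
noncomputable def isometry (n : ℕ) : Matrix (Fin n → Fin d) (Fin n → Site D.r D.deg) ℂ :=
  tensorMatrix fun _ : Fin n => D.W

theorem isometry_star_mul (n : ℕ) : (D.isometry n)ᴴ * D.isometry n = 1 := by
  rw [isometry, tensorMatrix_conjTranspose, tensorMatrix_mul, D.W_star_mul, tensorMatrix_one]

theorem isometry_mul_star (n : ℕ) : D.isometry n * (D.isometry n)ᴴ = 1 := by
  rw [isometry, tensorMatrix_conjTranspose, tensorMatrix_mul, D.W_mul_star, tensorMatrix_one]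

variable {n : ℕ}

theorem permOp_eq_conj (σ : Equiv.Perm (Fin n)) : permOp (Fin n) (Fin d) σ =
    D.isometry n * permOp (Fin n) (Site D.r D.deg) σ * (D.isometry n)ᴴ := by
  rw [isometry, ← permOp_mul_tensorMatrix_const, Matrix.mul_assoc]
  have := D.isometry_mul_star n
  rw [isometry] at this
  rw [this, Matrix.mul_one]

theorem tensorMatrix_eq_conj (g : Fin n → G) :
    tensorMatrix (fun p => (π (g p) : Matrix (Fin d) (Fin d) ℂ)) =
      D.isometry n * (tensorMatrix fun p => siteRep D.deg D.irrep (g p)) * (D.isometry n)ᴴ := by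
  rw [isometry, tensorMatrix_conjTranspose, tensorMatrix_mul, tensorMatrix_mul]
  congr 1
  funext p
  exact D.decomp (g p)

theorem mem_of_invariant {X : Matrix (Fin n → Fin d) (Fin n → Fin d) ℂ} (h : PermInvariant X)
    (h' : LocallyInvariant π X) :
    (localFamily n D.r D.deg).Mem ((D.isometry n)ᴴ * X * D.isometry n) := by
  refine localFamily_mem_of_invariant D.irreducible D.inequivalent (fun σ => ?_) fun g => ?_
  · refine star_conj_comm (D.isometry_star_mul n) ?_
    rw [← D.permOp_eq_conj σ]
    exact comm_of_mul_mul_conjTranspose (permOp_conjTranspose_mul_self σ) (h σ)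
  · refine star_conj_comm (D.isometry_star_mul n) ?_
    rw [← D.tensorMatrix_eq_conj g]
    refine comm_of_mul_mul_conjTranspose ?_ (h' g)
    rw [tensorMatrix_conjTranspose, tensorMatrix_mul, ← tensorMatrix_one]
    congr 1
    funext p
    exact Unitary.coe_star_mul_self (π (g p))

/-- The block structure attached to the decomposition. -/
noncomputable abbrev blocks (n : ℕ) :
    (localFamily n D.r D.deg).Blocks (BlockIndex n D.deg) :=
  localBlocks n D.r D.deg D.r_pos

theorem P_eq_conj (b : BlockIndex n D.deg) : D.P n b.1.1 b.1.2 =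
    D.isometry n * (D.blocks n).P b * (D.isometry n)ᴴ := by
  rw [localBlocks_P]
  rfl

theorem exists_index {m : Fin D.k → ℕ} (hm : m ∈ types n D.k) {lam : ∀ j, Fin (D.deg j) → ℕ}
    (hlam : lam ∈ D.diagramFamilies m) :
    ∃ b : BlockIndex n D.deg, b.1 = ⟨m, lam⟩ :=
  ⟨⟨⟨m, lam⟩, Finset.mem_sigma.2 ⟨hm, hlam⟩⟩, rfl⟩

theorem pinching {X : Matrix (Fin n → Fin d) (Fin n → Fin d) ℂ} (h : PermInvariant X)
    (h' : LocallyInvariant π X) : X = ∑ m ∈ types n D.k, ∑ lam ∈ D.diagramFamilies m,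
      D.P n m lam * X * D.P n m lam := by
  have h1 := (D.blocks n).eq_sum_P_mul_mul (D.mem_of_invariant h h')
  have h2 := congrArg (fun Y => D.isometry n * Y * (D.isometry n)ᴴ) h1
  beta_reduce at h2
  rw [conj_star (D.isometry_mul_star n), Matrix.mul_sum, Matrix.sum_mul] at h2
  have h3 : ∀ b : BlockIndex n D.deg, D.isometry n * ((D.blocks n).P b *
      ((D.isometry n)ᴴ * X * D.isometry n) * (D.blocks n).P b) * (D.isometry n)ᴴ =
      D.P n b.1.1 b.1.2 * X * D.P n b.1.1 b.1.2 := by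
    intro b
    rw [D.P_eq_conj]
    simp only [Matrix.mul_assoc]
  rw [Finset.sum_congr rfl fun b _ => h3 b] at h2
  rw [Finset.sum_coe_sort ((types n D.k).sigma fun m => Fintype.piFinset fun j =>
      diagrams (m j) (D.deg j)) (fun b => D.P n b.1 b.2 * X * D.P n b.1 b.2),
    Finset.sum_sigma] at h2
  exact h2

/-- The compression map. -/
noncomputable def compression (n : ℕ) : Matrix (Fin n → Fin d) (Fin n → Fin d) ℂ →ₗ[ℂ]
    Matrix (Fin n → Fin d) (Fin n → Fin d) ℂ :=
  conjMap (D.isometry n) (D.blocks n).reduce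

/-- The recovery map. -/
noncomputable def recovery (n : ℕ) : Matrix (Fin n → Fin d) (Fin n → Fin d) ℂ →ₗ[ℂ]
    Matrix (Fin n → Fin d) (Fin n → Fin d) ℂ :=
  conjMap (D.isometry n) (localFamily n D.r D.deg).twirl

theorem isCPTP_compression : IsCPTP (D.compression n) :=
  ((D.blocks n).isKraus_reduce.conjMap _).isCPTP fun X => by
    rw [conjMap_apply, trace_conj (D.isometry_star_mul n), (D.blocks n).trace_reduce,
      trace_star_conj (D.isometry_mul_star n)]

theorem isCPTP_recovery : IsCPTP (D.recovery n) :=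
  ((localFamily n D.r D.deg).isKraus_twirl.conjMap _).isCPTP fun X => by
    rw [conjMap_apply, trace_conj (D.isometry_star_mul n), TwirlFamily.trace_twirl,
      trace_star_conj (D.isometry_mul_star n)]

theorem compression_P_mul_mul (b : BlockIndex n D.deg)
    (X : Matrix (Fin n → Fin d) (Fin n → Fin d) ℂ) :
    D.compression n (D.P n b.1.1 b.1.2 * X * D.P n b.1.1 b.1.2) =
      D.P n b.1.1 b.1.2 * D.compression n X * D.P n b.1.1 b.1.2 := by
  have h1 : (D.isometry n)ᴴ * (D.P n b.1.1 b.1.2 * X * D.P n b.1.1 b.1.2) * D.isometry n =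
      (D.blocks n).P b * ((D.isometry n)ᴴ * X * D.isometry n) * (D.blocks n).P b := by
    conv_lhs => rw [← conj_star (D.isometry_mul_star n) X, D.P_eq_conj,
      conj_mul_conj (D.isometry_star_mul n), conj_mul_conj (D.isometry_star_mul n),
      star_conj (D.isometry_star_mul n)]
  rw [compression, conjMap_apply, h1, (D.blocks n).reduce_P_mul_mul, conjMap_apply, D.P_eq_conj,
    conj_mul_conj (D.isometry_star_mul n), conj_mul_conj (D.isometry_star_mul n)]

theorem recovery_compression {X : Matrix (Fin n → Fin d) (Fin n → Fin d) ℂ} (h : PermInvariant X)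
    (h' : LocallyInvariant π X) : D.recovery n (D.compression n X) = X := by
  rw [recovery, compression, conjMap_apply, conjMap_apply, star_conj (D.isometry_star_mul n),
    (D.blocks n).twirl_reduce (D.mem_of_invariant h h'), conj_star (D.isometry_mul_star n)]

theorem pinching_ext {E : Type*} [NormedAddCommGroup E] [InnerProductSpace ℂ E]
    {X : Matrix (Fin n → Fin d) (Fin n → Fin d) (E →L[ℂ] E)} (h : PermInvariantExt X)
    (h' : LocallyInvariantExt π X) : X = ∑ m ∈ types n D.k, ∑ lam ∈ D.diagramFamilies m,
      tensorOne E (D.P n m lam) * X * tensorOne E (D.P n m lam) := by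
  refine eq_of_forall_matrixElement fun u v => ?_
  conv_lhs => rw [D.pinching (h.map (matrixElement u v)) (h'.map (matrixElement u v))]
  rw [matrix_map_sum]
  refine Finset.sum_congr rfl fun m _ => ?_
  rw [matrix_map_sum]
  refine Finset.sum_congr rfl fun lam _ => ?_
  rw [map_mul_tensorOne, map_tensorOne_mul]

theorem tensorId_compression {E : Type*} [NormedAddCommGroup E] [InnerProductSpace ℂ E]
    (X : Matrix (Fin n → Fin d) (Fin n → Fin d) (E →L[ℂ] E))
    {m : Fin D.k → ℕ} (hm : m ∈ types n D.k) {lam : ∀ j, Fin (D.deg j) → ℕ}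
    (hlam : lam ∈ D.diagramFamilies m) :
    tensorId (D.compression n) (tensorOne E (D.P n m lam) * X * tensorOne E (D.P n m lam)) =
      tensorOne E (D.P n m lam) * tensorId (D.compression n) X * tensorOne E (D.P n m lam) := by
  refine eq_of_forall_matrixElement fun u v => ?_
  rw [map_tensorId, map_mul_tensorOne, map_tensorOne_mul, map_mul_tensorOne, map_tensorOne_mul,
    map_tensorId]
  exact D.compression_P_mul_mul ⟨⟨m, lam⟩, Finset.mem_sigma.2 ⟨hm, hlam⟩⟩ _

theorem tensorId_recovery_comp_compression {E : Type*} [NormedAddCommGroup E]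
    [InnerProductSpace ℂ E]
    {X : Matrix (Fin n → Fin d) (Fin n → Fin d) (E →L[ℂ] E)} (h : PermInvariantExt X)
    (h' : LocallyInvariantExt π X) : tensorId (D.recovery n ∘ₗ D.compression n) X = X := by
  refine eq_of_forall_matrixElement fun u v => ?_
  rw [map_tensorId, LinearMap.comp_apply]
  exact D.recovery_compression (h.map (matrixElement u v)) (h'.map (matrixElement u v))

/-- The operators `diag(lam_j / n) / r_j`. -/
noncomputable def spectrumOp (n : ℕ) (lam : ∀ j, Fin (D.deg j) → ℕ) (j : Fin D.k) :
    Matrix (Fin (D.deg j)) (Fin (D.deg j)) ℂ :=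
  Matrix.diagonal fun i => (D.r j : ℂ)⁻¹ * (((lam j i : ℝ) / n : ℝ) : ℂ)

/-- The factor 1/r_j is shifted from the representation space to the multiplicity space, so that the
state becomes a conjugate ⨁_j 1 ⊗ U_j C_j U_j†. -/
theorem tensorMatrix_tau (lam : ∀ j, Fin (D.deg j) → ℕ)
    (U : ∀ j, Matrix.unitaryGroup (Fin (D.deg j)) ℂ) :
    (tensorMatrix fun _ : Fin n => D.tau n lam U) =
      D.isometry n * conjPow n D.r (D.spectrumOp n lam) U * (D.isometry n)ᴴ := by
  rw [isometry, conjPow, blockPow, tensorMatrix_conjTranspose, tensorMatrix_mul, tensorMatrix_mul]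
  congr 1
  funext _
  rw [tau, blockOp]
  congr 3
  funext j
  rw [Matrix.smul_kronecker, ← Matrix.kronecker_smul]
  congr 1
  have h : D.spectrumOp n lam j =
      (D.r j : ℂ)⁻¹ • Matrix.diagonal (fun i => (lam j i : ℂ) / (n : ℂ)) := by
    rw [spectrumOp, ← Matrix.diagonal_smul]
    congr 1
    funext i
    simp
  rw [h, Matrix.mul_smul, Matrix.smul_mul]

theorem averagedIID_eq_conj (lam : ∀ j, Fin (D.deg j) → ℕ) : D.averagedIID n lam =
    D.isometry n * haarAverage n D.r (D.spectrumOp n lam) * (D.isometry n)ᴴ := by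
  ext x y
  rw [mul_haarAverage_mul_apply, averagedIID, Matrix.of_apply]
  simp only [tensorMatrix_tau]

theorem blockPow_spectrumOp (lam : ∀ j, Fin (D.deg j) → ℕ) :
    blockPow n D.r (D.spectrumOp n lam) =
      tensorMatrix fun _ : Fin n => siteDiag D.r fun j i => (lam j i : ℝ) / n := by
  rw [blockPow]
  congr 1
  funext _
  exact blockOp_diagonal _

/-- The abstract bound is applied to the Haar average, which lies in the commutant by
`haarAverage_mem` and commutes with it by `comm_of_mem`. Its normalisation hypothesis is
`prefactor_mul_trace`. -/
theorem exists_support_le {ρ : Matrix (Fin n → Fin d) (Fin n → Fin d) ℂ} (hρ : ρ.PosSemidef)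
    (h : PermInvariant ρ) (h' : LocallyInvariant π ρ) {m : Fin D.k → ℕ} (hm : m ∈ types n D.k)
    {lam : ∀ j, Fin (D.deg j) → ℕ} (hlam : lam ∈ D.diagramFamilies m) :
    ∃ Q : Matrix (Fin n → Fin d) (Fin n → Fin d) ℂ,
      IsSupportProjection (D.compression n (D.P n m lam * ρ * D.P n m lam)) Q ∧
      (((fc m * ∏ j, fq (lam j) : ℝ) : ℂ) • D.compression n (D.averagedIID n lam)
        - Q).PosSemidef := by
  obtain ⟨b, hb⟩ := D.exists_index hm hlam
  obtain ⟨b, hb'⟩ := b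
  subst hb
  set b : BlockIndex n D.deg := ⟨⟨m, lam⟩, hb'⟩ with hbdef
  have hA := haarAverage_mem (n := n) (r := D.r) (D.spectrumOp n lam)
  -- All blocks are needed, although the state belongs to `lam`: the other traces show that the
  -- discarded coefficients are nonnegative.
  have htr : ∀ b' : BlockIndex n D.deg,
      ((D.blocks n).e b' * haarAverage n D.r (D.spectrumOp n lam)).trace =
        ((∏ j, ((D.r j : ℝ) ^ b'.1.1 j)⁻¹ *
          MvPolynomial.eval (fun i => (lam j i : ℝ) / n) (schurPoly (b'.1.2 j)) : ℝ) : ℂ) := by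
    intro b'
    rw [trace_mul_haarAverage _ ((D.blocks n).comm b'), blockPow_spectrumOp]
    exact trace_minimalProj_mul_siteDiag b'.eq_sum b'.antitone D.r_pos b'.sum_eq _
  obtain ⟨Q, hQ, hle⟩ := (D.blocks n).exists_support_le hA
    (fun Z hZ => comm_of_mem D.r_pos (haarAverage_comm _) hZ) (D.mem_of_invariant h h')
    (by
      have := hρ.mul_mul_conjTranspose_same (D.isometry n)ᴴ
      rwa [Matrix.conjTranspose_conjTranspose] at this) b (prefactor_nonneg b.eq_sum b.antitone)
    (fun b' => by
      rw [htr b']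
      refine Complex.zero_le_real.2 (Finset.prod_nonneg fun j _ => mul_nonneg (by positivity) ?_)
      exact eval_schurPoly_nonneg (standardNumbering _) (b'.antitone j) fun i => by positivity)
    (by
      rw [htr b]
      refine Eq.trans ?_ (trace_minimalProj b.eq_sum b.antitone D.r_pos b.sum_eq).symm
      have := prefactor_mul_trace b.eq_sum b.antitone D.r_pos b.sum_eq
      exact_mod_cast this)
  refine ⟨D.isometry n * Q * (D.isometry n)ᴴ, ?_, ?_⟩
  · have h1 : D.compression n (D.P n m lam * ρ * D.P n m lam) = D.isometry n *
        ((D.blocks n).reduce ((D.blocks n).P b * ((D.isometry n)ᴴ * ρ * D.isometry n) *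
          (D.blocks n).P b)) * (D.isometry n)ᴴ := by
      rw [D.compression_P_mul_mul b, (D.blocks n).reduce_P_mul_mul, D.P_eq_conj b, compression,
        conjMap_apply, conj_mul_conj (D.isometry_star_mul n),
        conj_mul_conj (D.isometry_star_mul n)]
    rw [h1]
    exact hQ.conj (D.isometry_star_mul n) (D.isometry_mul_star n)
  · have h2 := hle.mul_mul_conjTranspose_same (D.isometry n)
    rw [Matrix.mul_sub, Matrix.sub_mul, Matrix.mul_smul, Matrix.smul_mul] at h2
    rw [averagedIID_eq_conj, compression, conjMap_apply, star_conj (D.isometry_star_mul n)]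
    exact h2

end LocalDecomposition

/-! ### Existence of local decompositions -/

section Decomposition

variable {G : Type*} [Group G]

theorem coe_map_inv {a : ℕ} (ρ : G →* Matrix.unitaryGroup (Fin a) ℂ) (g : G) :
    (ρ g⁻¹ : Matrix (Fin a) (Fin a) ℂ) = (ρ g : Matrix (Fin a) (Fin a) ℂ)ᴴ := by
  rw [map_inv]
  rfl

theorem conjTranspose_intertwines {a b : ℕ} {ρ : G →* Matrix.unitaryGroup (Fin a) ℂ}
    {σ : G →* Matrix.unitaryGroup (Fin b) ℂ} {N : Matrix (Fin a) (Fin b) ℂ}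
    (hN : ∀ g, (ρ g : Matrix (Fin a) (Fin a) ℂ) * N = N * (σ g : Matrix (Fin b) (Fin b) ℂ))
    (g : G) : (σ g : Matrix (Fin b) (Fin b) ℂ) * Nᴴ = Nᴴ * (ρ g : Matrix (Fin a) (Fin a) ℂ) := by
  have h := congrArg Matrix.conjTranspose (hN g⁻¹)
  rw [coe_map_inv, coe_map_inv, Matrix.conjTranspose_mul, Matrix.conjTranspose_mul,
    Matrix.conjTranspose_conjTranspose, Matrix.conjTranspose_conjTranspose] at h
  exact h.symm

/-- Equivalent irreducible unitary representations are unitarily equivalent. -/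
theorem exists_unitary_intertwiner {a b : ℕ} {ρ : G →* Matrix.unitaryGroup (Fin a) ℂ}
    {σ : G →* Matrix.unitaryGroup (Fin b) ℂ} (hρ : (matrixRep ρ).IsIrreducible)
    (hσ : (matrixRep σ).IsIrreducible) (e : (matrixRep σ).Equiv (matrixRep ρ)) :
    ∃ M : Matrix (Fin a) (Fin b) ℂ,
      (∀ g, (ρ g : Matrix (Fin a) (Fin a) ℂ) * M = M * (σ g : Matrix (Fin b) (Fin b) ℂ)) ∧
      Mᴴ * M = 1 ∧ M * Mᴴ = 1 := by
  set N : Matrix (Fin a) (Fin b) ℂ := LinearMap.toMatrix' e.toLinearMap with hNdef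
  have hNv : ∀ v, N *ᵥ v = e v := fun v => LinearMap.toMatrix'_mulVec _ _
  have hN : ∀ g, (ρ g : Matrix (Fin a) (Fin a) ℂ) * N =
      N * (σ g : Matrix (Fin b) (Fin b) ℂ) := by
    intro g
    refine Matrix.toLin'.injective (LinearMap.ext fun v => ?_)
    rw [Matrix.toLin'_mul_apply, Matrix.toLin'_mul_apply, Matrix.toLin'_apply, Matrix.toLin'_apply,
      Matrix.toLin'_apply, Matrix.toLin'_apply, hNv, hNv, ← matrixRep_apply, ← matrixRep_apply]
    exact (LinearMap.congr_fun (e.isIntertwining' g) v).symm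
  have hNH := conjTranspose_intertwines hN
  have hN0 : N ≠ 0 := by
    intro h
    have h1 : e (Pi.single ⟨0, pos_of_isIrreducible hσ⟩ 1) = e 0 := by
      rw [← hNv, ← hNv, h, Matrix.zero_mulVec, Matrix.zero_mulVec]
    have h2 := congrFun (e.toLinearEquiv.injective h1) ⟨0, pos_of_isIrreducible hσ⟩
    simp at h2
  -- By Schur's lemma N†N = z and NN† = z' are scalars. Comparing the two readings of NN†N gives z'
  -- = z, and z > 0 because N ≠ 0; so N/√z is unitary.
  obtain ⟨z, hz⟩ := exists_scalar_of_commutes hσ (Nᴴ * N) fun g => by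
    rw [← Matrix.mul_assoc, hNH, Matrix.mul_assoc, hN, Matrix.mul_assoc]
  obtain ⟨z', hz'⟩ := exists_scalar_of_commutes hρ (N * Nᴴ) fun g => by
    rw [← Matrix.mul_assoc, hN, Matrix.mul_assoc, hNH, Matrix.mul_assoc]
  have hzz : z' = z := by
    have h : z' • N = z • N := by
      calc z' • N = N * Nᴴ * N := by rw [hz', Matrix.smul_mul, Matrix.one_mul]
        _ = z • N := by rw [Matrix.mul_assoc, hz, Matrix.mul_smul, Matrix.mul_one]
    exact smul_left_injective ℂ hN0 h
  have hz0 : 0 ≤ z := by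
    have h := (Matrix.posSemidef_conjTranspose_mul_self N).diag_nonneg
      (i := ⟨0, pos_of_isIrreducible hσ⟩)
    rw [hz] at h
    simpa using h
  obtain ⟨s, hs⟩ : ∃ s : ℝ, z = s := ⟨z.re, (Complex.eq_re_of_ofReal_le hz0)⟩
  have hspos : 0 < s := by
    rw [hs] at hz0
    refine lt_of_le_of_ne (by exact_mod_cast hz0) fun h => hN0 ?_
    rw [hs, ← h, Complex.ofReal_zero, zero_smul] at hz
    exact Matrix.conjTranspose_mul_self_eq_zero.1 hz
  have hsq : ((Real.sqrt s)⁻¹ : ℂ) * ((Real.sqrt s)⁻¹ : ℂ) * z = 1 := by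
    rw [hs]
    have h : (Real.sqrt s)⁻¹ * (Real.sqrt s)⁻¹ * s = 1 := by
      rw [← mul_inv, Real.mul_self_sqrt hspos.le, inv_mul_cancel₀ hspos.ne']
    exact_mod_cast h
  have hstar : star ((Real.sqrt s)⁻¹ : ℂ) = ((Real.sqrt s)⁻¹ : ℂ) := by
    rw [star_inv₀]
    congr 1
    exact Complex.conj_ofReal _
  refine ⟨((Real.sqrt s)⁻¹ : ℂ) • N, fun g => ?_, ?_, ?_⟩
  · rw [Matrix.mul_smul, hN, Matrix.smul_mul]
  · rw [Matrix.conjTranspose_smul, hstar, Matrix.smul_mul, Matrix.mul_smul, hz, smul_smul,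
      smul_smul, hsq, one_smul]
  · rw [Matrix.conjTranspose_smul, hstar, Matrix.smul_mul, Matrix.mul_smul, hz', hzz, smul_smul,
      smul_smul, hsq, one_smul]

/-- An isometric embedding of an irreducible unitary representation. -/
structure IrreducibleEmbedding {d : ℕ} (π : G →* Matrix.unitaryGroup (Fin d) ℂ) where
  /-- the dimension -/
  dim : ℕ
  /-- the irreducible representation -/
  rep : G →* Matrix.unitaryGroup (Fin dim) ℂ
  irreducible : (matrixRep rep).IsIrreducible
  /-- the embedding -/
  T : Matrix (Fin d) (Fin dim) ℂ
  star_mul_self : Tᴴ * T = 1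
  intertwines : ∀ g, (π g : Matrix (Fin d) (Fin d) ℂ) * T =
    T * (rep g : Matrix (Fin dim) (Fin dim) ℂ)

/-- Complete reducibility. -/
def IsCompletelyReducible {d : ℕ} (π : G →* Matrix.unitaryGroup (Fin d) ℂ) : Prop :=
  ∃ (ι : Type) (_ : Fintype ι) (F : ι → IrreducibleEmbedding π),
    (∀ i j, i ≠ j → (F i).Tᴴ * (F j).T = 0) ∧ ∑ i, (F i).T * (F i).Tᴴ = 1

/-- The composition with an isometric intertwiner. -/
noncomputable def IrreducibleEmbedding.comp {d a : ℕ} {π : G →* Matrix.unitaryGroup (Fin d) ℂ}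
    {ρ : G →* Matrix.unitaryGroup (Fin a) ℂ} (F : IrreducibleEmbedding ρ)
    (S : Matrix (Fin d) (Fin a) ℂ) (hS : Sᴴ * S = 1)
    (h : ∀ g, (π g : Matrix (Fin d) (Fin d) ℂ) * S = S * (ρ g : Matrix (Fin a) (Fin a) ℂ)) :
    IrreducibleEmbedding π where
  dim := F.dim
  rep := F.rep
  irreducible := F.irreducible
  T := S * F.T
  star_mul_self := by
    rw [Matrix.conjTranspose_mul, Matrix.mul_assoc, ← Matrix.mul_assoc Sᴴ, hS, Matrix.one_mul,
      F.star_mul_self]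
  intertwines g := by
    rw [← Matrix.mul_assoc, h, Matrix.mul_assoc, F.intertwines, Matrix.mul_assoc]

theorem IsCompletelyReducible.sum {d a b : ℕ} {π : G →* Matrix.unitaryGroup (Fin d) ℂ}
    {ρ : G →* Matrix.unitaryGroup (Fin a) ℂ} {σ : G →* Matrix.unitaryGroup (Fin b) ℂ}
    (hρ : IsCompletelyReducible ρ) (hσ : IsCompletelyReducible σ)
    {S : Matrix (Fin d) (Fin a) ℂ} {S' : Matrix (Fin d) (Fin b) ℂ} (hS : Sᴴ * S = 1)
    (hS' : S'ᴴ * S' = 1) (hSS' : Sᴴ * S' = 0) (hsum : S * Sᴴ + S' * S'ᴴ = 1)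
    (h : ∀ g, (π g : Matrix (Fin d) (Fin d) ℂ) * S = S * (ρ g : Matrix (Fin a) (Fin a) ℂ))
    (h' : ∀ g, (π g : Matrix (Fin d) (Fin d) ℂ) * S' = S' * (σ g : Matrix (Fin b) (Fin b) ℂ)) :
    IsCompletelyReducible π := by
  obtain ⟨ι, _, F, hF, hF1⟩ := hρ
  obtain ⟨ι', _, F', hF', hF1'⟩ := hσ
  have hS'S : S'ᴴ * S = 0 := by
    have := congrArg Matrix.conjTranspose hSS'
    rwa [Matrix.conjTranspose_mul, Matrix.conjTranspose_conjTranspose,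
      Matrix.conjTranspose_zero] at this
  refine ⟨ι ⊕ ι', inferInstance, Sum.elim (fun i => (F i).comp S hS h)
    (fun i => (F' i).comp S' hS' h'), ?_, ?_⟩
  · rintro (i | i) (j | j) hij
    · change (S * (F i).T)ᴴ * (S * (F j).T) = 0
      rw [Matrix.conjTranspose_mul, Matrix.mul_assoc, ← Matrix.mul_assoc Sᴴ, hS, Matrix.one_mul,
        hF i j (fun hh => hij (by rw [hh]))]
    · change (S * (F i).T)ᴴ * (S' * (F' j).T) = 0
      rw [Matrix.conjTranspose_mul, Matrix.mul_assoc, ← Matrix.mul_assoc Sᴴ, hSS', Matrix.zero_mul,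
        Matrix.mul_zero]
    · change (S' * (F' i).T)ᴴ * (S * (F j).T) = 0
      rw [Matrix.conjTranspose_mul, Matrix.mul_assoc, ← Matrix.mul_assoc S'ᴴ, hS'S, Matrix.zero_mul,
        Matrix.mul_zero]
    · change (S' * (F' i).T)ᴴ * (S' * (F' j).T) = 0
      rw [Matrix.conjTranspose_mul, Matrix.mul_assoc, ← Matrix.mul_assoc S'ᴴ, hS', Matrix.one_mul,
        hF' i j (fun hh => hij (by rw [hh]))]
  · rw [Fintype.sum_sum_type]
    change ∑ i, (S * (F i).T) * (S * (F i).T)ᴴ + ∑ i, (S' * (F' i).T) * (S' * (F' i).T)ᴴ = 1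
    have e1 : ∀ i, (S * (F i).T) * (S * (F i).T)ᴴ = S * ((F i).T * (F i).Tᴴ) * Sᴴ := fun i => by
      rw [Matrix.conjTranspose_mul]
      simp only [Matrix.mul_assoc]
    have e2 : ∀ i, (S' * (F' i).T) * (S' * (F' i).T)ᴴ = S' * ((F' i).T * (F' i).Tᴴ) * S'ᴴ :=
      fun i => by
        rw [Matrix.conjTranspose_mul]
        simp only [Matrix.mul_assoc]
    simp only [e1, e2]
    rw [← Matrix.sum_mul, ← Matrix.mul_sum, hF1, ← Matrix.sum_mul, ← Matrix.mul_sum, hF1',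
      Matrix.mul_one, Matrix.mul_one, hsum]

/-- The restriction of a representation to the range of an isometry. -/
noncomputable def restrictRep {d a : ℕ} (π : G →* Matrix.unitaryGroup (Fin d) ℂ)
    (S : Matrix (Fin d) (Fin a) ℂ) (hS : Sᴴ * S = 1)
    (h : ∀ g, (π g : Matrix (Fin d) (Fin d) ℂ) * S =
      S * (Sᴴ * (π g : Matrix (Fin d) (Fin d) ℂ) * S)) : G →* Matrix.unitaryGroup (Fin a) ℂ :=
  have hmul : ∀ g g', (Sᴴ * (π g : Matrix (Fin d) (Fin d) ℂ) * S) *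
      (Sᴴ * (π g' : Matrix (Fin d) (Fin d) ℂ) * S) =
      Sᴴ * (π (g * g') : Matrix (Fin d) (Fin d) ℂ) * S := fun g g' => by
    rw [Matrix.mul_assoc Sᴴ (π g : Matrix (Fin d) (Fin d) ℂ) S, Matrix.mul_assoc Sᴴ,
      Matrix.mul_assoc (π g : Matrix (Fin d) (Fin d) ℂ) S, ← h, map_mul,
      Submonoid.coe_mul]
    simp only [Matrix.mul_assoc]
  have hone : Sᴴ * (π 1 : Matrix (Fin d) (Fin d) ℂ) * S = 1 := by
    rw [map_one, OneMemClass.coe_one, Matrix.mul_one, hS]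
  { toFun := fun g => ⟨Sᴴ * (π g : Matrix (Fin d) (Fin d) ℂ) * S, by
      rw [Matrix.mem_unitaryGroup_iff]
      have h1 : star (Sᴴ * (π g : Matrix (Fin d) (Fin d) ℂ) * S) =
          Sᴴ * (π g⁻¹ : Matrix (Fin d) (Fin d) ℂ) * S := by
        rw [coe_map_inv, Matrix.star_eq_conjTranspose, Matrix.conjTranspose_mul,
          Matrix.conjTranspose_mul, Matrix.conjTranspose_conjTranspose, Matrix.mul_assoc]
      rw [h1, hmul, mul_inv_cancel, hone]⟩
    map_one' := Subtype.ext hone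
    map_mul' := fun g g' => Subtype.ext (hmul g g').symm }

/-- The matrix whose columns are given vectors. -/
def columnMatrix {d a : ℕ} (v : Fin a → EuclideanSpace ℂ (Fin d)) : Matrix (Fin d) (Fin a) ℂ :=
  Matrix.of fun x i => v i x

theorem columnMatrix_star_mul_apply {d a b : ℕ} (v : Fin a → EuclideanSpace ℂ (Fin d))
    (A : Matrix (Fin d) (Fin d) ℂ) (w : Fin b → EuclideanSpace ℂ (Fin d)) (i : Fin a) (j : Fin b) :
    ((columnMatrix v)ᴴ * (A * columnMatrix w)) i j =
      inner ℂ (v i) (Matrix.toEuclideanLin A (w j)) := by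
  rw [Matrix.mul_apply, PiLp.inner_apply]
  refine Finset.sum_congr rfl fun x _ => ?_
  rw [Matrix.mul_apply, Matrix.conjTranspose_apply, RCLike.inner_apply, mul_comm]
  rfl

/-- A subspace and its complement, as complementary isometries. -/
theorem exists_complementary_isometries {d : ℕ} (V : Submodule ℂ (EuclideanSpace ℂ (Fin d)))
    (hV : V ≠ ⊥) (hV' : V ≠ ⊤) : ∃ (a b : ℕ) (v : Fin a → EuclideanSpace ℂ (Fin d))
      (w : Fin b → EuclideanSpace ℂ (Fin d)), a < d ∧ b < d ∧ (∀ i, v i ∈ V) ∧ (∀ i, w i ∈ Vᗮ) ∧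
      (columnMatrix v)ᴴ * columnMatrix v = 1 ∧ (columnMatrix w)ᴴ * columnMatrix w = 1 ∧
      (columnMatrix v)ᴴ * columnMatrix w = 0 ∧
      columnMatrix v * (columnMatrix v)ᴴ + columnMatrix w * (columnMatrix w)ᴴ = 1 := by
  have hfin : Module.finrank ℂ V + Module.finrank ℂ Vᗮ = d := by
    rw [Submodule.finrank_add_finrank_orthogonal, finrank_euclideanSpace_fin]
  have hpos : 0 < Module.finrank ℂ V := Nat.pos_of_ne_zero fun h =>
    hV (Submodule.finrank_eq_zero.1 h)
  have hpos' : 0 < Module.finrank ℂ Vᗮ := Nat.pos_of_ne_zero fun h =>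
    hV' ((Submodule.orthogonal_eq_bot_iff).1 (Submodule.finrank_eq_zero.1 h))
  set e := stdOrthonormalBasis ℂ V
  set f := stdOrthonormalBasis ℂ Vᗮ
  set v : Fin (Module.finrank ℂ V) → EuclideanSpace ℂ (Fin d) :=
    fun i => (e i : EuclideanSpace ℂ (Fin d))
  set w : Fin (Module.finrank ℂ Vᗮ) → EuclideanSpace ℂ (Fin d) :=
    fun i => (f i : EuclideanSpace ℂ (Fin d))
  have h0 : ∀ {a b : ℕ} (v : Fin a → EuclideanSpace ℂ (Fin d))
      (w : Fin b → EuclideanSpace ℂ (Fin d)) i j,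
      ((columnMatrix v)ᴴ * columnMatrix w) i j = inner ℂ (v i) (w j) := by
    intro a b v w i j
    have := columnMatrix_star_mul_apply v 1 w i j
    rwa [Matrix.one_mul, Matrix.toLpLin_one] at this
  have h1 : (columnMatrix v)ᴴ * columnMatrix v = 1 := by
    ext i j
    rw [h0, Matrix.one_apply]
    exact orthonormal_iff_ite.1 e.orthonormal i j
  have h2 : (columnMatrix w)ᴴ * columnMatrix w = 1 := by
    ext i j
    rw [h0, Matrix.one_apply]
    exact orthonormal_iff_ite.1 f.orthonormal i j
  have h3 : (columnMatrix v)ᴴ * columnMatrix w = 0 := by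
    ext i j
    rw [h0]
    exact (Submodule.mem_orthogonal _ _).1 (f j).2 _ (e i).2
  have h4 : (columnMatrix w)ᴴ * columnMatrix v = 0 := by
    have := congrArg Matrix.conjTranspose h3
    rwa [Matrix.conjTranspose_mul, Matrix.conjTranspose_conjTranspose,
      Matrix.conjTranspose_zero] at this
  refine ⟨_, _, v, w, by omega, by omega, fun i => (e i).2, fun i => (f i).2, h1, h2, h3, ?_⟩
  rw [← Matrix.fromCols_mul_fromRows]
  rw [Matrix.mul_eq_one_comm_of_equiv ((finCongr hfin.symm).trans finSumFinEquiv.symm),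
    Matrix.fromRows_mul_fromCols, h1, h2, h3, h4, Matrix.fromBlocks_one]

/-- Induction on the dimension: the orthogonal complement of an invariant subspace is invariant
because π(g)† = π(g⁻¹), and for a proper nonzero subspace both parts are smaller. Dimension zero is
the empty sum. -/
theorem isCompletelyReducible {d : ℕ} (π : G →* Matrix.unitaryGroup (Fin d) ℂ) :
    IsCompletelyReducible π := by
  induction d using Nat.strong_induction_on with
  | _ d ih =>
  rcases Nat.eq_zero_or_pos d with rfl | hd
  · exact ⟨Empty, inferInstance, fun i => i.elim, fun i => i.elim, by
      ext i
      exact i.elim0⟩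
  by_cases hirr : (matrixRep π).IsIrreducible
  · exact ⟨Unit, inferInstance, fun _ => ⟨d, π, hirr, 1, by simp, by simp⟩,
      fun i j hij => (hij rfl).elim, by simp⟩
  obtain ⟨U, hU, hU'⟩ : ∃ U : Subrepresentation (matrixRep π),
      U.toSubmodule ≠ ⊥ ∧ U.toSubmodule ≠ ⊤ := by
    by_contra hcon
    push Not at hcon
    have : Nontrivial (Subrepresentation (matrixRep π)) := by
      refine ⟨⊥, ⊤, fun h => ?_⟩
      have h1 : (⊥ : Submodule ℂ (Fin d → ℂ)) = ⊤ := congrArg Subrepresentation.toSubmodule h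
      have h2 : (Pi.single (⟨0, hd⟩ : Fin d) (1 : ℂ) : Fin d → ℂ) ∈
          (⊥ : Submodule ℂ (Fin d → ℂ)) := h1 ▸ Submodule.mem_top
      have h3 := congrFun ((Submodule.mem_bot ℂ).1 h2) ⟨0, hd⟩
      simp at h3
    refine hirr ⟨fun U => ?_⟩
    by_cases h : U.toSubmodule = ⊥
    · exact Or.inl (Subrepresentation.toSubmodule_injective h)
    · exact Or.inr (Subrepresentation.toSubmodule_injective (hcon U h))
  set V : Submodule ℂ (EuclideanSpace ℂ (Fin d)) :=
    U.toSubmodule.comap (WithLp.linearEquiv 2 ℂ (Fin d → ℂ)).toLinearMap with hVdef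
  have hVinv : ∀ g, ∀ x ∈ V,
      Matrix.toEuclideanLin (π g : Matrix (Fin d) (Fin d) ℂ) x ∈ V := by
    intro g x hx
    exact U.apply_mem_toSubmodule g hx
  have hV : V ≠ ⊥ := by
    intro h
    refine hU (eq_bot_iff.2 fun x hx => ?_)
    have h1 : WithLp.toLp 2 x ∈ V := hx
    rw [h, Submodule.mem_bot] at h1
    rw [Submodule.mem_bot]
    exact congrArg WithLp.ofLp h1
  have hV' : V ≠ ⊤ := by
    intro h
    refine hU' (eq_top_iff.2 fun x _ => ?_)
    have h1 : WithLp.toLp 2 x ∈ V := h ▸ Submodule.mem_top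
    exact h1
  obtain ⟨a, b, v, w, ha, hb, hv, hw, h1, h2, h3, h4⟩ := exists_complementary_isometries V hV hV'
  have h5 : ∀ g, (columnMatrix w)ᴴ * ((π g : Matrix (Fin d) (Fin d) ℂ) * columnMatrix v) = 0 := by
    intro g
    ext i j
    rw [columnMatrix_star_mul_apply]
    exact (Submodule.mem_orthogonal' _ _).1 (hw i) _ (hVinv g _ (hv j))
  have h6 : ∀ g, (columnMatrix v)ᴴ * ((π g : Matrix (Fin d) (Fin d) ℂ) * columnMatrix w) = 0 := by
    intro g
    have := congrArg Matrix.conjTranspose (h5 g⁻¹)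
    rwa [coe_map_inv, Matrix.conjTranspose_mul, Matrix.conjTranspose_mul,
      Matrix.conjTranspose_conjTranspose, Matrix.conjTranspose_conjTranspose,
      Matrix.conjTranspose_zero, Matrix.mul_assoc] at this
  have h7 : ∀ g, (π g : Matrix (Fin d) (Fin d) ℂ) * columnMatrix v = columnMatrix v *
      ((columnMatrix v)ᴴ * (π g : Matrix (Fin d) (Fin d) ℂ) * columnMatrix v) := by
    intro g
    conv_lhs => rw [← Matrix.one_mul ((π g : Matrix (Fin d) (Fin d) ℂ) * columnMatrix v), ← h4,
      Matrix.add_mul, Matrix.mul_assoc (columnMatrix w), h5, Matrix.mul_zero, add_zero]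
    simp only [Matrix.mul_assoc]
  have h8 : ∀ g, (π g : Matrix (Fin d) (Fin d) ℂ) * columnMatrix w = columnMatrix w *
      ((columnMatrix w)ᴴ * (π g : Matrix (Fin d) (Fin d) ℂ) * columnMatrix w) := by
    intro g
    conv_lhs => rw [← Matrix.one_mul ((π g : Matrix (Fin d) (Fin d) ℂ) * columnMatrix w), ← h4,
      Matrix.add_mul, Matrix.mul_assoc (columnMatrix v), h6, Matrix.mul_zero, zero_add]
    simp only [Matrix.mul_assoc]
  exact (ih a ha (restrictRep π _ h1 h7)).sum (ih b hb (restrictRep π _ h2 h8)) h1 h2 h3 h4 h7 h8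

/-- The irreducible embeddings are grouped by equivalence. Unitary intertwiners adjust the members
of a class so that all carry the same matrices as its representative. The column (j, a, t) of W is
then column a of the t-th embedding of class j, and t runs over the degeneracy. -/
theorem exists_localDecomposition {d : ℕ} (π : G →* Matrix.unitaryGroup (Fin d) ℂ) :
    Nonempty (LocalDecomposition π) := by
  classical
  obtain ⟨ι, _, F, hF, hF1⟩ := isCompletelyReducible π
  let s : Setoid ι :=
    { r := fun i j => Nonempty ((matrixRep (F i).rep).Equiv (matrixRep (F j).rep))
      iseqv := ⟨fun _ => ⟨Representation.Equiv.refl _⟩, fun ⟨e⟩ => ⟨e.symm⟩,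
        fun ⟨e⟩ ⟨f⟩ => ⟨e.trans f⟩⟩ }
  let eQ : Fin (Fintype.card (Quotient s)) ≃ Quotient s := (Fintype.equivFin _).symm
  let o : Fin (Fintype.card (Quotient s)) → ι := fun j => (eQ j).out
  let deg : Fin (Fintype.card (Quotient s)) → ℕ := fun j =>
    Fintype.card {i : ι // Quotient.mk s i = eQ j}
  let ef : ∀ j, Fin (deg j) ≃ {i : ι // Quotient.mk s i = eQ j} :=
    fun j => (Fintype.equivFin _).symm
  let r : Fin (Fintype.card (Quotient s)) → ℕ := fun j => (F (o j)).dim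
  let ρ : ∀ j, G →* Matrix.unitaryGroup (Fin (r j)) ℂ := fun j => (F (o j)).rep
  have hM : ∀ j (t : Fin (deg j)), ∃ M : Matrix (Fin (F (ef j t).1).dim) (Fin (r j)) ℂ,
      (∀ g, ((F (ef j t).1).rep g : Matrix (Fin (F (ef j t).1).dim) (Fin (F (ef j t).1).dim) ℂ) * M =
        M * (ρ j g : Matrix (Fin (r j)) (Fin (r j)) ℂ)) ∧
        Mᴴ * M = 1 ∧ M * Mᴴ = 1 := by
    intro j t
    have h1 : Quotient.mk s (o j) = Quotient.mk s (ef j t).1 :=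
      (Quotient.out_eq _).trans (ef j t).2.symm
    obtain ⟨e⟩ := Quotient.exact h1
    exact exists_unitary_intertwiner (F _).irreducible (F _).irreducible e
  choose M hM1 hM2 hM3 using hM
  let T : ∀ j, Fin (deg j) → Matrix (Fin d) (Fin (r j)) ℂ := fun j t => (F (ef j t).1).T * M j t
  have hTT : ∀ j t, (T j t)ᴴ * T j t = 1 := fun j t => by
    rw [Matrix.conjTranspose_mul, Matrix.mul_assoc, ← Matrix.mul_assoc (F (ef j t).1).Tᴴ,
      (F (ef j t).1).star_mul_self, Matrix.one_mul, hM2]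
  have hTT0 : ∀ j t j' t', (ef j t).1 ≠ (ef j' t').1 → (T j t)ᴴ * T j' t' = 0 :=
    fun j t j' t' h => by
      rw [Matrix.conjTranspose_mul, Matrix.mul_assoc, ← Matrix.mul_assoc (F (ef j t).1).Tᴴ,
        hF _ _ h, Matrix.zero_mul, Matrix.mul_zero]
  -- The adjustment does not change the range projections, so they still sum to the identity.
  have hTTs : ∀ j t, T j t * (T j t)ᴴ = (F (ef j t).1).T * (F (ef j t).1).Tᴴ := fun j t => by
    rw [Matrix.conjTranspose_mul, Matrix.mul_assoc, ← Matrix.mul_assoc (M j t), hM3,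
      Matrix.one_mul]
  have hTπ : ∀ j t g, (π g : Matrix (Fin d) (Fin d) ℂ) * T j t =
      T j t * (ρ j g : Matrix (Fin (r j)) (Fin (r j)) ℂ) := fun j t g => by
    rw [← Matrix.mul_assoc, (F (ef j t).1).intertwines, Matrix.mul_assoc, hM1, Matrix.mul_assoc]
  let W : Matrix (Fin d) (Site r deg) ℂ := Matrix.of fun x y => T y.1 y.2.2 x y.2.1
  have hcol : ∀ (A : Matrix (Fin d) (Fin d) ℂ) x (y : Site r deg),
      (A * W) x y = (A * T y.1 y.2.2) x y.2.1 := fun A x y => rfl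
  have hW1 : Wᴴ * W = 1 := by
    ext ⟨j, a, t⟩ ⟨j', a', t'⟩
    have h1 : (Wᴴ * W) ⟨j, a, t⟩ ⟨j', a', t'⟩ = ((T j t)ᴴ * T j' t') a a' := rfl
    rw [h1]
    by_cases h : (ef j t).1 = (ef j' t').1
    · have hj : j = j' := eQ.injective (by rw [← (ef j t).2, h, (ef j' t').2])
      subst hj
      have ht : t = t' := (ef j).injective (Subtype.ext h)
      subst ht
      rw [hTT, Matrix.one_apply, Matrix.one_apply]
      simp
    · rw [hTT0 _ _ _ _ h, Matrix.one_apply_ne, Matrix.zero_apply]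
      intro hh
      obtain ⟨rfl, hh⟩ := Sigma.mk.inj hh
      obtain ⟨-, rfl⟩ := Prod.mk.inj (eq_of_heq hh)
      exact h rfl
  have hW2 : W * Wᴴ = 1 := by
    rw [← hF1]
    have h1 : ∑ i, (F i).T * (F i).Tᴴ = ∑ j, ∑ t, T j t * (T j t)ᴴ := by
      simp only [hTTs]
      rw [← (Equiv.sigmaFiberEquiv (fun i => eQ.symm (Quotient.mk s i))).sum_comp,
        Fintype.sum_sigma]
      refine Finset.sum_congr rfl fun j _ => ?_
      refine (Equiv.sum_comp ((ef j).trans (Equiv.subtypeEquivRight fun i =>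
        (Equiv.symm_apply_eq eQ).symm)) fun i => (F i.1).T * (F i.1).Tᴴ).symm
    rw [h1]
    ext x y
    rw [Matrix.mul_apply, Fintype.sum_sigma]
    simp only [Matrix.sum_apply]
    refine Finset.sum_congr rfl fun j _ => ?_
    rw [Fintype.sum_prod_type, Finset.sum_comm]
    rfl
  refine ⟨⟨_, r, deg, fun j => ?_, ρ, fun j => (F (o j)).irreducible, fun i j hij => ?_, W, hW1,
    hW2, fun g => ?_⟩⟩
  · exact Fintype.card_pos_iff.2 ⟨⟨o j, Quotient.out_eq _⟩⟩
  · refine ⟨fun e => hij (eQ.injective ?_)⟩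
    rw [← Quotient.out_eq (eQ i), ← Quotient.out_eq (eQ j)]
    exact Quotient.sound ⟨e⟩
  · have h1 : (π g : Matrix (Fin d) (Fin d) ℂ) * W = W * siteRep deg ρ g := by
      ext x ⟨j, a, t⟩
      rw [mul_siteRep_apply, hcol, hTπ]
      rfl
    change _ = W * siteRep deg ρ g * Wᴴ
    rw [← h1, Matrix.mul_assoc, hW2, Matrix.mul_one]

end Decomposition

theorem theorem2 {G : Type*} [Group G] (d n : ℕ)
    (π : G →* Matrix.unitaryGroup (Fin d) ℂ) :
    Nonempty (LocalDecomposition π) ∧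
    ∀ D : LocalDecomposition π,
      (∀ (E : Type*) [NormedAddCommGroup E] [InnerProductSpace ℂ E] [CompleteSpace E]
        (X : Matrix (Fin n → Fin d) (Fin n → Fin d) (E →L[ℂ] E)),
        PermInvariantExt X → LocallyInvariantExt π X →
        X = ∑ m ∈ types n D.k, ∑ lam ∈ D.diagramFamilies m,
          tensorOne E (D.P n m lam) * X * tensorOne E (D.P n m lam)) ∧
      ∃ S R : Matrix (Fin n → Fin d) (Fin n → Fin d) ℂ →ₗ[ℂ]
          Matrix (Fin n → Fin d) (Fin n → Fin d) ℂ,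
        IsCPTP S ∧ IsCPTP R ∧
        (∀ (E : Type*) [NormedAddCommGroup E] [InnerProductSpace ℂ E] [CompleteSpace E]
          (X : Matrix (Fin n → Fin d) (Fin n → Fin d) (E →L[ℂ] E)),
          ∀ m ∈ types n D.k, ∀ lam ∈ D.diagramFamilies m,
          tensorId S (tensorOne E (D.P n m lam) * X * tensorOne E (D.P n m lam)) =
            tensorOne E (D.P n m lam) * tensorId S X * tensorOne E (D.P n m lam)) ∧
        (∀ (E : Type*) [NormedAddCommGroup E] [InnerProductSpace ℂ E] [CompleteSpace E]
          (X : Matrix (Fin n → Fin d) (Fin n → Fin d) (E →L[ℂ] E)),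
          PermInvariantExt X → LocallyInvariantExt π X →
          tensorId (R ∘ₗ S) X = X) ∧
        (∀ ρ : Matrix (Fin n → Fin d) (Fin n → Fin d) ℂ,
          IsDensity ρ → PermInvariant ρ → LocallyInvariant π ρ →
          ∀ m ∈ types n D.k, ∀ lam ∈ D.diagramFamilies m,
          ∃ Q : Matrix (Fin n → Fin d) (Fin n → Fin d) ℂ,
            IsSupportProjection (S (D.P n m lam * ρ * D.P n m lam)) Q ∧
            (((fc m * ∏ j, fq (lam j) : ℝ) : ℂ) • S (D.averagedIID n lam) - Q).PosSemidef) := by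
  refine ⟨exists_localDecomposition π, fun D => ⟨?_, D.compression n, D.recovery n,
    D.isCPTP_compression, D.isCPTP_recovery, ?_, ?_, ?_⟩⟩
  · intro E _ _ _ X h h'
    exact D.pinching_ext h h'
  · intro E _ _ _ X m hm lam hlam
    exact D.tensorId_compression X hm hlam
  · intro E _ _ _ X h h'
    exact D.tensorId_recovery_comp_compression h h'
  · intro ρ hρ h h' m hm lam hlam
    exact D.exists_support_le hρ.1 h h' hm hlam

end DeFinetti

theorem theorem2 {G : Type*} [Group G] (d n : ℕ)
    (π : G →* Matrix.unitaryGroup (Fin d) ℂ) :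
    Nonempty (LocalDecomposition π) ∧
    ∀ D : LocalDecomposition π,
      (∀ (E : Type*) [NormedAddCommGroup E] [InnerProductSpace ℂ E] [CompleteSpace E]
        (X : Matrix (Fin n → Fin d) (Fin n → Fin d) (E →L[ℂ] E)),
        PermInvariantExt X → LocallyInvariantExt π X →
        X = ∑ m ∈ types n D.k, ∑ lam ∈ D.diagramFamilies m,
          tensorOne E (D.P n m lam) * X * tensorOne E (D.P n m lam)) ∧
      ∃ S R : Matrix (Fin n → Fin d) (Fin n → Fin d) ℂ →ₗ[ℂ]
          Matrix (Fin n → Fin d) (Fin n → Fin d) ℂ,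
        IsCPTP S ∧ IsCPTP R ∧
        (∀ (E : Type*) [NormedAddCommGroup E] [InnerProductSpace ℂ E] [CompleteSpace E]
          (X : Matrix (Fin n → Fin d) (Fin n → Fin d) (E →L[ℂ] E)),
          ∀ m ∈ types n D.k, ∀ lam ∈ D.diagramFamilies m,
          tensorId S (tensorOne E (D.P n m lam) * X * tensorOne E (D.P n m lam)) =
            tensorOne E (D.P n m lam) * tensorId S X * tensorOne E (D.P n m lam)) ∧
        (∀ (E : Type*) [NormedAddCommGroup E] [InnerProductSpace ℂ E] [CompleteSpace E]
          (X : Matrix (Fin n → Fin d) (Fin n → Fin d) (E →L[ℂ] E)),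
          PermInvariantExt X → LocallyInvariantExt π X →
          tensorId (R ∘ₗ S) X = X) ∧
        (∀ ρ : Matrix (Fin n → Fin d) (Fin n → Fin d) ℂ,
          IsDensity ρ → PermInvariant ρ → LocallyInvariant π ρ →
          ∀ m ∈ types n D.k, ∀ lam ∈ D.diagramFamilies m,
          ∃ Q : Matrix (Fin n → Fin d) (Fin n → Fin d) ℂ,
            IsSupportProjection (S (D.P n m lam * ρ * D.P n m lam)) Q ∧
            (((fc m * ∏ j, fq (lam j) : ℝ) : ℂ) • S (D.averagedIID n lam) - Q).PosSemidef) := by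
  refine ⟨exists_localDecomposition π, fun D => ⟨?_, D.compression n, D.recovery n,
    D.isCPTP_compression, D.isCPTP_recovery, ?_, ?_, ?_⟩⟩
  · intro E _ _ _ X h h'
    exact D.pinching_ext h h'
  · intro E _ _ _ X m hm lam hlam
    exact D.tensorId_compression X hm hlam
  · intro E _ _ _ X h h'
    exact D.tensorId_recovery_comp_compression h h'
  · intro ρ hρ h h' m hm lam hlam
    exact D.exists_support_le hρ.1 h h' hm hlam
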